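/- **Setting.** Let $(M,d)$ be a complete metric space, $\mathbf m$ a $\sigma$-finite Radon measure on $M$ (a Borel measure that is locally finite and inner regular with respect to compact sets), and $1<p<\infty$. Convergence in $L^0(\mathbf m)$ means convergence in measure on every set of finite measure. For $f:M\to\mathbb R$ put $\operatorname{lip}f(x)=\limsup_{y\to x}|f(y)-f(x)|/d(y,x)$ (equal to $0$ at isolated points), and let $D_{\operatorname{lip}}$ be the space of Lipschitz functions $f:M\to\mathbb R$ with $\operatorname{lip}f\in L^p(\mathbf m)$. *Relaxation.* A function $G\in L^p(\mathbf m)$ is an upper relaxation at $f\in L^0(\mathbf m)$ if there are $f_n\in D_{\operatorname{lip}}$ with $f_n\to f$ in $L^0(\mathbf m)$ and $\operatorname{lip}f_n\rightharpoonup G'$ weakly in $L^p(\mathbf m)$ for some $G'\le G$. Let $D_p$ be the set of all $f$ that have an upper relaxation, and for $f\in D_p$ let $|Df|_{*,p}$ be the infimum in $L^p(\mathbf m)$ of all upper relaxations at $f$. *Modules.* Let $F:D\to L^p(\mathbf m)$ be defined on a real vector space, with $F\ge 0$, $F(f+g)\le F(f)+F(g)$ and $F(cf)=|c|F(f)$.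 The $L^p(\mathbf m)$-normed module generated by $F$ is the completion of the space of countable families $\omega=\{(f_i,A_i)\}_i$, where $\{A_i\}$ is a Borel partition of $M$ and $f_i\in D$, with $\|\omega\|^p=\sum_i\int_{A_i}F(f_i)^p\,d\mathbf m<\infty$, for the seminorm $\|\cdot\|$; it is an $L^\infty(\mathbf m)$-module, and $d_Ff$ denotes the class of $\{(f,M)\}$. Let $L^p_{\operatorname{lip}}(T^*M)$ with differential $d_{\operatorname{lip}}$ be the module generated by $\operatorname{lip}$ on $D_{\operatorname{lip}}$, and $L^p(T^*M)$ with differential $d_p$ the module generated by $|D\cdot|_{*,p}$ on $D_p$. Let $L^p_{\operatorname{lip}_0}(T^*M)$ be the closed $L^\infty(\mathbf m)$-submodule of $L^p_{\operatorname{lip}}(T^*M)$ generated by all limits of sequences $d_{\operatorname{lip}}f_n$ with $f_n\in D_{\operatorname{lip}}$, $f_n\to0$ in $L^0(\mathbf m)$. The Sobolev space $W^{1,p}(M,\mathbf m)$ is $L^p(\mathbf m)\cap D_p$ with the norm $(\|f\|_{L^p}^p+\||Df|_{*,p}\|_{L^p}^p)^{1/p}$. The operator $d_{\operatorname{lip}}$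 is closable if $f_n\in D_{\operatorname{lip}}$, $f_n\to0$ in $L^0(\mathbf m)$ and $d_{\operatorname{lip}}f_n\to\omega$ imply $\omega=0$. *Dimension.* Let $\mathcal M$ be one of these modules. A set $S\subset\mathcal M$ of elements supported in $A$ is independent on $A$ if for finitely many distinct $v_i\in S$ and $a_i\in L^\infty(\mathbf m)$ the equation $\chi_A\sum_ia_iv_i=0$ implies $a_i=0$ a.e. on $A$ for all $i$. $\mathcal M$ has dimension $n$ on $E$ if for every measurable $A\subset E$ of positive measure every maximal such set $S$ has exactly $n$ elements. $\mathcal M$ is locally finite dimensional if $M$ has a measurable partition $E_0,E_1,\dots,E_\infty$ with $\mathbf m(E_\infty)=0$ such that $\mathcal M$ has dimension $n$ on $E_n$ for every $n\in\mathbb N$; then $\dim(\mathcal M,x)=n$ for $x\in E_n$. It is bounded by $N$ if moreover $\dim(\mathcal M,x)\le N$ for a.e. $x$. Write $\dim_{\operatorname{lip}}$, $\dim_p$ and $\dim_0$ for the dimensions of $L^p_{\operatorname{lip}}(T^*M)$, $L^p(T^*M)$ and $L^p_{\operatorname{lip}_0}(T^*M)$. **Statement.** Suppose that $L^p_{\operatorname{lip}}(T^*M)$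 is locally finite dimensional. Then: 1. $L^p_{\operatorname{lip}}(T^*M)$ is reflexive. 2. There is an isometric $L^\infty(\mathbf m)$-linear isomorphism $L^p_{\operatorname{lip}}(T^*M)/L^p_{\operatorname{lip}_0}(T^*M)\cong L^p(T^*M)$ that maps the class of $d_{\operatorname{lip}}f$ to $d_pf$ for all $f\in D_{\operatorname{lip}}$. Moreover $d_{\operatorname{lip}}$ is closable if and only if $L^p_{\operatorname{lip}_0}(T^*M)=\{0\}$; in that case there is an isometric $L^\infty(\mathbf m)$-linear isomorphism $L^p_{\operatorname{lip}}(T^*M)\cong L^p(T^*M)$ that maps $d_{\operatorname{lip}}f$ to $d_pf$, and $|Df|_{*,p}=\operatorname{lip}f$ a.e. for all $f\in D_{\operatorname{lip}}$. 3. $L^p_{\operatorname{lip}_0}(T^*M)$ and $L^p(T^*M)$ are locally finite dimensional, and $\dim_{\operatorname{lip}}=\dim_p+\dim_0$ $\mathbf m$-almost everywhere. If $L^p_{\operatorname{lip}}(T^*M)$ is bounded by $N$, then so is $L^p(T^*M)$. 4. $L^p(T^*M)$ and $W^{1,p}(M,\mathbf m)$ are reflexive. 5. The following are equivalent: $d_{\operatorname{lip}}$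 is closable; $\dim_{\operatorname{lip}}=\dim_p$ $\mathbf m$-almost everywhere; the functional $f\mapsto\int(\operatorname{lip}f)^p\,d\mathbf m$ is lower semicontinuous on $D_{\operatorname{lip}}$ with respect to convergence in $L^0(\mathbf m)$. -/

import Mathlib

open MeasureTheory Filter Topology UniformSpace Set
open scoped ENNReal NNReal

noncomputable section

/-! ## The ring `L^∞(m)` -/

/-- The space `L^∞(m)`. -/
abbrev LInfty {X : Type*} [MeasurableSpace X] (m : Measure X) : Type _ := Lp ℝ ∞ m

namespace LInfty

variable {X : Type*} [MeasurableSpace X] {m : Measure X}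

instance : Mul (LInfty m) where
  mul a b := ⟨(a : X →ₘ[m] ℝ) * (b : X →ₘ[m] ℝ), by
    rw [Lp.mem_Lp_iff_memLp]
    exact (memLp_congr_ae (AEEqFun.coeFn_mul _ _)).2 ((Lp.memLp b).mul (Lp.memLp a))⟩

instance : One (LInfty m) where
  one := ⟨1, by
    rw [Lp.mem_Lp_iff_memLp]
    refine (memLp_congr_ae (AEEqFun.coeFn_one (α := X) (β := ℝ) (μ := m))).2 ?_
    exact memLp_top_of_bound aestronglyMeasurable_const 1 (ae_of_all _ fun x => by simp)⟩

theorem coe_mul_ae (a b : LInfty m) : ∀ᵐ x ∂m, (a * b : LInfty m) x = a x * b x :=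
  AEEqFun.coeFn_mul (a : X →ₘ[m] ℝ) b

theorem coe_one_ae : ∀ᵐ x ∂m, (1 : LInfty m) x = 1 :=
  AEEqFun.coeFn_one (α := X) (β := ℝ) (μ := m)

/-- `L^∞(m)` is a commutative ring under pointwise almost everywhere multiplication. -/
instance : CommRing (LInfty m) where
  toAddCommGroup := (inferInstance : AddCommGroup (Lp ℝ ∞ m))
  mul_assoc a b c := Subtype.ext (mul_assoc (a : X →ₘ[m] ℝ) b c)
  mul_comm a b := Subtype.ext (mul_comm (a : X →ₘ[m] ℝ) b)
  one_mul a := Subtype.ext (one_mul (a : X →ₘ[m] ℝ))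
  mul_one a := Subtype.ext (mul_one (a : X →ₘ[m] ℝ))
  left_distrib a b c := by
    refine Lp.ext ?_
    filter_upwards [coe_mul_ae a (b + c), Lp.coeFn_add b c, Lp.coeFn_add (a * b) (a * c),
      coe_mul_ae a b, coe_mul_ae a c] with x h1 h2 h3 h4 h5
    rw [h1, h2, h3, Pi.add_apply, Pi.add_apply, h4, h5, mul_add]
  right_distrib a b c := by
    refine Lp.ext ?_
    filter_upwards [coe_mul_ae (a + b) c, Lp.coeFn_add a b, Lp.coeFn_add (a * c) (b * c),
      coe_mul_ae a c, coe_mul_ae b c] with x h1 h2 h3 h4 h5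
    rw [h1, h2, h3, Pi.add_apply, Pi.add_apply, h4, h5, add_mul]
  zero_mul a := by
    refine Lp.ext ?_
    filter_upwards [coe_mul_ae 0 a, Lp.coeFn_zero ℝ ∞ m] with x h1 h2
    rw [h1, h2, Pi.zero_apply, zero_mul]
  mul_zero a := by
    refine Lp.ext ?_
    filter_upwards [coe_mul_ae a 0, Lp.coeFn_zero ℝ ∞ m] with x h1 h2
    rw [h1, h2, Pi.zero_apply, mul_zero]

theorem exists_bound (a : LInfty m) : ∃ C : ℝ, 0 ≤ C ∧ ∀ᵐ x ∂m, |a x| ≤ C :=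
  ⟨_, lpNorm_nonneg, ae_le_lpNorm_exponent_top (Lp.memLp a)⟩

/-- The characteristic function `χ_A` of a measurable set, as an element of `L^∞(m)`. -/
def chi (m : Measure X) {A : Set X} (hA : MeasurableSet A) : LInfty m :=
  MemLp.toLp (A.indicator fun _ => (1 : ℝ)) <| by
    refine memLp_top_of_bound (stronglyMeasurable_const.indicator hA).aestronglyMeasurable 1
      (ae_of_all _ fun x => ?_)
    by_cases hx : x ∈ A <;> simp [hx]

end LInfty

/-! ## Countably valued maps -/

/-- `s` takes countably many values, each on a measurable set: the data of a countable measurable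
partition `(A_i)` and values `d_i`, with `s = d_i` on `A_i`. -/
def CountablyValued {X : Type*} [MeasurableSpace X] {D : Type*} (s : X → D) : Prop :=
  (range s).Countable ∧ ∀ d, MeasurableSet (s ⁻¹' {d})

namespace CountablyValued

variable {X : Type*} [MeasurableSpace X] {D E G : Type*}

theorem const (d : D) : CountablyValued (fun _ : X => d) := by
  classical
  refine ⟨(countable_singleton d).mono (by rintro _ ⟨x, rfl⟩; rfl), fun e => ?_⟩
  exact MeasurableSet.const (d = e)

theorem map₂ {s : X → D} {t : X → E} (hs : CountablyValued s) (ht : CountablyValued t)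
    (φ : D → E → G) : CountablyValued (fun x => φ (s x) (t x)) := by
  have hc := hs.1.prod ht.1
  refine ⟨(hc.image fun q => φ q.1 q.2).mono ?_, fun g => ?_⟩
  · rintro _ ⟨x, rfl⟩
    exact ⟨(s x, t x), ⟨mem_range_self x, mem_range_self x⟩, rfl⟩
  · have : (fun x => φ (s x) (t x)) ⁻¹' {g}
        = ⋃ q ∈ (range s ×ˢ range t) ∩ {q | φ q.1 q.2 = g}, s ⁻¹' {q.1} ∩ t ⁻¹' {q.2} := by
      ext x
      simp only [mem_preimage, mem_singleton_iff, mem_iUnion, mem_inter_iff, mem_prod,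
        mem_range, mem_ofPred_eq, exists_prop, Prod.exists]
      constructor
      · intro h
        exact ⟨s x, t x, ⟨⟨⟨x, rfl⟩, ⟨x, rfl⟩⟩, h⟩, rfl, rfl⟩
      · rintro ⟨d, e, ⟨_, h⟩, rfl, rfl⟩
        exact h
    rw [this]
    exact MeasurableSet.biUnion (hc.mono inter_subset_left)
      fun q _ => (hs.2 q.1).inter (ht.2 q.2)

theorem map {s : X → D} (hs : CountablyValued s) (φ : D → G) :
    CountablyValued (fun x => φ (s x)) := hs.map₂ hs fun d _ => φ d

theorem measurable {a : X → ℝ} (ha : CountablyValued a) : Measurable a := by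
  intro B _
  have : a ⁻¹' B = ⋃ c ∈ range a ∩ B, a ⁻¹' {c} := by
    ext x
    simp
  rw [this]
  exact MeasurableSet.biUnion (ha.1.mono inter_subset_left) fun c _ => ha.2 c

theorem ae₂ {m : Measure X} {s : X → D} {t : X → E} (hs : CountablyValued s)
    (ht : CountablyValued t) {P : D → E → X → Prop} (h : ∀ d e, ∀ᵐ x ∂m, P d e x) :
    ∀ᵐ x ∂m, P (s x) (t x) x := by
  have h1 : ∀ᵐ x ∂m, ∀ q ∈ range s ×ˢ range t, P q.1 q.2 x :=
    (ae_ball_iff (hs.1.prod ht.1)).2 fun q _ => h q.1 q.2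
  filter_upwards [h1] with x hx
  exact hx (s x, t x) ⟨mem_range_self x, mem_range_self x⟩

end CountablyValued

/-- Bounded countably valued functions: the simple functions `∑ a_j χ_{B_j}`. -/
def IsSimple {X : Type*} [MeasurableSpace X] (a : X → ℝ) : Prop :=
  CountablyValued a ∧ ∃ C, ∀ x, |a x| ≤ C

namespace IsSimple

variable {X : Type*} [MeasurableSpace X] {a b : X → ℝ}

theorem const (c : ℝ) : IsSimple (fun _ : X => c) :=
  ⟨CountablyValued.const c, |c|, fun _ => le_rfl⟩

theorem add (ha : IsSimple a) (hb : IsSimple b) : IsSimple (fun x => a x + b x) := by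
  obtain ⟨ha, C, hC⟩ := ha
  obtain ⟨hb, C', hC'⟩ := hb
  exact ⟨ha.map₂ hb fun c d => c + d, C + C',
    fun x => (abs_add_le _ _).trans (add_le_add (hC x) (hC' x))⟩

theorem sub (ha : IsSimple a) (hb : IsSimple b) : IsSimple (fun x => a x - b x) := by
  obtain ⟨ha, C, hC⟩ := ha
  obtain ⟨hb, C', hC'⟩ := hb
  exact ⟨ha.map₂ hb fun c d => c - d, C + C',
    fun x => (abs_sub _ _).trans (add_le_add (hC x) (hC' x))⟩

theorem mul (ha : IsSimple a) (hb : IsSimple b) : IsSimple (fun x => a x * b x) := by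
  obtain ⟨ha, C, hC⟩ := ha
  obtain ⟨hb, C', hC'⟩ := hb
  refine ⟨ha.map₂ hb fun c d => c * d, C * C', fun x => ?_⟩
  rw [abs_mul]
  exact mul_le_mul (hC x) (hC' x) (abs_nonneg _) ((abs_nonneg _).trans (hC x))

end IsSimple

namespace LInfty

variable {X : Type*} [MeasurableSpace X] {m : Measure X}

/-- Every element of `L^∞(m)` is a uniform limit of simple functions. -/
theorem exists_simple (a : LInfty m) : ∃ b : ℕ → X → ℝ, (∀ n, IsSimple (b n)) ∧
    ∀ n : ℕ, ∀ᵐ x ∂m, |a x - b n x| ≤ 1 / ((n : ℝ) + 1) := by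
  obtain ⟨C, hC0, hC⟩ := a.exists_bound
  have hmeas : Measurable (fun x => max (-C) (min C (a x))) :=
    measurable_const.max (measurable_const.min (Lp.stronglyMeasurable a).measurable)
  have habs : ∀ x, |max (-C) (min C (a x))| ≤ C := fun x =>
    abs_le.2 ⟨le_max_left _ _, max_le (by linarith) (min_le_left _ _)⟩
  have hfl : ∀ (n : ℕ) (t : ℝ), |t - (⌊((n : ℝ) + 1) * t⌋ : ℝ) / ((n : ℝ) + 1)|
      ≤ 1 / ((n : ℝ) + 1) := by
    intro n t
    have hn : (0 : ℝ) < (n : ℝ) + 1 := by positivity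
    have h1 := Int.floor_le (((n : ℝ) + 1) * t)
    have h2 := Int.lt_floor_add_one (((n : ℝ) + 1) * t)
    have h3 : t - (⌊((n : ℝ) + 1) * t⌋ : ℝ) / ((n : ℝ) + 1)
        = (((n : ℝ) + 1) * t - ⌊((n : ℝ) + 1) * t⌋) / ((n : ℝ) + 1) := by
      field_simp
    rw [h3, abs_of_nonneg (div_nonneg (by linarith) hn.le)]
    gcongr
    linarith
  refine ⟨fun n x => (⌊((n : ℝ) + 1) * max (-C) (min C (a x))⌋ : ℝ) / ((n : ℝ) + 1),
    fun n => ⟨?_, C + 1 / ((n : ℝ) + 1), fun x => ?_⟩, fun n => ?_⟩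
  · have hz : CountablyValued fun x => ⌊((n : ℝ) + 1) * max (-C) (min C (a x))⌋ :=
      ⟨to_countable _, fun k => (Int.measurable_floor.comp (hmeas.const_mul _))
        (measurableSet_singleton k)⟩
    exact hz.map fun k : ℤ => (k : ℝ) / ((n : ℝ) + 1)
  · have h1 := hfl n (max (-C) (min C (a x)))
    have h2 := habs x
    rw [abs_le] at *
    constructor <;> linarith [h1.1, h1.2, h2.1, h2.2]
  · filter_upwards [hC] with x hx
    have h1 : max (-C) (min C (a x)) = a x := by
      rw [abs_le] at hx
      rw [min_eq_right hx.2, max_eq_right hx.1]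
    simpa only [h1] using hfl n (a x)

end LInfty

/-! ## The module generated by an `L^p`-valued functional -/

/-- A subadditive, absolutely homogeneous functional `D → L^p_+(m)` on a real vector space. -/
structure LpFunctional {X : Type*} [MeasurableSpace X] (m : Measure X) (p : ℝ≥0)
    [Fact (1 ≤ (p : ℝ≥0∞))] (D : Type*) [AddCommGroup D] [Module ℝ D] where
  toFun : D → Lp ℝ p m
  nonneg : ∀ f, 0 ≤ toFun f
  add_le : ∀ f h, toFun (f + h) ≤ toFun f + toFun h
  smul_eq : ∀ (c : ℝ) f, toFun (c • f) = |c| • toFun f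

namespace LpFunctional

variable {X : Type*} [MeasurableSpace X] {m : Measure X} {p : ℝ≥0} [Fact (1 ≤ (p : ℝ≥0∞))]
  {D : Type*} [AddCommGroup D] [Module ℝ D] (F : LpFunctional m p D)

/-- The pointwise norm of `s = {(f_i, A_i)}`: it is `F f_i` on `A_i`. -/
def ptNorm (s : X → D) (x : X) : ℝ := F.toFun (s x) x

theorem ptNorm_measurable {s : X → D} (hs : CountablyValued s) : Measurable (F.ptNorm s) := by
  intro B hB
  have : F.ptNorm s ⁻¹' B = ⋃ d ∈ range s, s ⁻¹' {d} ∩ (F.toFun d) ⁻¹' B := by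
    ext x
    simp only [mem_preimage, mem_iUnion, mem_inter_iff, mem_singleton_iff, exists_prop]
    exact ⟨fun h => ⟨s x, mem_range_self x, rfl, h⟩, by rintro ⟨d, _, h1, h2⟩; rwa [← h1] at h2⟩
  rw [this]
  exact MeasurableSet.biUnion hs.1 fun d _ =>
    (hs.2 d).inter ((Lp.stronglyMeasurable (F.toFun d)).measurable hB)

theorem ptNorm_nonneg {s : X → D} (hs : CountablyValued s) : ∀ᵐ x ∂m, 0 ≤ F.ptNorm s x := by
  refine hs.ae₂ (E := D) hs (P := fun d _ x => 0 ≤ F.toFun d x) fun d _ => ?_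
  filter_upwards [(Lp.coeFn_nonneg (F.toFun d)).2 (F.nonneg d)] with x hx
  simpa using hx

theorem ptNorm_add {s t : X → D} (hs : CountablyValued s) (ht : CountablyValued t) :
    ∀ᵐ x ∂m, F.ptNorm (s + t) x ≤ F.ptNorm s x + F.ptNorm t x := by
  refine hs.ae₂ ht (P := fun d e x => F.toFun (d + e) x ≤ F.toFun d x + F.toFun e x)
    fun d e => ?_
  filter_upwards [(Lp.coeFn_le _ _).2 (F.add_le d e), Lp.coeFn_add (F.toFun d) (F.toFun e)]
    with x h1 h2
  rw [h2] at h1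
  exact h1

theorem ptNorm_smul {a : X → ℝ} {s : X → D} (ha : CountablyValued a) (hs : CountablyValued s) :
    ∀ᵐ x ∂m, F.ptNorm (fun y => a y • s y) x = |a x| * F.ptNorm s x := by
  refine ha.ae₂ hs (P := fun c d x => F.toFun (c • d) x = |c| * F.toFun d x) fun c d => ?_
  rw [F.smul_eq]
  filter_upwards [Lp.coeFn_smul |c| (F.toFun d)] with x hx
  simpa using hx

theorem memLp_smul {a : X → ℝ} {s : X → D} (ha : CountablyValued a) {C : ℝ}
    (hC : ∀ᵐ x ∂m, |a x| ≤ C)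
    (hs : CountablyValued s) (hs' : MemLp (F.ptNorm s) p m) :
    MemLp (F.ptNorm fun y => a y • s y) p m := by
  refine hs'.of_le_mul (c := C)
    (F.ptNorm_measurable (ha.map₂ hs fun c d => c • d)).aestronglyMeasurable ?_
  filter_upwards [F.ptNorm_smul ha hs, hC] with x h1 h2
  rw [h1, norm_mul, Real.norm_eq_abs, abs_abs]
  gcongr

/-- The vector space `Pfm` of pre-forms `{(f_i, A_i)}`, written as countably valued maps
`s : X → D` (`s = f_i` on `A_i`) with `∑ ∫_{A_i} (F f_i)^p < ∞`. -/
def pfm : Submodule ℝ (X → D) where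
  carrier := {s | CountablyValued s ∧ MemLp (F.ptNorm s) p m}
  add_mem' := by
    rintro s t ⟨hs, hs'⟩ ⟨ht, ht'⟩
    have hst : CountablyValued (s + t) := hs.map₂ ht fun d e => d + e
    refine ⟨hst, (hs'.add ht').mono' (F.ptNorm_measurable hst).aestronglyMeasurable ?_⟩
    filter_upwards [F.ptNorm_add hs ht, F.ptNorm_nonneg hst] with x h1 h2
    rw [Real.norm_of_nonneg h2]
    exact h1
  zero_mem' := by
    refine ⟨CountablyValued.const 0, ?_⟩
    have h : F.toFun 0 = 0 := by simpa using F.smul_eq 0 0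
    have : F.ptNorm 0 = (F.toFun 0 : X → ℝ) := rfl
    rw [this]
    exact Lp.memLp _
  smul_mem' := by
    rintro c s ⟨hs, hs'⟩
    exact ⟨hs.map fun d => c • d,
      F.memLp_smul (a := fun _ => c) (CountablyValued.const c) (C := |c|)
        (ae_of_all _ fun _ => le_rfl) hs hs'⟩

/-- `Pfm` with the seminorm `‖ |·| ‖_{L^p}`; the equivalence relation on `Pfm` is "the seminorm of
the difference vanishes". -/
def PreModule : Type _ := F.pfm

instance : AddCommGroup F.PreModule := inferInstanceAs (AddCommGroup F.pfm)
instance : Module ℝ F.PreModule := inferInstanceAs (Module ℝ F.pfm)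

/-- The map underlying a pre-form. -/
def PreModule.val {F : LpFunctional m p D} (s : F.PreModule) : X → D := (s : F.pfm).1

variable {F} in
theorem PreModule.cv (s : F.PreModule) : CountablyValued s.val := (s : F.pfm).2.1
variable {F} in
theorem PreModule.memLp (s : F.PreModule) : MemLp (F.ptNorm s.val) p m := (s : F.pfm).2.2

theorem toFun_zero : F.toFun 0 = 0 := by simpa using F.smul_eq 0 0

/-- The seminorm `‖ |s| ‖_{L^p}` on `Pfm`. -/
def preNorm (s : F.PreModule) : ℝ := (eLpNorm (F.ptNorm s.val) p m).toReal

theorem preNorm_zero : F.preNorm 0 = 0 := by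
  have h1 : F.ptNorm (0 : F.PreModule).val = (F.toFun 0 : X → ℝ) := rfl
  rw [preNorm, h1, F.toFun_zero, eLpNorm_congr_ae (Lp.coeFn_zero ℝ (p : ℝ≥0∞) m), eLpNorm_zero]
  rfl

theorem eLpNorm_ptNorm_add_le {s t : X → D} (hs : CountablyValued s) (ht : CountablyValued t) :
    eLpNorm (F.ptNorm (s + t)) p m ≤ eLpNorm (F.ptNorm s) p m + eLpNorm (F.ptNorm t) p m := by
  refine le_trans (eLpNorm_mono_ae (g := F.ptNorm s + F.ptNorm t) ?_)
    (eLpNorm_add_le (F.ptNorm_measurable hs).aestronglyMeasurable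
      (F.ptNorm_measurable ht).aestronglyMeasurable Fact.out)
  filter_upwards [F.ptNorm_add hs ht,
    F.ptNorm_nonneg (s := s + t) (hs.map₂ ht fun d e => d + e)] with x h1 h2
  rw [Real.norm_of_nonneg h2, Pi.add_apply, Real.norm_eq_abs]
  exact h1.trans (le_abs_self _)

theorem preNorm_add_le (s t : F.PreModule) : F.preNorm (s + t) ≤ F.preNorm s + F.preNorm t :=
  (ENNReal.toReal_mono (ENNReal.add_ne_top.2 ⟨s.memLp.2.ne, t.memLp.2.ne⟩)
    (F.eLpNorm_ptNorm_add_le s.cv t.cv)).trans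
    (ENNReal.toReal_add s.memLp.2.ne t.memLp.2.ne).le

theorem preNorm_neg (s : F.PreModule) : F.preNorm (-s) = F.preNorm s := by
  rw [preNorm, preNorm]
  congr 1
  refine eLpNorm_congr_ae ?_
  have h1 : (-s).val = fun y => (-1 : ℝ) • s.val y := by
    funext y
    rw [neg_one_smul]
    rfl
  rw [h1]
  filter_upwards [F.ptNorm_smul (CountablyValued.const (-1 : ℝ)) s.cv] with x hx
  rw [hx]
  simp

instance : SeminormedAddCommGroup F.PreModule :=
  AddGroupSeminorm.toSeminormedAddCommGroup
    { toFun := F.preNorm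
      map_zero' := F.preNorm_zero
      add_le' := F.preNorm_add_le
      neg' := F.preNorm_neg }

theorem PreModule.norm_def (s : F.PreModule) : ‖s‖ = (eLpNorm (F.ptNorm s.val) p m).toReal := rfl

/-- Multiplication of pre-forms by a simple function:
`a {(f_i, A_i)} = {(a_j f_i, A_i ∩ B_j)}` when `a = a_j` on `B_j`. -/
def preSMul (a : X → ℝ) (ha : IsSimple a) : F.PreModule →ₗ[ℝ] F.PreModule where
  toFun s := (⟨fun x => a x • s.val x, ha.1.map₂ s.cv fun c d => c • d,
    F.memLp_smul ha.1 (ae_of_all _ ha.2.choose_spec) s.cv s.memLp⟩ : F.pfm)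
  map_add' s t := Subtype.ext (funext fun x => smul_add (a x) (s.val x) (t.val x))
  map_smul' c s := Subtype.ext (funext fun x => smul_comm (a x) c (s.val x))

theorem preSMul_norm_le {a : X → ℝ} (ha : IsSimple a) {C : ℝ} (hC0 : 0 ≤ C) (hC : ∀ᵐ x ∂m, |a x| ≤ C) (s : F.PreModule) :
    ‖F.preSMul a ha s‖ ≤ C * ‖s‖ := by
  rw [PreModule.norm_def, PreModule.norm_def]
  have h : eLpNorm (F.ptNorm (F.preSMul a ha s).val) p m
      ≤ ENNReal.ofReal C * eLpNorm (F.ptNorm s.val) p m := by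
    refine eLpNorm_le_mul_eLpNorm_of_ae_le_mul ?_ _
    filter_upwards [F.ptNorm_smul ha.1 s.cv, hC] with x h1 h2
    change ‖F.ptNorm (fun y => a y • s.val y) x‖ ≤ _
    rw [h1, norm_mul, Real.norm_eq_abs, abs_abs]
    gcongr
  have h3 := ENNReal.toReal_mono (ENNReal.mul_ne_top ENNReal.ofReal_ne_top s.memLp.2.ne) h
  rwa [ENNReal.toReal_mul, ENNReal.toReal_ofReal hC0] at h3

instance : NormedSpace ℝ F.PreModule where
  norm_smul_le c s := F.preSMul_norm_le (IsSimple.const c) (norm_nonneg c) (ae_of_all _ fun _ => le_rfl) s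

/-- The `F`-module: the completion of `Pfm/∼`. -/
abbrev FModule : Type _ := Completion F.PreModule

/-- The pre-form `{(f, M)}`. -/
def single (f : D) : F.PreModule :=
  (⟨fun _ => f, CountablyValued.const f, Lp.memLp (F.toFun f)⟩ : F.pfm)

/-- The operator `d_F f = [f, M]`. -/
def d : D →ₗ[ℝ] F.FModule where
  toFun f := ((F.single f : F.PreModule) : F.FModule)
  map_add' f g := (Completion.coe_add (F.single f) (F.single g))
  map_smul' c f := (Completion.coe_smul c (F.single f))

/-- Multiplication by a simple function on the `F`-module. -/
def simpleMul (a : X → ℝ) (ha : IsSimple a) : F.FModule →L[ℝ] F.FModule :=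
  ((F.preSMul a ha).mkContinuousOfExistsBound
    ⟨|ha.2.choose|, fun s => F.preSMul_norm_le ha (abs_nonneg _)
      (ae_of_all _ fun x => (ha.2.choose_spec x).trans (le_abs_self _)) s⟩).completion

theorem simpleMul_coe (a : X → ℝ) (ha : IsSimple a) (s : F.PreModule) :
    F.simpleMul a ha (s : F.FModule) = (F.preSMul a ha s : F.PreModule) :=
  ContinuousLinearMap.completion_apply_coe _ s

theorem simpleMul_norm_le {a : X → ℝ} (ha : IsSimple a) {C : ℝ} (hC0 : 0 ≤ C)
    (hC : ∀ᵐ x ∂m, |a x| ≤ C) (v : F.FModule) : ‖F.simpleMul a ha v‖ ≤ C * ‖v‖ := by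
  induction v using Completion.induction_on with
  | hp => exact isClosed_le (by fun_prop) (by fun_prop)
  | ih s =>
    rw [simpleMul_coe, Completion.norm_coe, Completion.norm_coe]
    exact F.preSMul_norm_le ha hC0 hC s

theorem simpleMul_add {a b : X → ℝ} (ha : IsSimple a) (hb : IsSimple b) (v : F.FModule) :
    F.simpleMul _ (ha.add hb) v = F.simpleMul a ha v + F.simpleMul b hb v := by
  induction v using Completion.induction_on with
  | hp => exact isClosed_eq (by fun_prop) (by fun_prop)
  | ih s =>
    rw [simpleMul_coe, simpleMul_coe, simpleMul_coe, ← Completion.coe_add]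
    congr 1
    exact Subtype.ext (funext fun x => add_smul (a x) (b x) (s.val x))

theorem simpleMul_sub {a b : X → ℝ} (ha : IsSimple a) (hb : IsSimple b) (v : F.FModule) :
    F.simpleMul _ (ha.sub hb) v = F.simpleMul a ha v - F.simpleMul b hb v := by
  induction v using Completion.induction_on with
  | hp => exact isClosed_eq (by fun_prop) (by fun_prop)
  | ih s =>
    rw [simpleMul_coe, simpleMul_coe, simpleMul_coe, ← Completion.coe_sub]
    congr 1
    exact Subtype.ext (funext fun x => sub_smul (a x) (b x) (s.val x))

theorem simpleMul_mul {a b : X → ℝ} (ha : IsSimple a) (hb : IsSimple b) (v : F.FModule) :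
    F.simpleMul _ (ha.mul hb) v = F.simpleMul a ha (F.simpleMul b hb v) := by
  induction v using Completion.induction_on with
  | hp => exact isClosed_eq (by fun_prop) (by fun_prop)
  | ih s =>
    rw [simpleMul_coe, simpleMul_coe, simpleMul_coe]
    congr 1
    exact Subtype.ext (funext fun x => mul_smul (a x) (b x) (s.val x))

theorem simpleMul_one (v : F.FModule) : F.simpleMul _ (IsSimple.const 1) v = v := by
  induction v using Completion.induction_on with
  | hp => exact isClosed_eq (by fun_prop) (by fun_prop)
  | ih s =>
    rw [simpleMul_coe]
    congr 1
    exact Subtype.ext (funext fun x => one_smul ℝ (s.val x))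

theorem tendsto_one_div : Tendsto (fun n : ℕ => 1 / ((n : ℝ) + 1)) atTop (𝓝 0) :=
  tendsto_one_div_add_atTop_nhds_zero_nat

theorem exists_smul (a : LInfty m) (v : F.FModule) :
    ∃ w : F.FModule, ∀ (b : X → ℝ) (hb : IsSimple b) (ε : ℝ), 0 ≤ ε →
      (∀ᵐ x ∂m, |a x - b x| ≤ ε) → ‖w - F.simpleMul b hb v‖ ≤ ε * ‖v‖ := by
  obtain ⟨b, hb, hab⟩ := a.exists_simple
  have key : ∀ (n : ℕ) (c : X → ℝ) (hc : IsSimple c) (ε : ℝ), 0 ≤ ε →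
      (∀ᵐ x ∂m, |a x - c x| ≤ ε) →
      ‖F.simpleMul (b n) (hb n) v - F.simpleMul c hc v‖ ≤ (1 / ((n : ℝ) + 1) + ε) * ‖v‖ := by
    intro n c hc ε hε h
    rw [← simpleMul_sub]
    refine F.simpleMul_norm_le _ (by positivity) ?_ v
    filter_upwards [hab n, h] with x h1 h2
    rw [abs_le] at *
    constructor <;> linarith [h1.1, h1.2, h2.1, h2.2]
  have hcau : CauchySeq fun n => F.simpleMul (b n) (hb n) v := by
    refine cauchySeq_of_le_tendsto_0 (fun n : ℕ => 2 * (1 / ((n : ℝ) + 1)) * ‖v‖) ?_ ?_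
    · intro n k N hn hk
      rw [dist_eq_norm]
      refine (key n _ (hb k) _ (by positivity) (hab k)).trans ?_
      have h1 : 1 / ((n : ℝ) + 1) ≤ 1 / ((N : ℝ) + 1) := by gcongr
      have h2 : 1 / ((k : ℝ) + 1) ≤ 1 / ((N : ℝ) + 1) := by gcongr
      gcongr
      linarith
    · simpa using (tendsto_one_div.const_mul 2).mul_const ‖v‖
  obtain ⟨w, hw⟩ := cauchySeq_tendsto_of_complete hcau
  refine ⟨w, fun c hc ε hε h => ?_⟩
  refine le_of_tendsto_of_tendsto' (hw.sub_const _).norm ?_ fun n => key n c hc ε hε h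
  simpa using (tendsto_one_div.add_const ε).mul_const ‖v‖

/-- The product `a · v` of `a ∈ L^∞(m)` and an element of the `F`-module: the extension by
continuity of the multiplication by simple functions. -/
instance : SMul (LInfty m) F.FModule where
  smul a v := (F.exists_smul a v).choose

theorem smul_sub_le (a : LInfty m) (v : F.FModule) (b : X → ℝ) (hb : IsSimple b) (ε : ℝ)
    (hε : 0 ≤ ε) (h : ∀ᵐ x ∂m, |a x - b x| ≤ ε) :
    ‖a • v - F.simpleMul b hb v‖ ≤ ε * ‖v‖ :=
  (F.exists_smul a v).choose_spec b hb ε hε h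

theorem tendsto_smul (a : LInfty m) (v : F.FModule) {b : ℕ → X → ℝ} (hb : ∀ n, IsSimple (b n))
    {ε : ℕ → ℝ} (hε0 : ∀ n, 0 ≤ ε n) (hε : Tendsto ε atTop (𝓝 0))
    (h : ∀ n, ∀ᵐ x ∂m, |a x - b n x| ≤ ε n) :
    Tendsto (fun n => F.simpleMul (b n) (hb n) v) atTop (𝓝 (a • v)) := by
  rw [tendsto_iff_norm_sub_tendsto_zero]
  refine squeeze_zero (fun _ => norm_nonneg _) (fun n => ?_)
    (by simpa using hε.mul_const ‖v‖)
  rw [norm_sub_rev]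
  exact F.smul_sub_le a v (b n) (hb n) (ε n) (hε0 n) (h n)

theorem smul_eq_of_simple (a : LInfty m) (v : F.FModule) (b : X → ℝ) (hb : IsSimple b)
    (h : ∀ᵐ x ∂m, a x = b x) : a • v = F.simpleMul b hb v := by
  have h1 := F.smul_sub_le a v b hb 0 le_rfl (by filter_upwards [h] with x hx; simp [hx])
  rw [zero_mul] at h1
  exact sub_eq_zero.1 (norm_le_zero_iff.1 h1)

theorem norm_smul_le_of_bound (a : LInfty m) {C : ℝ} (hC0 : 0 ≤ C) (hC : ∀ᵐ x ∂m, |a x| ≤ C)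
    (v : F.FModule) : ‖a • v‖ ≤ C * ‖v‖ := by
  obtain ⟨b, hb, hab⟩ := a.exists_simple
  have ht := F.tendsto_smul a v hb (fun n => by positivity) tendsto_one_div hab
  have hl : Tendsto (fun n : ℕ => (C + 1 / ((n : ℝ) + 1)) * ‖v‖) atTop (𝓝 (C * ‖v‖)) := by
    simpa using (tendsto_one_div.const_add C).mul_const ‖v‖
  refine le_of_tendsto_of_tendsto' ht.norm hl fun n => ?_
  refine F.simpleMul_norm_le (hb n) (by positivity) ?_ v
  filter_upwards [hC, hab n] with x h1 h2
  rw [abs_le] at *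
  constructor <;> linarith [h1.1, h1.2, h2.1, h2.2]

/-- The `F`-module is a module over `L^∞(m)`. -/
instance : Module (LInfty m) F.FModule where
  one_smul v := by
    rw [F.smul_eq_of_simple 1 v _ (IsSimple.const 1) LInfty.coe_one_ae, simpleMul_one]
  mul_smul a c v := by
    obtain ⟨b, hb, hab⟩ := a.exists_simple
    obtain ⟨e, he, hce⟩ := c.exists_simple
    obtain ⟨A, hA0, hA⟩ := a.exists_bound
    obtain ⟨K, hK0, hK⟩ := c.exists_bound
    have h1 : Tendsto (fun n => F.simpleMul _ ((hb n).mul (he n)) v) atTop (𝓝 ((a * c) • v)) := by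
      refine F.tendsto_smul (a * c) v (fun n => (hb n).mul (he n))
        (ε := fun n : ℕ => A * (1 / ((n : ℝ) + 1))
          + (1 / ((n : ℝ) + 1)) * (K + 1 / ((n : ℝ) + 1)))
        (fun n => by positivity) ?_ fun n => ?_
      · simpa using (tendsto_one_div.const_mul A).add
          (tendsto_one_div.mul (tendsto_one_div.const_add K))
      · filter_upwards [hA, hK, hab n, hce n, LInfty.coe_mul_ae a c] with x h1 h2 h3 h4 h5
        have h6 : |e n x| ≤ K + 1 / ((n : ℝ) + 1) := by
          rw [abs_le] at *
          constructor <;> linarith [h2.1, h2.2, h4.1, h4.2]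
        rw [h5, show a x * c x - b n x * e n x
          = a x * (c x - e n x) + (a x - b n x) * e n x by ring]
        refine (abs_add_le _ _).trans ?_
        rw [abs_mul, abs_mul]
        gcongr
    have h2 : Tendsto (fun n => F.simpleMul (b n) (hb n) (F.simpleMul (e n) (he n) v)) atTop
        (𝓝 (a • c • v)) := by
      have h3 := F.tendsto_smul a (c • v) hb (fun n => by positivity) tendsto_one_div hab
      have h4 := F.tendsto_smul c v he (fun n => by positivity) tendsto_one_div hce
      have h5 : Tendsto (fun n => F.simpleMul (b n) (hb n) (F.simpleMul (e n) (he n) v - c • v))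
          atTop (𝓝 0) := by
        refine squeeze_zero_norm (a := fun n => (A + 1) * ‖F.simpleMul (e n) (he n) v - c • v‖)
          (fun n => F.simpleMul_norm_le (hb n) (by positivity) ?_ _) ?_
        · have hn : 1 / ((n : ℝ) + 1) ≤ 1 := by
            rw [div_le_one (by positivity)]
            linarith [Nat.cast_nonneg (α := ℝ) n]
          filter_upwards [hA, hab n] with x h1 h2
          rw [abs_le] at *
          constructor <;> linarith [h1.1, h1.2, h2.1, h2.2]
        · simpa using (tendsto_iff_norm_sub_tendsto_zero.1 h4).const_mul (A + 1)
      have h6 := h3.add h5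
      rw [add_zero] at h6
      refine h6.congr fun n => ?_
      rw [← map_add]
      congr 1
      abel
    refine tendsto_nhds_unique h1 (h2.congr fun n => ?_)
    rw [simpleMul_mul]
  smul_zero a := by
    obtain ⟨C, hC0, hC⟩ := a.exists_bound
    have h := F.norm_smul_le_of_bound a hC0 hC 0
    rw [norm_zero, mul_zero] at h
    exact norm_le_zero_iff.1 h
  smul_add a v w := by
    obtain ⟨b, hb, hab⟩ := a.exists_simple
    have h1 := F.tendsto_smul a v hb (fun n => by positivity) tendsto_one_div hab
    have h2 := F.tendsto_smul a w hb (fun n => by positivity) tendsto_one_div hab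
    have h3 := F.tendsto_smul a (v + w) hb (fun n => by positivity) tendsto_one_div hab
    exact tendsto_nhds_unique h3 ((h1.add h2).congr fun n => (map_add _ v w).symm)
  add_smul a c v := by
    obtain ⟨b, hb, hab⟩ := a.exists_simple
    obtain ⟨e, he, hce⟩ := c.exists_simple
    have h1 := F.tendsto_smul a v hb (fun n => by positivity) tendsto_one_div hab
    have h2 := F.tendsto_smul c v he (fun n => by positivity) tendsto_one_div hce
    have h3 : Tendsto (fun n => F.simpleMul _ ((hb n).add (he n)) v) atTop (𝓝 ((a + c) • v)) := by
      refine F.tendsto_smul (a + c) v (fun n => (hb n).add (he n))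
        (ε := fun n : ℕ => 1 / ((n : ℝ) + 1) + 1 / ((n : ℝ) + 1)) (fun n => by positivity)
        (by simpa using tendsto_one_div.add tendsto_one_div) fun n => ?_
      filter_upwards [hab n, hce n, Lp.coeFn_add a c] with x h1 h2 h3
      rw [h3, Pi.add_apply]
      rw [abs_le] at *
      constructor <;> linarith [h1.1, h1.2, h2.1, h2.2]
    exact tendsto_nhds_unique h3 ((h1.add h2).congr fun n => (F.simpleMul_add _ _ v).symm)
  zero_smul v := by
    have h := F.norm_smul_le_of_bound 0 le_rfl
      (by filter_upwards [Lp.coeFn_zero ℝ ∞ m] with x hx using (abs_eq_zero.2 hx).le) v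
    rw [zero_mul] at h
    exact norm_le_zero_iff.1 h

instance : ContinuousConstSMul (LInfty m) F.FModule where
  continuous_const_smul a := by
    obtain ⟨C, hC0, hC⟩ := a.exists_bound
    refine AddMonoidHomClass.continuous_of_bound
      (DistribSMul.toAddMonoidHom F.FModule a) C fun v => ?_
    exact F.norm_smul_le_of_bound a hC0 hC v

end LpFunctional
/-! ## Local dimension of an `L^∞(m)`-module, reflexivity -/

section Dimension

variable {X : Type*} [MeasurableSpace X] (m : Measure X) {𝓜 : Type*} [AddCommGroup 𝓜]
  [Module (LInfty m) 𝓜]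

/-- The set `S` is locally independent on `A`: a relation `∑ a_v v = 0` on `A` between finitely
many elements of `S`, with coefficients in `L^∞(m)`, forces all `a_v` to vanish on `A`. -/
def LocallyIndependent {A : Set X} (hA : MeasurableSet A) (S : Set 𝓜) : Prop :=
  ∀ (I : Finset 𝓜), (I : Set 𝓜) ⊆ S → ∀ a : 𝓜 → LInfty m,
    LInfty.chi m hA • (∑ v ∈ I, a v • v) = 0 → ∀ v ∈ I, LInfty.chi m hA * a v = 0

/-- `S` is a locally independent set on `A` of elements supported in `A`. -/
def IsIndependentSetOn {A : Set X} (hA : MeasurableSet A) (S : Set 𝓜) : Prop :=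
  (∀ v ∈ S, LInfty.chi m hA • v = v) ∧ LocallyIndependent m hA S

variable (𝓜) in
/-- `𝓜` has constant local dimension `n` on `E`: for every measurable `A ⊆ E` of positive measure,
every maximal independent set on `A` has cardinality `n`. -/
def HasLocalDim (E : Set X) (n : ℕ) : Prop :=
  ∀ (A : Set X) (hA : MeasurableSet A), A ⊆ E → m A ≠ 0 →
    ∀ S : Set 𝓜, Maximal (IsIndependentSetOn m hA) S → S.encard = n

variable (𝓜) in
/-- `δ` is the local dimension function `x ↦ dim(𝓜, x)` of a locally finite dimensional module:
`E_n = {δ = n}` and `E_∞ = {δ = ∞}` is a measurable partition with `m(E_∞) = 0`, and `𝓜` has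
dimension `n` on `E_n`. -/
def IsLocalDim (δ : X → ℕ∞) : Prop :=
  Measurable δ ∧ m {x | δ x = ⊤} = 0 ∧ ∀ n : ℕ, HasLocalDim m 𝓜 {x | δ x = n} n

variable (𝓜) in
/-- `𝓜` is locally finite dimensional. -/
def LocallyFiniteDim : Prop := ∃ δ : X → ℕ∞, IsLocalDim m 𝓜 δ

variable (𝓜) in
/-- `𝓜` has local finite dimension bounded by `N`. -/
def LocalDimBoundedBy (N : ℕ) : Prop :=
  ∃ δ : X → ℕ∞, IsLocalDim m 𝓜 δ ∧ ∀ᵐ x ∂m, δ x ≤ N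

end Dimension

/-- A normed space is reflexive if the canonical map into its bidual is onto. -/
def IsReflexive (E : Type*) [NormedAddCommGroup E] [NormedSpace ℝ E] : Prop :=
  Function.Surjective (NormedSpace.inclusionInDoubleDual ℝ E)

/-! ## Convergence in `L^0(m)` -/

/-- Convergence in `L^0(m)`: convergence in measure on sets of finite measure. -/
def TendstoL0 {X : Type*} [MeasurableSpace X] (m : Measure X) (u : ℕ → X → ℝ) (f : X → ℝ) : Prop :=
  ∀ A, MeasurableSet A → m A < ∞ → TendstoInMeasure (m.restrict A) u atTop f

/-! ## The local Lipschitz constant -/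

section Slope

variable {X : Type*} [MetricSpace X]

/-- The local Lipschitz constant `lip f(x) = limsup_{y → x} |f(y) - f(x)| / d(y,x)`
(equal to `0` at isolated points). -/
def lipConst (f : X → ℝ) (x : X) : ℝ≥0∞ :=
  limsup (fun y => edist (f y) (f x) / edist y x) (𝓝[≠] x)

theorem ennreal_limsup_add_le {α : Type*} (l : Filter α) (u v : α → ℝ≥0∞) :
    limsup (u + v) l ≤ limsup u l + limsup v l := by
  by_cases hu : limsup u l = ∞
  · simp [hu]
  by_cases hv : limsup v l = ∞
  · simp [hv]
  refine ENNReal.le_of_forall_pos_le_add fun ε hε _ => ?_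
  have hε2 : ((ε / 2 : ℝ≥0) : ℝ≥0∞) ≠ 0 := by
    have : 0 < ε / 2 := by positivity
    exact_mod_cast this.ne'
  have h1 := eventually_lt_of_limsup_lt (ENNReal.lt_add_right hu hε2)
  have h2 := eventually_lt_of_limsup_lt (ENNReal.lt_add_right hv hε2)
  refine limsup_le_of_le (h := ?_)
  filter_upwards [h1, h2] with x hx hy
  calc u x + v x ≤ (limsup u l + (ε / 2 : ℝ≥0)) + (limsup v l + (ε / 2 : ℝ≥0)) :=
        add_le_add hx.le hy.le
    _ = limsup u l + limsup v l + ((ε / 2 : ℝ≥0) + (ε / 2 : ℝ≥0) : ℝ≥0) := by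
        push_cast
        ring
    _ = _ := by rw [add_halves]

theorem lipConst_add_le (f g : X → ℝ) (x : X) :
    lipConst (f + g) x ≤ lipConst f x + lipConst g x := by
  refine le_trans (limsup_le_limsup (Eventually.of_forall fun y => ?_))
    (ennreal_limsup_add_le _ _ _)
  simp only [Pi.add_apply]
  rw [← ENNReal.add_div]
  gcongr
  exact edist_add_add_le _ _ _ _

theorem lipConst_smul (c : ℝ) (f : X → ℝ) (x : X) :
    lipConst (c • f) x = ‖c‖ₑ * lipConst f x := by
  rw [lipConst, lipConst, ← ENNReal.limsup_const_mul_of_ne_top enorm_ne_top]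
  congr 1
  funext y
  simp only [Pi.smul_apply]
  rw [edist_smul₀, ENNReal.smul_def, smul_eq_mul, mul_div_assoc]
  rfl

theorem lipConst_le {f : X → ℝ} {K : ℝ≥0} (hf : LipschitzWith K f) (x : X) :
    lipConst f x ≤ K := by
  refine limsup_le_of_le (h := ?_)
  exact Eventually.of_forall fun y => ENNReal.div_le_of_le_mul (hf y x)

theorem measurable_lipConst [MeasurableSpace X] [BorelSpace X] {f : X → ℝ} (hf : Continuous f) :
    Measurable (lipConst f) := by
  have h : lipConst f = fun x => ⨅ n : ℕ, ⨆ y, ⨆ _ : dist y x < 1 / ((n : ℝ) + 1) ∧ y ≠ x,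
      edist (f y) (f x) / edist y x := by
    funext x
    have hb := nhdsWithin_hasBasis (Metric.nhds_basis_ball_inv_nat_succ (x := x)) {x}ᶜ
    rw [lipConst, hb.limsup_eq_iInf_iSup]
    simp
  rw [h]
  refine Measurable.iInf fun n => LowerSemicontinuous.measurable ?_
  refine lowerSemicontinuous_iSup fun y x₀ c hc => ?_
  change c < ⨆ _ : dist y x₀ < 1 / ((n : ℝ) + 1) ∧ y ≠ x₀, edist (f y) (f x₀) / edist y x₀ at hc
  by_cases hy : dist y x₀ < 1 / ((n : ℝ) + 1) ∧ y ≠ x₀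
  · have hc' : c < edist (f y) (f x₀) / edist y x₀ := by
      rwa [iSup_pos hy] at hc
    have h1 : ∀ᶠ x in 𝓝 x₀, dist y x < 1 / ((n : ℝ) + 1) :=
      (continuous_const.dist continuous_id).continuousAt.eventually_lt_const hy.1
    have h2 : ∀ᶠ x in 𝓝 x₀, y ≠ x := by
      filter_upwards [isOpen_ne.mem_nhds hy.2.symm] with x hx using Ne.symm hx
    have hq : Tendsto (fun x => edist (f y) (f x) / edist y x) (𝓝 x₀)
        (𝓝 (edist (f y) (f x₀) / edist y x₀)) := by
      refine ENNReal.Tendsto.div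
        ((continuous_const.edist hf).tendsto x₀) (Or.inr ?_)
        ((continuous_const.edist continuous_id).tendsto x₀) (Or.inl (edist_ne_top _ _))
      exact (edist_pos.2 hy.2).ne'
    filter_upwards [h1, h2, hq.eventually_const_lt hc'] with x h3 h4 h5
    change c < ⨆ _ : dist y x < 1 / ((n : ℝ) + 1) ∧ y ≠ x, edist (f y) (f x) / edist y x
    rwa [iSup_pos ⟨h3, h4⟩]
  · rw [iSup_neg hy] at hc
    exact absurd hc not_lt_bot

end Slope

/-! ## The functional `f ↦ lip f` -/

section LipFunctional

variable {X : Type*} [MetricSpace X]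

/-- The local Lipschitz constant as a real-valued function. -/
def locLip (f : X → ℝ) (x : X) : ℝ := (lipConst f x).toReal

theorem locLip_measurable [MeasurableSpace X] [BorelSpace X] {f : X → ℝ} (hf : Continuous f) : Measurable (locLip f) :=
  (measurable_lipConst hf).ennreal_toReal

theorem locLip_nonneg (f : X → ℝ) (x : X) : 0 ≤ locLip f x := ENNReal.toReal_nonneg

theorem locLip_add_le {f g : X → ℝ} {K L : ℝ≥0} (hf : LipschitzWith K f) (hg : LipschitzWith L g)
    (x : X) : locLip (f + g) x ≤ locLip f x + locLip g x := by
  have h1 : lipConst f x ≠ ∞ := ((lipConst_le hf x).trans_lt ENNReal.coe_lt_top).ne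
  have h2 : lipConst g x ≠ ∞ := ((lipConst_le hg x).trans_lt ENNReal.coe_lt_top).ne
  rw [locLip, locLip, locLip, ← ENNReal.toReal_add h1 h2]
  exact ENNReal.toReal_mono (ENNReal.add_ne_top.2 ⟨h1, h2⟩) (lipConst_add_le f g x)

theorem locLip_smul (c : ℝ) (f : X → ℝ) (x : X) : locLip (c • f) x = |c| * locLip f x := by
  rw [locLip, locLip, lipConst_smul, ENNReal.toReal_mul, toReal_enorm, Real.norm_eq_abs]

variable [MeasurableSpace X] [BorelSpace X]

/-- The vector space of Lipschitz functions `f` with `lip f ∈ L^p(m)`. -/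
def lipSubmodule (m : Measure X) (p : ℝ≥0) : Submodule ℝ (X → ℝ) where
  carrier := {f | (∃ K, LipschitzWith K f) ∧ MemLp (locLip f) p m}
  add_mem' := by
    rintro f g ⟨⟨K, hf⟩, hf'⟩ ⟨⟨L, hg⟩, hg'⟩
    refine ⟨⟨K + L, hf.add hg⟩, (hf'.add hg').mono'
      (locLip_measurable (hf.add hg).continuous).aestronglyMeasurable (ae_of_all _ fun x => ?_)⟩
    rw [Real.norm_of_nonneg (locLip_nonneg _ _)]
    exact locLip_add_le hf hg x
  zero_mem' := by
    refine ⟨⟨0, LipschitzWith.const' 0⟩, ?_⟩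
    have : locLip (0 : X → ℝ) = 0 := by
      funext x
      simpa using locLip_smul 0 (0 : X → ℝ) x
    rw [this]
    exact MemLp.zero
  smul_mem' := by
    rintro c f ⟨⟨K, hf⟩, hf'⟩
    refine ⟨⟨_, (lipschitzWith_smul c).comp hf⟩, ?_⟩
    have : locLip (c • f) = fun x => |c| * locLip f x := funext fun x => locLip_smul c f x
    rw [this]
    exact hf'.const_mul _

/-- The domain `D(F^lip_p) = {f ∈ Lip(M,d) : lip f ∈ L^p(m)}`. -/
def LipDomain (m : Measure X) (p : ℝ≥0) : Type _ := lipSubmodule m p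

variable (m : Measure X) (p : ℝ≥0)

instance : AddCommGroup (LipDomain m p) := inferInstanceAs (AddCommGroup (lipSubmodule m p))
instance : Module ℝ (LipDomain m p) := inferInstanceAs (Module ℝ (lipSubmodule m p))

variable {m p}

/-- The function underlying an element of the domain. -/
def LipDomain.val (f : LipDomain m p) : X → ℝ := (f : lipSubmodule m p).1

theorem LipDomain.lip (f : LipDomain m p) : ∃ K, LipschitzWith K f.val := (f : lipSubmodule m p).2.1

theorem LipDomain.continuous (f : LipDomain m p) : Continuous f.val := f.lip.choose_spec.continuous

theorem LipDomain.memLp (f : LipDomain m p) : MemLp (locLip f.val) p m := (f : lipSubmodule m p).2.2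

variable (m p)

/-- The functional `F^lip_p : f ↦ lip f`. -/
def lipFunctional [Fact (1 ≤ (p : ℝ≥0∞))] : LpFunctional m p (LipDomain m p) where
  toFun f := f.memLp.toLp (locLip f.val)
  nonneg f := by
    rw [← Lp.coeFn_nonneg]
    filter_upwards [f.memLp.coeFn_toLp] with x hx
    rw [hx]
    exact locLip_nonneg _ _
  add_le f g := by
    rw [← Lp.coeFn_le]
    filter_upwards [f.memLp.coeFn_toLp, g.memLp.coeFn_toLp, (f + g).memLp.coeFn_toLp,
      Lp.coeFn_add (f.memLp.toLp _) (g.memLp.toLp _)] with x h1 h2 h3 h4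
    rw [h3, h4, Pi.add_apply, h1, h2]
    exact locLip_add_le f.lip.choose_spec g.lip.choose_spec x
  smul_eq c f := by
    refine Lp.ext ?_
    filter_upwards [f.memLp.coeFn_toLp, (c • f).memLp.coeFn_toLp,
      Lp.coeFn_smul |c| (f.memLp.toLp (locLip f.val))] with x h1 h2 h3
    rw [h2, h3, Pi.smul_apply, h1, smul_eq_mul]
    exact locLip_smul c f.val x

end LipFunctional
/-! ## Infima in `L^p(m)` -/

theorem LpAux.abs_smul_mono (c : ℝ) {X : Type*} [MeasurableSpace X] {m : Measure X} {p : ℝ≥0} {G H : Lp ℝ p m} (h : G ≤ H) : |c| • G ≤ |c| • H := by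
  rw [← Lp.coeFn_le] at *
  filter_upwards [h, Lp.coeFn_smul |c| G, Lp.coeFn_smul |c| H] with x h1 h2 h3
  rw [h2, h3, Pi.smul_apply, Pi.smul_apply]
  exact mul_le_mul_of_nonneg_left h1 (abs_nonneg c)

section LpAux

variable {X : Type*} [MeasurableSpace X] {m : Measure X} {p : ℝ≥0} [Fact (1 ≤ (p : ℝ≥0∞))]

theorem LpAux.isClosed_nonneg : IsClosed {G : Lp ℝ p m | 0 ≤ G} := isClosed_le continuous_const
  continuous_id

theorem LpAux.norm_sub_rpow_le {G H : Lp ℝ p m} (hG : 0 ≤ G) (h : G ≤ H) :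
    ‖H - G‖ ^ (p : ℝ) + ‖G‖ ^ (p : ℝ) ≤ ‖H‖ ^ (p : ℝ) := by
  have hp1 : (1 : ℝ) ≤ p := by
    have : 1 ≤ (p : ℝ≥0∞) := Fact.out
    exact_mod_cast this
  have hp0 : (p : ℝ≥0∞) ≠ 0 := (zero_lt_one.trans_le (Fact.out : 1 ≤ (p : ℝ≥0∞))).ne'
  have key : ∀ K : Lp ℝ p m, ENNReal.ofReal (‖K‖ ^ (p : ℝ)) = ∫⁻ x, ‖K x‖ₑ ^ (p : ℝ) ∂m := by
    intro K
    rw [← ENNReal.ofReal_rpow_of_nonneg (norm_nonneg _) (by linarith), Lp.norm_def,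
      ENNReal.ofReal_toReal (Lp.eLpNorm_ne_top K),
      eLpNorm_eq_lintegral_rpow_enorm_toReal hp0 ENNReal.coe_ne_top, ENNReal.coe_toReal,
      ← ENNReal.rpow_mul, one_div_mul_cancel (by linarith), ENNReal.rpow_one]
  rw [← ENNReal.ofReal_le_ofReal_iff (by positivity),
    ENNReal.ofReal_add (by positivity) (by positivity), key, key, key,
    ← lintegral_add_left' (by fun_prop)]
  refine lintegral_mono_ae ?_
  filter_upwards [(Lp.coeFn_nonneg G).2 hG, (Lp.coeFn_le G H).2 h, Lp.coeFn_sub H G]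
    with x h1 h2 h3
  refine (ENNReal.add_rpow_le_rpow_add _ _ hp1).trans ?_
  gcongr
  rw [h3, Pi.sub_apply, Real.enorm_of_nonneg (sub_nonneg.2 h2), Real.enorm_of_nonneg h1,
    Real.enorm_of_nonneg (h1.trans h2), ← ENNReal.ofReal_add (sub_nonneg.2 h2) h1]
  simp

/-- Nonempty sets of nonnegative functions in `L^p(m)` have an infimum. -/
theorem LpAux.exists_isGLB {U : Set (Lp ℝ p m)} (hne : U.Nonempty) (h0 : ∀ G ∈ U, 0 ≤ G) :
    ∃ g, IsGLB U g := by
  have hp1 : (1 : ℝ) ≤ p := by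
    have : 1 ≤ (p : ℝ≥0∞) := Fact.out
    exact_mod_cast this
  have hp0 : (0 : ℝ) < p := by linarith
  obtain ⟨G₀, hG₀⟩ := hne
  let L : Set (Lp ℝ p m) := {K | 0 ≤ K ∧ K ∈ lowerBounds U}
  have hL0 : (0 : Lp ℝ p m) ∈ L := ⟨le_rfl, fun G hG => h0 G hG⟩
  have hsup : ∀ K ∈ L, ∀ K' ∈ L, K ⊔ K' ∈ L := fun K hK K' hK' =>
    ⟨hK.1.trans le_sup_left, fun G hG => sup_le (hK.2 hG) (hK'.2 hG)⟩
  have hnm : ∀ {K K' : Lp ℝ p m}, 0 ≤ K → K ≤ K' → ‖K‖ ≤ ‖K'‖ := fun {K K'} h1 h2 =>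
    norm_le_norm_of_abs_le_abs (by rwa [abs_of_nonneg h1, abs_of_nonneg (h1.trans h2)])
  have hbdd : BddAbove ((fun K : Lp ℝ p m => ‖K‖) '' L) := by
    refine ⟨‖G₀‖, ?_⟩
    rintro _ ⟨K, hK, rfl⟩
    exact hnm hK.1 (hK.2 hG₀)
  have hLne : ((fun K : Lp ℝ p m => ‖K‖) '' L).Nonempty := ⟨_, 0, hL0, rfl⟩
  set s := sSup ((fun K : Lp ℝ p m => ‖K‖) '' L) with hs
  have hle : ∀ K ∈ L, ‖K‖ ≤ s := fun K hK => le_csSup hbdd ⟨K, hK, rfl⟩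
  have hex : ∀ n : ℕ, ∃ K ∈ L, s - 1 / ((n : ℝ) + 1) < ‖K‖ := by
    intro n
    obtain ⟨_, ⟨K, hK, rfl⟩, h⟩ := exists_lt_of_lt_csSup hLne
      (show s - 1 / ((n : ℝ) + 1) < s from sub_lt_self _ (by positivity))
    exact ⟨K, hK, h⟩
  choose K hK hKs using hex
  let H : ℕ → Lp ℝ p m := fun n => Nat.rec (K 0) (fun k Hk => Hk ⊔ K (k + 1)) n
  have hH : ∀ n, H n ∈ L := by
    intro n
    induction n with
    | zero => exact hK 0
    | succ k ih => exact hsup _ ih _ (hK (k + 1))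
  have hmono : Monotone H := monotone_nat_of_le_succ fun n =>
    (le_sup_left : H n ≤ H n ⊔ K (n + 1))
  have hKH : ∀ n, K n ≤ H n := by
    intro n
    cases n with
    | zero => exact le_rfl
    | succ k => exact (le_sup_right : K (k + 1) ≤ H k ⊔ K (k + 1))
  have hlim : Tendsto (fun n => ‖H n‖) atTop (𝓝 s) := by
    have h1 : Tendsto (fun n : ℕ => s - 1 / ((n : ℝ) + 1)) atTop (𝓝 s) := by
      simpa using tendsto_one_div_add_atTop_nhds_zero_nat.const_sub s
    exact tendsto_of_tendsto_of_tendsto_of_le_of_le h1 tendsto_const_nhds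
      (fun n => (hKs n).le.trans (hnm (hK n).1 (hKH n))) fun n => hle _ (hH n)
  have hlimp : Tendsto (fun n => s ^ (p : ℝ) - ‖H n‖ ^ (p : ℝ)) atTop (𝓝 0) := by
    have h1 := (hlim.rpow_const (p := (p : ℝ)) (Or.inr hp0.le)).const_sub (s ^ (p : ℝ))
    rwa [sub_self] at h1
  have hs0 : 0 ≤ s := (norm_nonneg _).trans (hle 0 hL0)
  have hcau : CauchySeq H := by
    rw [Metric.cauchySeq_iff']
    intro ε hε
    have hev : ∀ᶠ n in atTop, s ^ (p : ℝ) - ‖H n‖ ^ (p : ℝ) < ε ^ (p : ℝ) :=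
      hlimp.eventually_lt_const (Real.rpow_pos_of_pos hε _)
    obtain ⟨N, hN⟩ := hev.exists
    refine ⟨N, fun n hn => ?_⟩
    rw [dist_eq_norm]
    have h1 := LpAux.norm_sub_rpow_le (hH N).1 (hmono hn)
    have h2 : ‖H n‖ ^ (p : ℝ) ≤ s ^ (p : ℝ) :=
      Real.rpow_le_rpow (norm_nonneg _) (hle _ (hH n)) hp0.le
    exact (Real.rpow_lt_rpow_iff (norm_nonneg _) hε.le hp0).1 (by linarith)
  obtain ⟨g, hg⟩ := cauchySeq_tendsto_of_complete hcau
  have hgs : ‖g‖ = s := tendsto_nhds_unique hg.norm hlim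
  have hgL : g ∈ L := ⟨ge_of_tendsto' hg fun n => (hH n).1,
    fun G hG => le_of_tendsto' hg fun n => (hH n).2 hG⟩
  refine ⟨g, hgL.2, fun K' hK' => ?_⟩
  have h1 : g ⊔ K' ∈ L := ⟨hgL.1.trans le_sup_left, fun G hG => sup_le (hgL.2 hG) (hK' hG)⟩
  have h2 := LpAux.norm_sub_rpow_le hgL.1 (le_sup_left : g ≤ g ⊔ K')
  have h3 : ‖g ⊔ K'‖ ^ (p : ℝ) ≤ ‖g‖ ^ (p : ℝ) := by
    rw [hgs]
    exact Real.rpow_le_rpow (norm_nonneg _) (hle _ h1) hp0.le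
  have h4 : ‖g ⊔ K' - g‖ = 0 := by
    by_contra hne
    have := Real.rpow_pos_of_pos (lt_of_le_of_ne (norm_nonneg _) (Ne.symm hne)) (p : ℝ)
    linarith
  have h5 : g ⊔ K' = g := sub_eq_zero.1 (norm_eq_zero.1 h4)
  exact (le_sup_right : K' ≤ g ⊔ K').trans h5.le

end LpAux

/-! ## Relaxation -/

section Relaxed

theorem TendstoL0.add {X : Type*} [MeasurableSpace X] {m : Measure X} {u v : ℕ → X → ℝ}
    {f g : X → ℝ} (hu : TendstoL0 m u f) (hv : TendstoL0 m v g) :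
    TendstoL0 m (fun n => u n + v n) (f + g) := by
  intro A hA hmA ε hε
  have h1 := hu A hA hmA (ε / 2) (ENNReal.half_pos hε.ne')
  have h2 := hv A hA hmA (ε / 2) (ENNReal.half_pos hε.ne')
  have h3 := h1.add h2
  rw [add_zero] at h3
  refine tendsto_of_tendsto_of_tendsto_of_le_of_le tendsto_const_nhds h3 (fun _ => zero_le)
    fun n => ?_
  refine (measure_mono fun x hx => ?_).trans (measure_union_le _ _)
  by_contra hcon
  simp only [mem_union, mem_ofPred_eq, not_or, not_le] at hcon
  have h4 := (edist_add_add_le (u n x) (v n x) (f x) (g x)).trans_lt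
    (ENNReal.add_lt_add hcon.1 hcon.2)
  rw [ENNReal.add_halves] at h4
  exact absurd hx (not_le.2 h4)

theorem TendstoL0.const_smul {X : Type*} [MeasurableSpace X] {m : Measure X} {u : ℕ → X → ℝ}
    {f : X → ℝ} (hu : TendstoL0 m u f) (c : ℝ) :
    TendstoL0 m (fun n => c • u n) (c • f) := by
  intro A hA hmA ε hε
  by_cases hc : c = 0
  · subst hc
    simp [hε.ne']
  have hc' : (‖c‖ₑ : ℝ≥0∞) ≠ 0 := by simpa using hc
  have h1 := hu A hA hmA (ε / ‖c‖ₑ) (ENNReal.div_pos hε.ne' enorm_ne_top)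
  refine h1.congr fun n => ?_
  congr 1
  ext x
  simp only [mem_ofPred_eq, Pi.smul_apply]
  rw [edist_smul₀, ENNReal.smul_def, smul_eq_mul, mul_comm]
  exact ENNReal.div_le_iff hc' enorm_ne_top

theorem TendstoL0.congr_right {X : Type*} [MeasurableSpace X] {m : Measure X} {u : ℕ → X → ℝ}
    {f g : X → ℝ} (hu : TendstoL0 m u f) (h : f =ᵐ[m] g) : TendstoL0 m u g :=
  fun A hA hmA => (hu A hA hmA).congr_right (ae_restrict_of_ae h)

theorem TendstoL0.const {X : Type*} [MeasurableSpace X] {m : Measure X} (f : X → ℝ) :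
    TendstoL0 m (fun _ => f) f := by
  intro A _ _ ε hε
  simp [hε.ne']

variable {X : Type*} [MetricSpace X] [MeasurableSpace X] [BorelSpace X] (m : Measure X) (p : ℝ≥0)
  [Fact (1 ≤ (p : ℝ≥0∞))]

/-- `G` is an upper relaxation at `f`: there are `f_n ∈ D(F^lip_p)` with `f_n → f` in `L^0(m)` and
`G_n ≥ lip f_n` with `G_n ⇀ G` weakly in `L^p(m)`. (By weak compactness this is the same as
`lip f_n ⇀ G'` for some `G' ≤ G`.) -/
def IsUpperRelaxation (f : X →ₘ[m] ℝ) (G : Lp ℝ p m) : Prop :=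
  ∃ (u : ℕ → LipDomain m p) (H : ℕ → Lp ℝ p m), TendstoL0 m (fun n => (u n).val) f ∧
    (∀ n, (lipFunctional m p).toFun (u n) ≤ H n) ∧
    ∀ φ : StrongDual ℝ (Lp ℝ p m), Tendsto (fun n => φ (H n)) atTop (𝓝 (φ G))

variable {m p}

theorem IsUpperRelaxation.add {f g : X →ₘ[m] ℝ} {G G' : Lp ℝ p m}
    (hf : IsUpperRelaxation m p f G) (hg : IsUpperRelaxation m p g G') :
    IsUpperRelaxation m p (f + g) (G + G') := by
  obtain ⟨u, H, h1, h2, h3⟩ := hf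
  obtain ⟨v, K, k1, k2, k3⟩ := hg
  refine ⟨fun n => u n + v n, fun n => H n + K n,
    (h1.add k1).congr_right (AEEqFun.coeFn_add f g).symm,
    fun n => ((lipFunctional m p).add_le _ _).trans (add_le_add (h2 n) (k2 n)), fun φ => ?_⟩
  simpa only [map_add] using (h3 φ).add (k3 φ)

theorem IsUpperRelaxation.smul {f : X →ₘ[m] ℝ} {G : Lp ℝ p m} (c : ℝ)
    (hf : IsUpperRelaxation m p f G) : IsUpperRelaxation m p (c • f) (|c| • G) := by
  obtain ⟨u, H, h1, h2, h3⟩ := hf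
  refine ⟨fun n => c • u n, fun n => |c| • H n,
    (h1.const_smul c).congr_right (AEEqFun.coeFn_smul c f).symm, fun n => ?_, fun φ => ?_⟩
  · rw [(lipFunctional m p).smul_eq]
    exact LpAux.abs_smul_mono c (h2 n)
  · simpa only [map_smul] using (h3 φ).const_smul |c|

theorem IsUpperRelaxation.nonneg {f : X →ₘ[m] ℝ} {G : Lp ℝ p m}
    (hf : IsUpperRelaxation m p f G) : 0 ≤ G := by
  obtain ⟨u, H, -, h2, h3⟩ := hf
  by_contra hG
  have hconv : Convex ℝ {G : Lp ℝ p m | 0 ≤ G} := by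
    intro x hx y hy a b ha hb _
    have h4 := LpAux.abs_smul_mono a hx
    have h5 := LpAux.abs_smul_mono b hy
    rw [smul_zero, abs_of_nonneg ha] at h4
    rw [smul_zero, abs_of_nonneg hb] at h5
    exact add_nonneg h4 h5
  obtain ⟨φ, c, hc, hφ⟩ := geometric_hahn_banach_point_closed hconv LpAux.isClosed_nonneg
    (show G ∉ {G : Lp ℝ p m | 0 ≤ G} from hG)
  exact absurd (ge_of_tendsto' (h3 φ) fun n =>
    (hφ (H n) (((lipFunctional m p).nonneg (u n)).trans (h2 n))).le) (not_le.2 hc)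

theorem isUpperRelaxation_lip (f : LipDomain m p) :
    IsUpperRelaxation m p (AEEqFun.mk f.val f.continuous.aestronglyMeasurable)
      ((lipFunctional m p).toFun f) :=
  ⟨fun _ => f, fun _ => (lipFunctional m p).toFun f,
    (TendstoL0.const f.val).congr_right (AEEqFun.coeFn_mk _ _).symm, fun _ => le_rfl,
    fun _ => tendsto_const_nhds⟩

theorem isUpperRelaxation_zero : IsUpperRelaxation m p 0 0 := by
  refine ⟨fun _ => 0, fun _ => 0, ?_, fun _ => ?_, fun φ => tendsto_const_nhds⟩
  · refine (TendstoL0.const (0 : X → ℝ)).congr_right ?_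
    exact (AEEqFun.coeFn_zero (α := X) (β := ℝ) (μ := m)).symm
  · rw [(lipFunctional m p).toFun_zero]

variable (m p)

/-- The domain `D(F_p)` of the relaxed functional: the `f ∈ L^0(m)` admitting an upper
relaxation. -/
def RelaxedDomain : Submodule ℝ (X →ₘ[m] ℝ) where
  carrier := {f | ∃ G, IsUpperRelaxation m p f G}
  add_mem' := fun ⟨G, hG⟩ ⟨G', hG'⟩ => ⟨G + G', hG.add hG'⟩
  zero_mem' := ⟨0, isUpperRelaxation_zero⟩
  smul_mem' := fun c _ ⟨G, hG⟩ => ⟨|c| • G, hG.smul c⟩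

variable {m p}

theorem exists_relaxedSlope (f : RelaxedDomain m p) :
    ∃ g, IsGLB {G | IsUpperRelaxation m p (f : X →ₘ[m] ℝ) G} g :=
  LpAux.exists_isGLB f.2 fun _ hG => hG.nonneg

/-- The relaxed slope `|Df|_{*,p}` (the lower relaxation of `lip` at `f`): the largest `L^p`
function which is a.e. below all upper relaxations at `f`. -/
def relaxedSlope (f : RelaxedDomain m p) : Lp ℝ p m := (exists_relaxedSlope f).choose

theorem isGLB_relaxedSlope (f : RelaxedDomain m p) :
    IsGLB {G | IsUpperRelaxation m p (f : X →ₘ[m] ℝ) G} (relaxedSlope f) :=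
  (exists_relaxedSlope f).choose_spec

theorem relaxedSlope_nonneg (f : RelaxedDomain m p) : 0 ≤ relaxedSlope f :=
  (isGLB_relaxedSlope f).2 fun _ hG => IsUpperRelaxation.nonneg hG

theorem relaxedSlope_add_le (f g : RelaxedDomain m p) :
    relaxedSlope (f + g) ≤ relaxedSlope f + relaxedSlope g := by
  rw [← sub_le_iff_le_add]
  refine (isGLB_relaxedSlope f).2 fun G hG => ?_
  rw [sub_le_comm]
  refine (isGLB_relaxedSlope g).2 fun G' hG' => ?_
  rw [sub_le_iff_le_add']
  exact (isGLB_relaxedSlope (f + g)).1 (IsUpperRelaxation.add hG hG')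

theorem relaxedSlope_smul_le (c : ℝ) (f : RelaxedDomain m p) (hc : c ≠ 0) :
    relaxedSlope (c • f) ≤ |c| • relaxedSlope f := by
  have h : |c⁻¹| • relaxedSlope (c • f) ≤ relaxedSlope f := by
    refine (isGLB_relaxedSlope f).2 fun G hG => ?_
    have h1 := LpAux.abs_smul_mono c⁻¹
      ((isGLB_relaxedSlope (c • f)).1 (IsUpperRelaxation.smul c hG))
    rwa [smul_smul, ← abs_mul, inv_mul_cancel₀ hc, abs_one, one_smul] at h1
  have h2 := LpAux.abs_smul_mono c h
  rwa [smul_smul, ← abs_mul, mul_inv_cancel₀ hc, abs_one, one_smul] at h2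

theorem relaxedSlope_smul (c : ℝ) (f : RelaxedDomain m p) :
    relaxedSlope (c • f) = |c| • relaxedSlope f := by
  by_cases hc : c = 0
  · subst hc
    rw [zero_smul, abs_zero, zero_smul]
    exact le_antisymm ((isGLB_relaxedSlope 0).1 isUpperRelaxation_zero) (relaxedSlope_nonneg 0)
  refine le_antisymm (relaxedSlope_smul_le c f hc) ?_
  have h := LpAux.abs_smul_mono c (relaxedSlope_smul_le c⁻¹ (c • f) (inv_ne_zero hc))
  rwa [smul_smul, inv_mul_cancel₀ hc, one_smul, smul_smul, ← abs_mul, mul_inv_cancel₀ hc,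
    abs_one, one_smul] at h

variable (m p)

/-- The functional `F_p : f ↦ |Df|_{*,p}`. -/
def relaxedFunctional : LpFunctional m p (RelaxedDomain m p) where
  toFun := relaxedSlope
  nonneg := relaxedSlope_nonneg
  add_le := relaxedSlope_add_le
  smul_eq := relaxedSlope_smul

variable {m p}

/-- A Lipschitz function with `lip f ∈ L^p(m)`, seen as an element of `D(F_p)`. -/
def LipDomain.toRelaxed (f : LipDomain m p) : RelaxedDomain m p :=
  ⟨AEEqFun.mk f.val f.continuous.aestronglyMeasurable, _, isUpperRelaxation_lip f⟩

end Relaxed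

/-! ## The Lipschitz, cotangent and `Lipschitz_0` modules, the Sobolev space -/

section Modules

variable {X : Type*} [MetricSpace X] [MeasurableSpace X] [BorelSpace X] (m : Measure X) (p : ℝ≥0)
  [Fact (1 ≤ (p : ℝ≥0∞))]

/-- The `L^p`-Lipschitz module `L^p_lip(T^*M)`. -/
abbrev LipModule : Type _ := (lipFunctional m p).FModule

/-- The `L^p`-cotangent module `L^p(T^*M)`. -/
abbrev CotangentModule : Type _ := (relaxedFunctional m p).FModule

/-- The Lipschitz differential `d_lip`. -/
def dLip : LipDomain m p →ₗ[ℝ] LipModule m p := (lipFunctional m p).d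

/-- The `L^p`-differential `d_p`. -/
def dSob : RelaxedDomain m p →ₗ[ℝ] CotangentModule m p := (relaxedFunctional m p).d

/-- The set of limits of `d_lip f_n` along sequences `f_n → 0` in `L^0(m)`. -/
def lipZeroSet : Set (LipModule m p) :=
  {ω | ∃ u : ℕ → LipDomain m p, TendstoL0 m (fun n => (u n).val) 0 ∧
    Tendsto (fun n => dLip m p (u n)) atTop (𝓝 ω)}

/-- The `Lipschitz_0` module: the (closed) submodule generated by `lipZeroSet`. -/
def lipZeroModule : Submodule (LInfty m) (LipModule m p) :=
  (Submodule.span (LInfty m) (lipZeroSet m p)).topologicalClosure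

/-- `d_lip` is closable as an operator from `L^0(m)` to `L^p_lip(T^*M)`. -/
def DLipClosable : Prop :=
  ∀ (u : ℕ → LipDomain m p) (ω : LipModule m p), TendstoL0 m (fun n => (u n).val) 0 →
    Tendsto (fun n => dLip m p (u n)) atTop (𝓝 ω) → ω = 0

/-- The functional `f ↦ ∫ (lip f)^p dm`. -/
def lipEnergy (f : LipDomain m p) : ℝ≥0∞ := ∫⁻ x, lipConst f.val x ^ (p : ℝ) ∂m

/-- Lower semicontinuity of `f ↦ ∫ (lip f)^p dm` on its domain, with respect to convergence in
`L^0(m)`. -/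
def LipEnergyLSC : Prop :=
  ∀ (u : ℕ → LipDomain m p) (f : LipDomain m p), TendstoL0 m (fun n => (u n).val) f.val →
    lipEnergy m p f ≤ liminf (fun n => lipEnergy m p (u n)) atTop

/-- The Sobolev space `W^{1,p}(M,m)` of all `f ∈ L^p(m) ∩ D(F_p)`, identified with the graph of
`d_p`: its norm is `‖f‖^p = ‖f‖_{L^p}^p + ‖d_p f‖^p`. -/
def SobolevSpace : Submodule ℝ (WithLp (p : ℝ≥0∞) (Lp ℝ p m × CotangentModule m p)) where
  carrier := {z | ∃ f : RelaxedDomain m p, (f : X →ₘ[m] ℝ) = (z.fst : X →ₘ[m] ℝ) ∧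
    dSob m p f = z.snd}
  add_mem' := by
    rintro z w ⟨f, hf, hf'⟩ ⟨g, hg, hg'⟩
    refine ⟨f + g, ?_, ?_⟩
    · simp [hf, hg]
    · simp [hf', hg']
  zero_mem' := ⟨0, by simp, by simp⟩
  smul_mem' := by
    rintro c z ⟨f, hf, hf'⟩
    refine ⟨c • f, ?_, ?_⟩
    · simp only [Submodule.coe_smul, hf]
      rfl
    · simp [hf']

end Modules
end

open MeasureTheory Filter Topology UniformSpace Set
open scoped ENNReal NNReal

noncomputable section

/-! ## Reflexive spaces -/

section Reflexive

variable {E F G : Type*} [NormedAddCommGroup E] [NormedSpace ℝ E] [NormedAddCommGroup F]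
  [NormedSpace ℝ F] [NormedAddCommGroup G] [NormedSpace ℝ G]

/-! The proof has two halves: commutative algebra over the ring `LInfty m`, which turns finite
dimension into reflexivity, and calculus of Lipschitz functions, which turns reflexivity into a
description of the relaxed slope.

Algebra. `LInfty m` is reduced, so its localization at a minimal prime `P` is a field. The sets `A`
with `chi m hA ∉ P` form an ultrafilter, and the localization of a module at `P` is a vector space,
whose dimension is `stalkRank`. Independence at `P` spreads out to a set
(`IndependentAt.exists_familyIndependentOn`), and the space of minimal primes is compact
(`LInfty.exists_cover`). Hence local dimension `n` on `A` means that the stalk has rank `n` at every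
minimal prime avoiding `χ_A` (`hasLocalDim_iff`). Localization is exact, so dimensions add in exact
sequences. Two lower semicontinuous ranks with a locally constant finite sum are locally constant,
so submodules and quotients stay locally finite dimensional.

Reflexivity. If the stalks have rank at most `n`, take `v` of largest support. The closed submodule
generated by `v` is isometric to a closed subspace of `L^p` of the finite measure `A ↦ ‖χ_A v‖^p`,
hence reflexive. The quotient has smaller stalks, and the three-space property closes an induction
on `n`. Since `p > 1`, functionals have absolutely continuous norms, and the pieces `{δ ≤ n}` glue
to a reflexive module.

Relaxation. Let `lipLimitSet f` consist of the limits of `d_lip u_n` with `u_n → f`. It is closed,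
and a translate of `lipZeroSet` when nonempty. By reflexivity and Mazur's lemma, the upper
relaxations at `f` are exactly the functions above `|ω|` for some `ω` in it
(`isUpperRelaxation_iff`). Truncation, the Leibniz rule with Lipschitz cutoffs and inner regularity
show that `lipZeroSet` is stable under `LInfty m`, so it equals the `Lipschitz_0` module
(`mem_lipZeroModule_iff`). Elements of `lipLimitSet f` can therefore be glued along measurable sets,
and one of smallest norm has pointwise norm equal to the relaxed slope
(`exists_mem_lipLimitSet_pnorm_eq`). So the quotient norm of `d_lip f` is the norm of `d_p f`, also
after restriction to any set, and the quotient is the cotangent module.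

The rest follows. Closability says that `Lipschitz_0` vanishes, hence that its dimension is zero.
Mazur's lemma gives lower semicontinuity from closability, and lower semicontinuity applied to
differences `u_n - u_k` gives the converse. The Sobolev space is a closed subspace of a reflexive
product. -/

/-- Functionals on an isometrically embedded subspace extend. -/
theorem LinearIsometry.exists_dual_extension (ι : F →ₗᵢ[ℝ] E) (l : StrongDual ℝ F) :
    ∃ L : StrongDual ℝ E, (∀ x, L (ι x) = l x) ∧ ‖L‖ = ‖l‖ := by
  obtain ⟨L, hL, hn⟩ := exists_extension_norm_eq (𝕜 := ℝ) (LinearMap.range ι.toLinearMap)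
    (l.comp ι.equivRange.symm.toContinuousLinearEquiv.toContinuousLinearMap)
  refine ⟨L, fun x => ?_, ?_⟩
  · have h := hL (ι.equivRange x)
    simp only [ContinuousLinearMap.comp_apply, ContinuousLinearEquiv.coe_coe,
      LinearIsometryEquiv.coe_toContinuousLinearEquiv, LinearIsometryEquiv.symm_apply_apply] at h
    exact h
  · rw [hn]
    refine le_antisymm (ContinuousLinearMap.opNorm_le_bound _ (norm_nonneg _) fun x => ?_)
      (ContinuousLinearMap.opNorm_le_bound _ (ContinuousLinearMap.opNorm_nonneg _) fun x => ?_)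
    · exact (l.le_opNorm _).trans_eq (by
        congr 1
        exact ι.equivRange.symm.norm_map x)
    · have h := (l.comp
        ι.equivRange.symm.toContinuousLinearEquiv.toContinuousLinearMap).le_opNorm (ι.equivRange x)
      simpa using h

/-- In a reflexive space the evaluation at a bidual element is the evaluation at a point. -/
theorem IsReflexive.exists_eq (hE : IsReflexive E) (ξ : StrongDual ℝ (StrongDual ℝ E)) :
    ∃ x : E, ∀ L : StrongDual ℝ E, ξ L = L x := by
  obtain ⟨x, hx⟩ := hE ξ
  exact ⟨x, fun L => by rw [← hx]; rfl⟩

theorem isReflexive_of_exists (h : ∀ ξ : StrongDual ℝ (StrongDual ℝ E),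
    ∃ x : E, ∀ L : StrongDual ℝ E, ξ L = L x) : IsReflexive E := fun ξ => by
  obtain ⟨x, hx⟩ := h ξ
  exact ⟨x, ContinuousLinearMap.ext fun L => (hx L).symm⟩

theorem isReflexive_of_subsingleton [Subsingleton E] : IsReflexive E :=
  isReflexive_of_exists fun ξ => ⟨0, fun L => by
    have : L = 0 := ContinuousLinearMap.ext fun x => by
      rw [Subsingleton.elim x 0, map_zero, map_zero]
    rw [this, map_zero, zero_apply]⟩

theorem IsReflexive.equiv (hE : IsReflexive E) (e : E ≃L[ℝ] F) : IsReflexive F := by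
  refine isReflexive_of_exists fun ξ => ?_
  obtain ⟨x, hx⟩ := hE.exists_eq
    (ξ.comp ((ContinuousLinearMap.compL ℝ F E ℝ).flip e.symm.toContinuousLinearMap))
  refine ⟨e x, fun L => ?_⟩
  have h := hx (L.comp e.toContinuousLinearMap)
  simp only [ContinuousLinearMap.comp_apply] at h
  rw [show L (e x) = (L.comp e.toContinuousLinearMap) x from rfl, ContinuousLinearMap.comp_apply,
    ← h]
  congr 1
  ext y
  simp

/-- A closed subspace of a reflexive space is reflexive. -/
theorem IsReflexive.of_isometry (hE : IsReflexive E) (ι : F →ₗᵢ[ℝ] E) (hι : IsClosed (range ι)) :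
    IsReflexive F := by
  refine isReflexive_of_exists fun ξ => ?_
  obtain ⟨x, hx⟩ := hE.exists_eq
    (ξ.comp ((ContinuousLinearMap.compL ℝ F E ℝ).flip ι.toContinuousLinearMap))
  have hx' : ∀ L : StrongDual ℝ E, ξ (L.comp ι.toContinuousLinearMap) = L x := hx
  have hmem : x ∈ range ι := by
    by_contra hcon
    obtain ⟨L, u, hL, hu⟩ := geometric_hahn_banach_closed_point
      (s := (LinearMap.range ι.toLinearMap : Set E)) (Submodule.convex _) hι hcon
    have h0 : L.comp ι.toContinuousLinearMap = 0 := by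
      ext y
      by_contra hne
      -- A functional bounded above by `u` on a subspace vanishes there: otherwise this multiple of
      -- `y` would be sent to `u + 1`.
      have h1 := hL (ι (((u + 1) / L (ι y)) • y)) ⟨_, rfl⟩
      have hne' : L (ι y) ≠ 0 := hne
      rw [map_smul, map_smul, smul_eq_mul, div_mul_cancel₀ _ hne'] at h1
      linarith
    have h1 := hx' L
    rw [h0, map_zero] at h1
    have h2 := hL (ι 0) ⟨0, rfl⟩
    rw [map_zero, map_zero] at h2
    linarith
  obtain ⟨y, rfl⟩ := hmem
  refine ⟨y, fun l => ?_⟩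
  obtain ⟨L, hL, -⟩ := ι.exists_dual_extension l
  rw [← hL, ← hx' L]
  congr 1
  ext z
  exact (hL z).symm

/-- Three-space property: an extension of reflexive spaces is reflexive. -/
theorem IsReflexive.of_exact [CompleteSpace E] [CompleteSpace G] (hF : IsReflexive F)
    (hG : IsReflexive G) (ι : F →ₗᵢ[ℝ] E) (π : E →L[ℝ] G) (hπ : Function.Surjective π)
    (hex : ∀ x, π x = 0 ↔ x ∈ range ι) : IsReflexive E := by
  refine isReflexive_of_exists fun ξ => ?_
  obtain ⟨q, hq⟩ := hG.exists_eq (ξ.comp ((ContinuousLinearMap.compL ℝ E G ℝ).flip π))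
  obtain ⟨x₀, rfl⟩ := hπ q
  have hq' : ∀ L : StrongDual ℝ G, ξ (L.comp π) = L (π x₀) := hq
  -- Subtracting `x₀` makes the bidual element vanish on functionals that factor through `π`. What
  -- is left depends only on restrictions to the subspace, so it is an element of the bidual of `F`.
  set η := ξ - NormedSpace.inclusionInDoubleDual ℝ E x₀ with hη
  have hη0 : ∀ L : StrongDual ℝ E, (∀ y, L (ι y) = 0) → η L = 0 := by
    intro L hL
    have hker : LinearMap.ker π.toLinearMap ≤ LinearMap.ker L.toLinearMap := by
      intro x hx
      obtain ⟨y, rfl⟩ := (hex x).1 hx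
      exact hL y
    let L' : G →ₗ[ℝ] ℝ := ((LinearMap.ker π.toLinearMap).liftQ L.toLinearMap hker).comp
      (π.toLinearMap.quotKerEquivOfSurjective hπ).symm.toLinearMap
    have hL' : ∀ x, L' (π x) = L x := by
      intro x
      have : (π.toLinearMap.quotKerEquivOfSurjective hπ).symm (π x)
          = Submodule.Quotient.mk x := by
        rw [LinearEquiv.symm_apply_eq]
        rfl
      simp only [L', LinearMap.comp_apply, LinearEquiv.coe_coe, this]
      rfl
    have hc : Continuous L' := by
      -- Open mapping theorem: a bounded surjection of Banach spaces is a quotient map, so the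
      -- functional that descends algebraically is continuous.
      refine (π.isQuotientMap hπ).continuous_iff.2 ?_
      exact L.continuous.congr fun x => (hL' x).symm
    have h1 := hq' ⟨L', hc⟩
    have h2 : (⟨L', hc⟩ : StrongDual ℝ G).comp π = L := ContinuousLinearMap.ext hL'
    rw [h2] at h1
    change ξ L - L x₀ = 0
    rw [h1]
    exact sub_eq_zero.2 (hL' x₀)
  have hη1 : ∀ L L' : StrongDual ℝ E, (∀ y, L (ι y) = L' (ι y)) → η L = η L' := by
    intro L L' h
    have := hη0 (L - L') fun y => by simp [h y]
    rwa [map_sub, sub_eq_zero] at this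
  choose ext hext hextn using ι.exists_dual_extension
  -- The chosen extension `ext l` is not linear in `l`, but by `hη1` the value `η (ext l)` depends
  -- only on `l`. The bound uses that `ext` preserves norms.
  let ηY : StrongDual ℝ (StrongDual ℝ F) := LinearMap.mkContinuous
    { toFun := fun l => η (ext l)
      map_add' := fun l l' => by
        rw [← map_add]
        exact hη1 _ _ fun y => by simp [hext]
      map_smul' := fun c l => by
        rw [RingHom.id_apply, ← map_smul]
        exact hη1 _ _ fun y => by simp [hext] } ‖η‖ fun l => by
          rw [← hextn l]
          exact η.le_opNorm _
  obtain ⟨y, hy⟩ := hF.exists_eq ηY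
  refine ⟨x₀ + ι y, fun L => ?_⟩
  have h1 : η L = L (ι y) := by
    rw [hη1 L (ext (L.comp ι.toContinuousLinearMap)) fun z => by simp [hext]]
    exact hy (L.comp ι.toContinuousLinearMap)
  have h2 : η L = ξ L - L x₀ := rfl
  rw [map_add, ← h1, h2]
  ring

theorem IsReflexive.prod [CompleteSpace E] [CompleteSpace F] (hE : IsReflexive E)
    (hF : IsReflexive F) : IsReflexive (E × F) :=
  hE.of_exact hF (LinearIsometry.inl ℝ E F) (ContinuousLinearMap.snd ℝ E F)
    Prod.snd_surjective fun x => by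
      constructor
      · intro h
        exact ⟨x.1, Prod.ext rfl h.symm⟩
      · rintro ⟨y, rfl⟩
        rfl

/-- Bounded sequences in reflexive spaces converge weakly along ultrafilters. -/
theorem IsReflexive.exists_weak_limit (hE : IsReflexive E) {x : ℕ → E} {C : ℝ}
    (hC : ∀ n, ‖x n‖ ≤ C) (U : Ultrafilter ℕ) :
    ∃ y, ∀ L : StrongDual ℝ E, Tendsto (fun n => L (x n)) U (𝓝 (L y)) := by
  -- Along an ultrafilter every bounded real sequence converges, so no subsequence has to be
  -- extracted. The limits are linear in `L` and define an element of the bidual, which reflexivity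
  -- represents by a point.
  have h : ∀ L : StrongDual ℝ E, ∃ c ∈ Metric.closedBall (0 : ℝ) (‖L‖ * C),
      Tendsto (fun n => L (x n)) U (𝓝 c) := by
    intro L
    have := (isCompact_closedBall (0 : ℝ) (‖L‖ * C)).ultrafilter_le_nhds
      (U.map fun n => L (x n)) (by
        rw [le_principal_iff]
        refine Filter.mem_map.2 (Filter.univ_mem' fun n => ?_)
        simp only [mem_preimage, mem_closedBall_zero_iff]
        exact (L.le_opNorm _).trans (by gcongr; exact hC n))
    exact this
  choose c hc hlim using h
  let ξ : StrongDual ℝ (StrongDual ℝ E) := LinearMap.mkContinuous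
    { toFun := c
      map_add' := fun L L' => tendsto_nhds_unique (hlim (L + L')) ((hlim L).add (hlim L'))
      map_smul' := fun r L => tendsto_nhds_unique (hlim (r • L)) ((hlim L).const_smul r) } C
    fun L => by
      have := mem_closedBall_zero_iff.1 (hc L)
      rwa [mul_comm] at this
  obtain ⟨y, hy⟩ := hE.exists_eq ξ
  exact ⟨y, fun L => by rw [← hy L]; exact hlim L⟩

/-- A closed convex set contains the weak limits along an ultrafilter of its points. -/
theorem mem_of_weak_limit {x : ℕ → E} {U : Ultrafilter ℕ} {y : E}
    (hy : ∀ L : StrongDual ℝ E, Tendsto (fun n => L (x n)) U (𝓝 (L y))) {K : Set E}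
    (hK : Convex ℝ K) (hK' : IsClosed K) (hx : ∀ᶠ n in (U : Filter ℕ), x n ∈ K) : y ∈ K := by
  by_contra hcon
  obtain ⟨L, u, hL, hu⟩ := geometric_hahn_banach_closed_point hK hK' hcon
  exact absurd (le_of_tendsto (hy L) (hx.mono fun n hn => (hL _ hn).le)) (not_le.2 hu)

theorem norm_le_of_weak_limit {x : ℕ → E} {U : Ultrafilter ℕ} {y : E}
    (hy : ∀ L : StrongDual ℝ E, Tendsto (fun n => L (x n)) U (𝓝 (L y))) {C : ℝ}
    (hx : ∀ᶠ n in (U : Filter ℕ), ‖x n‖ ≤ C) : ‖y‖ ≤ C :=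
  mem_closedBall_zero_iff.1 (mem_of_weak_limit hy (convex_closedBall 0 C)
    Metric.isClosed_closedBall (hx.mono fun _ h => mem_closedBall_zero_iff.2 h))

/-- Mazur's lemma, for the image of a sequence under a linear map. -/
theorem exists_convexHull_tendsto {V : Type*} [AddCommGroup V] [Module ℝ V] (T : V →ₗ[ℝ] E)
    (u : ℕ → V) {U : Ultrafilter ℕ} (hU : (U : Filter ℕ) ≤ atTop) {y : E}
    (hy : ∀ L : StrongDual ℝ E, Tendsto (fun n => L (T (u n))) U (𝓝 (L y))) :
    ∃ g : ℕ → V, (∀ k, g k ∈ convexHull ℝ (u '' Ici k)) ∧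
      Tendsto (fun k => T (g k)) atTop (𝓝 y) := by
  -- Hulls of tails are used, not of the whole sequence, so that convex combinations keep the other
  -- limits of `u`, such as limits at a point.
  have h : ∀ k, y ∈ closure (T '' convexHull ℝ (u '' Ici k)) := fun k =>
    mem_of_weak_limit hy ((convex_convexHull ℝ _).linear_image T).closure isClosed_closure
      (Filter.mem_of_superset (hU (Ici_mem_atTop k)) fun n hn =>
        subset_closure ⟨_, subset_convexHull ℝ _ ⟨n, hn, rfl⟩, rfl⟩)
  have h' : ∀ k : ℕ, ∃ g ∈ convexHull ℝ (u '' Ici k), dist y (T g) < 1 / ((k : ℝ) + 1) := by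
    intro k
    obtain ⟨_, ⟨g, hg, rfl⟩, hd⟩ := Metric.mem_closure_iff.1 (h k) (1 / ((k : ℝ) + 1))
      (by positivity)
    exact ⟨g, hg, hd⟩
  choose g hg hd using h'
  refine ⟨g, hg, tendsto_iff_dist_tendsto_zero.2 ?_⟩
  refine squeeze_zero (fun _ => dist_nonneg) (fun k => ?_)
    (tendsto_one_div_add_atTop_nhds_zero_nat (𝕜 := ℝ))
  rw [dist_comm]
  exact (hd k).le

/-- Closed convex nonempty sets in reflexive spaces have elements of smallest norm. -/
theorem IsReflexive.exists_norm_min (hE : IsReflexive E) {K : Set E} (hK : Convex ℝ K)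
    (hK' : IsClosed K) (hne : K.Nonempty) : ∃ x ∈ K, ∀ y ∈ K, ‖x‖ ≤ ‖y‖ := by
  have hbdd : BddBelow (norm '' K) := ⟨0, by rintro _ ⟨x, -, rfl⟩; exact norm_nonneg x⟩
  set s := sInf (norm '' K)
  have h : ∀ n : ℕ, ∃ x ∈ K, ‖x‖ < s + 1 / ((n : ℝ) + 1) := by
    intro n
    obtain ⟨_, ⟨x, hx, rfl⟩, h⟩ := exists_lt_of_csInf_lt (hne.image norm)
      (show s < s + 1 / ((n : ℝ) + 1) from lt_add_of_pos_right _ (by positivity))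
    exact ⟨x, hx, h⟩
  choose x hx hxs using h
  obtain ⟨U, hU⟩ := Ultrafilter.exists_le (atTop : Filter ℕ)
  obtain ⟨y, hy⟩ := hE.exists_weak_limit (x := x) (C := s + 1) (fun n => (hxs n).le.trans (by
    gcongr
    rw [div_le_one (by positivity)]
    linarith [Nat.cast_nonneg (α := ℝ) n])) U
  refine ⟨y, mem_of_weak_limit hy hK hK' (Eventually.of_forall hx), fun z hz => ?_⟩
  -- A closed ball is closed and convex, so it contains weak limits: the weak limit of a minimizing
  -- sequence is a minimizer.
  refine le_trans (le_of_forall_pos_le_add fun ε hε => ?_) (csInf_le hbdd ⟨z, hz, rfl⟩)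
  refine norm_le_of_weak_limit hy (hU ?_)
  filter_upwards [(tendsto_one_div_add_atTop_nhds_zero_nat (𝕜 := ℝ)).eventually_lt_const hε]
    with n hn
  exact (hxs n).le.trans (by linarith)

end Reflexive

/-! ## Reflexivity of `L^p` -/

section LpReflexive

variable {X : Type*} [MeasurableSpace X] {ν : Measure X}

/-- The signed measure `A ↦ L(χ_A)` of a functional `L` on `L^p(ν)`. -/
def dualSignedMeasure [IsFiniteMeasure ν] {p : ℝ≥0∞} [Fact (1 ≤ p)] (hp : p ≠ ∞)
    (L : StrongDual ℝ (Lp ℝ p ν)) : SignedMeasure X := by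
  classical
  exact
  { measureOf' := fun A => if hA : MeasurableSet A then
      L (indicatorConstLp p hA (measure_ne_top ν A) 1) else 0
    empty' := by simp
    not_measurable' := fun A hA => dif_neg hA
    m_iUnion' := by
      intro A hA hd
      have hU : MeasurableSet (⋃ i, A i) := MeasurableSet.iUnion hA
      have hF : ∀ F : Finset ℕ, MeasurableSet (⋃ i ∈ F, A i) :=
        fun F => Finset.measurableSet_biUnion F fun i _ => hA i
      have hsum : ∀ F : Finset ℕ, ∑ i ∈ F, L (indicatorConstLp p (hA i) (measure_ne_top ν _) 1)
          = L (indicatorConstLp p (hF F) (measure_ne_top ν _) 1) := by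
        intro F
        induction F using Finset.induction_on with
        | empty => simp
        | insert a F ha ih =>
          rw [Finset.sum_insert ha, ih, ← map_add, ← indicatorConstLp_disjoint_union]
          · congr 2
            simp
          · rw [disjoint_iUnion₂_right]
            intro i hi
            exact hd fun h => ha (h ▸ hi)
      -- Countable additivity reduces to convergence in `L^p` of the indicators of finite unions,
      -- which follows from convergence in measure of the sets because `p ≠ ∞`.
      have hlim : Tendsto (fun F : Finset ℕ => ν (symmDiff (⋃ i ∈ F, A i) (⋃ i, A i))) atTop
          (𝓝 0) := by
        refine tendsto_of_tendsto_of_tendsto_of_le_of_le tendsto_const_nhds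
          (ENNReal.tendsto_tsum_compl_atTop_zero (f := fun i => ν (A i)) ?_) (fun _ => zero_le)
          fun F => ?_
        · rw [← measure_iUnion hd hA]
          exact measure_ne_top _ _
        · refine (measure_mono (t := ⋃ i : {x // x ∉ F}, A i) ?_).trans (measure_iUnion_le _)
          rintro x (⟨h1, h2⟩ | ⟨h1, h2⟩)
          · simp only [mem_iUnion] at h1 h2
            obtain ⟨i, _, hi⟩ := h1
            exact absurd ⟨i, hi⟩ h2
          · simp only [mem_iUnion] at h1 h2 ⊢
            obtain ⟨i, hi⟩ := h1
            exact ⟨⟨i, fun hiF => h2 ⟨i, hiF, hi⟩⟩, hi⟩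
      have h := (L.continuous.tendsto _).comp (tendsto_indicatorConstLp_set (ht := hF)
        (hμt := fun F => measure_ne_top ν _) (hs := hU) (hμs := measure_ne_top ν _)
        (c := (1 : ℝ)) hp hlim)
      simp only [hA, hU, dif_pos]
      exact h.congr fun F => (hsum F).symm }

theorem dualSignedMeasure_apply [IsFiniteMeasure ν] {p : ℝ≥0∞} [Fact (1 ≤ p)] (hp : p ≠ ∞)
    (L : StrongDual ℝ (Lp ℝ p ν)) {A : Set X} (hA : MeasurableSet A) :
    dualSignedMeasure hp L A = L (indicatorConstLp p hA (measure_ne_top ν A) 1) := dif_pos hA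

/-- A functional on `L^p(ν)` acts on simple functions as the integral against a density. -/
theorem exists_density_of_dual [IsFiniteMeasure ν] {p : ℝ≥0∞} [Fact (1 ≤ p)] (hp : p ≠ ∞)
    (L : StrongDual ℝ (Lp ℝ p ν)) : ∃ h : X → ℝ, Measurable h ∧ Integrable h ν ∧
      ∀ φ : SimpleFunc X ℝ, L ((φ.memLp_of_isFiniteMeasure p ν).toLp φ) = ∫ x, h x * φ x ∂ν := by
  set s := dualSignedMeasure hp L with hs
  have hac : s ≪ᵥ ν.toENNRealVectorMeasure := by
    refine VectorMeasure.AbsolutelyContinuous.mk fun A hA h0 => ?_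
    rw [Measure.toENNRealVectorMeasure_apply_measurable hA] at h0
    rw [hs, dualSignedMeasure_apply hp L hA]
    have : indicatorConstLp p hA (measure_ne_top ν A) (1 : ℝ) = 0 := by
      rw [Lp.eq_zero_iff_ae_eq_zero]
      refine indicatorConstLp_coeFn.trans ?_
      exact indicator_meas_zero h0
    rw [this, map_zero]
  have hint := SignedMeasure.integrable_rnDeriv s ν
  refine ⟨s.rnDeriv ν, SignedMeasure.measurable_rnDeriv s ν, hint, fun φ => ?_⟩
  induction φ using SimpleFunc.induction with
  | const c hA =>
    rename_i A
    have h1 : L (indicatorConstLp p hA (measure_ne_top ν A) 1) = ∫ x in A, s.rnDeriv ν x ∂ν := by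
      rw [← dualSignedMeasure_apply hp L hA, ← hs, ← withDensityᵥ_apply hint hA,
        SignedMeasure.withDensityᵥ_rnDeriv_eq s ν hac]
    have h2 : ((SimpleFunc.piecewise A hA (SimpleFunc.const X c)
        (SimpleFunc.const X 0)).memLp_of_isFiniteMeasure p ν).toLp _
        = c • indicatorConstLp p hA (measure_ne_top ν A) (1 : ℝ) := by
      refine Lp.ext ?_
      filter_upwards [MemLp.coeFn_toLp ((SimpleFunc.piecewise A hA (SimpleFunc.const X c)
        (SimpleFunc.const X 0)).memLp_of_isFiniteMeasure p ν),
        Lp.coeFn_smul c (indicatorConstLp p hA (measure_ne_top ν A) (1 : ℝ)),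
        indicatorConstLp_coeFn (p := p) (hs := hA) (hμs := measure_ne_top ν A) (c := (1 : ℝ))]
        with x h3 h4 h5
      rw [h3, h4, Pi.smul_apply, h5]
      by_cases hx : x ∈ A <;> simp [hx]
    rw [h2, map_smul, h1, smul_eq_mul, ← integral_const_mul, ← integral_indicator hA]
    refine integral_congr_ae (ae_of_all _ fun x => ?_)
    by_cases hx : x ∈ A <;> simp [hx, mul_comm]
  | add _ h1 h2 =>
    rename_i f g _
    have hi : ∀ f : SimpleFunc X ℝ, Integrable (fun x => s.rnDeriv ν x * f x) ν := by
      intro f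
      obtain ⟨C, hC⟩ := f.exists_forall_norm_le
      exact hint.mul_bdd f.measurable.aestronglyMeasurable (ae_of_all _ hC)
    have h3 : ((f + g).memLp_of_isFiniteMeasure p ν).toLp _
        = (f.memLp_of_isFiniteMeasure p ν).toLp _ + (g.memLp_of_isFiniteMeasure p ν).toLp _ :=
      rfl
    rw [h3, map_add, h1, h2, ← integral_add (hi f) (hi g)]
    simp only [SimpleFunc.coe_add, Pi.add_apply, mul_add]

/-- Converse of Hölder's inequality. For simple `0 ≤ ψ_n ↑ |h|` the test function `f_n = sign(h)
ψ_n^(Q-1)` satisfies `|f_n|^P = ψ_n^Q` and gives `∫ ψ_n^Q ≤ L f_n ≤ ‖L‖ (∫ ψ_n^Q)^(1/P)`. Hence `∫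
ψ_n^Q ≤ ‖L‖^Q` for all `n`, and Fatou's lemma concludes. -/
theorem memLp_density_of_dual [IsFiniteMeasure ν] {p q : ℝ≥0∞} [Fact (1 ≤ p)] (hp : p ≠ ∞)
    (hq : q ≠ ∞) [hpq : ENNReal.HolderConjugate p q] {L : StrongDual ℝ (Lp ℝ p ν)} {h : X → ℝ}
    (hm : Measurable h) (hint : Integrable h ν)
    (hL : ∀ φ : SimpleFunc X ℝ,
      L ((φ.memLp_of_isFiniteMeasure p ν).toLp φ) = ∫ x, h x * φ x ∂ν) : MemLp h q ν := by
  have hPQ := ENNReal.HolderConjugate.toReal_of_ne_top hp hq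
  set P := p.toReal
  set Q := q.toReal
  have hq0 : q ≠ 0 := fun h0 => by
    have := hPQ.symm.pos
    simp [Q, h0] at this
  have hp0 : p ≠ 0 := fun h0 => by
    have := hPQ.pos
    simp [P, h0] at this
  have hhm : Measurable fun x => ENNReal.ofReal |h x| := hm.abs.ennreal_ofReal
  let ψ : ℕ → SimpleFunc X ℝ := fun n =>
    (SimpleFunc.eapprox (fun x => ENNReal.ofReal |h x|) n).map ENNReal.toReal
  have hψ0 : ∀ n x, 0 ≤ ψ n x := fun n x => ENNReal.toReal_nonneg
  have hψle : ∀ n x, ψ n x ≤ |h x| := fun n x => by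
    have h1 : SimpleFunc.eapprox (fun x => ENNReal.ofReal |h x|) n x ≤ ENNReal.ofReal |h x| := by
      rw [← SimpleFunc.iSup_eapprox_apply hhm x]
      exact le_iSup (fun n => SimpleFunc.eapprox (fun x => ENNReal.ofReal |h x|) n x) n
    have h2 := ENNReal.toReal_mono ENNReal.ofReal_ne_top h1
    rwa [ENNReal.toReal_ofReal (abs_nonneg _)] at h2
  have hψlim : ∀ x, Tendsto (fun n => ψ n x) atTop (𝓝 |h x|) := fun x => by
    have h1 := (ENNReal.tendsto_toReal ENNReal.ofReal_ne_top).comp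
      (SimpleFunc.tendsto_eapprox hhm x)
    rwa [ENNReal.toReal_ofReal (abs_nonneg _)] at h1
  have hS : MeasurableSet {x | 0 ≤ h x} := measurableSet_le measurable_const hm
  let σ : SimpleFunc X ℝ := SimpleFunc.piecewise _ hS (SimpleFunc.const X 1)
    (SimpleFunc.const X (-1))
  have hσ : ∀ x, h x * σ x = |h x| := fun x => by
    by_cases hx : 0 ≤ h x
    · have : σ x = 1 := by simp [σ, hx]
      rw [this, abs_of_nonneg hx, mul_one]
    · have : σ x = -1 := by simp [σ, hx]
      rw [this, abs_of_neg (not_le.1 hx)]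
      ring
  have hσ1 : ∀ x, |σ x| = 1 := fun x => by
    by_cases hx : 0 ≤ h x <;> simp [σ, hx]
  let f : ℕ → SimpleFunc X ℝ := fun n => σ * (ψ n).map fun t => t ^ (Q - 1)
  have hf : ∀ n x, f n x = σ x * ψ n x ^ (Q - 1) := fun n x => rfl
  have hQ1 : 0 < Q - 1 := hPQ.symm.sub_one_pos
  have hI0 : ∀ n, 0 ≤ ∫ x, ψ n x ^ Q ∂ν := fun n =>
    integral_nonneg fun x => Real.rpow_nonneg (hψ0 n x) _
  have hnorm : ∀ n, ‖((f n).memLp_of_isFiniteMeasure p ν).toLp (f n)‖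
      = (∫ x, ψ n x ^ Q ∂ν) ^ P⁻¹ := fun n => by
    have : ∀ x, ‖f n x‖ ^ P = ψ n x ^ Q := fun x => by
      rw [hf, norm_mul, Real.norm_eq_abs, hσ1, one_mul, Real.norm_eq_abs,
        abs_of_nonneg (Real.rpow_nonneg (hψ0 n x) _), ← Real.rpow_mul (hψ0 n x),
        hPQ.symm.sub_one_mul_conj]
    rw [Lp.norm_toLp, ((f n).memLp_of_isFiniteMeasure p ν).eLpNorm_eq_integral_rpow_norm hp0 hp,
      ENNReal.toReal_ofReal (by positivity)]
    simp only [P] at this ⊢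
    simp only [this]
  have hle : ∀ n, ∫ x, ψ n x ^ Q ∂ν ≤ ‖L‖ * (∫ x, ψ n x ^ Q ∂ν) ^ P⁻¹ := fun n => by
    have h1 : ∫ x, ψ n x ^ Q ∂ν ≤ ∫ x, h x * f n x ∂ν := by
      refine integral_mono ?_ ?_ fun x => ?_
      · exact ((ψ n).map fun t => t ^ Q).integrable_of_isFiniteMeasure
      · obtain ⟨C, hC⟩ := (f n).exists_forall_norm_le
        exact hint.mul_bdd (f n).measurable.aestronglyMeasurable (ae_of_all _ hC)
      · change ψ n x ^ Q ≤ h x * f n x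
        rw [hf, ← mul_assoc, hσ]
        calc ψ n x ^ Q = ψ n x * ψ n x ^ (Q - 1) := by
              conv_lhs => rw [show Q = 1 + (Q - 1) by ring]
              rw [Real.rpow_add_of_nonneg (hψ0 n x) zero_le_one hQ1.le, Real.rpow_one]
          _ ≤ _ := by
              have := hψ0 n x
              gcongr
              exact hψle n x
    rw [← hL] at h1
    refine h1.trans ((le_abs_self _).trans ((L.le_opNorm _).trans_eq ?_))
    rw [hnorm]
  have hbound : ∀ n, ∫ x, ψ n x ^ Q ∂ν ≤ ‖L‖ ^ Q := fun n => by
    -- Dividing by `I ^ P⁻¹` requires the integral to be positive; it is finite because `ψ n` is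
    -- simple.
    rcases (hI0 n).eq_or_lt with h0 | h0
    · rw [← h0]
      positivity
    · have h1 := hle n
      set I := ∫ x, ψ n x ^ Q ∂ν
      have h2 : I = I ^ Q⁻¹ * I ^ P⁻¹ := by
        rw [← Real.rpow_add h0, add_comm, hPQ.inv_add_inv_eq_one, Real.rpow_one]
      have h3 : I ^ Q⁻¹ ≤ ‖L‖ := by
        refine le_of_mul_le_mul_right ?_ (Real.rpow_pos_of_pos h0 P⁻¹)
        rwa [← h2]
      calc I = (I ^ Q⁻¹) ^ Q := by
            rw [← Real.rpow_mul h0.le, inv_mul_cancel₀ hPQ.symm.ne_zero, Real.rpow_one]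
        _ ≤ _ := Real.rpow_le_rpow (by positivity) h3 hPQ.symm.nonneg
  refine ⟨hm.aestronglyMeasurable, (eLpNorm_lt_top_iff_lintegral_rpow_enorm_lt_top hq0 hq).2 ?_⟩
  have h1 : ∀ n, ∫⁻ x, ENNReal.ofReal (ψ n x ^ Q) ∂ν ≤ ENNReal.ofReal (‖L‖ ^ Q) := fun n => by
    rw [← ofReal_integral_eq_lintegral_ofReal (f := fun x => ψ n x ^ Q)
      ((ψ n).map fun t => t ^ Q).integrable_of_isFiniteMeasure
      (ae_of_all _ fun x => Real.rpow_nonneg (hψ0 n x) _)]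
    exact ENNReal.ofReal_le_ofReal (hbound n)
  refine lt_of_le_of_lt ?_ (ENNReal.ofReal_lt_top (r := ‖L‖ ^ Q))
  calc ∫⁻ x, ‖h x‖ₑ ^ Q ∂ν = ∫⁻ x, liminf (fun n => ENNReal.ofReal (ψ n x ^ Q)) atTop ∂ν := by
        refine lintegral_congr fun x => ?_
        have h2 : Tendsto (fun n => ENNReal.ofReal (ψ n x ^ Q)) atTop
            (𝓝 (ENNReal.ofReal (|h x| ^ Q))) :=
          (ENNReal.continuous_ofReal.tendsto _).comp
            ((hψlim x).rpow_const (Or.inr hPQ.symm.nonneg))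
        rw [h2.liminf_eq, ← ENNReal.ofReal_rpow_of_nonneg (abs_nonneg _) hPQ.symm.nonneg,
          Real.enorm_eq_ofReal_abs]
    _ ≤ liminf (fun n => ∫⁻ x, ENNReal.ofReal (ψ n x ^ Q) ∂ν) atTop :=
        lintegral_liminf_le fun n =>
          ((ψ n).map fun t => ENNReal.ofReal (t ^ Q)).measurable
    _ ≤ _ := liminf_le_of_le (by isBoundedDefault) fun b hb => by
        obtain ⟨n, hn⟩ := hb.exists
        exact hn.trans (h1 n)

/-- Functionals on `L^p` of a finite measure are integrals against functions in `L^q`. -/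
theorem exists_dual_eq_lpPairing [IsFiniteMeasure ν] {p q : ℝ≥0∞} [Fact (1 ≤ p)] [Fact (1 ≤ q)]
    (hp : p ≠ ∞) (hq : q ≠ ∞) [hpq : ENNReal.HolderConjugate q p] (L : StrongDual ℝ (Lp ℝ p ν)) :
    ∃ g : Lp ℝ q ν, (ContinuousLinearMap.mul ℝ ℝ).lpPairing ν q p g = L := by
  obtain ⟨h, hm, hint, hL⟩ := exists_density_of_dual hp L
  have hmem : MemLp h q ν := memLp_density_of_dual hp hq (hpq := hpq.symm) hm hint hL
  refine ⟨hmem.toLp h, ContinuousLinearMap.ext fun f => ?_⟩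
  refine (Lp.simpleFunc.denseRange (E := ℝ) (μ := ν) hp).induction_on
    (p := fun f => (ContinuousLinearMap.mul ℝ ℝ).lpPairing ν q p (hmem.toLp h) f = L f) f
    (isClosed_eq (by fun_prop) (by fun_prop)) fun φ => ?_
  have h1 : (φ : Lp ℝ p ν) = ((Lp.simpleFunc.toSimpleFunc φ).memLp_of_isFiniteMeasure p ν).toLp _
      := by
    refine Lp.ext ?_
    filter_upwards [MemLp.coeFn_toLp
      ((Lp.simpleFunc.toSimpleFunc φ).memLp_of_isFiniteMeasure p ν),
      Lp.simpleFunc.toSimpleFunc_eq_toFun φ] with x h2 h3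
    rw [h2, ← h3]
  rw [h1, hL, ContinuousLinearMap.lpPairing_eq_integral]
  refine integral_congr_ae ?_
  filter_upwards [hmem.coeFn_toLp, MemLp.coeFn_toLp
      ((Lp.simpleFunc.toSimpleFunc φ).memLp_of_isFiniteMeasure p ν)] with x h2 h3
  simp only [h2, h3, ContinuousLinearMap.mul_apply']

/-- Riesz representation is used twice: a bidual element pulled back along `L^q → (L^p)*` is a
functional on `L^q`, hence the pairing with some `b ∈ L^p`, and every functional on `L^p` is itself
such a pairing. -/
theorem isReflexive_Lp_of_isFiniteMeasure [IsFiniteMeasure ν] {p q : ℝ≥0∞} [Fact (1 ≤ p)]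
    [Fact (1 ≤ q)] (hp : p ≠ ∞) (hq : q ≠ ∞) [hpq : ENNReal.HolderConjugate q p] :
    IsReflexive (Lp ℝ p ν) := by
  have : ENNReal.HolderConjugate p q := hpq.symm
  refine isReflexive_of_exists fun ξ => ?_
  obtain ⟨b, hb⟩ := exists_dual_eq_lpPairing hq hp
    (ξ.comp ((ContinuousLinearMap.mul ℝ ℝ).lpPairing ν q p))
  refine ⟨b, fun L => ?_⟩
  obtain ⟨g, rfl⟩ := exists_dual_eq_lpPairing hp hq L
  rw [← ContinuousLinearMap.comp_apply, ← hb, ContinuousLinearMap.lpPairing_eq_integral,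
    ContinuousLinearMap.lpPairing_eq_integral]
  simp only [ContinuousLinearMap.mul_apply', mul_comm]

/-- A Banach space with a dense subspace isometric to a subspace of a reflexive space is
reflexive. -/
theorem IsReflexive.of_denseRange {E F V : Type*} [NormedAddCommGroup E] [NormedSpace ℝ E]
    [CompleteSpace E] [NormedAddCommGroup F] [NormedSpace ℝ F] [CompleteSpace F]
    [AddCommGroup V] [Module ℝ V] (hF : IsReflexive F) (T : V →ₗ[ℝ] E) (S : V →ₗ[ℝ] F)
    (hT : DenseRange T) (h : ∀ v, ‖S v‖ = ‖T v‖) : IsReflexive E := by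
  have hb : ∃ C, ∀ v, ‖S v‖ ≤ C * ‖T v‖ := ⟨1, fun v => by rw [h, one_mul]⟩
  -- The assignment `T v ↦ S v` is isometric on a dense subspace and extends by continuity. The
  -- range is closed because `E` is complete.
  let ι : E →ₗᵢ[ℝ] F :=
    { (S.extendOfNorm T).toLinearMap with
      norm_map' := fun x => by
        refine hT.induction_on (p := fun x => ‖S.extendOfNorm T x‖ = ‖x‖) x
          (isClosed_eq (by fun_prop) (by fun_prop)) fun v => ?_
        rw [LinearMap.extendOfNorm_eq hT hb, h] }
  exact hF.of_isometry ι ι.isometry.isClosedEmbedding.isClosed_range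

/-- `L^p(m)` is reflexive for `1 < p < ∞` and `σ`-finite `m`. -/
theorem isReflexive_Lp {m : Measure X} [SigmaFinite m] {p q : ℝ≥0∞} [Fact (1 ≤ p)]
    [Fact (1 ≤ q)] (hp : p ≠ ∞) (hq : q ≠ ∞) [ENNReal.HolderConjugate q p] :
    IsReflexive (Lp ℝ p m) := by
  have hp0 : p ≠ 0 := (zero_lt_one.trans_le (Fact.out : 1 ≤ p)).ne'
  have hP0 : 0 < p.toReal := ENNReal.toReal_pos hp0 hp
  let g : X → ℝ≥0∞ := m.rnDeriv m.toFinite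
  have hgm : Measurable g := Measure.measurable_rnDeriv _ _
  have hg : m.toFinite.withDensity g = m :=
    Measure.withDensity_rnDeriv_eq _ _ (absolutelyContinuous_toFinite m)
  have hgt : ∀ᵐ x ∂m.toFinite, g x < ∞ := Measure.rnDeriv_lt_top _ _
  -- With `g` the density of `m` with respect to the finite measure `m.toFinite`, multiplication by
  -- `g^(1/p)` embeds `L^p(m)` isometrically into `L^p(m.toFinite)`.
  let w : X → ℝ := fun x => (g x).toReal ^ p.toReal⁻¹
  have hwm : Measurable w := hgm.ennreal_toReal.pow_const _
  -- Statements a.e. for `m` are transferred only where `w ≠ 0`. That suffices: elsewhere both sides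
  -- of the linearity identities carry the factor `w = 0`.
  have hae : ∀ {P : X → Prop}, (∀ᵐ x ∂m, P x) → ∀ᵐ x ∂m.toFinite, w x ≠ 0 → P x := by
    intro P h
    rw [← hg, ae_withDensity_iff hgm] at h
    filter_upwards [h] with x hx hw
    refine hx fun h0 => hw ?_
    simp only [w, h0, ENNReal.toReal_zero]
    exact Real.zero_rpow (inv_ne_zero hP0.ne')
  have hnorm : ∀ f : X → ℝ, Measurable f →
      eLpNorm (fun x => f x * w x) p m.toFinite = eLpNorm f p m := by
    intro f hf
    rw [eLpNorm_eq_lintegral_rpow_enorm_toReal hp0 hp,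
      eLpNorm_eq_lintegral_rpow_enorm_toReal hp0 hp]
    congr 1
    conv_rhs => rw [← hg]
    rw [lintegral_withDensity_eq_lintegral_mul _ hgm (by fun_prop)]
    refine lintegral_congr_ae ?_
    filter_upwards [hgt] with x hx
    rw [Pi.mul_apply, enorm_mul, ENNReal.mul_rpow_of_nonneg _ _ hP0.le, mul_comm]
    congr 1
    rw [Real.enorm_of_nonneg (by positivity), ENNReal.ofReal_rpow_of_nonneg (by positivity) hP0.le,
      ← Real.rpow_mul (by positivity), inv_mul_cancel₀ hP0.ne', Real.rpow_one,
      ENNReal.ofReal_toReal hx.ne]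
  have hmem : ∀ f : Lp ℝ p m, MemLp (fun x => f x * w x) p m.toFinite := fun f => by
    have hf := (Lp.stronglyMeasurable f).measurable
    refine ⟨(hf.mul hwm).aestronglyMeasurable, ?_⟩
    rw [hnorm _ hf]
    exact Lp.eLpNorm_lt_top f
  let S : Lp ℝ p m →ₗ[ℝ] Lp ℝ p m.toFinite :=
    { toFun := fun f => (hmem f).toLp _
      map_add' := fun f f' => by
        refine Lp.ext ?_
        filter_upwards [(hmem (f + f')).coeFn_toLp, (hmem f).coeFn_toLp, (hmem f').coeFn_toLp,
          Lp.coeFn_add ((hmem f).toLp _) ((hmem f').toLp _), hae (Lp.coeFn_add f f')]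
          with x h1 h2 h3 h4 h5
        rw [h1, h4, Pi.add_apply, h2, h3]
        by_cases hw : w x = 0
        · simp [hw]
        · rw [h5 hw, Pi.add_apply, add_mul]
      map_smul' := fun c f => by
        refine Lp.ext ?_
        filter_upwards [(hmem (c • f)).coeFn_toLp, (hmem f).coeFn_toLp,
          Lp.coeFn_smul c ((hmem f).toLp _), hae (Lp.coeFn_smul c f)] with x h1 h2 h3 h4
        rw [h1, RingHom.id_apply, h3, Pi.smul_apply, h2]
        by_cases hw : w x = 0
        · simp [hw]
        · rw [h4 hw, Pi.smul_apply, smul_eq_mul, smul_eq_mul, mul_assoc] }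
  refine (isReflexive_Lp_of_isFiniteMeasure (ν := m.toFinite) (q := q) hp hq).of_denseRange
    LinearMap.id S (Function.surjective_id.denseRange) fun f => ?_
  change ‖(hmem f).toLp _‖ = ‖f‖
  rw [Lp.norm_toLp, hnorm _ (Lp.stronglyMeasurable f).measurable, Lp.norm_def]

end LpReflexive

theorem isReflexive_Lp_nnreal {X : Type*} [MeasurableSpace X] {m : Measure X} [SigmaFinite m]
    {p : ℝ≥0} [Fact (1 ≤ (p : ℝ≥0∞))] (hp : 1 < p) : IsReflexive (Lp ℝ p m) := by
  have hpq := (NNReal.HolderConjugate.conjExponent hp).symm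
  have : Fact (1 ≤ (p.conjExponent : ℝ≥0∞)) := ⟨by exact_mod_cast hpq.lt.le⟩
  have : ENNReal.HolderConjugate (p.conjExponent : ℝ≥0∞) p := by
    rw [ENNReal.holderConjugate_coe_iff]
    exact hpq
  exact isReflexive_Lp (q := p.conjExponent) ENNReal.coe_ne_top ENNReal.coe_ne_top

/-! ## Algebra of `L^∞(m)` -/

namespace LInfty

variable {X : Type*} [MeasurableSpace X] {m : Measure X}

theorem ext_ae {a b : LInfty m} (h : ∀ᵐ x ∂m, a x = b x) : a = b := Lp.ext h

theorem coe_zero_ae : ∀ᵐ x ∂m, (0 : LInfty m) x = 0 := Lp.coeFn_zero ℝ ∞ m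

theorem eq_zero_iff {a : LInfty m} : a = 0 ↔ ∀ᵐ x ∂m, a x = 0 :=
  Lp.eq_zero_iff_ae_eq_zero

theorem coe_add_ae (a b : LInfty m) : ∀ᵐ x ∂m, (a + b) x = a x + b x := Lp.coeFn_add a b

theorem coe_sub_ae (a b : LInfty m) : ∀ᵐ x ∂m, (a - b) x = a x - b x := Lp.coeFn_sub a b

theorem coe_real_smul_ae (c : ℝ) (a : LInfty m) : ∀ᵐ x ∂m, (c • a) x = c * a x :=
  Lp.coeFn_smul c a

instance : IsScalarTower ℝ (LInfty m) (LInfty m) where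
  smul_assoc c a b := by
    refine ext_ae ?_
    change ∀ᵐ x ∂m, ((c • a) * b) x = (c • (a * b)) x
    filter_upwards [coe_mul_ae (c • a) b, coe_real_smul_ae c a, coe_real_smul_ae c (a * b),
      coe_mul_ae a b] with x h1 h2 h3 h4
    rw [h1, h2, h3, h4, mul_assoc]

theorem abs_le_norm_ae (a : LInfty m) : ∀ᵐ x ∂m, |a x| ≤ ‖a‖ :=
  ae_le_lpNorm_exponent_top (Lp.memLp a) |>.mono fun x hx => by
    rwa [Lp.norm_def, toReal_eLpNorm (Lp.aestronglyMeasurable a)]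

theorem norm_le_of_ae {a : LInfty m} {C : ℝ} (hC0 : 0 ≤ C) (h : ∀ᵐ x ∂m, |a x| ≤ C) :
    ‖a‖ ≤ C := by
  rw [Lp.norm_def, eLpNorm_exponent_top]
  refine ENNReal.toReal_le_of_le_ofReal hC0 (essSup_le_of_ae_le _ ?_)
  filter_upwards [h] with x hx
  rw [Real.enorm_eq_ofReal_abs]
  exact ENNReal.ofReal_le_ofReal hx

variable {A B : Set X}

theorem chi_ae (hA : MeasurableSet A) : ∀ᵐ x ∂m, chi m hA x = A.indicator (fun _ => 1) x :=
  MemLp.coeFn_toLp _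

theorem chi_mem_ae (hA : MeasurableSet A) :
    ∀ᵐ x ∂m, (x ∈ A → chi m hA x = 1) ∧ (x ∉ A → chi m hA x = 0) := by
  filter_upwards [chi_ae (m := m) hA] with x hx
  rw [hx]
  exact ⟨fun h => indicator_of_mem h _, fun h => indicator_of_notMem h _⟩

theorem abs_chi_le (hA : MeasurableSet A) : ∀ᵐ x ∂m, |chi m hA x| ≤ 1 := by
  filter_upwards [chi_mem_ae (m := m) hA] with x hx
  by_cases h : x ∈ A
  · rw [hx.1 h, abs_one]
  · rw [hx.2 h, abs_zero]
    exact zero_le_one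

theorem mul_chi_eq_zero_iff {a : LInfty m} (hA : MeasurableSet A) :
    a * chi m hA = 0 ↔ ∀ᵐ x ∂m, x ∈ A → a x = 0 := by
  rw [eq_zero_iff]
  refine eventually_congr ?_
  filter_upwards [coe_mul_ae a (chi m hA), chi_mem_ae (m := m) hA] with x h1 h2
  rw [h1]
  by_cases h : x ∈ A
  · simp [h2.1 h, h]
  · simp [h2.2 h, h]

theorem mul_chi_eq_self_iff {a : LInfty m} (hA : MeasurableSet A) :
    a * chi m hA = a ↔ ∀ᵐ x ∂m, x ∉ A → a x = 0 := by
  rw [Lp.ext_iff]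
  refine eventually_congr ?_
  filter_upwards [coe_mul_ae a (chi m hA), chi_mem_ae (m := m) hA] with x h1 h2
  rw [h1]
  by_cases h : x ∈ A
  · simp [h2.1 h, h]
  · simp [h2.2 h, h, eq_comm]

theorem chi_mul (hA : MeasurableSet A) (hB : MeasurableSet B) :
    chi m hA * chi m hB = chi m (hA.inter hB) := by
  refine ext_ae ?_
  filter_upwards [coe_mul_ae (chi m hA) (chi m hB), chi_ae (m := m) hA, chi_ae (m := m) hB,
    chi_ae (m := m) (hA.inter hB)] with x h1 h2 h3 h4
  rw [h1, h2, h3, h4]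
  by_cases h : x ∈ A <;> by_cases h' : x ∈ B <;> simp [h, h']

theorem chi_mul_self (hA : MeasurableSet A) : chi m hA * chi m hA = chi m hA := by
  rw [mul_chi_eq_self_iff]
  filter_upwards [chi_mem_ae (m := m) hA] with x hx using hx.2

theorem chi_mul_of_subset (hA : MeasurableSet A) (hB : MeasurableSet B) (h : A ⊆ B) :
    chi m hA * chi m hB = chi m hA := by
  rw [mul_chi_eq_self_iff]
  filter_upwards [chi_mem_ae (m := m) hA] with x hx h' using hx.2 fun h'' => h' (h h'')

theorem chi_congr {hA : MeasurableSet A} {hB : MeasurableSet B} (h : A =ᵐ[m] B) :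
    chi m hA = chi m hB := by
  refine ext_ae ?_
  filter_upwards [chi_mem_ae (m := m) hA, chi_mem_ae (m := m) hB, h.mem_iff] with x h1 h2 h3
  by_cases hx : x ∈ A
  · rw [h1.1 hx, h2.1 (h3.1 hx)]
  · rw [h1.2 hx, h2.2 (fun h => hx (h3.2 h))]

theorem chi_eq_zero_iff (hA : MeasurableSet A) : chi m hA = 0 ↔ m A = 0 := by
  rw [eq_zero_iff, measure_eq_zero_iff_ae_notMem]
  refine eventually_congr ?_
  filter_upwards [chi_mem_ae (m := m) hA] with x hx
  by_cases h : x ∈ A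
  · simp [hx.1 h, h]
  · simp [hx.2 h, h]

theorem chi_add_compl (hA : MeasurableSet A) : chi m hA + chi m hA.compl = 1 := by
  refine ext_ae ?_
  filter_upwards [coe_add_ae (chi m hA) (chi m hA.compl), coe_one_ae (m := m),
    chi_mem_ae (m := m) hA, chi_mem_ae (m := m) hA.compl] with x h1 h2 h3 h4
  rw [h1, h2]
  by_cases h : x ∈ A
  · rw [h3.1 h, h4.2 (not_not.2 h), add_zero]
  · rw [h3.2 h, h4.1 h, zero_add]

theorem chi_mul_compl (hA : MeasurableSet A) : chi m hA * chi m hA.compl = 0 := by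
  rw [mul_chi_eq_zero_iff]
  filter_upwards [chi_mem_ae (m := m) hA] with x hx using hx.2

theorem chi_compl_mul (hA : MeasurableSet A) : chi m hA.compl * chi m hA = 0 := by
  rw [mul_comm, chi_mul_compl]

theorem chi_univ : chi m MeasurableSet.univ = 1 := by
  refine ext_ae ?_
  filter_upwards [chi_mem_ae (m := m) MeasurableSet.univ, coe_one_ae (m := m)] with x h1 h2
  rw [h1.1 trivial, h2]

theorem chi_union (hA : MeasurableSet A) (hB : MeasurableSet B) (hd : Disjoint A B) :
    chi m (hA.union hB) = chi m hA + chi m hB := by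
  refine ext_ae ?_
  filter_upwards [coe_add_ae (chi m hA) (chi m hB), chi_ae (m := m) hA, chi_ae (m := m) hB,
    chi_ae (m := m) (hA.union hB)] with x h1 h2 h3 h4
  rw [h1, h2, h3, h4, indicator_union_of_disjoint hd]

/-- `a ∈ L^∞(m)` from a bounded measurable function. -/
def ofBounded (f : X → ℝ) (hf : Measurable f) (h : ∃ C, ∀ x, |f x| ≤ C) : LInfty m :=
  (memLp_top_of_bound hf.aestronglyMeasurable h.choose
    (ae_of_all _ h.choose_spec) : MemLp f ∞ m).toLp f

theorem ofBounded_ae {f : X → ℝ} (hf : Measurable f) (h : ∃ C, ∀ x, |f x| ≤ C) :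
    ∀ᵐ x ∂m, (ofBounded f hf h : LInfty m) x = f x := MemLp.coeFn_toLp _

theorem measurableSet_ne_zero (a : LInfty m) : MeasurableSet {x | a x ≠ 0} :=
  ((Lp.stronglyMeasurable a).measurable (measurableSet_singleton 0)).compl

theorem mul_chi_support (a : LInfty m) : a * chi m a.measurableSet_ne_zero = a := by
  rw [mul_chi_eq_self_iff]
  exact ae_of_all _ fun x hx => not_not.1 hx

theorem mul_eq_zero_iff_chi (a b : LInfty m) :
    a * b = 0 ↔ a * chi m b.measurableSet_ne_zero = 0 := by
  rw [mul_chi_eq_zero_iff, eq_zero_iff]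
  refine eventually_congr ?_
  filter_upwards [coe_mul_ae a b] with x h1
  rw [h1, mul_eq_zero]
  by_cases h : b x = 0 <;> simp [h]

/-- Reducedness is what the stalk method rests on: the minimal primes then intersect in zero and the
localizations at them are fields. -/
instance : IsReduced (LInfty m) where
  eq_zero a := by
    rintro ⟨n, hn⟩
    have h : ∀ k : ℕ, ∀ᵐ x ∂m, (a ^ k) x = a x ^ k := by
      intro k
      induction k with
      | zero => simpa using coe_one_ae (m := m)
      | succ k ih =>
        filter_upwards [ih, coe_mul_ae (a ^ k) a] with x h1 h2
        rw [pow_succ, h2, h1, pow_succ]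
    rw [eq_zero_iff]
    filter_upwards [h n, eq_zero_iff.1 hn] with x h1 h2
    rw [h1] at h2
    exact eq_zero_of_pow_eq_zero h2

/-- The intersection of the minimal primes is the nilradical, which is zero. Applied to `χ_A`, this
yields a minimal prime at which a given set of positive measure is visible. -/
theorem exists_minimalPrime_notMem {a : LInfty m} (ha : a ≠ 0) :
    ∃ P ∈ minimalPrimes (LInfty m), a ∉ P := by
  by_contra! h
  have h1 : a ∈ sInf (⊥ : Ideal (LInfty m)).minimalPrimes :=
    Submodule.mem_sInf.2 fun P hP => h P hP
  rw [Ideal.sInf_minimalPrimes] at h1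
  obtain ⟨n, hn⟩ := h1
  exact ha (IsReduced.eq_zero a ⟨n, hn⟩)

/-- The localization at a minimal prime has a single prime, so its maximal ideal is nil: some `s ∉
P` kills a power `a ^ n`. Then `s * a` is nilpotent, hence zero. -/
theorem exists_notMem_mul_eq_zero {P : Ideal (LInfty m)} (hP : P ∈ minimalPrimes (LInfty m))
    {a : LInfty m} (ha : a ∈ P) : ∃ s ∉ P, s * a = 0 := by
  have := hP.1.1
  have hS := IsLocalization.subsingleton_primeSpectrum_of_mem_minimalPrimes P hP
    (Localization.AtPrime P)
  have h1 : algebraMap (LInfty m) (Localization.AtPrime P) a ∈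
      nilradical (Localization.AtPrime P) := by
    rw [nilradical_eq_sInf]
    refine Submodule.mem_sInf.2 fun J hJ => ?_
    have h2 : J = IsLocalRing.maximalIdeal (Localization.AtPrime P) :=
      congrArg PrimeSpectrum.asIdeal (Subsingleton.elim (⟨J, hJ⟩ : PrimeSpectrum _)
        ⟨IsLocalRing.maximalIdeal _, inferInstance⟩)
    rw [h2]
    exact (IsLocalization.AtPrime.to_map_mem_maximal_iff _ P a).2 ha
  obtain ⟨n, hn⟩ := h1
  rw [← map_pow, Ideal.zero_eq_bot, Ideal.mem_bot,
    IsLocalization.map_eq_zero_iff P.primeCompl] at hn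
  obtain ⟨⟨s, hs⟩, h⟩ := hn
  refine ⟨s, hs, IsReduced.eq_zero _ ⟨n + 1, ?_⟩⟩
  rw [mul_pow, pow_succ, mul_assoc, pow_succ a, ← mul_assoc s, show s * a ^ n = 0 from h, zero_mul,
    mul_zero]

/-- The maximal ideal consists of fractions with numerator in `P`, and these vanish by the preceding
lemma. Stalks of modules are therefore vector spaces. -/
theorem isField_localization {P : Ideal (LInfty m)} [P.IsPrime]
    (hP : P ∈ minimalPrimes (LInfty m)) : IsField (Localization.AtPrime P) := by
  rw [IsLocalRing.isField_iff_maximalIdeal_eq, eq_bot_iff]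
  intro z hz
  obtain ⟨a, s, rfl⟩ := IsLocalization.exists_mk'_eq P.primeCompl z
  rw [IsLocalization.AtPrime.mk'_mem_maximal_iff _ P] at hz
  obtain ⟨t, ht, hta⟩ := exists_notMem_mul_eq_zero hP hz
  rw [Ideal.mem_bot, IsLocalization.mk'_eq_zero_iff]
  exact ⟨⟨t, ht⟩, hta⟩

/-- A prime decides every measurable set. Together with the next three lemmas this says that the
sets whose indicator avoids `P` form an ultrafilter of measurable sets. -/
theorem chi_mem_or_compl_mem {P : Ideal (LInfty m)} [hP : P.IsPrime] (hA : MeasurableSet A) :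
    chi m hA ∈ P ∨ chi m hA.compl ∈ P :=
  hP.mem_or_mem (by rw [chi_mul_compl]; exact P.zero_mem)

theorem chi_compl_notMem {P : Ideal (LInfty m)} [hP : P.IsPrime] {hA : MeasurableSet A}
    (h : chi m hA ∈ P) : chi m hA.compl ∉ P := fun h' =>
  hP.ne_top ((Ideal.eq_top_iff_one P).2 (by rw [← chi_add_compl hA]; exact P.add_mem h h'))

theorem chi_notMem_of_subset {P : Ideal (LInfty m)} {hA : MeasurableSet A} {hB : MeasurableSet B}
    (h : A ⊆ B) (h' : chi m hA ∉ P) : chi m hB ∉ P := fun hmem => h' (by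
  rw [← chi_mul_of_subset hA hB h]
  exact P.mul_mem_left _ hmem)

theorem chi_inter_notMem {P : Ideal (LInfty m)} [hP : P.IsPrime] {hA : MeasurableSet A}
    {hB : MeasurableSet B} (h : chi m hA ∉ P) (h' : chi m hB ∉ P) :
    chi m (hA.inter hB) ∉ P := fun hmem => by
  rw [← chi_mul hA hB] at hmem
  exact (hP.mem_or_mem hmem).elim h h'

/-- Compactness of the space of minimal primes of `L^∞(m)`. -/
theorem exists_cover (𝒞 : Set X → Prop) (h0 : 𝒞 ∅)
    (hU : ∀ C D, MeasurableSet C → MeasurableSet D → 𝒞 C → 𝒞 D → 𝒞 (C ∪ D))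
    (hA : MeasurableSet A)
    (h : ∀ P ∈ minimalPrimes (LInfty m), chi m hA ∉ P →
      ∃ (C : Set X) (hC : MeasurableSet C), 𝒞 C ∧ chi m hC ∉ P) :
    ∃ C, MeasurableSet C ∧ 𝒞 C ∧ m (A \ C) = 0 := by
  -- The functions supported in some member of `𝒞` form an ideal because `𝒞` is stable under unions.
  -- The claim is that it contains `χ_A`.
  let I : Ideal (LInfty m) :=
    { carrier := {r | ∃ (C : Set X) (hC : MeasurableSet C), 𝒞 C ∧ r * chi m hC = r}
      zero_mem' := ⟨∅, MeasurableSet.empty, h0, zero_mul _⟩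
      add_mem' := by
        rintro r s ⟨C, hC, hC', hr⟩ ⟨D, hD, hD', hs⟩
        refine ⟨C ∪ D, hC.union hD, hU C D hC hD hC' hD', ?_⟩
        rw [add_mul]
        congr 1
        · rw [← hr, mul_assoc, chi_mul_of_subset _ _ subset_union_left]
        · rw [← hs, mul_assoc, chi_mul_of_subset _ _ subset_union_right]
      smul_mem' := by
        rintro c r ⟨C, hC, hC', hr⟩
        exact ⟨C, hC, hC', by rw [smul_eq_mul, mul_assoc, hr]⟩ }
  by_cases hI : chi m hA ∈ I
  · obtain ⟨C, hC, hC', hr⟩ := hI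
    refine ⟨C, hC, hC', ?_⟩
    rw [mul_chi_eq_self_iff] at hr
    rw [measure_eq_zero_iff_ae_notMem]
    filter_upwards [hr, chi_mem_ae (m := m) hA] with x h1 h2 h3
    exact one_ne_zero ((h2.1 h3.1).symm.trans (h1 h3.2))
  · exfalso
    -- Otherwise a prime `Q ⊇ I` avoids the idempotent `χ_A`. For a minimal prime `P ⊆ Q` and the
    -- set `C` that belongs to it, `χ_C ∈ I ⊆ Q` and `1 - χ_C ∈ P ⊆ Q`, so `1 ∈ Q`.
    obtain ⟨Q, hQ, hIQ, hAQ⟩ := I.exists_le_prime_notMem_of_isIdempotentElem _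
      (chi_mul_self hA) hI
    obtain ⟨P, hP, hPQ⟩ := Ideal.exists_minimalPrimes_le (I := ⊥) (J := Q) bot_le
    obtain ⟨C, hC, hC', hCP⟩ := h P hP fun h => hAQ (hPQ h)
    have := hP.1.1
    have h1 : chi m hC ∈ Q := hIQ ⟨C, hC, hC', chi_mul_self hC⟩
    have h2 : chi m hC.compl ∈ Q := hPQ ((chi_mem_or_compl_mem hC).resolve_left hCP)
    exact chi_compl_notMem h1 h2

end LInfty

/-! ## Supports -/

section Support

variable {X : Type*} [MeasurableSpace X] (m : Measure X) {E : Type*} [AddCommGroup E]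
  [Module (LInfty m) E]

/-- `v` vanishes exactly outside of the measurable set `S`. -/
def IsSupportOf (v : E) {S : Set X} (hS : MeasurableSet S) : Prop :=
  ∀ a : LInfty m, a • v = 0 ↔ a * LInfty.chi m hS = 0

variable {m}

theorem IsSupportOf.chi_smul {v : E} {S : Set X} {hS : MeasurableSet S} (h : IsSupportOf m v hS) :
    LInfty.chi m hS • v = v := by
  have h1 := (h _).2 (LInfty.chi_compl_mul hS)
  conv_rhs => rw [← one_smul (LInfty m) v, ← LInfty.chi_add_compl hS, add_smul, h1, add_zero]

end Support

/-! ### Gluing along countable families, and elements of largest support -/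

section FullSupport

variable {X : Type*} [MeasurableSpace X] {m : Measure X} {E : Type*} [NormedAddCommGroup E]
  [NormedSpace ℝ E] [CompleteSpace E] [Module (LInfty m) E] [IsScalarTower ℝ (LInfty m) E]

theorem smul_real_comm {E : Type*} [AddCommGroup E] [Module ℝ E] [Module (LInfty m) E]
    [IsScalarTower ℝ (LInfty m) E] (a : LInfty m) (c : ℝ) (v : E) : a • c • v = c • a • v := by
  have h : ∀ w : E, c • w = (c • (1 : LInfty m)) • w := fun w => by rw [smul_assoc, one_smul]
  rw [h, h (a • v), smul_smul, smul_smul, mul_comm]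

/-- Elements can be glued along countably many disjoint sets, up to scalars. -/
theorem exists_glue (hc : ∀ a : LInfty m, Continuous fun v : E => a • v) {D : ℕ → Set X}
    (hD : ∀ n, MeasurableSet (D n)) (hdis : Pairwise (Function.onFun Disjoint D)) (w : ℕ → E) :
    ∃ (v : E) (c : ℕ → ℝ), (∀ k, c k ≠ 0) ∧
      ∀ k, LInfty.chi m (hD k) • v = c k • LInfty.chi m (hD k) • w k := by
  let u : ℕ → E := fun n => LInfty.chi m (hD n) • w n
  -- The weights make the series absolutely convergent. They are nonzero, so on each piece the sum
  -- has the same annihilator as the piece.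
  let c : ℕ → ℝ := fun n => (1 / 2) ^ n / (1 + ‖u n‖)
  have hc0 : ∀ n, c n ≠ 0 := fun n => by positivity
  have hsum : Summable fun n => c n • u n := by
    refine Summable.of_norm_bounded (g := fun n : ℕ => (1 / 2 : ℝ) ^ n)
      (summable_geometric_of_lt_one (by norm_num) (by norm_num)) fun n => ?_
    rw [norm_smul, Real.norm_of_nonneg (by positivity), div_mul_eq_mul_div,
      div_le_iff₀ (by positivity)]
    gcongr
    linarith
  refine ⟨∑' n, c n • u n, c, hc0, fun k => ?_⟩
  have h3 : HasSum (fun n => LInfty.chi m (hD k) • c n • u n)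
      (LInfty.chi m (hD k) • ∑' n, c n • u n) :=
    hsum.hasSum.map (DistribSMul.toAddMonoidHom E (LInfty.chi m (hD k))) (hc _)
  refine h3.unique ?_
  convert hasSum_single (f := fun n => LInfty.chi m (hD k) • c n • u n) k ?_ using 1
  · rw [smul_real_comm]
    simp only [u, smul_smul, LInfty.chi_mul_self]
  · intro n hn
    rw [smul_real_comm]
    simp only [u, smul_smul, LInfty.chi_mul]
    have : LInfty.chi m ((hD k).inter (hD n)) = 0 := by
      rw [LInfty.chi_eq_zero_iff, (hdis hn.symm).inter_eq, measure_empty]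
    rw [this, zero_smul, smul_zero]

/-- Countably many elements can be replaced by a single one with larger support. -/
theorem exists_annihilator_le (hc : ∀ a : LInfty m, Continuous fun v : E => a • v)
    (hs : ∀ v : E, ∃ (S : Set X) (hS : MeasurableSet S), IsSupportOf m v hS) (w : ℕ → E) :
    ∃ v : E, ∀ a : LInfty m, a • v = 0 → ∀ n, a • w n = 0 := by
  choose S hS hw using fun n => hs (w n)
  have hD : ∀ n, MeasurableSet (disjointed S n) := fun n => MeasurableSet.disjointed hS n
  obtain ⟨v, c, hc0, hv⟩ := exists_glue hc hD (disjoint_disjointed S) w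
  refine ⟨v, fun a ha => ?_⟩
  have h1 : ∀ k, ∀ᵐ x ∂m, x ∈ disjointed S k → a x = 0 := by
    intro k
    rw [← LInfty.mul_chi_eq_zero_iff (hD k)]
    have h3 : (a * LInfty.chi m (hD k)) • v = 0 := by
      rw [mul_comm, mul_smul, ha, smul_zero]
    rw [mul_smul, hv, smul_real_comm] at h3
    have h4 := (smul_eq_zero.1 h3).resolve_left (hc0 k)
    simp only [smul_smul] at h4
    have h5 := (hw k _).1 h4
    rwa [mul_assoc, LInfty.chi_mul_of_subset _ _ (disjointed_subset S k)] at h5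
  intro n
  rw [hw n, LInfty.mul_chi_eq_zero_iff]
  filter_upwards [ae_all_iff.2 h1] with x hx hxn
  have : x ∈ ⋃ k, disjointed S k := by
    rw [iUnion_disjointed]
    exact mem_iUnion.2 ⟨n, hxn⟩
  obtain ⟨k, hk⟩ := mem_iUnion.1 this
  exact hx k hk

/-- There is an element of largest support. -/
theorem exists_full_support [SigmaFinite m]
    (hc : ∀ a : LInfty m, Continuous fun v : E => a • v)
    (hs : ∀ v : E, ∃ (S : Set X) (hS : MeasurableSet S), IsSupportOf m v hS) :
    ∃ v : E, ∀ a : LInfty m, a • v = 0 → ∀ w : E, a • w = 0 := by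
  choose S hS hw using hs
  set μ := m.toFinite
  have hbdd : BddAbove (range fun v => μ.real (S v)) :=
    ⟨μ.real univ, by
      rintro _ ⟨v, rfl⟩
      exact measureReal_mono (subset_univ _)⟩
  -- Exhaustion: among all supports, measured by a finite measure equivalent to `m`, the supremum is
  -- attained because countably many supports can be joined into one.
  set s := ⨆ v, μ.real (S v) with hs
  have hle : ∀ v, μ.real (S v) ≤ s := fun v => le_ciSup hbdd v
  have hmono : ∀ v w : E, (∀ a : LInfty m, a • v = 0 → a • w = 0) → m (S w \ S v) = 0 := by
    intro v w h
    have h1 := h (LInfty.chi m (hS v).compl) ((hw v _).2 (LInfty.chi_compl_mul _))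
    rw [hw w, LInfty.mul_chi_eq_zero_iff] at h1
    rw [measure_eq_zero_iff_ae_notMem]
    filter_upwards [h1, LInfty.chi_mem_ae (m := m) (hS v).compl] with x h2 h3 h4
    exact one_ne_zero ((h3.1 h4.2).symm.trans (h2 h4.1))
  have hmono' : ∀ v w : E, (∀ a : LInfty m, a • v = 0 → a • w = 0) → S w ≤ᵐ[μ] S v := fun v w h =>
    ae_le_set.2 (toFinite_absolutelyContinuous m (hmono v w h))
  have hex : ∀ n : ℕ, ∃ v, s - 1 / ((n : ℝ) + 1) < μ.real (S v) := fun n =>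
    exists_lt_of_lt_ciSup (sub_lt_self _ (by positivity))
  choose w hws using hex
  obtain ⟨v, hv⟩ := exists_annihilator_le hc (fun v => ⟨S v, hS v, hw v⟩) w
  have hv' : s ≤ μ.real (S v) := by
    have h1 : Tendsto (fun n : ℕ => s - 1 / ((n : ℝ) + 1)) atTop (𝓝 s) := by
      simpa using tendsto_one_div_add_atTop_nhds_zero_nat.const_sub s
    refine le_of_tendsto' h1 fun n => (hws n).le.trans ?_
    exact ENNReal.toReal_mono (measure_ne_top _ _)
      (measure_mono_ae (hmono' v (w n) fun a ha => hv a ha n))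
  refine ⟨v, fun a ha z => ?_⟩
  -- The element `v'` has a support containing those of `v` and of `z`. By maximality it is no
  -- larger than `S v` up to a null set, so the support of `z` lies in that of `v`.
  obtain ⟨v', hv''⟩ := exists_annihilator_le hc (fun v => ⟨S v, hS v, hw v⟩)
    (fun n => if n = 0 then v else z)
  have h1 := hmono' v' v fun a ha => by simpa using hv'' a ha 0
  have h2 := hmono v' z fun a ha => by simpa using hv'' a ha 1
  have h3 : S v =ᵐ[μ] S v' := by
    refine ae_eq_of_ae_subset_of_measure_ge h1 ?_ (hS v).nullMeasurableSet (measure_ne_top _ _)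
    exact (ENNReal.toReal_le_toReal (measure_ne_top _ _) (measure_ne_top _ _)).1
      ((hle v').trans hv')
  rw [hw z, LInfty.mul_chi_eq_zero_iff]
  have h4 := (LInfty.mul_chi_eq_zero_iff (hS v)).1 ((hw v a).1 ha)
  filter_upwards [h4, measure_eq_zero_iff_ae_notMem.1 h2,
    (absolutelyContinuous_toFinite m).ae_eq h3 |>.mem_iff] with x h5 h6 h7 h8
  exact h5 (h7.2 (by_contra fun h => h6 ⟨h8, h⟩))

end FullSupport

/-! ## `L^p`-normed modules -/

section LpModule

variable {X : Type*} [MeasurableSpace X] (m : Measure X) (p : ℝ≥0) (E : Type*)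
  [NormedAddCommGroup E] [Module (LInfty m) E]

/-- `L^p(m)`-normed modules over `L^∞(m)`, in terms of the norm. -/
structure IsLpModule : Prop where
  -- No pointwise norm is required. These three conditions on the norm pass to submodules and
  -- quotients, and they still produce a measure `A ↦ ‖χ_A v‖^p` for each `v`.
  norm_smul_le : ∀ (a : LInfty m) {C : ℝ}, 0 ≤ C → (∀ᵐ x ∂m, |a x| ≤ C) → ∀ v : E,
    ‖a • v‖ ≤ C * ‖v‖
  norm_rpow : ∀ {A : Set X} (hA : MeasurableSet A) (v : E),
    ‖v‖ ^ (p : ℝ) = ‖LInfty.chi m hA • v‖ ^ (p : ℝ) + ‖LInfty.chi m hA.compl • v‖ ^ (p : ℝ)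
  tendsto_zero : ∀ (A : ℕ → Set X) (hA : ∀ n, MeasurableSet (A n)), Antitone A → ⋂ n, A n = ∅ →
    ∀ v : E, Tendsto (fun n => LInfty.chi m (hA n) • v) atTop (𝓝 0)

variable {m p E}

namespace IsLpModule

theorem of_isometry (hE : IsLpModule m p E) {F : Type*} [NormedAddCommGroup F]
    [Module (LInfty m) F] (ι : F →ₗ[LInfty m] E) (hι : ∀ v, ‖ι v‖ = ‖v‖) : IsLpModule m p F where
  norm_smul_le a C hC0 hC v := by
    rw [← hι, map_smul, ← hι v]
    exact hE.norm_smul_le a hC0 hC _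
  norm_rpow hA v := by
    simpa only [← hι, map_smul] using hE.norm_rpow hA (ι v)
  tendsto_zero A hA hA' hA'' v := by
    rw [tendsto_zero_iff_norm_tendsto_zero]
    have h := (hE.tendsto_zero A hA hA' hA'' (ι v)).norm
    simpa only [norm_zero, ← map_smul, hι] using h

theorem submodule (hE : IsLpModule m p E) (V : Submodule (LInfty m) E) : IsLpModule m p V :=
  hE.of_isometry V.subtype fun _ => rfl

theorem norm_chi_smul_le (hE : IsLpModule m p E) {A : Set X} (hA : MeasurableSet A) (v : E) :
    ‖LInfty.chi m hA • v‖ ≤ ‖v‖ := by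
  simpa using hE.norm_smul_le _ zero_le_one (LInfty.abs_chi_le hA) v

theorem continuous_smul (hE : IsLpModule m p E) (a : LInfty m) : Continuous fun v : E => a • v := by
  obtain ⟨C, hC0, hC⟩ := a.exists_bound
  exact AddMonoidHomClass.continuous_of_bound (DistribSMul.toAddMonoidHom E a) C fun v =>
    hE.norm_smul_le a hC0 hC v

theorem continuousConstSMul (hE : IsLpModule m p E) : ContinuousConstSMul (LInfty m) E :=
  ⟨hE.continuous_smul⟩

theorem norm_smul_le_mul (hE : IsLpModule m p E) (a : LInfty m) (v : E) :
    ‖a • v‖ ≤ ‖a‖ * ‖v‖ :=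
  hE.norm_smul_le a (norm_nonneg a) a.abs_le_norm_ae v

theorem norm_add_rpow (hE : IsLpModule m p E) {A : Set X} (hA : MeasurableSet A) (v w : E) :
    ‖LInfty.chi m hA • v + LInfty.chi m hA.compl • w‖ ^ (p : ℝ)
      = ‖LInfty.chi m hA • v‖ ^ (p : ℝ) + ‖LInfty.chi m hA.compl • w‖ ^ (p : ℝ) := by
  rw [hE.norm_rpow hA]
  congr 3
  · rw [smul_add, smul_smul, smul_smul, LInfty.chi_mul_self, LInfty.chi_mul_compl, zero_smul,
      add_zero]
  · rw [smul_add, smul_smul, smul_smul, LInfty.chi_mul_self, LInfty.chi_compl_mul, zero_smul,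
      zero_add]

/-- The hypotheses say that `Q` carries the quotient norm. Additivity of `‖·‖^p` survives because
almost optimal lifts over `A` and over its complement can be chosen separately and glued, while an
almost optimal lift of `q` can be cut into two. -/
theorem of_quotient (hE : IsLpModule m p E) {Q : Type*} [NormedAddCommGroup Q]
    [Module (LInfty m) Q] (π : E →ₗ[LInfty m] Q) (h1 : ∀ v, ‖π v‖ ≤ ‖v‖)
    (h2 : ∀ (q : Q) {ε : ℝ}, 0 < ε → ∃ v, π v = q ∧ ‖v‖ < ‖q‖ + ε) : IsLpModule m p Q where
  norm_smul_le a C hC0 hC q := by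
    refine le_of_forall_pos_le_add fun ε hε => ?_
    obtain ⟨v, rfl, hv⟩ := h2 q (ε := ε / (C + 1)) (by positivity)
    rw [← map_smul]
    refine (h1 _).trans ((hE.norm_smul_le a hC0 hC v).trans ?_)
    have : C * (ε / (C + 1)) ≤ ε := by
      rw [mul_div_assoc', div_le_iff₀ (by positivity)]
      nlinarith
    nlinarith
  norm_rpow {A} hA q := by
    have hlim : ∀ c : ℝ, Tendsto (fun n : ℕ => (c + 1 / ((n : ℝ) + 1)) ^ (p : ℝ)) atTop
        (𝓝 (c ^ (p : ℝ))) := fun c => by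
      have := (tendsto_one_div_add_atTop_nhds_zero_nat (𝕜 := ℝ)).const_add c
      rw [add_zero] at this
      exact this.rpow_const (Or.inr p.coe_nonneg)
    refine le_antisymm ?_ ?_
    · refine ge_of_tendsto' ((hlim ‖LInfty.chi m hA • q‖).add
        (hlim ‖LInfty.chi m hA.compl • q‖)) fun n => ?_
      obtain ⟨v, hv, hv'⟩ := h2 (LInfty.chi m hA • q) (ε := 1 / ((n : ℝ) + 1)) (by positivity)
      obtain ⟨w, hw, hw'⟩ := h2 (LInfty.chi m hA.compl • q) (ε := 1 / ((n : ℝ) + 1))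
        (by positivity)
      have h3 : π (LInfty.chi m hA • v + LInfty.chi m hA.compl • w) = q := by
        rw [map_add, map_smul, map_smul, hv, hw, smul_smul, smul_smul, LInfty.chi_mul_self,
          LInfty.chi_mul_self, ← add_smul, LInfty.chi_add_compl, one_smul]
      calc ‖q‖ ^ (p : ℝ) ≤ ‖LInfty.chi m hA • v + LInfty.chi m hA.compl • w‖ ^ (p : ℝ) := by
            conv_lhs => rw [← h3]
            gcongr
            exact h1 _
        _ = _ := hE.norm_add_rpow hA v w
        _ ≤ _ := by
            gcongr
            · exact (hE.norm_chi_smul_le hA v).trans hv'.le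
            · exact (hE.norm_chi_smul_le hA.compl w).trans hw'.le
    · refine ge_of_tendsto' (hlim ‖q‖) fun n => ?_
      obtain ⟨v, rfl, hv'⟩ := h2 q (ε := 1 / ((n : ℝ) + 1)) (by positivity)
      calc _ ≤ ‖LInfty.chi m hA • v‖ ^ (p : ℝ) + ‖LInfty.chi m hA.compl • v‖ ^ (p : ℝ) := by
            rw [← map_smul, ← map_smul]
            gcongr <;> exact h1 _
        _ = ‖v‖ ^ (p : ℝ) := (hE.norm_rpow hA v).symm
        _ ≤ _ := by gcongr
  tendsto_zero A hA hA' hA'' q := by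
    obtain ⟨v, rfl, -⟩ := h2 q one_pos
    refine squeeze_zero_norm (fun n => ?_)
      (tendsto_zero_iff_norm_tendsto_zero.1 (hE.tendsto_zero A hA hA' hA'' v))
    rw [← map_smul]
    exact h1 _

theorem quotient (hE : IsLpModule m p E) (V : Submodule (LInfty m) E)
    [hV : IsClosed (V : Set E)] :
    letI := Submodule.Quotient.normedAddCommGroup V
    IsLpModule m p (E ⧸ V) :=
  letI := Submodule.Quotient.normedAddCommGroup V
  hE.of_quotient V.mkQ (fun v => Submodule.Quotient.norm_mk_le V v) fun q _ hε =>
    Submodule.Quotient.norm_mk_lt q hε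

theorem tendsto_zero_of_null (hE : IsLpModule m p E) {A : ℕ → Set X}
    (hA : ∀ n, MeasurableSet (A n)) (hanti : Antitone A) (hnull : m (⋂ n, A n) = 0) (v : E) :
    Tendsto (fun n => LInfty.chi m (hA n) • v) atTop (𝓝 0) := by
  have hN : MeasurableSet (⋂ n, A n) := MeasurableSet.iInter hA
  refine (hE.tendsto_zero (fun n => A n \ ⋂ n, A n) (fun n => (hA n).diff hN)
    (fun i j hij => sdiff_subset_sdiff_left (hanti hij)) ?_ v).congr fun n => ?_
  · refine eq_empty_of_forall_notMem fun x hx => ?_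
    rw [mem_iInter] at hx
    exact (hx 0).2 (mem_iInter.2 fun n => (hx n).1)
  · congr 1
    exact LInfty.chi_congr (sdiff_null_ae_eq_self hnull)

/-- Dominated convergence in `L^p`-normed modules. -/
theorem tendsto_smul (hE : IsLpModule m p E) {a : ℕ → LInfty m} {b : LInfty m} {C : ℝ}
    (hC : ∀ n, ∀ᵐ x ∂m, |a n x| ≤ C) (hab : ∀ᵐ x ∂m, Tendsto (fun n => a n x) atTop (𝓝 (b x)))
    (v : E) : Tendsto (fun n => a n • v) atTop (𝓝 (b • v)) := by
  obtain ⟨K, hK0, hK⟩ := b.exists_bound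
  have hD : ∀ n, ∀ᵐ x ∂m, |(a n - b) x| ≤ |C| + K := fun n => by
    filter_upwards [hC n, hK, LInfty.coe_sub_ae (a n) b] with x h1 h2 h3
    rw [h3]
    exact (abs_sub _ _).trans (add_le_add (h1.trans (le_abs_self C)) h2)
  rw [tendsto_iff_norm_sub_tendsto_zero]
  have key : ∀ ε > 0, ∀ᶠ n in atTop, ‖a n • v - b • v‖ ≤ ε * ‖v‖ + ε := by
    intro ε hε
    -- Egorov's splitting: `B n` is where some later term is off by more than `ε`. These sets
    -- decrease to a null set; off `B n` the multiplier is at most `ε`, and on it `χ_(B n) v` is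
    -- small.
    let B : ℕ → Set X := fun n => ⋃ k ≥ n, {x | ε < |(a k - b) x|}
    have hB : ∀ n, MeasurableSet (B n) := fun n =>
      MeasurableSet.biUnion (to_countable _) fun k _ => measurableSet_lt measurable_const
        (Lp.stronglyMeasurable (a k - b)).measurable.abs
    have hanti : Antitone B := fun i j hij =>
      biUnion_subset_biUnion_left fun k (hk : j ≤ k) => hij.trans hk
    have hnull : m (⋂ n, B n) = 0 := by
      rw [measure_eq_zero_iff_ae_notMem]
      filter_upwards [hab, ae_all_iff.2 fun n => LInfty.coe_sub_ae (a n) b] with x hx h' hmem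
      rw [tendsto_iff_dist_tendsto_zero] at hx
      obtain ⟨N, hN⟩ := eventually_atTop.1 (hx.eventually_lt_const hε)
      have h1 := mem_iInter.1 hmem N
      simp only [B, mem_iUnion, mem_ofPred_eq, exists_prop] at h1
      obtain ⟨k, hk, hk'⟩ := h1
      rw [h' k] at hk'
      exact lt_asymm hk' (hN k hk)
    have hlim := (tendsto_zero_iff_norm_tendsto_zero.1
      (hE.tendsto_zero_of_null hB hanti hnull v)).const_mul (|C| + K)
    rw [mul_zero] at hlim
    filter_upwards [hlim.eventually_lt_const hε] with n hn
    have h1 : a n • v - b • v = ((a n - b) * LInfty.chi m (hB n).compl) • v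
        + (a n - b) • LInfty.chi m (hB n) • v := by
      rw [smul_smul, ← add_smul, ← mul_add, add_comm (LInfty.chi m _), LInfty.chi_add_compl,
        mul_one, sub_smul]
    rw [h1]
    refine (norm_add_le _ _).trans (add_le_add (hE.norm_smul_le _ hε.le ?_ v) ?_)
    · filter_upwards [LInfty.coe_mul_ae (a n - b) (LInfty.chi m (hB n).compl),
        LInfty.chi_mem_ae (m := m) (hB n).compl] with x h2 h3
      rw [h2]
      by_cases hx : x ∈ (B n)ᶜ
      · rw [h3.1 hx, mul_one]
        by_contra hcon
        exact hx (mem_biUnion (le_refl n) (not_le.1 hcon))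
      · rw [h3.2 hx, mul_zero, abs_zero]
        exact hε.le
    · exact (hE.norm_smul_le _ (by positivity) (hD n) _).trans hn.le
  rw [Metric.tendsto_atTop]
  intro ε hε
  obtain ⟨N, hN⟩ := eventually_atTop.1 (key (ε / (2 * (‖v‖ + 1))) (by positivity))
  refine ⟨N, fun n hn => ?_⟩
  rw [dist_zero_right, norm_norm]
  refine (hN n hn).trans_lt ?_
  rw [← mul_add_one, div_mul_eq_mul_div, div_lt_iff₀ (by positivity)]
  have := norm_nonneg v
  nlinarith

theorem tendsto_chi_smul (hE : IsLpModule m p E) {A : ℕ → Set X} (hA : ∀ n, MeasurableSet (A n))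
    (hmono : Monotone A) (hnull : m (⋃ n, A n)ᶜ = 0) (v : E) :
    Tendsto (fun n => LInfty.chi m (hA n) • v) atTop (𝓝 v) := by
  have h := hE.tendsto_smul (a := fun n => LInfty.chi m (hA n)) (b := 1) (C := 1)
    (fun n => LInfty.abs_chi_le (hA n)) ?_ v
  · rwa [one_smul] at h
  · filter_upwards [measure_eq_zero_iff_ae_notMem.1 hnull, LInfty.coe_one_ae (m := m),
      ae_all_iff.2 fun n => LInfty.chi_mem_ae (m := m) (hA n)] with x h1 h2 h3
    rw [h2]
    obtain ⟨N, hN⟩ := mem_iUnion.1 (not_not.1 h1)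
    refine tendsto_const_nhds.congr' ?_
    filter_upwards [eventually_ge_atTop N] with n hn
    exact ((h3 n).1 (hmono hn hN)).symm

end IsLpModule

end LpModule

/-! ### The measures `‖χ_A v‖^p`, supports, and reflexivity of modules with one generator -/

section LpModuleReflexive

variable {X : Type*} [MeasurableSpace X] {m : Measure X} {p : ℝ≥0}
  {E : Type*} [NormedAddCommGroup E] [Module (LInfty m) E]

namespace IsLpModule

theorem norm_chi_union_rpow (hE : IsLpModule m p E) {A B : Set X} (hA : MeasurableSet A)
    (hB : MeasurableSet B) (hd : Disjoint A B) (v : E) :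
    ‖LInfty.chi m (hA.union hB) • v‖ ^ (p : ℝ)
      = ‖LInfty.chi m hA • v‖ ^ (p : ℝ) + ‖LInfty.chi m hB • v‖ ^ (p : ℝ) := by
  have h := hE.norm_add_rpow hA (LInfty.chi m hA • v) (LInfty.chi m hB • v)
  have h1 : LInfty.chi m hA.compl * LInfty.chi m hB = LInfty.chi m hB := by
    rw [mul_comm, LInfty.chi_mul_of_subset]
    exact fun x hx hx' => disjoint_left.1 hd hx' hx
  rwa [smul_smul, smul_smul, LInfty.chi_mul_self, h1, ← add_smul, ← LInfty.chi_union hA hB hd]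
    at h

end IsLpModule

variable [hp1 : Fact (1 ≤ (p : ℝ≥0∞))]

theorem NNReal.coe_pos_of_fact_one_le : 0 < (p : ℝ) := by
  have : 1 ≤ (p : ℝ≥0∞) := Fact.out
  have : (1 : ℝ) ≤ p := by exact_mod_cast this
  linarith

namespace IsLpModule

/-- The measure `A ↦ ‖χ_A v‖^p`. -/
def measure (hE : IsLpModule m p E) (v : E) : Measure X :=
  Measure.ofMeasurable (fun A hA => ENNReal.ofReal (‖LInfty.chi m hA • v‖ ^ (p : ℝ)))
    (by
      have : LInfty.chi m (MeasurableSet.empty (α := X)) = 0 := by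
        rw [LInfty.chi_eq_zero_iff, measure_empty]
      rw [this, zero_smul, norm_zero, Real.zero_rpow NNReal.coe_pos_of_fact_one_le.ne',
        ENNReal.ofReal_zero])
    (by
      intro A hA hd
      have hF : ∀ n : ℕ, MeasurableSet (⋃ i ∈ Finset.range n, A i) := fun n =>
        Finset.measurableSet_biUnion _ fun i _ => hA i
      have hU : MeasurableSet (⋃ i, A i) := MeasurableSet.iUnion hA
      have hsub : ∀ n : ℕ, (⋃ i ∈ Finset.range n, A i) ⊆ ⋃ i, A i := fun n =>
        iUnion₂_subset fun i _ => subset_iUnion A i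
      have hsum : ∀ n : ℕ, ∑ i ∈ Finset.range n, ENNReal.ofReal (‖LInfty.chi m (hA i) • v‖ ^ (p : ℝ))
          = ENNReal.ofReal (‖LInfty.chi m (hF n) • v‖ ^ (p : ℝ)) := by
        intro n
        induction n with
        | zero =>
          have : LInfty.chi m (hF 0) = 0 := by
            rw [LInfty.chi_eq_zero_iff]
            simp
          rw [this, zero_smul, norm_zero, Real.zero_rpow NNReal.coe_pos_of_fact_one_le.ne',
            ENNReal.ofReal_zero, Finset.sum_range_zero]
        | succ n ih =>
          have h1 : LInfty.chi m (hF (n + 1)) = LInfty.chi m ((hF n).union (hA n)) := by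
            congr 1
            rw [Finset.range_add_one, Finset.set_biUnion_insert, union_comm]
          rw [Finset.sum_range_succ, ih, h1, hE.norm_chi_union_rpow (hF n) (hA n) ?_,
            ENNReal.ofReal_add (by positivity) (by positivity)]
          rw [disjoint_iUnion₂_left]
          intro i hi
          exact hd (Finset.mem_range.1 hi).ne
      have hT : ∀ n : ℕ, MeasurableSet ((⋃ i, A i) \ ⋃ i ∈ Finset.range n, A i) := fun n =>
        hU.diff (hF n)
      have hsplit : ∀ n : ℕ, ‖LInfty.chi m hU • v‖ ^ (p : ℝ)
          = ‖LInfty.chi m (hF n) • v‖ ^ (p : ℝ) + ‖LInfty.chi m (hT n) • v‖ ^ (p : ℝ) := by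
        intro n
        rw [← hE.norm_chi_union_rpow (hF n) (hT n) disjoint_sdiff_right]
        congr 4
        exact (union_sdiff_cancel (hsub n)).symm
      -- Finite additivity becomes countable because the tails of the union decrease to the empty
      -- set, where the order continuity of the norm applies.
      have h0 : Tendsto (fun n => LInfty.chi m (hT n) • v) atTop (𝓝 0) := by
        refine hE.tendsto_zero _ hT (fun i j hij => ?_) ?_ v
        · refine sdiff_subset_sdiff_right (biUnion_subset_biUnion_left fun k hk => ?_)
          exact Finset.mem_range.2 ((Finset.mem_range.1 hk).trans_le hij)
        · refine eq_empty_of_forall_notMem fun x hx => ?_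
          rw [mem_iInter] at hx
          obtain ⟨i, hi⟩ := mem_iUnion.1 (hx 0).1
          exact (hx (i + 1)).2 (mem_biUnion (Finset.mem_range.2 (Nat.lt_succ_self i)) hi)
      have h1 : Tendsto (fun n => ‖LInfty.chi m (hF n) • v‖ ^ (p : ℝ)) atTop
          (𝓝 (‖LInfty.chi m hU • v‖ ^ (p : ℝ))) := by
        have h2 := (h0.norm.rpow_const (p := (p : ℝ)) (Or.inr p.coe_nonneg)).const_sub
          (‖LInfty.chi m hU • v‖ ^ (p : ℝ))
        rw [norm_zero, Real.zero_rpow NNReal.coe_pos_of_fact_one_le.ne', sub_zero] at h2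
        refine h2.congr fun n => ?_
        rw [hsplit n, add_sub_cancel_right]
      refine tendsto_nhds_unique ((ENNReal.continuous_ofReal.tendsto _).comp h1)
        ((ENNReal.tendsto_nat_tsum _).congr hsum))

theorem measure_apply (hE : IsLpModule m p E) (v : E) {A : Set X} (hA : MeasurableSet A) :
    hE.measure v A = ENNReal.ofReal (‖LInfty.chi m hA • v‖ ^ (p : ℝ)) :=
  Measure.ofMeasurable_apply A hA

theorem measure_univ (hE : IsLpModule m p E) (v : E) :
    hE.measure v univ = ENNReal.ofReal (‖v‖ ^ (p : ℝ)) := by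
  rw [hE.measure_apply v MeasurableSet.univ, LInfty.chi_univ, one_smul]

theorem isFiniteMeasure (hE : IsLpModule m p E) (v : E) : IsFiniteMeasure (hE.measure v) :=
  ⟨by rw [hE.measure_univ]; exact ENNReal.ofReal_lt_top⟩

theorem measure_eq_zero_iff (hE : IsLpModule m p E) (v : E) {A : Set X} (hA : MeasurableSet A) :
    hE.measure v A = 0 ↔ LInfty.chi m hA • v = 0 := by
  rw [hE.measure_apply v hA, ENNReal.ofReal_eq_zero]
  constructor
  · intro h
    by_contra hne
    exact absurd (Real.rpow_pos_of_pos (norm_pos_iff.2 hne) (p : ℝ)) (not_lt.2 h)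
  · intro h
    rw [h, norm_zero, Real.zero_rpow NNReal.coe_pos_of_fact_one_le.ne']

theorem measure_absolutelyContinuous (hE : IsLpModule m p E) (v : E) : hE.measure v ≪ m := by
  refine Measure.AbsolutelyContinuous.mk fun A hA h => ?_
  rw [hE.measure_eq_zero_iff v hA, (LInfty.chi_eq_zero_iff hA).2 h, zero_smul]

/-- The support is the set where the density of `A ↦ ‖χ_A v‖^p` with respect to `m` does not vanish.
If `a • v = 0`, then `a` can be inverted in `L^∞` on `{|a| > 1/(n+1)}`, so the indicator of this set
kills `v` and the set is disjoint from the support. -/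
theorem exists_isSupportOf [SigmaFinite m] (hE : IsLpModule m p E) (v : E) :
    ∃ (S : Set X) (hS : MeasurableSet S), IsSupportOf m v hS := by
  have := hE.isFiniteMeasure v
  have hfm := Measure.measurable_rnDeriv (hE.measure v) m
  have hS : MeasurableSet {x | (hE.measure v).rnDeriv m x ≠ 0} :=
    (hfm (measurableSet_singleton 0)).compl
  have hchi : ∀ {A : Set X} (hA : MeasurableSet A), LInfty.chi m hA • v = 0 ↔
      ∀ᵐ x ∂m, x ∈ A → x ∉ {x | (hE.measure v).rnDeriv m x ≠ 0} := by
    intro A hA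
    rw [← hE.measure_eq_zero_iff v hA, ← Measure.withDensity_rnDeriv_eq _ _
      (hE.measure_absolutelyContinuous v), withDensity_apply _ hA, lintegral_eq_zero_iff hfm,
      Filter.EventuallyEq, ae_restrict_iff' hA]
    rw [Measure.withDensity_rnDeriv_eq _ _ (hE.measure_absolutelyContinuous v)]
    simp
  refine ⟨_, hS, fun a => ⟨fun h => ?_, fun h => ?_⟩⟩
  · have hpos : ∀ n : ℕ, ∀ᵐ x ∂m, x ∈ {x | 1 / ((n : ℝ) + 1) < |a x|} →
        x ∉ {x | (hE.measure v).rnDeriv m x ≠ 0} := by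
      intro n
      have hA : MeasurableSet {x | 1 / ((n : ℝ) + 1) < |a x|} :=
        measurableSet_lt measurable_const (Lp.stronglyMeasurable a).measurable.abs
      have hn : (0 : ℝ) < 1 / ((n : ℝ) + 1) := by positivity
      let b : LInfty m := LInfty.ofBounded
        ({x | 1 / ((n : ℝ) + 1) < |a x|}.indicator fun x => (a x)⁻¹)
        ((Lp.stronglyMeasurable a).measurable.inv.indicator hA) ⟨(1 / ((n : ℝ) + 1))⁻¹, fun x => by
          by_cases hx : x ∈ {x | 1 / ((n : ℝ) + 1) < |a x|}
          · rw [indicator_of_mem hx, abs_inv]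
            exact inv_anti₀ hn (le_of_lt hx)
          · rw [indicator_of_notMem hx, abs_zero]
            positivity⟩
      rw [← hchi hA]
      have h1 : LInfty.chi m hA = b * a := by
        refine LInfty.ext_ae ?_
        filter_upwards [LInfty.chi_mem_ae (m := m) hA, LInfty.coe_mul_ae b a,
          LInfty.ofBounded_ae (m := m) (f := {x | 1 / ((n : ℝ) + 1) < |a x|}.indicator
            fun x => (a x)⁻¹) ((Lp.stronglyMeasurable a).measurable.inv.indicator hA) _]
          with x h2 h3 h4
        rw [h3, h4]
        by_cases hx : x ∈ {x | 1 / ((n : ℝ) + 1) < |a x|}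
        · rw [h2.1 hx, indicator_of_mem hx, inv_mul_cancel₀ fun h0 => ?_]
          have : 1 / ((n : ℝ) + 1) < |a x| := hx
          rw [h0, abs_zero] at this
          exact lt_asymm this hn
        · rw [h2.2 hx, indicator_of_notMem hx, zero_mul]
      rw [h1, mul_smul, h, smul_zero]
    rw [LInfty.mul_chi_eq_zero_iff]
    filter_upwards [ae_all_iff.2 hpos] with x hx hxS
    by_contra hne
    obtain ⟨n, hn⟩ := exists_nat_one_div_lt (abs_pos.2 hne)
    exact hx n hn hxS
  · have h1 : LInfty.chi m hS.compl • v = 0 := by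
      rw [hchi]
      exact ae_of_all _ fun x hx => hx
    rw [← one_smul (LInfty m) v, ← LInfty.chi_add_compl hS, add_smul, h1, add_zero, smul_smul, h,
      zero_smul]

end IsLpModule

theorem LInfty.memLp_top_simpleFunc (φ : SimpleFunc X ℝ) : MemLp φ ∞ m :=
  memLp_top_of_bound φ.measurable.aestronglyMeasurable φ.exists_forall_norm_le.choose
    (ae_of_all _ φ.exists_forall_norm_le.choose_spec)

/-- Simple functions as elements of `L^∞(m)`. -/
def LInfty.ofSimpleFunc (m : Measure X) : SimpleFunc X ℝ →ₗ[ℝ] LInfty m where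
  toFun φ := (memLp_top_simpleFunc φ).toLp φ
  map_add' _ _ := rfl
  map_smul' _ _ := rfl

theorem LInfty.ofSimpleFunc_ae (φ : SimpleFunc X ℝ) :
    ∀ᵐ x ∂m, LInfty.ofSimpleFunc m φ x = φ x :=
  MemLp.coeFn_toLp (memLp_top_simpleFunc φ)

/-- Elements of `L^∞(m)` are bounded a.e. limits of simple functions. -/
theorem LInfty.exists_simpleFunc_tendsto (a : LInfty m) : ∃ (φ : ℕ → SimpleFunc X ℝ) (C : ℝ),
    (∀ n, ∀ᵐ x ∂m, |LInfty.ofSimpleFunc m (φ n) x| ≤ C) ∧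
      ∀ᵐ x ∂m, Tendsto (fun n => LInfty.ofSimpleFunc m (φ n) x) atTop (𝓝 (a x)) := by
  obtain ⟨C, hC0, hC⟩ := a.exists_bound
  refine ⟨(Lp.stronglyMeasurable a).approxBounded C, C, fun n => ?_, ?_⟩
  · filter_upwards [LInfty.ofSimpleFunc_ae (m := m) ((Lp.stronglyMeasurable a).approxBounded C n)]
      with x hx
    rw [hx]
    exact (Lp.stronglyMeasurable a).norm_approxBounded_le hC0 n x
  · filter_upwards [hC, ae_all_iff.2 fun n => LInfty.ofSimpleFunc_ae (m := m)
      ((Lp.stronglyMeasurable a).approxBounded C n)] with x h1 h2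
    simp only [h2]
    exact (Lp.stronglyMeasurable a).tendsto_approxBounded_of_norm_le h1

variable [NormedSpace ℝ E] [IsScalarTower ℝ (LInfty m) E]

namespace IsLpModule

/-- On the fibre `{φ = c}` multiplication by `φ` is multiplication by `c`, and the measure adds up
the fibres. So `φ ↦ φ v` is isometric from simple functions in `L^p` of the measure of `v`. -/
theorem enorm_simpleFunc_smul (hE : IsLpModule m p E) (v : E) (φ : SimpleFunc X ℝ) :
    ENNReal.ofReal (‖LInfty.ofSimpleFunc m φ • v‖ ^ (p : ℝ))
      = ∫⁻ x, ‖φ x‖ₑ ^ (p : ℝ) ∂hE.measure v := by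
  have h1 : ∀ c : ℝ, hE.measure (LInfty.ofSimpleFunc m φ • v) (φ ⁻¹' {c})
      = ‖c‖ₑ ^ (p : ℝ) * hE.measure v (φ ⁻¹' {c}) := by
    intro c
    have hc : MeasurableSet (φ ⁻¹' {c}) := φ.measurableSet_fiber c
    have h2 : LInfty.chi m hc * LInfty.ofSimpleFunc m φ = c • LInfty.chi m hc := by
      refine LInfty.ext_ae ?_
      filter_upwards [LInfty.coe_mul_ae (LInfty.chi m hc) (LInfty.ofSimpleFunc m φ),
        LInfty.coe_real_smul_ae c (LInfty.chi m hc), LInfty.chi_mem_ae (m := m) hc,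
        LInfty.ofSimpleFunc_ae (m := m) φ] with x h3 h4 h5 h6
      rw [h3, h4, h6]
      by_cases hx : x ∈ φ ⁻¹' {c}
      · rw [h5.1 hx, one_mul, mul_one]
        exact hx
      · rw [h5.2 hx, zero_mul, mul_zero]
    rw [hE.measure_apply _ hc, hE.measure_apply _ hc, smul_smul, h2, smul_assoc, norm_smul,
      Real.mul_rpow (norm_nonneg _) (norm_nonneg _), ENNReal.ofReal_mul (by positivity),
      ← ENNReal.ofReal_rpow_of_nonneg (norm_nonneg _) p.coe_nonneg, ofReal_norm]
  have h2 := φ.sum_measure_preimage_singleton (μ := hE.measure (LInfty.ofSimpleFunc m φ • v))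
    φ.range
  have h3 : (φ ⁻¹' (φ.range : Set ℝ)) = univ := by
    rw [SimpleFunc.coe_range]
    exact preimage_range _
  rw [h3, hE.measure_univ] at h2
  rw [← h2, Finset.sum_congr rfl fun c _ => h1 c]
  have h4 := SimpleFunc.lintegral_eq_lintegral (φ.map fun t => ‖t‖ₑ ^ (p : ℝ)) (hE.measure v)
  rw [SimpleFunc.map_lintegral] at h4
  exact h4.symm

/-- The closed submodule generated by one element is reflexive. -/
theorem isReflexive_closure_span_singleton [CompleteSpace E] (hE : IsLpModule m p E) (hp : 1 < p)
    (v : E) (V : Submodule (LInfty m) E)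
    (hV : (V : Set E) = closure (range fun a : LInfty m => a • v)) : IsReflexive V := by
  have := hE.isFiniteMeasure v
  have hVc : IsClosed (V : Set E) := by
    rw [hV]
    exact isClosed_closure
  have : CompleteSpace V := hVc.completeSpace_coe
  have hmem : ∀ a : LInfty m, a • v ∈ V := fun a => by
    rw [← SetLike.mem_coe, hV]
    exact subset_closure ⟨a, rfl⟩
  let T : SimpleFunc X ℝ →ₗ[ℝ] V :=
    { toFun := fun φ => ⟨LInfty.ofSimpleFunc m φ • v, hmem _⟩
      map_add' := fun φ ψ => Subtype.ext (by
        change LInfty.ofSimpleFunc m (φ + ψ) • v = _ • v + _ • v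
        rw [map_add, add_smul])
      map_smul' := fun c φ => Subtype.ext (by
        change LInfty.ofSimpleFunc m (c • φ) • v = c • _ • v
        rw [map_smul, smul_assoc]) }
  let S : SimpleFunc X ℝ →ₗ[ℝ] Lp ℝ p (hE.measure v) :=
    { toFun := fun φ => (φ.memLp_of_isFiniteMeasure p _).toLp φ
      map_add' := fun _ _ => rfl
      map_smul' := fun _ _ => rfl }
  -- By dominated convergence, multiples of `v` by simple functions are dense among all multiples.
  -- The module thus has a dense subspace isometric to a subspace of `L^p` of a finite measure.
  have hT : DenseRange T := by
    have h1 : closure (range fun a : LInfty m => a • v)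
        ⊆ closure (range fun φ : SimpleFunc X ℝ => LInfty.ofSimpleFunc m φ • v) := by
      refine closure_minimal ?_ isClosed_closure
      rintro _ ⟨a, rfl⟩
      obtain ⟨φ, C, hC, hlim⟩ := a.exists_simpleFunc_tendsto
      exact mem_closure_of_tendsto (hE.tendsto_smul hC hlim v)
        (Eventually.of_forall fun n => mem_range_self (φ n))
    intro w
    rw [closure_subtype]
    have h2 : (Subtype.val '' range T : Set E)
        = range fun φ : SimpleFunc X ℝ => LInfty.ofSimpleFunc m φ • v := by
      rw [← range_comp]
      rfl
    rw [h2]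
    exact h1 (hV ▸ w.2)
  refine (isReflexive_Lp_nnreal (m := hE.measure v) hp).of_denseRange T S hT fun φ => ?_
  have h1 := hE.enorm_simpleFunc_smul v φ
  have hp0 := NNReal.coe_pos_of_fact_one_le (p := p)
  change ‖(φ.memLp_of_isFiniteMeasure p _).toLp φ‖ = ‖LInfty.ofSimpleFunc m φ • v‖
  rw [Lp.norm_toLp, eLpNorm_eq_lintegral_rpow_enorm_toReal (by exact_mod_cast hp0.ne')
    ENNReal.coe_ne_top, ENNReal.coe_toReal, ← h1,
    ENNReal.ofReal_rpow_of_nonneg (by positivity) (by positivity), ← Real.rpow_mul (norm_nonneg _),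
    mul_one_div_cancel hp0.ne', Real.rpow_one, ENNReal.toReal_ofReal (norm_nonneg _)]

end IsLpModule

end LpModuleReflexive

/-! ## Gluing of reflexive pieces -/

section Gluing

variable {X : Type*} [MeasurableSpace X] {m : Measure X} {p : ℝ≥0}
  {E : Type*} [NormedAddCommGroup E] [Module (LInfty m) E] [NormedSpace ℝ E]
  [IsScalarTower ℝ (LInfty m) E]

namespace IsLpModule

/-- Multiplication by `a` as a bounded linear operator. -/
def smulCLM (hE : IsLpModule m p E) (a : LInfty m) : E →L[ℝ] E :=
  LinearMap.mkContinuous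
    { toFun := fun v => a • v
      map_add' := smul_add a
      map_smul' := fun c v => smul_real_comm a c v } ‖a‖ (hE.norm_smul_le_mul a)

@[simp]
theorem smulCLM_apply (hE : IsLpModule m p E) (a : LInfty m) (v : E) : hE.smulCLM a v = a • v := rfl

/-- Functionals on `L^p`-normed modules have absolutely continuous norms when `1 < p`. -/
theorem tendsto_norm_comp_chi (hE : IsLpModule m p E) (hp : 1 < p) {C : ℕ → Set X}
    (hC : ∀ n, MeasurableSet (C n)) (hmono : Monotone C) (hnull : m (⋃ n, C n)ᶜ = 0)
    (L : StrongDual ℝ E) :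
    Tendsto (fun n => ‖L.comp (hE.smulCLM (LInfty.chi m (hC n).compl))‖) atTop (𝓝 0) := by
  have hp0 : (0 : ℝ) < p := by
    have : (1 : ℝ) < p := by exact_mod_cast hp
    linarith
  set t : ℕ → ℝ := fun n => ‖L.comp (hE.smulCLM (LInfty.chi m (hC n).compl))‖ with ht
  have hbound : ∀ n v, L (LInfty.chi m (hC n).compl • v) ≤ t n * ‖v‖ := fun n v =>
    (le_abs_self _).trans ((L.comp (hE.smulCLM (LInfty.chi m (hC n).compl))).le_opNorm v)
  have hanti : Antitone t := by
    intro i j hij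
    refine ContinuousLinearMap.opNorm_le_bound _ (norm_nonneg _) fun v => ?_
    have h1 : LInfty.chi m (hC j).compl • v
        = LInfty.chi m (hC i).compl • LInfty.chi m (hC j).compl • v := by
      rw [smul_smul, mul_comm, LInfty.chi_mul_of_subset _ _ (compl_subset_compl.2 (hmono hij))]
    change ‖L (LInfty.chi m (hC j).compl • v)‖ ≤ _
    rw [h1]
    refine ((L.comp (hE.smulCLM (LInfty.chi m (hC i).compl))).le_opNorm _).trans ?_
    gcongr
    exact hE.norm_chi_smul_le _ v
  have hbdd : BddBelow (range t) := ⟨0, by rintro _ ⟨n, rfl⟩; exact norm_nonneg _⟩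
  have hlim := tendsto_atTop_ciInf hanti hbdd
  set l := ⨅ n, t n with hl
  have hl0 : 0 ≤ l := le_ciInf fun n => norm_nonneg _
  have hle : ∀ n, l ≤ t n := fun n => ciInf_le hbdd n
  have happrox : ∀ n, ∀ c < l, ∃ w : E, ‖w‖ ≤ 1 ∧ c < L (LInfty.chi m (hC n).compl • w) := by
    intro n c hc
    obtain ⟨w, hw, hw'⟩ := ContinuousLinearMap.exists_lt_apply_of_lt_opNorm
      (L.comp (hE.smulCLM (LInfty.chi m (hC n).compl))) (hc.trans_le (hle n))
    rw [ContinuousLinearMap.comp_apply, smulCLM_apply, Real.norm_eq_abs, lt_abs] at hw'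
    rcases hw' with h | h
    · exact ⟨w, hw.le, h⟩
    · exact ⟨-w, by rw [norm_neg]; exact hw.le, by rwa [smul_neg, map_neg]⟩
  -- Two vectors of norm at most `1`, one carried by `C k \ C n` and one outside `C k`, each give
  -- `L` a value above `l - δ`. Their sum has norm at most `2^(1/p)`, while `L` has norm below `l +
  -- δ` outside `C n`. As `2^(1/p) < 2` for `p > 1`, letting `δ → 0` forces `l = 0`.
  have key : ∀ δ > 0, 2 * (l - δ) ≤ (l + δ) * 2 ^ (1 / (p : ℝ)) := by
    intro δ hδ
    obtain ⟨n, hn⟩ := (hlim.eventually_lt_const (lt_add_of_pos_right l hδ)).exists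
    obtain ⟨w, hw, hw'⟩ := happrox n (l - δ) (by linarith)
    have h1 := (L.continuous.tendsto _).comp
      (hE.tendsto_chi_smul hC hmono hnull (LInfty.chi m (hC n).compl • w))
    obtain ⟨k, hk, hnk⟩ :=
      ((h1.eventually_const_lt hw').and (eventually_ge_atTop n)).exists
    obtain ⟨w', hw2, hw2'⟩ := happrox k (l - δ) (by linarith)
    set u := LInfty.chi m (hC k) • LInfty.chi m (hC n).compl • w
      + LInfty.chi m (hC k).compl • w' with hu
    have hun : LInfty.chi m (hC n).compl • u = u := by
      rw [hu, smul_add, smul_smul, smul_smul, smul_smul, mul_assoc, mul_left_comm,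
        LInfty.chi_mul_self, ← smul_smul, mul_comm (LInfty.chi m (hC n).compl),
        LInfty.chi_mul_of_subset _ _ (compl_subset_compl.2 (hmono hnk))]
    have h2 : ‖u‖ ^ (p : ℝ) ≤ 2 := by
      rw [hu, hE.norm_add_rpow]
      have h3 : ‖LInfty.chi m (hC k) • LInfty.chi m (hC n).compl • w‖ ≤ 1 :=
        (hE.norm_chi_smul_le _ _).trans ((hE.norm_chi_smul_le _ _).trans hw)
      have h4 : ‖LInfty.chi m (hC k).compl • w'‖ ≤ 1 := (hE.norm_chi_smul_le _ _).trans hw2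
      have h5 := Real.rpow_le_one (norm_nonneg _) h3 hp0.le
      have h6 := Real.rpow_le_one (norm_nonneg _) h4 hp0.le
      linarith
    have h3 : ‖u‖ ≤ 2 ^ (1 / (p : ℝ)) := by
      have := Real.rpow_le_rpow (by positivity) h2 (z := 1 / (p : ℝ)) (by positivity)
      rwa [← Real.rpow_mul (norm_nonneg _), mul_one_div_cancel hp0.ne', Real.rpow_one] at this
    have h4 := hbound n u
    rw [hun] at h4
    have h5 : 2 * (l - δ) ≤ L u := by
      rw [hu, map_add]
      simp only [Function.comp_apply] at hk
      linarith
    calc 2 * (l - δ) ≤ t n * ‖u‖ := h5.trans h4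
      _ ≤ (l + δ) * 2 ^ (1 / (p : ℝ)) := by gcongr
  have hfin : 2 * l ≤ l * 2 ^ (1 / (p : ℝ)) := by
    have h1 : Tendsto (fun δ : ℝ => 2 * (l - δ)) (𝓝[>] 0) (𝓝 (2 * (l - 0))) :=
      ((continuous_const.mul (continuous_const.sub continuous_id)).tendsto 0).mono_left
        nhdsWithin_le_nhds
    have h2 : Tendsto (fun δ : ℝ => (l + δ) * 2 ^ (1 / (p : ℝ))) (𝓝[>] 0)
        (𝓝 ((l + 0) * 2 ^ (1 / (p : ℝ)))) :=
      (((continuous_const.add continuous_id).mul continuous_const).tendsto 0).mono_left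
        nhdsWithin_le_nhds
    have h3 := le_of_tendsto_of_tendsto h1 h2 (by
      filter_upwards [self_mem_nhdsWithin] with δ hδ using key δ hδ)
    simpa using h3
  have h2 : (2 : ℝ) ^ (1 / (p : ℝ)) < 2 := by
    conv_rhs => rw [← Real.rpow_one 2]
    refine Real.rpow_lt_rpow_of_exponent_lt one_lt_two ?_
    rw [div_lt_one hp0]
    exact_mod_cast hp
  have : l = 0 := by nlinarith
  rwa [this] at hlim

/-- An `L^p`-normed module, `1 < p`, is reflexive if its restrictions to the members of an
exhaustion are. -/
theorem isReflexive_of_exhaustion [CompleteSpace E] (hE : IsLpModule m p E) (hp : 1 < p)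
    {C : ℕ → Set X} (hC : ∀ n, MeasurableSet (C n)) (hmono : Monotone C)
    (hnull : m (⋃ n, C n)ᶜ = 0) (V : ℕ → Submodule (LInfty m) E)
    (hV : ∀ n v, v ∈ V n ↔ LInfty.chi m (hC n) • v = v) (hr : ∀ n, IsReflexive (V n)) :
    IsReflexive E := by
  have hp0 : (0 : ℝ) < p := by
    have : (1 : ℝ) < p := by exact_mod_cast hp
    linarith
  refine isReflexive_of_exists fun ξ => ?_
  let χ : ℕ → E →L[ℝ] E := fun n => hE.smulCLM (LInfty.chi m (hC n))
  have hχ : ∀ n v, χ n v = LInfty.chi m (hC n) • v := fun _ _ => rfl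
  have hχn : ∀ n v, ‖χ n v‖ ≤ ‖v‖ := fun n v => hE.norm_chi_smul_le _ v
  -- The functional `L ↦ ξ (L ∘ χ_n)` comes from the bidual of the reflexive piece `V n`, hence from
  -- a point `x n`.
  have hex : ∀ n, ∃ x : E, ∀ L : StrongDual ℝ E, ξ (L.comp (χ n)) = L x := by
    intro n
    let ι : V n →L[ℝ] E :=
      LinearMap.mkContinuous
        { toFun := fun v => (v : E)
          map_add' := fun _ _ => rfl
          map_smul' := fun _ _ => rfl } 1 fun v => by rw [one_mul]; rfl
    let P : E →L[ℝ] V n :=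
      LinearMap.mkContinuous
        { toFun := fun v => (⟨χ n v, (hV n _).2 (by
            rw [hχ, smul_smul, LInfty.chi_mul_self])⟩ : V n)
          map_add' := fun v w => Subtype.ext (map_add (χ n) v w)
          map_smul' := fun c v => Subtype.ext (map_smul (χ n) c v) } 1 fun v => by
            rw [one_mul]
            exact hχn n v
    obtain ⟨x, hx⟩ := (hr n).exists_eq
      (ξ.comp ((ContinuousLinearMap.compL ℝ E (V n) ℝ).flip P))
    exact ⟨x, fun L => hx (L.comp ι)⟩
  choose x hx using hex
  have hxn : ∀ n, ‖x n‖ ≤ ‖ξ‖ := by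
    intro n
    obtain ⟨L, hL, hLx⟩ := exists_dual_vector'' ℝ (x n)
    have h1 : ‖L.comp (χ n)‖ ≤ 1 := ContinuousLinearMap.opNorm_le_bound _ zero_le_one fun v =>
      (L.le_opNorm _).trans (mul_le_mul hL (hχn n v) (norm_nonneg _) zero_le_one)
    have h2 : ‖x n‖ = ξ (L.comp (χ n)) := by
      rw [hx, hLx]
      rfl
    rw [h2]
    exact (le_abs_self _).trans ((ξ.le_opNorm _).trans
      (mul_le_of_le_one_right (norm_nonneg _) h1))
  have hcons : ∀ i j, i ≤ j → χ i (x j) = x i := by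
    intro i j hij
    refine SeparatingDual.eq_iff_forall_dual_eq (R := ℝ) |>.2 fun L => ?_
    have h1 : (L.comp (χ i)).comp (χ j) = L.comp (χ i) := by
      ext v
      simp only [ContinuousLinearMap.comp_apply, hχ]
      rw [smul_smul, LInfty.chi_mul_of_subset _ _ (hmono hij)]
    rw [← hx i, ← h1, hx j]
    rfl
  -- Since `x i` is the restriction of `x j` to `C i`, the `p`-th powers of the norms of `x i` and
  -- of the increment add up. A bounded sequence with this property is Cauchy.
  have hpyth : ∀ i j, i ≤ j → ‖x j‖ ^ (p : ℝ) = ‖x i‖ ^ (p : ℝ) + ‖x j - x i‖ ^ (p : ℝ) := by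
    intro i j hij
    have h1 : LInfty.chi m (hC i).compl • x j = x j - x i := by
      rw [eq_sub_iff_add_eq, ← hcons i j hij, hχ, ← add_smul, add_comm, LInfty.chi_add_compl,
        one_smul]
    rw [hE.norm_rpow (hC i) (x j), h1, ← hχ, hcons i j hij]
  have hmonox : Monotone fun n => ‖x n‖ ^ (p : ℝ) := fun i j hij => by
    change ‖x i‖ ^ (p : ℝ) ≤ ‖x j‖ ^ (p : ℝ)
    rw [hpyth i j hij]
    exact le_add_of_nonneg_right (by positivity)
  have hbddx : BddAbove (range fun n => ‖x n‖ ^ (p : ℝ)) := ⟨‖ξ‖ ^ (p : ℝ), by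
    rintro _ ⟨n, rfl⟩
    exact Real.rpow_le_rpow (norm_nonneg _) (hxn n) hp0.le⟩
  have hlimx := tendsto_atTop_ciSup hmonox hbddx
  set s := ⨆ n, ‖x n‖ ^ (p : ℝ)
  have hcau : CauchySeq x := by
    rw [Metric.cauchySeq_iff']
    intro ε hε
    obtain ⟨N, hN⟩ := (hlimx.eventually_const_lt
      (sub_lt_self s (Real.rpow_pos_of_pos hε (p : ℝ)))).exists
    refine ⟨N, fun n hn => ?_⟩
    rw [dist_eq_norm]
    have h1 := hpyth N n hn
    have h2 : ‖x n‖ ^ (p : ℝ) ≤ s := le_ciSup hbddx n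
    exact (Real.rpow_lt_rpow_iff (norm_nonneg _) hε.le hp0).1 (by linarith)
  obtain ⟨y, hy⟩ := cauchySeq_tendsto_of_complete hcau
  refine ⟨y, fun L => ?_⟩
  -- Norm convergence in the dual is needed here, since `ξ` is only norm continuous.
  have h1 : Tendsto (fun n => L.comp (χ n)) atTop (𝓝 L) := by
    rw [tendsto_iff_norm_sub_tendsto_zero]
    refine (hE.tendsto_norm_comp_chi hp hC hmono hnull L).congr fun n => ?_
    rw [← norm_neg]
    congr 1
    ext v
    have : LInfty.chi m (hC n).compl • v = v - LInfty.chi m (hC n) • v := by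
      rw [eq_sub_iff_add_eq, ← add_smul, add_comm, LInfty.chi_add_compl, one_smul]
    simp only [neg_apply, sub_apply, ContinuousLinearMap.comp_apply, smulCLM_apply, hχ, this, map_sub]
    ring
  refine tendsto_nhds_unique ((ξ.continuous.tendsto L).comp h1) ?_
  refine ((L.continuous.tendsto y).comp hy).congr fun n => ?_
  exact (hx n L).symm

end IsLpModule

end Gluing

/-! ## Linear algebra over rings that are fields -/

section IsFieldLinearAlgebra

variable {K : Type*} [CommRing K] {V : Type*} [AddCommGroup V] [Module K V]

/-- `IsField` is a hypothesis and the field structure is created only inside the proofs, so that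
localized modules keep the ring structure of the localization. -/
theorem IsField.le_rank_iff (hK : IsField K) {n : ℕ} : (n : Cardinal) ≤ Module.rank K V ↔
    ∃ v : Fin n → V, LinearIndependent K v := by
  let _ := hK.toField
  constructor
  · intro h
    obtain ⟨s, hs, hli⟩ := le_rank_iff_exists_linearIndependent_finset.1 h
    exact ⟨fun i => (s.equivFinOfCardEq hs).symm i, hli.comp _ (Equiv.injective _)⟩
  · rintro ⟨v, hv⟩
    simpa using hv.cardinal_lift_le_rank

theorem IsField.exists_notMem_span (hK : IsField K) {ι : Type*} [Fintype ι] (v : ι → V)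
    (h : (Fintype.card ι : ℕ∞) < Cardinal.toENat (Module.rank K V)) :
    ∃ x, x ∉ Submodule.span K (range v) := by
  let _ := hK.toField
  by_contra! hcon
  refine absurd h (not_lt.2 ?_)
  rw [Cardinal.toENat_le_natCast, ← rank_top, ← Submodule.eq_top_iff'.2 hcon]
  have h1 := finrank_range_le_card (R := K) v
  have : Module.Finite K (Submodule.span K (range v)) :=
    Module.Finite.span_of_finite K (finite_range v)
  rw [← Module.finrank_eq_rank]
  exact_mod_cast h1

theorem IsField.linearIndependent_option (hK : IsField K) {ι : Type*} {v : ι → V} {x : V}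
    (hv : LinearIndependent K v) (hx : x ∉ Submodule.span K (range v)) :
    LinearIndependent K (fun o : Option ι => Option.casesOn' o x v) := by
  let _ := hK.toField
  exact hv.option hx

theorem IsField.rank_add_rank (hK : IsField K) {N Q : Type*} [AddCommGroup N] [Module K N]
    [AddCommGroup Q] [Module K Q] (ι : N →ₗ[K] V) (π : V →ₗ[K] Q) (hι : Function.Injective ι)
    (hπ : Function.Surjective π) (hex : Function.Exact ι π) :
    Cardinal.toENat (Module.rank K N) + Cardinal.toENat (Module.rank K Q)
      = Cardinal.toENat (Module.rank K V) := by
  let _ := hK.toField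
  have h1 := π.lift_rank_range_add_rank_ker
  have h2 := (LinearEquiv.ofInjective ι hι).lift_rank_eq
  have h3 : LinearMap.range ι = LinearMap.ker π := (LinearMap.exact_iff.1 hex).symm
  rw [h3] at h2
  rw [LinearMap.range_eq_top.2 hπ] at h1
  rw [← Cardinal.toENat_lift (c := Module.rank K N), h2, Cardinal.toENat_lift,
    ← Cardinal.toENat_lift (c := Module.rank K V), ← h1, map_add, Cardinal.toENat_lift,
    Cardinal.toENat_lift, rank_top, add_comm]

end IsFieldLinearAlgebra

/-! ## Independence at minimal primes -/

section Stalk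

variable {X : Type*} [MeasurableSpace X] {m : Measure X} {E : Type*} [AddCommGroup E]
  [Module (LInfty m) E]

/-- The family `w` is linearly independent at the prime `P`. -/
def IndependentAt (P : Ideal (LInfty m)) {ι : Type*} [Fintype ι] (w : ι → E) : Prop :=
  ∀ a : ι → LInfty m, ∑ i, a i • w i = 0 → ∀ i, a i ∈ P

variable (E) in
/-- The dimension of the stalk of `E` at the prime `P`. -/
def stalkRank (P : Ideal (LInfty m)) [P.IsPrime] : ℕ∞ :=
  Cardinal.toENat (Module.rank (Localization.AtPrime P) (LocalizedModule P.primeCompl E))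

variable {P : Ideal (LInfty m)} [hPp : P.IsPrime]

/-- Clearing denominators turns a relation in the stalk into a relation in `E` after multiplication
by some `t ∉ P`. Its coefficients lie in `P`, and elements of `P` vanish in the localization because
`P` is minimal. -/
theorem independentAt_iff (hP : P ∈ minimalPrimes (LInfty m)) {ι : Type*} [Fintype ι] (w : ι → E) :
    IndependentAt P w ↔ LinearIndependent (Localization.AtPrime P)
      (fun i => LocalizedModule.mk (w i) (1 : P.primeCompl)) := by
  have hsum : ∀ a : ι → LInfty m, ∑ i, algebraMap (LInfty m) (Localization.AtPrime P) (a i) •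
      LocalizedModule.mk (w i) (1 : P.primeCompl)
      = LocalizedModule.mk (∑ i, a i • w i) (1 : P.primeCompl) := by
    intro a
    rw [← LocalizedModule.mkLinearMap_apply, map_sum]
    refine Finset.sum_congr rfl fun i _ => ?_
    rw [map_smul, algebraMap_smul]
    rfl
  rw [Fintype.linearIndependent_iff]
  constructor
  · intro h g hg i
    obtain ⟨b, hb⟩ := IsLocalization.exist_integer_multiples_of_finite P.primeCompl g
    choose a ha using hb
    have h1 : LocalizedModule.mk (∑ i, a i • w i) (1 : P.primeCompl) = 0 := by
      rw [← hsum]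
      simp only [ha, smul_assoc]
      rw [← Finset.smul_sum, hg, smul_zero]
    rw [← LocalizedModule.mkLinearMap_apply, ← IsLocalizedModule.mk'_one P.primeCompl,
      IsLocalizedModule.mk'_eq_zero'] at h1
    obtain ⟨t, ht⟩ := h1
    have h2 : ∑ i, ((t : LInfty m) * a i) • w i = 0 := by
      simp only [mul_smul]
      rw [← Finset.smul_sum]
      exact ht
    obtain ⟨s, hs, hs0⟩ := LInfty.exists_notMem_mul_eq_zero hP
      ((hPp.mem_or_mem (h _ h2 i)).resolve_left t.2)
    have h3 : algebraMap (LInfty m) (Localization.AtPrime P) (a i) = 0 :=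
      (IsLocalization.map_eq_zero_iff P.primeCompl _ _).2 ⟨⟨s, hs⟩, hs0⟩
    rw [ha, Algebra.smul_def] at h3
    exact ((IsLocalization.map_units (Localization.AtPrime P) b).mul_right_eq_zero).1 h3
  · intro h a ha i
    have h1 := h (fun i => algebraMap (LInfty m) (Localization.AtPrime P) (a i))
      (by rw [hsum, ha, LocalizedModule.zero_mk]) i
    obtain ⟨s, hs⟩ := (IsLocalization.map_eq_zero_iff P.primeCompl _ _).1 h1
    exact (hPp.mem_or_mem (hs ▸ P.zero_mem : (s : LInfty m) * a i ∈ P)).resolve_left s.2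

theorem natCast_le_stalkRank_iff (hP : P ∈ minimalPrimes (LInfty m)) {n : ℕ} :
    (n : ℕ∞) ≤ stalkRank E P ↔ ∃ w : Fin n → E, IndependentAt P w := by
  rw [stalkRank, Cardinal.natCast_le_toENat, (LInfty.isField_localization hP).le_rank_iff]
  constructor
  · rintro ⟨v, hv⟩
    have h : ∀ i, ∃ (e : E) (s : P.primeCompl), v i = LocalizedModule.mk e s := fun i => by
      induction v i using LocalizedModule.induction_on with
      | h e s => exact ⟨e, s, rfl⟩
    choose e s hes using h
    refine ⟨e, (independentAt_iff hP e).2 ?_⟩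
    -- Denominators are units in the localization, so replacing stalk vectors by their numerators
    -- keeps them independent.
    let u : Fin n → (Localization.AtPrime P)ˣ := fun i =>
      (IsLocalization.map_units (Localization.AtPrime P) (s i)).unit
    have hu : (fun i => LocalizedModule.mk (e i) (1 : P.primeCompl)) = u • v := by
      funext i
      change _ = algebraMap (LInfty m) (Localization.AtPrime P) (s i) • v i
      rw [algebraMap_smul, hes, LocalizedModule.smul'_mk]
      exact (LocalizedModule.mk_cancel (s i) (e i)).symm
    rw [hu]
    exact hv.units_smul u
  · rintro ⟨w, hw⟩
    exact ⟨_, (independentAt_iff hP w).1 hw⟩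

theorem IndependentAt.card_le (hP : P ∈ minimalPrimes (LInfty m)) {ι : Type*} [Fintype ι]
    {w : ι → E} (hw : IndependentAt P w) : (Fintype.card ι : ℕ∞) ≤ stalkRank E P := by
  refine (natCast_le_stalkRank_iff hP).2 ⟨w ∘ (Fintype.equivFin ι).symm, fun a ha i => ?_⟩
  have := hw (a ∘ Fintype.equivFin ι) (by
    rw [← ha, ← (Fintype.equivFin ι).sum_comp]
    simp) ((Fintype.equivFin ι).symm i)
  simpa using this

theorem IndependentAt.exists_option (hP : P ∈ minimalPrimes (LInfty m)) {ι : Type*} [Fintype ι]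
    {w : ι → E} (hw : IndependentAt P w) (h : (Fintype.card ι : ℕ∞) < stalkRank E P) :
    ∃ e : E, IndependentAt P (fun o : Option ι => Option.casesOn' o e w) := by
  have hK := LInfty.isField_localization hP
  rw [independentAt_iff hP] at hw
  obtain ⟨x, hx⟩ := hK.exists_notMem_span
    (fun i => LocalizedModule.mk (w i) (1 : P.primeCompl)) h
  induction x using LocalizedModule.induction_on with
  | h e s =>
    refine ⟨e, (independentAt_iff hP _).2 ?_⟩
    have hfun : (fun o : Option ι => LocalizedModule.mk (Option.casesOn' o e w) (1 : P.primeCompl))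
        = fun o : Option ι => Option.casesOn' o (LocalizedModule.mk e (1 : P.primeCompl))
          fun i => LocalizedModule.mk (w i) (1 : P.primeCompl) := by
      funext o
      cases o <;> rfl
    rw [hfun]
    refine hK.linearIndependent_option hw fun he => hx ?_
    have h1 : LocalizedModule.mk e (1 : P.primeCompl)
        = algebraMap (LInfty m) (Localization.AtPrime P) s • LocalizedModule.mk e s := by
      rw [algebraMap_smul, LocalizedModule.smul'_mk]
      exact (LocalizedModule.mk_cancel s e).symm
    rw [h1] at he
    exact (Submodule.smul_mem_iff_of_isUnit _
      (IsLocalization.map_units (Localization.AtPrime P) s)).1 he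

theorem stalkRank_eq_zero_iff (hP : P ∈ minimalPrimes (LInfty m)) :
    stalkRank E P = 0 ↔ ∀ v : E, ∃ a ∉ P, a • v = 0 := by
  have h := natCast_le_stalkRank_iff (E := E) hP (n := 1)
  rw [Nat.cast_one, Order.one_le_iff_pos, pos_iff_ne_zero] at h
  rw [← not_iff_not, ← ne_eq, h]
  push Not
  constructor
  · rintro ⟨w, hw⟩
    refine ⟨w 0, fun a ha h0 => ha ?_⟩
    exact hw (fun _ => a) (by simpa using h0) 0
  · rintro ⟨v, hv⟩
    refine ⟨fun _ => v, fun a ha i => ?_⟩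
    rw [Subsingleton.elim i 0]
    by_contra hne
    exact hv _ hne (by simpa using ha)

/-- Localization preserves short exact sequences, and over the field at `P` ranks add. -/
theorem stalkRank_add (hP : P ∈ minimalPrimes (LInfty m)) {N Q : Type*} [AddCommGroup N]
    [Module (LInfty m) N] [AddCommGroup Q] [Module (LInfty m) Q] (ι : N →ₗ[LInfty m] E)
    (π : E →ₗ[LInfty m] Q) (hι : Function.Injective ι) (hπ : Function.Surjective π)
    (hex : Function.Exact ι π) : stalkRank N P + stalkRank Q P = stalkRank E P := by
  refine (LInfty.isField_localization hP).rank_add_rank (LocalizedModule.map P.primeCompl ι)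
    (LocalizedModule.map P.primeCompl π) ?_ ?_ ?_
  · exact IsLocalizedModule.map_injective P.primeCompl (LocalizedModule.mkLinearMap P.primeCompl N)
      (LocalizedModule.mkLinearMap P.primeCompl E) ι hι
  · exact IsLocalizedModule.map_surjective P.primeCompl
      (LocalizedModule.mkLinearMap P.primeCompl E) (LocalizedModule.mkLinearMap P.primeCompl Q) π hπ
  · exact LocalizedModule.map_exact P.primeCompl ι π hex

end Stalk

/-! ## Local independence and stalks -/

section LocalIndependence

variable {X : Type*} [MeasurableSpace X] {m : Measure X} {E : Type*} [AddCommGroup E]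
  [Module (LInfty m) E]

theorem LInfty.chi_union_mul_eq_zero_iff {A B : Set X} (hA : MeasurableSet A)
    (hB : MeasurableSet B) (a : LInfty m) :
    LInfty.chi m (hA.union hB) * a = 0 ↔ LInfty.chi m hA * a = 0 ∧ LInfty.chi m hB * a = 0 := by
  rw [mul_comm, mul_comm _ a, mul_comm _ a, LInfty.mul_chi_eq_zero_iff, LInfty.mul_chi_eq_zero_iff,
    LInfty.mul_chi_eq_zero_iff, ← eventually_and]
  refine eventually_congr (Eventually.of_forall fun x => ?_)
  simp only [mem_union]
  tauto

/-- The family `w` is linearly independent on the measurable set `A`. -/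
def FamilyIndependentOn {A : Set X} (hA : MeasurableSet A) {ι : Type*} [Fintype ι] (w : ι → E) :
    Prop :=
  ∀ a : ι → LInfty m, LInfty.chi m hA • ∑ i, a i • w i = 0 → ∀ i, LInfty.chi m hA * a i = 0

namespace FamilyIndependentOn

variable {A B : Set X} {hA : MeasurableSet A} {hB : MeasurableSet B} {ι : Type*} [Fintype ι]
  {w : ι → E}

theorem independentAt (h : FamilyIndependentOn (m := m) hA w) {P : Ideal (LInfty m)}
    [hP : P.IsPrime] (hAP : LInfty.chi m hA ∉ P) : IndependentAt P w := fun a ha i =>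
  (hP.mem_or_mem (by rw [h a (by rw [ha, smul_zero]) i]; exact P.zero_mem)).resolve_left hAP

theorem mono (h : FamilyIndependentOn (m := m) hA w) (hBA : B ⊆ A) :
    FamilyIndependentOn (m := m) hB w := by
  intro a ha i
  have h1 := h (fun i => LInfty.chi m hB * a i) (by
    simp only [mul_smul]
    rw [← Finset.smul_sum, ha, smul_zero]) i
  rwa [← mul_assoc, mul_comm (LInfty.chi m hA), LInfty.chi_mul_of_subset _ _ hBA] at h1

theorem congr {w' : ι → E} (h : FamilyIndependentOn (m := m) hA w)
    (hw : ∀ i, LInfty.chi m hA • w i = LInfty.chi m hA • w' i) :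
    FamilyIndependentOn (m := m) hA w' := by
  intro a ha
  refine h a ?_
  rw [← ha, Finset.smul_sum, Finset.smul_sum]
  refine Finset.sum_congr rfl fun i _ => ?_
  rw [smul_comm, hw, smul_comm]

theorem union (h : FamilyIndependentOn (m := m) hA w) (h' : FamilyIndependentOn (m := m) hB w) :
    FamilyIndependentOn (m := m) (hA.union hB) w := by
  intro a ha i
  rw [LInfty.chi_union_mul_eq_zero_iff hA hB]
  refine ⟨h a ?_ i, h' a ?_ i⟩
  · rw [← LInfty.chi_mul_of_subset hA (hA.union hB) subset_union_left, mul_smul, ha, smul_zero]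
  · rw [← LInfty.chi_mul_of_subset hB (hA.union hB) subset_union_right, mul_smul, ha, smul_zero]

theorem injective (h : FamilyIndependentOn (m := m) hA w) (hm : m A ≠ 0) :
    Function.Injective fun i => LInfty.chi m hA • w i := by
  classical
  intro i j hij
  by_contra hne
  have h1 := h (fun k => if k = i then 1 else if k = j then -1 else 0) (by
    rw [Finset.smul_sum, Finset.sum_eq_add i j hne]
    · have hji : j ≠ i := fun h => hne h.symm
      simp only [if_true, if_neg hji, one_smul, neg_smul, smul_neg]
      exact add_neg_eq_zero.2 hij
    · rintro k - ⟨h1, h2⟩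
      simp [h1, h2]
    · simp
    · simp) i
  rw [if_pos rfl, mul_one, LInfty.chi_eq_zero_iff] at h1
  exact hm h1

/-- An independent set on `A` must consist of elements supported in `A`, hence the multiplication by
`χ_A`. If `A` is null, every coefficient vanishes on `A` and there is nothing to show. -/
theorem isIndependentSetOn (h : FamilyIndependentOn (m := m) hA w) :
    IsIndependentSetOn m hA (range fun i => LInfty.chi m hA • w i) := by
  classical
  refine ⟨?_, fun I hI a ha v hv => ?_⟩
  · rintro _ ⟨i, rfl⟩
    rw [smul_smul, LInfty.chi_mul_self]
  by_cases hm : m A = 0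
  · rw [(LInfty.chi_eq_zero_iff hA).2 hm, zero_mul]
  set w' : ι → E := fun i => LInfty.chi m hA • w i with hw'
  have hinj : Function.Injective w' := h.injective hm
  have hfam : FamilyIndependentOn (m := m) hA w' := h.congr fun i => by
    rw [hw', smul_smul, LInfty.chi_mul_self]
  obtain ⟨i, rfl⟩ := hI hv
  have h1 := hfam (fun i => if w' i ∈ I then a (w' i) else 0) (by
    rw [← ha]
    congr 1
    have h2 : I = (Finset.univ.filter fun i => w' i ∈ I).image w' := by
      ext v
      simp only [Finset.mem_image, Finset.mem_filter, Finset.mem_univ, true_and]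
      constructor
      · intro hv
        obtain ⟨j, rfl⟩ := hI hv
        exact ⟨j, hv, rfl⟩
      · rintro ⟨j, hj, rfl⟩
        exact hj
    conv_rhs => rw [h2]
    rw [Finset.sum_image fun _ _ _ _ h => hinj h, Finset.sum_filter]
    refine Finset.sum_congr rfl fun j _ => ?_
    split_ifs <;> simp) i
  rwa [if_pos hv] at h1

end FamilyIndependentOn

variable {A : Set X} {hA : MeasurableSet A}

theorem IsIndependentSetOn.family {S : Set E} (h : IsIndependentSetOn m hA S) (I : Finset E)
    (hI : (I : Set E) ⊆ S) : FamilyIndependentOn (m := m) hA fun v : I => (v : E) := by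
  classical
  intro a ha i
  have h1 := h.2 I hI (fun v => if hv : v ∈ I then a ⟨v, hv⟩ else 0) (by
    rw [← ha]
    congr 1
    rw [← Finset.sum_coe_sort]
    exact Finset.sum_congr rfl fun j _ => by rw [dif_pos j.2]) i i.2
  rwa [dif_pos i.2] at h1

theorem isIndependentSetOn_empty : IsIndependentSetOn m hA (∅ : Set E) :=
  ⟨fun _ h => absurd h (notMem_empty _), fun _ hI _ _ _ hv => absurd (hI hv) (notMem_empty _)⟩

/-- Zorn's lemma applies because each relation involves finitely many elements, all of which lie in
one member of a chain. -/
theorem IsIndependentSetOn.exists_maximal {S : Set E} (h : IsIndependentSetOn m hA S) :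
    ∃ T, S ⊆ T ∧ Maximal (IsIndependentSetOn m hA) T := by
  refine zorn_subset_nonempty {T : Set E | IsIndependentSetOn m hA T} (fun c hc hchain hne => ?_) S h
  refine ⟨⋃₀ c, ⟨?_, fun I hI => ?_⟩, fun T hT => subset_sUnion_of_mem hT⟩
  · rintro v ⟨T, hT, hv⟩
    exact (hc hT).1 v hv
  · obtain ⟨T, hT, hIT⟩ := hchain.directedOn.exists_mem_subset_of_finset_subset_biUnion
      (f := id) hne (s := I)
      (by rw [sUnion_eq_biUnion] at hI; exact hI)
    exact (hc hT).2 I hIT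

end LocalIndependence

/-! ### From independence at a prime to independence on a set; local dimension as stalk rank -/

section LocalDim

variable {X : Type*} [MeasurableSpace X] {m : Measure X} [SigmaFinite m] {p : ℝ≥0} {E : Type*}
  [NormedAddCommGroup E] [Module (LInfty m) E]

/-- Independence at a minimal prime spreads out. -/
theorem IndependentAt.exists_familyIndependentOn (hE : IsLpModule m p E) {P : Ideal (LInfty m)}
    (hP : P ∈ minimalPrimes (LInfty m)) {ι : Type*} [Fintype ι] {w : ι → E}
    (hw : IndependentAt P w) :
    ∃ (C : Set X) (hC : MeasurableSet C), LInfty.chi m hC ∉ P ∧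
      FamilyIndependentOn (m := m) hC w := by
  classical
  have := hE.continuousConstSMul
  have hPp : P.IsPrime := hP.1.1
  let T : (ι → LInfty m) →ₗ[LInfty m] E :=
    { toFun := fun a => ∑ i, a i • w i
      map_add' := fun a b => by
        simp only [Pi.add_apply, add_smul, Finset.sum_add_distrib]
      map_smul' := fun c a => by
        simp only [Pi.smul_apply, smul_assoc, Finset.smul_sum, RingHom.id_apply] }
  have hT : Continuous T := by
    refine continuous_finsetSum _ fun i _ => ?_
    refine AddMonoidHomClass.continuous_of_bound
      (⟨⟨fun a : LInfty m => a • w i, zero_smul _ _⟩, fun a b => add_smul a b _⟩ : LInfty m →+ E)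
      ‖w i‖ (fun a => ?_) |>.comp (continuous_apply i)
    rw [mul_comm]
    exact hE.norm_smul_le_mul a (w i)
  have hTc : IsClosed (LinearMap.ker T : Set (ι → LInfty m)) := isClosed_singleton.preimage hT
  have : CompleteSpace (LinearMap.ker T) := hTc.completeSpace_coe
  have hsm : ∀ a : LInfty m, Continuous fun v : LinearMap.ker T => a • v := fun a => by
    have h1 : ∀ b : LInfty m, ‖a * b‖ ≤ ‖a‖ * ‖b‖ := fun b => by
      refine LInfty.norm_le_of_ae (by positivity) ?_
      filter_upwards [LInfty.coe_mul_ae a b, a.abs_le_norm_ae, b.abs_le_norm_ae] with x h1 h2 h3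
      rw [h1, abs_mul]
      gcongr
    have h2 : Continuous fun b : LInfty m => a * b :=
      AddMonoidHomClass.continuous_of_bound (AddMonoidHom.mulLeft a) ‖a‖ h1
    refine Continuous.subtype_mk (continuous_pi fun i => ?_) _
    exact h2.comp ((continuous_apply i).comp continuous_subtype_val)
  have hsupp : ∀ v : LinearMap.ker T, ∃ (S : Set X) (hS : MeasurableSet S),
      IsSupportOf m v hS := by
    intro v
    refine ⟨⋃ i, {x | v.1 i x ≠ 0}, MeasurableSet.iUnion fun i => (v.1 i).measurableSet_ne_zero,
      fun a => ?_⟩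
    rw [LInfty.mul_chi_eq_zero_iff, ← Subtype.coe_inj]
    change a • (v : ι → LInfty m) = 0 ↔ _
    rw [funext_iff]
    have h1 : ∀ i, (a • (v : ι → LInfty m)) i = (0 : ι → LInfty m) i ↔
        ∀ᵐ x ∂m, v.1 i x ≠ 0 → a x = 0 := fun i => by
      rw [Pi.smul_apply, smul_eq_mul, Pi.zero_apply, LInfty.mul_eq_zero_iff_chi,
        LInfty.mul_chi_eq_zero_iff]
      rfl
    rw [forall_congr' h1, ← ae_all_iff]
    refine eventually_congr (Eventually.of_forall fun x => ?_)
    simp only [mem_iUnion, mem_ofPred_eq, forall_exists_index]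
  -- The relations between the `w i` form a complete module, so there is a relation `a₀` of largest
  -- support: whatever kills `a₀` kills every relation.
  obtain ⟨a₀, ha₀⟩ := exists_full_support (m := m) hsm hsupp
  have h1 : ∀ i, ∃ s ∉ P, s * a₀.1 i = 0 := fun i =>
    LInfty.exists_notMem_mul_eq_zero hP (hw a₀.1 a₀.2 i)
  choose s hs hs0 using h1
  -- Each coefficient of `a₀` lies in `P` and is killed by some `s i ∉ P`. The product `t` is
  -- outside `P` and kills `a₀`, so no nonzero relation lives on `{t ≠ 0}`.
  set t := ∏ i, s i with ht
  have htP : t ∉ P := fun h => by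
    obtain ⟨i, -, hi⟩ := (Ideal.IsPrime.prod_mem_iff (p := P)).1 h
    exact hs i hi
  refine ⟨{x | t x ≠ 0}, t.measurableSet_ne_zero, fun h => htP ?_, fun a ha => ?_⟩
  · rw [← LInfty.mul_chi_support t]
    exact P.mul_mem_left _ h
  · have h2 : LInfty.chi m t.measurableSet_ne_zero • a₀ = 0 := by
      refine Subtype.ext (funext fun i => ?_)
      change LInfty.chi m t.measurableSet_ne_zero * a₀.1 i = 0
      have h3 : t * a₀.1 i = 0 := by
        rw [ht, ← Finset.prod_erase_mul _ _ (Finset.mem_univ i), mul_assoc, hs0, mul_zero]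
      rw [mul_comm, LInfty.mul_chi_eq_zero_iff]
      rw [mul_comm, LInfty.mul_eq_zero_iff_chi, LInfty.mul_chi_eq_zero_iff] at h3
      exact h3
    have h3 : (fun i => LInfty.chi m t.measurableSet_ne_zero * a i) ∈ LinearMap.ker T := by
      rw [LinearMap.mem_ker]
      change ∑ i, (LInfty.chi m t.measurableSet_ne_zero * a i) • w i = 0
      simp only [mul_smul]
      rw [← Finset.smul_sum, ha]
    intro i
    have h4 := congrFun (congrArg Subtype.val (ha₀ _ h2 ⟨_, h3⟩)) i
    change LInfty.chi m t.measurableSet_ne_zero * (LInfty.chi m t.measurableSet_ne_zero * a i) = 0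
      at h4
    rwa [← mul_assoc, LInfty.chi_mul_self] at h4

/-- Independent families which are smaller than the stalks can be enlarged. -/
theorem FamilyIndependentOn.exists_option (hE : IsLpModule m p E) {B : Set X}
    {hB : MeasurableSet B} {ι : Type*} [Fintype ι] {w : ι → E}
    (hw : FamilyIndependentOn (m := m) hB w)
    (hlt : ∀ (P : Ideal (LInfty m)) [P.IsPrime], P ∈ minimalPrimes (LInfty m) →
      LInfty.chi m hB ∉ P → (Fintype.card ι : ℕ∞) < stalkRank E P) :
    ∃ e : E, FamilyIndependentOn (m := m) hB fun o : Option ι => Option.casesOn' o e w := by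
  -- At each minimal prime a new vector exists and stays independent on a neighbourhood. Vectors
  -- found on `C` and on `D` are glued into one that works on `C ∪ D`, so compactness yields a
  -- single vector on `B`.
  obtain ⟨C, hC, hCc, hCn⟩ := LInfty.exists_cover (m := m) (A := B)
    (fun C => ∃ (hC : MeasurableSet C) (e : E),
      FamilyIndependentOn (m := m) hC fun o : Option ι => Option.casesOn' o e w)
    (by
      refine ⟨MeasurableSet.empty, 0, fun a _ i => ?_⟩
      rw [(LInfty.chi_eq_zero_iff MeasurableSet.empty).2 measure_empty, zero_mul])
    (by
      rintro C D hC hD ⟨_, e, he⟩ ⟨_, f, hf⟩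
      have h1 : FamilyIndependentOn (m := m) hC fun o : Option ι => Option.casesOn' o
          (LInfty.chi m hC • e + LInfty.chi m hC.compl • f) w := by
        refine he.congr fun o => ?_
        cases o with
        | none =>
          simp only [Option.casesOn'_none]
          rw [smul_add, smul_smul, smul_smul, LInfty.chi_mul_self, LInfty.chi_mul_compl,
            zero_smul, add_zero]
        | some v => rfl
      have h2 : FamilyIndependentOn (m := m) (hD.diff hC) fun o : Option ι => Option.casesOn' o
          (LInfty.chi m hC • e + LInfty.chi m hC.compl • f) w := by
        refine (hf.mono sdiff_subset).congr fun o => ?_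
        cases o with
        | none =>
          simp only [Option.casesOn'_none]
          have h3 : LInfty.chi m (hD.diff hC) * LInfty.chi m hC = 0 := by
            rw [LInfty.chi_mul, LInfty.chi_eq_zero_iff, sdiff_inter_self, measure_empty]
          rw [smul_add, smul_smul, smul_smul, h3,
            LInfty.chi_mul_of_subset _ _ (fun x hx => hx.2), zero_smul, zero_add]
        | some v => rfl
      refine ⟨hC.union hD, LInfty.chi m hC • e + LInfty.chi m hC.compl • f, ?_⟩
      convert h1.union h2 using 1
      exact union_sdiff_self.symm)
    hB
    (by
      intro P hP hBP
      have := hP.1.1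
      obtain ⟨e, he⟩ := (hw.independentAt hBP).exists_option hP (hlt P hP hBP)
      obtain ⟨C, hC, hCP, hCf⟩ := he.exists_familyIndependentOn hE hP
      exact ⟨C, hC, ⟨hC, e, hCf⟩, hCP⟩)
  obtain ⟨_, e, he⟩ := hCc
  refine ⟨e, ?_⟩
  have h1 := he.mono (hB := hB.inter hC) inter_subset_right
  intro a ha i
  have h2 : LInfty.chi m (hB.inter hC) = LInfty.chi m hB :=
      LInfty.chi_congr (ae_eq_set.2 ⟨by rw [sdiff_eq_empty.2 inter_subset_left, measure_empty],
        by rwa [sdiff_self_inter]⟩)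
  have h3 := h1 a (by rw [h2]; exact ha) i
  rwa [h2] at h3

/-- If the enlarged family were independent, its truncations would form an independent set
containing `I`. By maximality `χ_B e` would already belong to `I`, so two different indices would
have the same truncation. -/
theorem not_familyIndependentOn_of_maximal {X : Type*} [MeasurableSpace X] {m : Measure X}
    {E : Type*} [AddCommGroup E] [Module (LInfty m) E] {B : Set X} {hB : MeasurableSet B}
    (hmB : m B ≠ 0) {I : Finset E} (hmax : Maximal (IsIndependentSetOn m hB) (I : Set E)) (e : E) :
    ¬ FamilyIndependentOn (m := m) hB
      fun o : Option I => Option.casesOn' o e fun v => (v : E) := by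
  intro hBfam
  have hins := hBfam.isIndependentSetOn
  have hsub : (I : Set E) ⊆ range fun o : Option I =>
      LInfty.chi m hB • (Option.casesOn' o e fun v : I => (v : E)) := fun v hv =>
    ⟨some ⟨v, hv⟩, hmax.1.1 v hv⟩
  have hmem := hmax.2 hins hsub ⟨none, rfl⟩
  have h4 := hBfam.injective hmB (a₁ := none)
    (a₂ := some ⟨LInfty.chi m hB • e, hmem⟩) (by
      simp only [Option.casesOn'_none, Option.casesOn'_some]
      rw [smul_smul, LInfty.chi_mul_self])
  exact absurd h4 (by simp)

/-- The local dimension is the dimension of the stalks at the minimal primes. -/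
theorem hasLocalDim_iff (hE : IsLpModule m p E) {A : Set X} (hA : MeasurableSet A) (n : ℕ) :
    HasLocalDim m E A n ↔ ∀ (P : Ideal (LInfty m)) [P.IsPrime], P ∈ minimalPrimes (LInfty m) →
      LInfty.chi m hA ∉ P → stalkRank E P = n := by
  constructor
  · intro h P hPp hP hAP
    have hmeas : ∀ {C : Set X} (hC : MeasurableSet C), LInfty.chi m hC ∉ P → m C ≠ 0 :=
      fun hC hCP h0 => hCP (by rw [(LInfty.chi_eq_zero_iff hC).2 h0]; exact P.zero_mem)
    refine le_antisymm ?_ ?_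
    · refine ENat.forall_natCast_le_iff_le.1 fun k hk => ?_
      -- Upper bound: `k` independent vectors at `P` remain independent on `A ∩ C`, which is not
      -- null, and extend to a maximal set there. That set has `n` elements.
      obtain ⟨w, hw⟩ := (natCast_le_stalkRank_iff hP).1 hk
      obtain ⟨C, hC, hCP, hfam⟩ := hw.exists_familyIndependentOn hE hP
      have hACP := LInfty.chi_inter_notMem hAP hCP
      have hfam' := hfam.mono (hB := hA.inter hC) inter_subset_right
      obtain ⟨S, hS, hmax⟩ := hfam'.isIndependentSetOn.exists_maximal
      have h1 := h _ (hA.inter hC) inter_subset_left (hmeas _ hACP) S hmax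
      have h2 := encard_le_encard hS
      rw [h1, ← image_univ, (hfam'.injective (hmeas _ hACP)).injOn.encard_image] at h2
      simpa using h2
    -- Lower bound: a maximal set on `A` has `n` elements, and they are independent at `P`.
    · obtain ⟨S, -, hmax⟩ := (isIndependentSetOn_empty (m := m) (hA := hA) (E := E)).exists_maximal
      have h1 := h A hA subset_rfl (hmeas _ hAP) S hmax
      have hfin : S.Finite := finite_of_encard_eq_coe h1
      have h2 := ((hmax.1.family hfin.toFinset (by simp)).independentAt hAP).card_le hP
      rw [hfin.encard_eq_coe_toFinset_card] at h1
      rw [Fintype.card_coe] at h2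
      rwa [← h1]
  · intro h B hB hBA hmB S hmax
    have hBP : ∃ P ∈ minimalPrimes (LInfty m), LInfty.chi m hB ∉ P :=
      LInfty.exists_minimalPrime_notMem fun h0 => hmB ((LInfty.chi_eq_zero_iff hB).1 h0)
    have hcard : ∀ I : Finset E, (I : Set E) ⊆ S → I.card ≤ n := by
      intro I hI
      obtain ⟨P, hP, hBP⟩ := hBP
      have := hP.1.1
      have h1 := ((hmax.1.family I hI).independentAt hBP).card_le hP
      rw [h P hP (LInfty.chi_notMem_of_subset hBA hBP), Fintype.card_coe] at h1
      exact_mod_cast h1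
    have hfin : S.Finite := by
      by_contra hinf
      obtain ⟨I, hI, hIc⟩ := Set.Infinite.exists_subset_card_eq hinf (n + 1)
      have := hcard I hI
      omega
    obtain ⟨I, rfl⟩ := hfin.exists_finset_coe
    rw [encard_coe_eq_coe_finsetCard]
    have hle := hcard I subset_rfl
    by_contra hne
    have hlt : I.card < n := lt_of_le_of_ne hle fun h => hne (by rw [h])
    have hfam := hmax.1.family I subset_rfl
    -- A maximal set with fewer than `n` elements could be enlarged at every prime that sees `B`,
    -- hence on `B`.
    obtain ⟨e, he⟩ := hfam.exists_option hE fun P _ hP hBP => by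
      rw [h P hP (LInfty.chi_notMem_of_subset hBA hBP), Fintype.card_coe]
      exact_mod_cast hlt
    exact not_familyIndependentOn_of_maximal hmB hmax e he

end LocalDim

/-! ## Reflexivity and exact sequences of locally finite dimensional modules -/

section StalkRank

variable {X : Type*} [MeasurableSpace X] {m : Measure X} {E : Type*} [AddCommGroup E]
  [Module (LInfty m) E]

theorem LInfty.chi_union_mem {P : Ideal (LInfty m)} {A B : Set X} {hA : MeasurableSet A}
    {hB : MeasurableSet B} (h : LInfty.chi m hA ∈ P) (h' : LInfty.chi m hB ∈ P) :
    LInfty.chi m (hA.union hB) ∈ P := by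
  have h1 : LInfty.chi m (hA.union hB)
      = LInfty.chi m hA + LInfty.chi m hA.compl * LInfty.chi m hB := by
    rw [LInfty.chi_mul, ← LInfty.chi_union hA _ (disjoint_left.2 fun x hx hx' => hx'.1 hx)]
    congr 1
    ext x
    simp only [mem_union, mem_inter_iff, mem_compl_iff]
    tauto
  rw [h1]
  exact P.add_mem h (P.mul_mem_left _ h')

theorem LInfty.chi_iUnion_le_mem {P : Ideal (LInfty m)} {A : ℕ → Set X}
    (hA : ∀ n, MeasurableSet (A n)) (n : ℕ) (h : ∀ k ≤ n, LInfty.chi m (hA k) ∈ P) {B : Set X}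
    (hB : MeasurableSet B) (hBA : ∀ x ∈ B, ∃ k ≤ n, x ∈ A k) : LInfty.chi m hB ∈ P := by
  induction n generalizing B with
  | zero =>
    by_contra hBP
    refine LInfty.chi_notMem_of_subset (hB := hA 0) (fun x hx => ?_) hBP (h 0 le_rfl)
    obtain ⟨k, hk, hxk⟩ := hBA x hx
    rwa [Nat.le_zero.1 hk] at hxk
  | succ n ih =>
    have h1 := ih (fun k hk => h k (hk.trans n.le_succ)) (hB.diff (hA (n + 1))) fun x hx => by
      obtain ⟨k, hk, hxk⟩ := hBA x hx.1
      refine ⟨k, Nat.lt_succ_iff.1 (lt_of_le_of_ne hk ?_), hxk⟩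
      rintro rfl
      exact hx.2 hxk
    have h2 := LInfty.chi_union_mem h1 (h (n + 1) le_rfl)
    by_contra hBP
    refine LInfty.chi_notMem_of_subset (fun x hx => ?_) hBP h2
    by_cases hxA : x ∈ A (n + 1)
    · exact Or.inr hxA
    · exact Or.inl ⟨hx, hxA⟩

variable {P : Ideal (LInfty m)} [hPp : P.IsPrime]

theorem stalkRank_mono (hP : P ∈ minimalPrimes (LInfty m)) {N : Type*} [AddCommGroup N]
    [Module (LInfty m) N] (ι : N →ₗ[LInfty m] E) (hι : Function.Injective ι) :
    stalkRank N P ≤ stalkRank E P := by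
  refine ENat.forall_natCast_le_iff_le.1 fun k hk => ?_
  obtain ⟨w, hw⟩ := (natCast_le_stalkRank_iff hP).1 hk
  refine (natCast_le_stalkRank_iff hP).2 ⟨fun i => ι (w i), fun a ha => hw a (hι ?_)⟩
  rw [map_zero, ← ha, map_sum]
  exact Finset.sum_congr rfl fun i _ => map_smul ι _ _

theorem stalkRank_of_subsingleton (hP : P ∈ minimalPrimes (LInfty m)) [Subsingleton E] :
    stalkRank E P = 0 :=
  (stalkRank_eq_zero_iff hP).2 fun _ =>
    ⟨1, fun h => hPp.ne_top ((Ideal.eq_top_iff_one P).2 h), Subsingleton.elim _ _⟩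

theorem HasLocalDim.mono {A B : Set X} {n : ℕ} (h : HasLocalDim m E A n) (hBA : B ⊆ A) :
    HasLocalDim m E B n := fun C hC hCB => h C hC (hCB.trans hBA)

end StalkRank

/-! ### Reflexivity of locally finite dimensional modules -/

section Reflexive

variable {X : Type*} [MeasurableSpace X] {m : Measure X} [SigmaFinite m] {p : ℝ≥0}
  [hp1 : Fact (1 ≤ (p : ℝ≥0∞))]

/-- A nonzero `v` has a support `S` of positive measure. At a minimal prime avoiding `χ_S` no scalar
outside the prime can kill `v`, so the stalk is nonzero there. -/
theorem IsLpModule.subsingleton_of_stalkRank {E : Type*} [NormedAddCommGroup E]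
    [Module (LInfty m) E] (hE : IsLpModule m p E)
    (h : ∀ (P : Ideal (LInfty m)) [P.IsPrime], P ∈ minimalPrimes (LInfty m) → stalkRank E P = 0) :
    Subsingleton E := by
  refine subsingleton_of_forall_eq 0 fun v => ?_
  obtain ⟨S, hS, hv⟩ := hE.exists_isSupportOf v
  by_contra hne
  have h1 : LInfty.chi m hS ≠ 0 := fun h0 => hne (by rw [← hv.chi_smul, h0, zero_smul])
  obtain ⟨P, hP, hSP⟩ := LInfty.exists_minimalPrime_notMem h1
  have := hP.1.1
  obtain ⟨a, ha, hav⟩ := (stalkRank_eq_zero_iff hP).1 (h P hP) v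
  have h2 := (hv a).1 hav
  exact (this.mem_or_mem (h2 ▸ P.zero_mem : a * LInfty.chi m hS ∈ P)).elim ha hSP

/-- `L^p`-normed modules with stalks of bounded dimension are reflexive. -/
theorem IsLpModule.isReflexive_of_stalkRank_le (hp : 1 < p) (n : ℕ) {E : Type*}
    [NormedAddCommGroup E] [NormedSpace ℝ E] [CompleteSpace E] [Module (LInfty m) E]
    [IsScalarTower ℝ (LInfty m) E] (hE : IsLpModule m p E)
    (h : ∀ (P : Ideal (LInfty m)) [P.IsPrime], P ∈ minimalPrimes (LInfty m) →
      stalkRank E P ≤ n) : IsReflexive E := by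
  induction n generalizing E with
  | zero =>
    have := hE.subsingleton_of_stalkRank fun P _ hP => by simpa using h P hP
    exact isReflexive_of_subsingleton
  | succ n ih =>
    have := hE.continuousConstSMul
    -- With `v` of largest support, its closed span has a nonzero stalk wherever `E` has one. So the
    -- quotient loses at least one dimension there, and where `E` has zero stalk it has nothing to
    -- lose.
    obtain ⟨v, hv⟩ := exists_full_support hE.continuous_smul hE.exists_isSupportOf
    set V : Submodule (LInfty m) E := (Submodule.span (LInfty m) {v}).topologicalClosure with hV
    have hVset : (V : Set E) = closure (range fun a : LInfty m => a • v) := by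
      rw [hV, Submodule.topologicalClosure_coe]
      congr 1
      ext w
      simp [Submodule.mem_span_singleton]
    have hvV : v ∈ V := Submodule.le_topologicalClosure _ (Submodule.mem_span_singleton_self v)
    have hVc : IsClosed (V : Set E) := Submodule.isClosed_topologicalClosure _
    let _ := Submodule.Quotient.normedAddCommGroup V
    have hQ : IsLpModule m p (E ⧸ V) := hE.quotient V
    refine IsReflexive.of_exact (hE.isReflexive_closure_span_singleton hp v V hVset)
      (ih hQ fun P hPp hP => ?_)
      ({ V.subtype.restrictScalars ℝ with norm_map' := fun _ => rfl } : V →ₗᵢ[ℝ] E)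
      (LinearMap.mkContinuous (V.mkQ.restrictScalars ℝ) 1 fun w => by
        rw [one_mul]
        exact Submodule.Quotient.norm_mk_le V w)
      (Submodule.mkQ_surjective V) fun w => ?_
    · have h1 := stalkRank_add hP V.subtype V.mkQ (Submodule.injective_subtype V)
        (Submodule.mkQ_surjective V) (LinearMap.exact_subtype_mkQ V)
      by_cases h0 : stalkRank V P = 0
      · have h2 : stalkRank E P = 0 := by
          rw [stalkRank_eq_zero_iff hP] at h0 ⊢
          obtain ⟨a, ha, hav⟩ := h0 ⟨v, hvV⟩
          exact fun w => ⟨a, ha, hv a (congrArg Subtype.val hav) w⟩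
        rw [h2, h0, zero_add] at h1
        rw [h1]
        exact zero_le
      · have h2 : 1 + stalkRank (E ⧸ V) P ≤ 1 + n := by
          calc 1 + stalkRank (E ⧸ V) P ≤ stalkRank V P + stalkRank (E ⧸ V) P := by
                gcongr
                exact Order.one_le_iff_pos.2 (pos_iff_ne_zero.2 h0)
            _ ≤ ((n + 1 : ℕ) : ℕ∞) := h1.le.trans (h P hP)
            _ = 1 + n := by push_cast; rw [add_comm]
        exact (ENat.add_le_add_iff_left ENat.one_ne_top).1 h2
    · change V.mkQ w = 0 ↔ w ∈ range V.subtype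
      simp

variable {E : Type*} [NormedAddCommGroup E] [NormedSpace ℝ E] [CompleteSpace E]
  [Module (LInfty m) E] [IsScalarTower ℝ (LInfty m) E]

/-- Locally finite dimensional `L^p`-normed modules are reflexive. -/
theorem IsLpModule.isReflexive_of_locallyFiniteDim (hE : IsLpModule m p E) (hp : 1 < p)
    (h : LocallyFiniteDim m E) : IsReflexive E := by
  obtain ⟨δ, hδ, hδ0, hdim⟩ := h
  have := hE.continuousConstSMul
  have hC : ∀ n : ℕ, MeasurableSet {x | δ x ≤ n} := fun n => hδ (to_countable (Iic (n : ℕ∞))).measurableSet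
  have hD : ∀ n : ℕ, MeasurableSet {x | δ x = n} := fun n => hδ (measurableSet_singleton _)
  let V : ℕ → Submodule (LInfty m) E := fun n =>
    { carrier := {v | LInfty.chi m (hC n) • v = v}
      add_mem' := fun {v w} hv hw => by
        rw [mem_ofPred_eq] at *
        rw [smul_add, hv, hw]
      zero_mem' := smul_zero _
      smul_mem' := fun a v hv => by
        rw [mem_ofPred_eq] at *
        rw [smul_comm, hv] }
  refine hE.isReflexive_of_exhaustion hp hC (fun i j hij x hx => ?_) ?_ V (fun _ _ => Iff.rfl)
    fun n => ?_
  · exact le_trans (show δ x ≤ (i : ℕ∞) from hx) (by exact_mod_cast hij)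
  · refine measure_mono_null (fun x hx => ?_) hδ0
    by_contra hne
    obtain ⟨k, hk⟩ := ENat.ne_top_iff_exists.1 hne
    exact hx (mem_iUnion.2 ⟨k, hk.symm.le⟩)
  · have hVc : IsClosed (V n : Set E) := isClosed_eq (continuous_const_smul _) continuous_id
    have : CompleteSpace (V n) := hVc.completeSpace_coe
    refine (hE.submodule (V n)).isReflexive_of_stalkRank_le hp n fun P hPp hP => ?_
    -- Either `P` sees none of the sets `{δ = k}` with `k ≤ n`, and then the part of the module
    -- supported in their union has zero stalk, or it sees one of them and the rank is at most `k ≤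
    -- n`.
    by_cases hP' : ∀ k ≤ n, LInfty.chi m (hD k) ∈ P
    · have h1 : LInfty.chi m (hC n) ∈ P :=
        LInfty.chi_iUnion_le_mem hD n hP' (hC n) fun x hx => by
          obtain ⟨k, hk⟩ := ENat.ne_top_iff_exists.1
            (ne_top_of_le_ne_top (ENat.natCast_ne_top n) hx)
          refine ⟨k, ?_, hk.symm⟩
          have hx' : δ x ≤ n := hx
          rw [← hk] at hx'
          exact_mod_cast hx'
      obtain ⟨s, hs, hs0⟩ := LInfty.exists_notMem_mul_eq_zero hP h1
      have h2 : stalkRank (V n) P = 0 := (stalkRank_eq_zero_iff hP).2 fun v =>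
        ⟨s, hs, Subtype.ext (by
          change s • (v : E) = 0
          have h3 : LInfty.chi m (hC n) • (v : E) = v := v.2
          rw [← h3, smul_smul, hs0, zero_smul])⟩
      rw [h2]
      exact zero_le
    · push Not at hP'
      obtain ⟨k, hk, hkP⟩ := hP'
      refine (stalkRank_mono hP (V n).subtype (Submodule.injective_subtype _)).trans ?_
      rw [(hasLocalDim_iff hE (hD k) k).1 (hdim k) P hP hkP]
      exact_mod_cast hk

end Reflexive

/-! ### Local dimension on countable unions -/

section LocalDimPieces

variable {X : Type*} [MeasurableSpace X] {m : Measure X} [SigmaFinite m] {p : ℝ≥0}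
  {E : Type*} [NormedAddCommGroup E] [NormedSpace ℝ E] [CompleteSpace E]
  [Module (LInfty m) E] [IsScalarTower ℝ (LInfty m) E]

/-- Stalks do not settle this, since a prime may contain every `χ_(A n)` and still avoid the
indicator of the union. Maximal sets are counted directly: one piece of positive measure bounds
their size by `k`, and if a vector were missing, vectors missing on the disjoint pieces would glue
to one missing on `B`. -/
theorem hasLocalDim_iUnion (hE : IsLpModule m p E) {A : ℕ → Set X}
    (hA : ∀ n, MeasurableSet (A n)) (k : ℕ) (h : ∀ n, HasLocalDim m E (A n) k) :
    HasLocalDim m E (⋃ n, A n) k := by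
  intro B hB hBA hmB S hmax
  have hD : ∀ n, MeasurableSet (B ∩ disjointed A n) := fun n =>
    hB.inter (MeasurableSet.disjointed hA n)
  have hDA : ∀ n, B ∩ disjointed A n ⊆ A n := fun n =>
    inter_subset_right.trans (disjointed_subset A n)
  have hBU : B = ⋃ n, B ∩ disjointed A n := by
    rw [← inter_iUnion, iUnion_disjointed, inter_eq_left.2 hBA]
  have hrank : ∀ n (P : Ideal (LInfty m)) [P.IsPrime], P ∈ minimalPrimes (LInfty m) →
      LInfty.chi m (hD n) ∉ P → stalkRank E P = k := fun n =>
    (hasLocalDim_iff hE (hD n) k).1 ((h n).mono (hDA n))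
  have hpos : ∃ n, m (B ∩ disjointed A n) ≠ 0 := by
    by_contra! h0
    exact hmB (by rw [hBU]; exact measure_iUnion_null h0)
  obtain ⟨n₀, hn₀⟩ := hpos
  obtain ⟨P, hP, hBP⟩ := LInfty.exists_minimalPrime_notMem
    fun h0 => hn₀ ((LInfty.chi_eq_zero_iff (m := m) (hD n₀)).1 h0)
  have hPp := hP.1.1
  have hcard : ∀ I : Finset E, (I : Set E) ⊆ S → I.card ≤ k := by
    intro I hI
    have h1 := (((hmax.1.family I hI).mono (hB := hD n₀) inter_subset_left).independentAt
      hBP).card_le hP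
    rw [hrank n₀ P hP hBP, Fintype.card_coe] at h1
    exact_mod_cast h1
  have hfin : S.Finite := by
    by_contra hinf
    obtain ⟨I, hI, hIc⟩ := Set.Infinite.exists_subset_card_eq hinf (k + 1)
    have := hcard I hI
    omega
  obtain ⟨I, rfl⟩ := hfin.exists_finset_coe
  rw [encard_coe_eq_coe_finsetCard]
  by_contra hne
  have hlt : I.card < k := lt_of_le_of_ne (hcard I subset_rfl) fun h => hne (by rw [h])
  have hfam := hmax.1.family I subset_rfl
  have hex : ∀ n, ∃ e : E, FamilyIndependentOn (m := m) (hD n)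
      fun o : Option I => Option.casesOn' o e fun v => (v : E) := fun n =>
    (hfam.mono inter_subset_left).exists_option hE fun P _ hP hBP => by
      rw [hrank n P hP hBP, Fintype.card_coe]
      exact_mod_cast hlt
  choose e he using hex
  obtain ⟨v, c, hc0, hv⟩ := exists_glue hE.continuous_smul hD (fun i j hij =>
    ((disjoint_disjointed A) hij).mono inter_subset_right inter_subset_right) e
  refine not_familyIndependentOn_of_maximal hmB hmax v fun a ha i => ?_
  have key : ∀ n, LInfty.chi m (hD n) * a i = 0 := by
    intro n
    -- On the `n`-th piece `v` is `c n` times `e n`, so the scalar is moved into the coefficient; it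
    -- is nonzero and is removed again at the end.
    let b : Option I → LInfty m := fun o => Option.casesOn' o (c n • a none) fun j => a (some j)
    have hb : LInfty.chi m (hD n) • ∑ o, b o • (Option.casesOn' o (e n) fun v : I => (v : E))
        = 0 := by
      have h1 : LInfty.chi m (hD n) • ∑ o : Option I, a o • (Option.casesOn' o v fun v : I => (v : E))
          = 0 := by
        rw [← LInfty.chi_mul_of_subset (hD n) hB inter_subset_left, mul_smul, ha, smul_zero]
      rw [Fintype.sum_option, smul_add] at h1 ⊢
      simp only [Option.casesOn'_none, Option.casesOn'_some, b] at h1 ⊢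
      rw [← h1]
      congr 1
      rw [smul_comm, smul_comm _ _ v, hv, smul_assoc, smul_real_comm]
    have h2 := he n b hb i
    cases i with
    | none =>
      simp only [b, Option.casesOn'_none] at h2
      rw [mul_smul_comm] at h2
      exact (smul_eq_zero.1 h2).resolve_left (hc0 n)
    | some j => exact h2
  have h3 : ∀ n, ∀ᵐ x ∂m, x ∈ B ∩ disjointed A n → a i x = 0 := fun n => by
    rw [← LInfty.mul_chi_eq_zero_iff (hD n), mul_comm]
    exact key n
  rw [mul_comm, LInfty.mul_chi_eq_zero_iff]
  filter_upwards [ae_all_iff.2 h3] with x hx hxB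
  rw [hBU] at hxB
  obtain ⟨n, hn⟩ := mem_iUnion.1 hxB
  exact hx n hn

/-- The function `κ n` is the new dimension on `{δ = n}` and is irrelevant elsewhere. A level set of
the new dimension meets infinitely many of the sets `{δ = n}` in general, hence the need for
countable unions. -/
theorem isLocalDim_of_pieces (hE : IsLpModule m p E) {δ : X → ℕ∞} (hδ : Measurable δ)
    (hδ0 : m {x | δ x = ⊤} = 0) {κ : ℕ → X → ℕ} (hκ : ∀ n, Measurable (κ n))
    (h : ∀ n k : ℕ, HasLocalDim m E ({x | δ x = n} ∩ {x | κ n x = k}) k) :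
    ∃ δ' : X → ℕ∞, IsLocalDim m E δ' := by
  have hset : ∀ k : ℕ, {x | (if δ x = ⊤ then (⊤ : ℕ∞) else (κ (δ x).toNat x : ℕ∞)) = k}
      = ⋃ n : ℕ, {x | δ x = n} ∩ {x | κ n x = k} := by
    intro k
    ext x
    simp only [mem_ofPred_eq, mem_iUnion, mem_inter_iff]
    constructor
    · intro hx
      split_ifs at hx with h1
      · exact absurd hx (ENat.top_ne_natCast k)
      · exact ⟨(δ x).toNat, (ENat.natCast_toNat h1).symm, by exact_mod_cast hx⟩
    · rintro ⟨n, h1, h2⟩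
      rw [if_neg (by rw [h1]; exact ENat.natCast_ne_top n), h1, ENat.toNat_natCast, h2]
  have hmeas : ∀ n k : ℕ, MeasurableSet ({x | δ x = n} ∩ {x | κ n x = k}) := fun n k =>
    (hδ (measurableSet_singleton _)).inter (hκ n (measurableSet_singleton _))
  refine ⟨fun x => if δ x = ⊤ then ⊤ else κ (δ x).toNat x, ?_, ?_, fun k => ?_⟩
  · refine measurable_to_countable' fun a => ?_
    induction a using ENat.recTopCoe with
    | top =>
      have : (fun x => if δ x = ⊤ then (⊤ : ℕ∞) else (κ (δ x).toNat x : ℕ∞)) ⁻¹' {⊤}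
          = δ ⁻¹' {⊤} := by
        ext x
        simp
      rw [this]
      exact hδ (measurableSet_singleton _)
    | coe k =>
      change MeasurableSet {x | (if δ x = ⊤ then (⊤ : ℕ∞) else (κ (δ x).toNat x : ℕ∞)) = k}
      rw [hset]
      exact MeasurableSet.iUnion fun n => hmeas n k
  · simpa using hδ0
  · rw [hset]
    exact hasLocalDim_iUnion hE (fun n => hmeas n k) k fun n => h n k

end LocalDimPieces

/-! ### Dimensions in exact sequences -/

section ExactSequence

variable {X : Type*} [MeasurableSpace X] {m : Measure X} [SigmaFinite m] {p : ℝ≥0}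

/-- If a level set `{δ = n}` with `n ≠ k` had positive measure, some minimal prime would see it, and
the stalk there would have both ranks. -/
theorem IsLocalDim.ae_eq_of_stalkRank {E : Type*} [NormedAddCommGroup E] [Module (LInfty m) E]
    (hE : IsLpModule m p E) {δ : X → ℕ∞} (h : IsLocalDim m E δ) (k : ℕ)
    (hr : ∀ (P : Ideal (LInfty m)) [P.IsPrime], P ∈ minimalPrimes (LInfty m) →
      stalkRank E P = k) : ∀ᵐ x ∂m, δ x = k := by
  have h1 : ∀ n : ℕ, n ≠ k → m {x | δ x = n} = 0 := by
    intro n hn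
    have hD : MeasurableSet {x | δ x = n} := h.1 (measurableSet_singleton _)
    by_contra h0
    obtain ⟨P, hP, hDP⟩ := LInfty.exists_minimalPrime_notMem
      fun h' => h0 ((LInfty.chi_eq_zero_iff (m := m) hD).1 h')
    have := hP.1.1
    have h2 := (hasLocalDim_iff hE hD n).1 (h.2.2 n) P hP hDP
    rw [hr P hP] at h2
    exact hn (by exact_mod_cast h2.symm)
  filter_upwards [measure_eq_zero_iff_ae_notMem.1 h.2.1,
    ae_all_iff.2 fun n : ℕ => ae_all_iff.2 fun hn : n ≠ k =>
      measure_eq_zero_iff_ae_notMem.1 (h1 n hn)] with x hx hx'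
  obtain ⟨n, hn⟩ := ENat.ne_top_iff_exists.1 hx
  by_contra hne
  exact hx' n (fun h => hne (by rw [← hn, h])) hn.symm

theorem IsLocalDim.subsingleton [hp1 : Fact (1 ≤ (p : ℝ≥0∞))] {E : Type*} [NormedAddCommGroup E]
    [Module (LInfty m) E] (hE : IsLpModule m p E) {δ : X → ℕ∞} (h : IsLocalDim m E δ)
    (h0 : ∀ᵐ x ∂m, δ x = 0) : Subsingleton E := by
  refine hE.subsingleton_of_stalkRank fun P hPp hP => ?_
  have hD : MeasurableSet {x | δ x = (0 : ℕ)} := h.1 (measurableSet_singleton _)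
  refine (hasLocalDim_iff hE hD 0).1 (h.2.2 0) P hP ?_
  have h1 : LInfty.chi m hD = 1 := by
    rw [← LInfty.chi_univ]
    refine LInfty.chi_congr (eventuallyEq_univ.2 ?_)
    filter_upwards [h0] with x hx
    simpa using hx
  rw [h1]
  exact fun h1 => hPp.ne_top ((Ideal.eq_top_iff_one P).2 h1)

variable {N E Q : Type*} [NormedAddCommGroup N] [Module (LInfty m) N]
  [NormedAddCommGroup E] [Module (LInfty m) E] [NormedAddCommGroup Q] [Module (LInfty m) Q]

/-- Where the dimensions of two modules add up to a constant, they are locally constant. -/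
theorem exists_measurable_stalkRank (hN : IsLpModule m p N) (hQ : IsLpModule m p Q) {A : Set X}
    (hA : MeasurableSet A) (n : ℕ)
    (h : ∀ (P : Ideal (LInfty m)) [P.IsPrime], P ∈ minimalPrimes (LInfty m) →
      LInfty.chi m hA ∉ P → stalkRank N P + stalkRank Q P = n) :
    ∃ κ : X → ℕ, Measurable κ ∧ (∀ x, κ x ≤ n) ∧ ∀ k, HasLocalDim m N (A ∩ {x | κ x = k}) k ∧
      HasLocalDim m Q (A ∩ {x | κ x = k}) (n - k) := by
  have hmeas : ∀ {C : Set X} (_ : MeasurableSet C) {κ : X → ℕ} (_ : Measurable κ) (k : ℕ),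
      MeasurableSet (C ∩ {x | κ x = k}) := fun {_} hC {_} hκ k => hC.inter (hκ (measurableSet_singleton k))
  -- The condition quantifies over all measurable subsets of a level set, which makes it stable
  -- under the gluing required by `exists_cover`.
  let Qf : Set X → (X → ℕ) → Prop := fun C κ => ∀ (k : ℕ) (B : Set X) (hB : MeasurableSet B),
    B ⊆ C ∩ {x | κ x = k} → ∀ (P : Ideal (LInfty m)) [P.IsPrime], P ∈ minimalPrimes (LInfty m) →
      LInfty.chi m hB ∉ P → stalkRank N P = k
  obtain ⟨C, hC, ⟨κ, hκ, hκn, hκ'⟩, hCn⟩ := LInfty.exists_cover (m := m) (A := A)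
    (fun C => ∃ κ : X → ℕ, Measurable κ ∧ (∀ x, κ x ≤ n) ∧ Qf (A ∩ C) κ)
    (by
      refine ⟨fun _ => 0, measurable_const, fun _ => n.zero_le, fun k B hB hB' P _ hP hBP => absurd ?_ hBP⟩
      have : LInfty.chi m hB = 0 := by
        rw [LInfty.chi_eq_zero_iff]
        refine measure_mono_null hB' ?_
        simp
      rw [this]
      exact P.zero_mem)
    (by
      rintro C D hC hD ⟨κ, hκ, hκn, hκ'⟩ ⟨η, hη, hηn, hη'⟩
      classical
      refine ⟨C.piecewise κ η, hκ.piecewise hC hη, fun x => ?_, fun k B hB hB' P _ hP hBP => ?_⟩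
      · by_cases hx : x ∈ C
        · rw [piecewise_eq_of_mem _ _ _ hx]
          exact hκn x
        · rw [piecewise_eq_of_notMem _ _ _ hx]
          exact hηn x
      by_cases h1 : LInfty.chi m (hB.inter hC) ∈ P
      · have h2 : LInfty.chi m (hB.inter hC.compl) ∉ P := fun h2 => by
          have h3 := LInfty.chi_union_mem h1 h2
          refine LInfty.chi_notMem_of_subset (fun x hx => ?_) hBP h3
          rw [← inter_union_distrib_left, union_compl_self, inter_univ]
          exact hx
        refine hη' k _ (hB.inter hC.compl) (fun x hx => ?_) P hP h2
        have h3 := hB' hx.1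
        have h4 : C.piecewise κ η x = k := h3.2
        rw [piecewise_eq_of_notMem _ _ _ hx.2] at h4
        exact ⟨⟨h3.1.1, h3.1.2.resolve_left hx.2⟩, h4⟩
      · refine hκ' k _ (hB.inter hC) (fun x hx => ?_) P hP h1
        have h3 := hB' hx.1
        have h4 : C.piecewise κ η x = k := h3.2
        rw [piecewise_eq_of_mem _ _ _ hx.2] at h4
        exact ⟨⟨h3.1.1, hx.2⟩, h4⟩)
    hA
    (by
      intro P hP hAP
      have hPp := hP.1.1
      have h1 := h P hP hAP
      obtain ⟨i, hi⟩ := ENat.ne_top_iff_exists.1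
        (ne_top_of_le_ne_top (ENat.natCast_ne_top n) (h1 ▸ le_self_add : stalkRank N P ≤ n))
      obtain ⟨j, hj⟩ := ENat.ne_top_iff_exists.1
        (ne_top_of_le_ne_top (ENat.natCast_ne_top n) (h1 ▸ le_add_self : stalkRank Q P ≤ n))
      have hij : i + j = n := by
        rw [← hi, ← hj] at h1
        exact_mod_cast h1
      -- Independent vectors in `N` and in `Q` spread out, so near `P` the two ranks are at least
      -- `i` and `j`. Their sum is `n = i + j` throughout, so both ranks are constant near `P`.
      obtain ⟨w, hw⟩ := (natCast_le_stalkRank_iff hP).1 hi.le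
      obtain ⟨u, hu⟩ := (natCast_le_stalkRank_iff hP).1 hj.le
      obtain ⟨C, hC, hCP, hCf⟩ := hw.exists_familyIndependentOn hN hP
      obtain ⟨D, hD, hDP, hDf⟩ := hu.exists_familyIndependentOn hQ hP
      refine ⟨C ∩ D, hC.inter hD, ⟨fun _ => i, measurable_const, fun _ => by
        change i ≤ n
        omega, ?_⟩,
        LInfty.chi_inter_notMem hCP hDP⟩
      intro k B hB hB' P' _ hP' hBP'
      have h2 : B ⊆ A ∩ (C ∩ D) := hB'.trans inter_subset_left
      have h3 := ((hCf.mono (hB := hB) (h2.trans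
        (inter_subset_right.trans inter_subset_left))).independentAt hBP').card_le hP'
      have h4 := ((hDf.mono (hB := hB) (h2.trans
        (inter_subset_right.trans inter_subset_right))).independentAt hBP').card_le hP'
      rw [Fintype.card_fin] at h3 h4
      have h5 := h P' hP' (LInfty.chi_notMem_of_subset (h2.trans inter_subset_left) hBP')
      obtain ⟨i', hi'⟩ := ENat.ne_top_iff_exists.1
        (ne_top_of_le_ne_top (ENat.natCast_ne_top n) (h5 ▸ le_self_add : stalkRank N P' ≤ n))
      obtain ⟨j', hj'⟩ := ENat.ne_top_iff_exists.1
        (ne_top_of_le_ne_top (ENat.natCast_ne_top n) (h5 ▸ le_add_self : stalkRank Q P' ≤ n))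
      rw [← hi', ← hj'] at h5
      rw [← hi'] at h3
      rw [← hj'] at h4
      have h6 : i' + j' = n := by exact_mod_cast h5
      have h7 : i ≤ i' := by exact_mod_cast h3
      have h8 : j ≤ j' := by exact_mod_cast h4
      -- The function on this neighbourhood is constantly `i`, so its other level sets are empty and
      -- no prime sees a subset of them.
      have h9 : i = k := by
        by_contra hne
        refine hBP' ?_
        have : B = ∅ := eq_empty_of_forall_notMem fun x hx => hne (hB' hx).2
        rw [(LInfty.chi_eq_zero_iff hB).2 (by rw [this, measure_empty])]
        exact P'.zero_mem
      rw [← hi', ← h9]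
      have : i' = i := by omega
      rw [this])
  have hfin : ∀ (k : ℕ) (P : Ideal (LInfty m)) [P.IsPrime], P ∈ minimalPrimes (LInfty m) →
      LInfty.chi m (hmeas hA hκ k) ∉ P → stalkRank N P = k := by
    intro k P _ hP hAP
    refine hκ' k ((A ∩ C) ∩ {x | κ x = k}) (hmeas (hA.inter hC) hκ k) subset_rfl P hP ?_
    have h1 : LInfty.chi m (hmeas (hA.inter hC) hκ k) = LInfty.chi m (hmeas hA hκ k) := by
      refine LInfty.chi_congr (ae_eq_set.2 ⟨?_, ?_⟩)
      · rw [sdiff_eq_empty.2 (inter_subset_inter_left _ inter_subset_left), measure_empty]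
      · refine measure_mono_null (fun x hx => ?_) hCn
        exact ⟨hx.1.1, fun hxC => hx.2 ⟨⟨hx.1.1, hxC⟩, hx.1.2⟩⟩
    rwa [h1]
  refine ⟨κ, hκ, hκn, fun k => ⟨(hasLocalDim_iff hN (hmeas hA hκ k) k).2 (hfin k),
    (hasLocalDim_iff hQ (hmeas hA hκ k) (n - k)).2 fun P _ hP hAP => ?_⟩⟩
  have h1 := h P hP (LInfty.chi_notMem_of_subset inter_subset_left hAP)
  rw [hfin k P hP hAP] at h1
  obtain ⟨j, hj⟩ := ENat.ne_top_iff_exists.1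
    (ne_top_of_le_ne_top (ENat.natCast_ne_top n) (h1 ▸ le_add_self : stalkRank Q P ≤ n))
  rw [← hj] at h1 ⊢
  have h2 : k + j = n := by exact_mod_cast h1
  rw [← h2, Nat.add_sub_cancel_left]

variable (hN : IsLpModule m p N) (hE : IsLpModule m p E) (hQ : IsLpModule m p Q)
  (ι : N →ₗ[LInfty m] E) (π : E →ₗ[LInfty m] Q) (hι : Function.Injective ι)
  (hπ : Function.Surjective π) (hex : Function.Exact ι π)

include hN hE hQ hι hπ hex

/-- Dimensions are additive in exact sequences. -/
theorem IsLocalDim.ae_eq_add {δ δQ δN : X → ℕ∞} (h : IsLocalDim m E δ) (h' : IsLocalDim m Q δQ)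
    (h'' : IsLocalDim m N δN) : ∀ᵐ x ∂m, δ x = δQ x + δN x := by
  have h1 : ∀ i j k : ℕ, i ≠ j + k →
      m ({x | δ x = i} ∩ {x | δQ x = j} ∩ {x | δN x = k}) = 0 := by
    intro i j k hne
    have hi : MeasurableSet {x | δ x = i} := h.1 (measurableSet_singleton _)
    have hj : MeasurableSet {x | δQ x = j} := h'.1 (measurableSet_singleton _)
    have hk : MeasurableSet {x | δN x = k} := h''.1 (measurableSet_singleton _)
    by_contra h0
    -- A triple intersection of positive measure is seen by a minimal prime, where the three
    -- dimensions are stalk ranks and add up.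
    obtain ⟨P, hP, hDP⟩ := LInfty.exists_minimalPrime_notMem
      fun h' => h0 ((LInfty.chi_eq_zero_iff (m := m) ((hi.inter hj).inter hk)).1 h')
    have := hP.1.1
    have e1 := (hasLocalDim_iff hE hi i).1 (h.2.2 i) P hP
      (LInfty.chi_notMem_of_subset (inter_subset_left.trans inter_subset_left) hDP)
    have e2 := (hasLocalDim_iff hQ hj j).1 (h'.2.2 j) P hP
      (LInfty.chi_notMem_of_subset (inter_subset_left.trans inter_subset_right) hDP)
    have e3 := (hasLocalDim_iff hN hk k).1 (h''.2.2 k) P hP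
      (LInfty.chi_notMem_of_subset inter_subset_right hDP)
    have e4 := stalkRank_add hP ι π hι hπ hex
    rw [e1, e2, e3] at e4
    exact hne (by rw [add_comm]; exact_mod_cast e4.symm)
  filter_upwards [measure_eq_zero_iff_ae_notMem.1 h.2.1, measure_eq_zero_iff_ae_notMem.1 h'.2.1,
    measure_eq_zero_iff_ae_notMem.1 h''.2.1, ae_all_iff.2 fun i : ℕ => ae_all_iff.2 fun j : ℕ =>
      ae_all_iff.2 fun k : ℕ => ae_all_iff.2 fun hn : i ≠ j + k =>
        measure_eq_zero_iff_ae_notMem.1 (h1 i j k hn)] with x hx hx' hx'' hall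
  obtain ⟨i, hi⟩ := ENat.ne_top_iff_exists.1 hx
  obtain ⟨j, hj⟩ := ENat.ne_top_iff_exists.1 hx'
  obtain ⟨k, hk⟩ := ENat.ne_top_iff_exists.1 hx''
  by_contra hne
  refine hall i j k (fun h => hne ?_) ⟨⟨hi.symm, hj.symm⟩, hk.symm⟩
  rw [← hi, ← hj, ← hk, h]
  push_cast
  rfl

/-- Submodules and quotients of locally finite dimensional modules are locally finite
dimensional. -/
theorem LocallyFiniteDim.of_exact [NormedSpace ℝ N] [IsScalarTower ℝ (LInfty m) N]
    [CompleteSpace N] [NormedSpace ℝ Q] [IsScalarTower ℝ (LInfty m) Q] [CompleteSpace Q]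
    (h : LocallyFiniteDim m E) : LocallyFiniteDim m N ∧ LocallyFiniteDim m Q := by
  obtain ⟨δ, hδ, hδ0, hdim⟩ := h
  have hD : ∀ n : ℕ, MeasurableSet {x | δ x = n} := fun n => hδ (measurableSet_singleton _)
  have hex' := fun n : ℕ => exists_measurable_stalkRank hN hQ (hD n) n fun P _ hP hDP => by
    rw [stalkRank_add hP ι π hι hπ hex, (hasLocalDim_iff hE (hD n) n).1 (hdim n) P hP hDP]
  choose κ hκ hκn hκ' using hex'
  refine ⟨isLocalDim_of_pieces hN hδ hδ0 hκ fun n k => (hκ' n k).1,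
    isLocalDim_of_pieces hQ hδ hδ0 (κ := fun n x => n - κ n x)
      (fun n => (measurable_of_countable fun k => n - k).comp (hκ n)) fun n k => ?_⟩
  by_cases hk : k ≤ n
  · have h1 := (hκ' n (n - k)).2
    rw [Nat.sub_sub_self hk] at h1
    refine h1.mono fun x hx => ⟨hx.1, ?_⟩
    have h2 : n - κ n x = k := hx.2
    have h3 := hκn n x
    change κ n x = n - k
    omega
  -- The truncated difference `n - κ n x` never exceeds `n`, so this level set is empty.
  · refine HasLocalDim.mono (A := ∅) (fun A hA hA' hmA => absurd ?_ hmA) fun x hx => ?_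
    · rw [subset_empty_iff.1 hA', measure_empty]
    · have : n - κ n x = k := hx.2
      omega

end ExactSequence

/-! ## The pointwise norm on the module generated by a functional -/

/-- Multiplication of `L^p` functions by an `L^∞` function. -/
def LpAux.mulL {X : Type*} [MeasurableSpace X] {m : Measure X} {p : ℝ≥0} [Fact (1 ≤ (p : ℝ≥0∞))]
    (a : LInfty m) : Lp ℝ p m →L[ℝ] Lp ℝ p m :=
  (ContinuousLinearMap.mul ℝ ℝ).holderL m ∞ p p a

theorem LpAux.mulL_ae {X : Type*} [MeasurableSpace X] {m : Measure X} {p : ℝ≥0}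
    [Fact (1 ≤ (p : ℝ≥0∞))] (a : LInfty m) (G : Lp ℝ p m) :
    ∀ᵐ x ∂m, LpAux.mulL a G x = a x * G x :=
  (ContinuousLinearMap.mul ℝ ℝ).coeFn_holder a G

namespace LpFunctional

variable {X : Type*} [MeasurableSpace X] {m : Measure X} {p : ℝ≥0} [Fact (1 ≤ (p : ℝ≥0∞))]
  {D : Type*} [AddCommGroup D] [Module ℝ D] (F : LpFunctional m p D)

theorem simpleMul_const (c : ℝ) (v : F.FModule) :
    F.simpleMul (fun _ => c) (IsSimple.const c) v = c • v := by
  induction v using Completion.induction_on with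
  | hp =>
    exact isClosed_eq (F.simpleMul (fun _ => c) (IsSimple.const c)).continuous
      (continuous_const_smul c)
  | ih s =>
    rw [simpleMul_coe, ← Completion.coe_smul]
    rfl

theorem const_smul_one_smul (c : ℝ) (v : F.FModule) : (c • (1 : LInfty m)) • v = c • v := by
  rw [← simpleMul_const]
  refine F.smul_eq_of_simple _ v _ (IsSimple.const c) ?_
  filter_upwards [LInfty.coe_real_smul_ae c (1 : LInfty m), LInfty.coe_one_ae (m := m)]
    with x h1 h2
  rw [h1, h2, mul_one]

instance : IsScalarTower ℝ (LInfty m) F.FModule where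
  smul_assoc c a v := by
    rw [← F.const_smul_one_smul c (a • v), smul_smul, smul_mul_assoc, one_mul]

/-- The pointwise norm of a pre-form. -/
def prePnorm (s : F.PreModule) : Lp ℝ p m := s.memLp.toLp (F.ptNorm s.val)

theorem prePnorm_ae (s : F.PreModule) : ∀ᵐ x ∂m, F.prePnorm s x = F.ptNorm s.val x :=
  MemLp.coeFn_toLp _

theorem norm_prePnorm (s : F.PreModule) : ‖F.prePnorm s‖ = ‖s‖ := Lp.norm_toLp _ _

theorem prePnorm_add_le (s t : F.PreModule) :
    F.prePnorm (s + t) ≤ F.prePnorm s + F.prePnorm t := by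
  rw [← Lp.coeFn_le]
  filter_upwards [F.prePnorm_ae s, F.prePnorm_ae t, F.prePnorm_ae (s + t),
    Lp.coeFn_add (F.prePnorm s) (F.prePnorm t), F.ptNorm_add s.cv t.cv] with x h1 h2 h3 h4 h5
  rw [h3, h4, Pi.add_apply, h1, h2]
  exact h5

theorem prePnorm_nonneg (s : F.PreModule) : 0 ≤ F.prePnorm s := by
  rw [← Lp.coeFn_nonneg]
  filter_upwards [F.prePnorm_ae s, F.ptNorm_nonneg s.cv] with x h1 h2
  rw [h1]
  exact h2

theorem prePnorm_preSMul (a : X → ℝ) (ha : IsSimple a) (s : F.PreModule) :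
    ∀ᵐ x ∂m, F.prePnorm (F.preSMul a ha s) x = |a x| * F.prePnorm s x := by
  filter_upwards [F.prePnorm_ae s, F.prePnorm_ae (F.preSMul a ha s), F.ptNorm_smul ha.1 s.cv]
    with x h1 h2 h3
  rw [h1, h2]
  exact h3

theorem prePnorm_neg (s : F.PreModule) : F.prePnorm (-s) = F.prePnorm s := by
  refine Lp.ext ?_
  filter_upwards [F.prePnorm_preSMul _ (IsSimple.const (-1)) s] with x hx
  have h1 : F.preSMul _ (IsSimple.const (-1)) s = -s := by
    rw [← neg_one_smul ℝ s]
    rfl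
  rw [h1] at hx
  rw [hx, abs_neg, abs_one, one_mul]

theorem lipschitzWith_prePnorm : LipschitzWith 1 F.prePnorm := by
  refine LipschitzWith.of_dist_le_mul fun s t => ?_
  rw [dist_eq_norm, dist_eq_norm, NNReal.coe_one, one_mul, ← norm_prePnorm]
  refine norm_le_norm_of_abs_le_abs ?_
  rw [abs_of_nonneg (F.prePnorm_nonneg _), abs_le']
  constructor
  · rw [sub_le_iff_le_add]
    simpa using F.prePnorm_add_le (s - t) t
  · rw [neg_sub, sub_le_iff_le_add, ← F.prePnorm_neg (s - t), neg_sub]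
    simpa using F.prePnorm_add_le (t - s) s

/-- The pointwise norm `|v| ∈ L^p(m)`. -/
def pnorm : F.FModule → Lp ℝ p m := Completion.extension F.prePnorm

theorem continuous_pnorm : Continuous F.pnorm := Completion.continuous_extension

theorem pnorm_coe (s : F.PreModule) : F.pnorm (s : F.FModule) = F.prePnorm s :=
  Completion.extension_coe F.lipschitzWith_prePnorm.uniformContinuous s

theorem pnorm_d (f : D) : F.pnorm (F.d f) = F.toFun f := by
  change F.pnorm ((F.single f : F.PreModule) : F.FModule) = _
  rw [pnorm_coe]
  exact Lp.ext (F.prePnorm_ae (F.single f))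

theorem norm_pnorm (v : F.FModule) : ‖F.pnorm v‖ = ‖v‖ := by
  induction v using Completion.induction_on with
  | hp => exact isClosed_eq F.continuous_pnorm.norm continuous_norm
  | ih s => rw [pnorm_coe, norm_prePnorm, Completion.norm_coe]

theorem norm_d (f : D) : ‖F.d f‖ = ‖F.toFun f‖ := by rw [← norm_pnorm, pnorm_d]

theorem pnorm_nonneg (v : F.FModule) : 0 ≤ F.pnorm v := by
  induction v using Completion.induction_on with
  | hp => exact isClosed_le continuous_const F.continuous_pnorm
  | ih s =>
    rw [pnorm_coe]
    exact F.prePnorm_nonneg s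

theorem pnorm_simpleMul (a : X → ℝ) (ha : IsSimple a) {b : LInfty m}
    (hb : ∀ᵐ x ∂m, b x = |a x|) (v : F.FModule) :
    F.pnorm (F.simpleMul a ha v) = LpAux.mulL b (F.pnorm v) := by
  induction v using Completion.induction_on with
  | hp =>
    exact isClosed_eq (F.continuous_pnorm.comp (F.simpleMul a ha).continuous)
      ((LpAux.mulL b).continuous.comp F.continuous_pnorm)
  | ih s =>
    rw [simpleMul_coe, pnorm_coe, pnorm_coe]
    refine Lp.ext ?_
    filter_upwards [F.prePnorm_preSMul a ha s, hb, LpAux.mulL_ae b (F.prePnorm s)] with x h1 h2 h3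
    rw [h1, h3, h2]

theorem isSimple_indicator {A : Set X} (hA : MeasurableSet A) :
    IsSimple (A.indicator fun _ => (1 : ℝ)) := by
  classical
  have h : A.indicator (fun _ => (1 : ℝ)) = fun x => if x ∈ A then 1 else 0 := by
    funext x
    rw [indicator_apply]
  refine ⟨⟨((finite_singleton (0 : ℝ)).insert 1).countable.mono ?_, fun d => ?_⟩, 1, fun x => ?_⟩
  · rintro _ ⟨x, rfl⟩
    by_cases hx : x ∈ A <;> simp [hx]
  · exact (measurable_const.indicator hA) (measurableSet_singleton d)
  · by_cases hx : x ∈ A <;> simp [hx]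

theorem chi_smul_eq {A : Set X} (hA : MeasurableSet A) (v : F.FModule) :
    LInfty.chi m hA • v = F.simpleMul _ (isSimple_indicator hA) v :=
  F.smul_eq_of_simple _ v _ _ (LInfty.chi_ae hA)

theorem pnorm_chi_smul {A : Set X} (hA : MeasurableSet A) (v : F.FModule) :
    F.pnorm (LInfty.chi m hA • v) = LpAux.mulL (LInfty.chi m hA) (F.pnorm v) := by
  rw [chi_smul_eq]
  refine F.pnorm_simpleMul _ _ ?_ v
  filter_upwards [LInfty.chi_ae (m := m) hA] with x hx
  rw [hx]
  by_cases h : x ∈ A <;> simp [h]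

theorem pnorm_chi_smul_ae {A : Set X} (hA : MeasurableSet A) (v : F.FModule) :
    ∀ᵐ x ∂m, F.pnorm (LInfty.chi m hA • v) x = A.indicator (F.pnorm v) x := by
  rw [pnorm_chi_smul]
  filter_upwards [LpAux.mulL_ae (LInfty.chi m hA) (F.pnorm v), LInfty.chi_mem_ae (m := m) hA]
    with x h1 h2
  rw [h1]
  by_cases h : x ∈ A
  · rw [h2.1 h, one_mul, indicator_of_mem h]
  · rw [h2.2 h, zero_mul, indicator_of_notMem h]

/-- Gluing of pointwise norms. -/
theorem pnorm_glue_ae {A : Set X} (hA : MeasurableSet A) (v w : F.FModule) :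
    ∀ᵐ x ∂m, (x ∈ A → F.pnorm (LInfty.chi m hA • v + LInfty.chi m hA.compl • w) x = F.pnorm v x) ∧
      (x ∉ A → F.pnorm (LInfty.chi m hA • v + LInfty.chi m hA.compl • w) x = F.pnorm w x) := by
  have h1 := F.pnorm_chi_smul_ae hA (LInfty.chi m hA • v + LInfty.chi m hA.compl • w)
  have h2 := F.pnorm_chi_smul_ae hA.compl (LInfty.chi m hA • v + LInfty.chi m hA.compl • w)
  rw [smul_add, smul_smul, smul_smul, LInfty.chi_mul_self, LInfty.chi_mul_compl, zero_smul,
    add_zero] at h1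
  rw [smul_add, smul_smul, smul_smul, LInfty.chi_mul_self, LInfty.chi_compl_mul, zero_smul,
    zero_add] at h2
  filter_upwards [h1, h2, F.pnorm_chi_smul_ae hA v, F.pnorm_chi_smul_ae hA.compl w]
    with x h3 h4 h5 h6
  constructor
  · intro hx
    rw [h5, indicator_of_mem hx, indicator_of_mem hx] at h3
    exact h3.symm
  · intro hx
    have hx' : x ∈ Aᶜ := hx
    rw [h6, indicator_of_mem hx', indicator_of_mem hx'] at h4
    exact h4.symm

theorem ofReal_norm_rpow (G : Lp ℝ p m) :
    ENNReal.ofReal (‖G‖ ^ (p : ℝ)) = ∫⁻ x, ‖G x‖ₑ ^ (p : ℝ) ∂m := by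
  have hp0 := NNReal.coe_pos_of_fact_one_le (p := p)
  rw [← ENNReal.ofReal_rpow_of_nonneg (norm_nonneg _) hp0.le, Lp.norm_def,
    ENNReal.ofReal_toReal (Lp.eLpNorm_ne_top G),
    eLpNorm_eq_lintegral_rpow_enorm_toReal (by exact_mod_cast hp0.ne') ENNReal.coe_ne_top,
    ENNReal.coe_toReal, ← ENNReal.rpow_mul, one_div_mul_cancel hp0.ne', ENNReal.rpow_one]

theorem ofReal_norm_chi_smul (v : F.FModule) {A : Set X} (hA : MeasurableSet A) :
    ENNReal.ofReal (‖LInfty.chi m hA • v‖ ^ (p : ℝ))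
      = ∫⁻ x in A, ‖F.pnorm v x‖ₑ ^ (p : ℝ) ∂m := by
  have hp0 := NNReal.coe_pos_of_fact_one_le (p := p)
  rw [← norm_pnorm, ofReal_norm_rpow, ← lintegral_indicator hA]
  refine lintegral_congr_ae ?_
  filter_upwards [F.pnorm_chi_smul_ae hA v] with x hx
  rw [hx]
  by_cases h : x ∈ A
  · simp [h]
  · simp [h, hp0]

/-- The module generated by a functional is an `L^p`-normed module. -/
theorem isLpModule : IsLpModule m p F.FModule where
  norm_smul_le a C hC0 hC v := F.norm_smul_le_of_bound a hC0 hC v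
  norm_rpow {A} hA v := by
    rw [← ENNReal.ofReal_eq_ofReal_iff (by positivity) (by positivity),
      ENNReal.ofReal_add (by positivity) (by positivity), ofReal_norm_chi_smul,
      ofReal_norm_chi_smul, lintegral_add_compl _ hA, ← norm_pnorm, ofReal_norm_rpow]
  tendsto_zero A hA hA' hA'' v := by
    have hp0 := NNReal.coe_pos_of_fact_one_le (p := p)
    -- The density `|v|^p` defines a finite measure, and order continuity of the norm is its
    -- continuity from above.
    set ν := m.withDensity fun x => ‖F.pnorm v x‖ₑ ^ (p : ℝ) with hν
    have hνA : ∀ n, ν (A n) = ENNReal.ofReal (‖LInfty.chi m (hA n) • v‖ ^ (p : ℝ)) := fun n => by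
      rw [hν, withDensity_apply _ (hA n), ofReal_norm_chi_smul]
    have h1 := tendsto_measure_iInter_atTop (μ := ν) (fun n => (hA n).nullMeasurableSet) hA'
      ⟨0, by rw [hνA]; exact ENNReal.ofReal_ne_top⟩
    rw [hA'', measure_empty] at h1
    simp only [Function.comp_def, hνA] at h1
    have h2 := (ENNReal.tendsto_toReal ENNReal.zero_ne_top).comp h1
    simp only [Function.comp_def, ENNReal.toReal_zero] at h2
    rw [tendsto_zero_iff_norm_tendsto_zero]
    have h3 := h2.rpow_const (p := 1 / (p : ℝ)) (Or.inr (by positivity))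
    rw [Real.zero_rpow (by positivity)] at h3
    refine h3.congr fun n => ?_
    rw [ENNReal.toReal_ofReal (by positivity), ← Real.rpow_mul (norm_nonneg _),
      mul_one_div_cancel hp0.ne', Real.rpow_one]

/-- The module is generated by the differentials, by gluing and passing to limits. -/
theorem mem_of_isClosed {S : Set F.FModule} (hS : IsClosed S) (hd : ∀ f, F.d f ∈ S)
    (hglue : ∀ {A : Set X} (hA : MeasurableSet A), ∀ v ∈ S, ∀ w ∈ S,
      LInfty.chi m hA • v + LInfty.chi m hA.compl • w ∈ S) (v : F.FModule) : v ∈ S := by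
  induction v using Completion.induction_on with
  | hp => exact hS
  | ih s =>
    rcases isEmpty_or_nonempty X with hX | hX
    · have : s = F.single 0 := Subtype.ext (Subsingleton.elim _ _)
      rw [this]
      exact hd 0
    -- A pre-form is built by gluing `d (e n)` onto one fibre after another. The partial results
    -- tend to it in norm, so a closed set stable under gluing contains it. Repetitions in the
    -- enumeration are harmless.
    obtain ⟨e, he⟩ := s.cv.1.exists_eq_range (range_nonempty _)
    have hC : ∀ n, MeasurableSet (s.val ⁻¹' {e n}) := fun n => s.cv.2 _
    have hT : ∀ n : ℕ, MeasurableSet (⋃ i ∈ Finset.range n, s.val ⁻¹' {e i}) := fun n =>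
      Finset.measurableSet_biUnion _ fun i _ => hC i
    have hmem : ∀ n : ℕ, LInfty.chi m (hT n) • (s : F.FModule) ∈ S := by
      intro n
      induction n with
      | zero =>
        have : LInfty.chi m (hT 0) = 0 := by
          rw [LInfty.chi_eq_zero_iff]
          simp
        rw [this, zero_smul, ← map_zero F.d]
        exact hd 0
      | succ n ih =>
        have h1 := hglue (hC n) _ (hd (e n)) _ ih
        have h2 : LInfty.chi m (hC n) • F.d (e n) = LInfty.chi m (hC n) • (s : F.FModule) := by
          change LInfty.chi m (hC n) • ((F.single (e n) : F.PreModule) : F.FModule) = _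
          rw [chi_smul_eq, chi_smul_eq, simpleMul_coe, simpleMul_coe]
          congr 1
          refine Subtype.ext (funext fun x => ?_)
          change (s.val ⁻¹' {e n}).indicator (fun _ => (1 : ℝ)) x • e n
            = (s.val ⁻¹' {e n}).indicator (fun _ => (1 : ℝ)) x • s.val x
          by_cases hx : x ∈ s.val ⁻¹' {e n}
          · rw [show s.val x = e n from hx]
          · rw [indicator_of_notMem hx, zero_smul, zero_smul]
        rw [h2, smul_smul, LInfty.chi_mul, ← add_smul, ← LInfty.chi_union _ _
          (disjoint_left.2 fun x hx hx' => hx'.1 hx)] at h1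
        convert h1 using 3
        rw [Finset.range_add_one, Finset.set_biUnion_insert, union_inter_distrib_left,
          union_compl_self, univ_inter]
    refine hS.mem_of_tendsto (F.isLpModule.tendsto_chi_smul hT (fun i j hij => ?_) ?_ _)
      (Eventually.of_forall hmem)
    · refine biUnion_subset_biUnion_left fun k hk => ?_
      exact Finset.mem_range.2 ((Finset.mem_range.1 hk).trans_le hij)
    · have : (⋃ n : ℕ, ⋃ i ∈ Finset.range n, s.val ⁻¹' {e i}) = univ := by
        refine eq_univ_of_forall fun x => ?_
        have hx : s.val x ∈ range e := he ▸ mem_range_self x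
        obtain ⟨n, hn⟩ := hx
        exact mem_iUnion.2 ⟨n + 1, mem_biUnion (Finset.mem_range.2 n.lt_succ_self) hn.symm⟩
      rw [this, compl_univ, measure_empty]

end LpFunctional

/-! ## Convergence in `L^0(m)` -/

section LZero

variable {X : Type*} [MeasurableSpace X] {m : Measure X}

/-- A finite measure is absolutely continuous in the `ε`-`δ` sense: sets of small `μ`-measure have
small `ν`-measure, because the density is integrable. -/
theorem MeasureTheory.TendstoInMeasure.of_absolutelyContinuous {ι : Type*} {l : Filter ι}
    {μ ν : Measure X} [SigmaFinite μ] [IsFiniteMeasure ν] (hνμ : ν ≪ μ) {u : ι → X → ℝ}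
    {f : X → ℝ} (h : TendstoInMeasure μ u l f) : TendstoInMeasure ν u l f := by
  intro ε hε
  have h1 := tendsto_setLIntegral_zero (μ := μ) (f := ν.rnDeriv μ)
    (Measure.lintegral_rnDeriv_lt_top ν μ).ne (h ε hε)
  refine h1.congr fun n => ?_
  rw [← withDensity_apply', Measure.withDensity_rnDeriv_eq _ _ hνμ]

/-- One finite measure equivalent to `m` replaces all restrictions to sets of finite measure.
Subsequences converging a.e. and diagonal sequences then become available. -/
theorem tendstoL0_iff [SigmaFinite m] {u : ℕ → X → ℝ} {f : X → ℝ} :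
    TendstoL0 m u f ↔ TendstoInMeasure m.toFinite u atTop f := by
  refine ⟨fun h ε hε => ?_, fun h A _ hmA => ?_⟩
  · rw [ENNReal.tendsto_atTop_zero]
    intro δ hδ
    have hμ : Tendsto (fun k => m.toFinite (spanningSets m k)ᶜ) atTop (𝓝 0) := by
      have h1 := tendsto_measure_iInter_atTop (μ := m.toFinite)
        (s := fun k => (spanningSets m k)ᶜ)
        (fun k => (measurableSet_spanningSets m k).compl.nullMeasurableSet)
        (fun i j hij => compl_subset_compl.2 (monotone_spanningSets m hij))
        ⟨0, measure_ne_top _ _⟩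
      rwa [← compl_iUnion, iUnion_spanningSets, compl_univ, measure_empty] at h1
    obtain ⟨k, hk⟩ := (hμ.eventually_lt_const (ENNReal.half_pos hδ.ne')).exists
    have h2 : TendstoInMeasure (m.toFinite.restrict (spanningSets m k)) u atTop f := by
      have : IsFiniteMeasure (m.restrict (spanningSets m k)) :=
        ⟨by simpa using measure_spanningSets_lt_top m k⟩
      refine TendstoInMeasure.of_absolutelyContinuous
        ((toFinite_absolutelyContinuous m).restrict _)
        (h _ (measurableSet_spanningSets m k) (measure_spanningSets_lt_top m k))
    obtain ⟨N, hN⟩ := ENNReal.tendsto_atTop_zero.1 (h2 ε hε) (δ / 2) (ENNReal.half_pos hδ.ne')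
    refine ⟨N, fun n hn => ?_⟩
    have h3 := hN n hn
    rw [Measure.restrict_apply' (measurableSet_spanningSets m k)] at h3
    rw [← ENNReal.add_halves δ]
    refine (measure_le_inter_add_sdiff _ _ (spanningSets m k)).trans (add_le_add h3 ?_)
    exact (measure_mono fun x hx => hx.2).trans hk.le
  · have : IsFiniteMeasure (m.restrict A) := ⟨by simpa using hmA⟩
    exact h.of_absolutelyContinuous
      (Measure.restrict_le_self.absolutelyContinuous.trans (absolutelyContinuous_toFinite m))

namespace TendstoL0

variable {u v : ℕ → X → ℝ} {f g : X → ℝ}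

theorem comp (h : TendstoL0 m u f) {φ : ℕ → ℕ} (hφ : Tendsto φ atTop atTop) :
    TendstoL0 m (fun n => u (φ n)) f := fun A hA hmA => (h A hA hmA).comp hφ

theorem sub (hu : TendstoL0 m u f) (hv : TendstoL0 m v g) :
    TendstoL0 m (fun n => u n - v n) (f - g) := by
  have h := hu.add (hv.const_smul (-1))
  simpa only [neg_smul, one_smul, ← sub_eq_add_neg] using h

theorem of_tendsto_ae (hu : ∀ n, AEStronglyMeasurable (u n) m)
    (h : ∀ᵐ x ∂m, Tendsto (fun n => u n x) atTop (𝓝 (f x))) : TendstoL0 m u f := by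
  intro A _ hmA
  have : IsFiniteMeasure (m.restrict A) := ⟨by simpa using hmA⟩
  exact tendstoInMeasure_of_tendsto_ae (fun n => (hu n).restrict) (ae_restrict_of_ae h)

theorem exists_subseq_ae [SigmaFinite m] (h : TendstoL0 m u f) :
    ∃ φ : ℕ → ℕ, StrictMono φ ∧ ∀ᵐ x ∂m, Tendsto (fun n => u (φ n) x) atTop (𝓝 (f x)) := by
  obtain ⟨φ, hφ, h1⟩ := (tendstoL0_iff.1 h).exists_seq_tendsto_ae
  exact ⟨φ, hφ, (absolutelyContinuous_toFinite m).ae_le h1⟩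

theorem of_tendsto_Lp {p : ℝ≥0∞} [Fact (1 ≤ p)] {G : ℕ → Lp ℝ p m} {G' : Lp ℝ p m}
    (h : Tendsto G atTop (𝓝 G')) : TendstoL0 m (fun n => G n) G' :=
  fun _ _ _ ε hε => tendsto_of_tendsto_of_tendsto_of_le_of_le tendsto_const_nhds
    (tendstoInMeasure_of_tendsto_Lp h ε hε) (fun _ => zero_le)
    fun _ => Measure.restrict_apply_le _ _

/-- A diagonal argument: convergence in `L^0(m)` is given by a metric. -/
theorem diagonal [SigmaFinite m] {fk : ℕ → X → ℝ} (hf : TendstoL0 m fk f) {u : ℕ → ℕ → X → ℝ}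
    (hu : ∀ k, TendstoL0 m (u k) (fk k)) {P : ℕ → ℕ → Prop} (hP : ∀ k, ∀ᶠ n in atTop, P k n) :
    ∃ n : ℕ → ℕ, (∀ k, P k (n k)) ∧ TendstoL0 m (fun k => u k (n k)) f := by
  have hε : ∀ k : ℕ, (0 : ℝ≥0∞) < ((k : ℝ≥0∞) + 1)⁻¹ := fun k =>
    ENNReal.inv_pos.2 (ENNReal.add_ne_top.2 ⟨ENNReal.natCast_ne_top k, ENNReal.one_ne_top⟩)
  have hlim : Tendsto (fun k : ℕ => ((k : ℝ≥0∞) + 1)⁻¹) atTop (𝓝 0) := by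
    have := (tendsto_add_atTop_iff_nat 1).2 ENNReal.tendsto_inv_nat_nhds_zero
    simpa using this
  -- The index is chosen so that `u k n` is within `1/(k+1)` of `fk k` outside a set of measure
  -- below `1/(k+1)`, besides satisfying `P`.
  have hex : ∀ k, ∃ n, P k n ∧
      m.toFinite {x | ((k : ℝ≥0∞) + 1)⁻¹ ≤ edist (u k n x) (fk k x)} < ((k : ℝ≥0∞) + 1)⁻¹ :=
    fun k => ((hP k).and
      ((tendstoL0_iff.1 (hu k) _ (hε k)).eventually_lt_const (hε k))).exists
  choose n hn hn' using hex
  refine ⟨n, hn, tendstoL0_iff.2 fun ε hε => ?_⟩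
  have h1 := tendstoL0_iff.1 hf (ε / 2) (ENNReal.half_pos hε.ne')
  have h2 := hlim.add h1
  rw [add_zero] at h2
  refine tendsto_of_tendsto_of_tendsto_of_le_of_le' tendsto_const_nhds h2
    (Eventually.of_forall fun _ => zero_le) ?_
  filter_upwards [hlim.eventually_lt_const (ENNReal.half_pos hε.ne')] with k hk
  refine (measure_mono fun x hx => ?_).trans
    ((measure_union_le _ _).trans (add_le_add (hn' k).le le_rfl))
  by_contra hcon
  simp only [mem_union, mem_ofPred_eq, not_or, not_le] at hcon
  have h4 := (edist_triangle (u k (n k) x) (fk k x) (f x)).trans_lt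
    (ENNReal.add_lt_add (hcon.1.trans hk) hcon.2)
  rw [ENNReal.add_halves] at h4
  exact absurd hx (not_le.2 h4)

end TendstoL0

end LZero

/-! ## Calculus of the local Lipschitz constant -/

section LipCalculus

variable {X : Type*} [MetricSpace X]

theorem lipConst_mono {f g : X → ℝ} {x : X}
    (h : ∀ᶠ y in 𝓝 x, edist (f y) (f x) ≤ edist (g y) (g x)) : lipConst f x ≤ lipConst g x := by
  refine limsup_le_limsup ?_
  filter_upwards [nhdsWithin_le_nhds h] with y hy
  gcongr

theorem lipConst_congr {f g : X → ℝ} {x : X} (h : f =ᶠ[𝓝 x] g) : lipConst f x = lipConst g x := by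
  have hx := h.eq_of_nhds
  exact le_antisymm (lipConst_mono (h.mono fun y hy => by rw [hy, hx]))
    (lipConst_mono (h.mono fun y hy => by rw [hy, hx]))

theorem locLip_eq_zero_of_eventuallyEq {f : X → ℝ} {x : X} (h : f =ᶠ[𝓝 x] 0) :
    locLip f x = 0 := by
  have : locLip (0 : X → ℝ) x = 0 := by simpa using locLip_smul 0 (0 : X → ℝ) x
  rw [← this, locLip, locLip, lipConst_congr h]

theorem LipschitzWith.lipConst_ne_top {f : X → ℝ} {K : ℝ≥0} (hf : LipschitzWith K f) (x : X) :
    lipConst f x ≠ ∞ := ((lipConst_le hf x).trans_lt ENNReal.coe_lt_top).ne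

theorem LipschitzWith.locLip_le {f : X → ℝ} {K : ℝ≥0} (hf : LipschitzWith K f) (x : X) :
    locLip f x ≤ K :=
  ENNReal.toReal_le_coe_of_le_coe (lipConst_le hf x)

theorem locLip_mono {f g : X → ℝ} {x : X} {K : ℝ≥0} (hg : LipschitzWith K g)
    (h : ∀ᶠ y in 𝓝 x, edist (f y) (f x) ≤ edist (g y) (g x)) : locLip f x ≤ locLip g x :=
  ENNReal.toReal_mono (hg.lipConst_ne_top x) (lipConst_mono h)

/-- The Leibniz rule for the local Lipschitz constant. -/
theorem lipConst_mul_sub_le {φ g : X → ℝ} {K : ℝ≥0} (hφ : LipschitzWith K φ) {x : X}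
    (hg : ContinuousAt g x) (c : ℝ) :
    lipConst (φ * g - c • g) x ≤ ‖φ x - c‖ₑ * lipConst g x + ‖g x‖ₑ * lipConst φ x := by
  by_cases hx : 𝓝[≠] x = ⊥
  · simp [lipConst, hx]
  have : NeBot (𝓝[≠] x) := ⟨hx⟩
  have hlim : limsup (fun y => ‖g y‖ₑ) (𝓝[≠] x) = ‖g x‖ₑ :=
    (hg.enorm.tendsto.mono_left nhdsWithin_le_nhds).limsup_eq
  have h1 : limsup (fun y => ‖g y‖ₑ * (edist (φ y) (φ x) / edist y x)) (𝓝[≠] x)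
      ≤ ‖g x‖ₑ * lipConst φ x := by
    rw [← hlim]
    exact ENNReal.limsup_mul_le' (Or.inr (hφ.lipConst_ne_top x))
      (Or.inl (by rw [hlim]; exact enorm_ne_top))
  rw [lipConst, lipConst, ← ENNReal.limsup_const_mul_of_ne_top enorm_ne_top]
  refine le_trans (limsup_le_limsup (Eventually.of_forall fun y => ?_))
    ((ennreal_limsup_add_le _ _ _).trans (add_le_add le_rfl h1))
  simp only [Pi.add_apply, ← mul_div_assoc, ← ENNReal.add_div]
  gcongr
  -- The identity behind the estimate is `φ(y)g(y) - φ(x)g(x) - c(g(y) - g(x)) = (φ(x) - c)(g(y) -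
  -- g(x)) + g(y)(φ(y) - φ(x))`. The constant `c` will be the value at `x` of a simple approximation
  -- of `φ`.
  rw [edist_eq_enorm_sub, edist_eq_enorm_sub, edist_eq_enorm_sub, ← enorm_mul, ← enorm_mul]
  refine le_trans (le_of_eq ?_) (enorm_add_le _ _)
  congr 1
  simp only [Pi.sub_apply, Pi.mul_apply, Pi.smul_apply, smul_eq_mul]
  ring

theorem locLip_mul_sub_le {φ g : X → ℝ} {K L : ℝ≥0} (hφ : LipschitzWith K φ)
    (hg : LipschitzWith L g) (x : X) (c : ℝ) :
    locLip (φ * g - c • g) x ≤ |φ x - c| * locLip g x + |g x| * locLip φ x := by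
  have h := lipConst_mul_sub_le hφ hg.continuous.continuousAt (x := x) c
  have h1 := ENNReal.mul_ne_top (enorm_ne_top (x := φ x - c)) (hg.lipConst_ne_top x)
  have h2 := ENNReal.mul_ne_top (enorm_ne_top (x := g x)) (hφ.lipConst_ne_top x)
  have h3 := ENNReal.toReal_mono (ENNReal.add_ne_top.2 ⟨h1, h2⟩) h
  rwa [ENNReal.toReal_add h1 h2, ENNReal.toReal_mul, ENNReal.toReal_mul, toReal_enorm,
    toReal_enorm] at h3

theorem lipschitzWith_mul_of_bounded {φ g : X → ℝ} {K L : ℝ≥0} (hφ : LipschitzWith K φ)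
    (hg : LipschitzWith L g) (hφ1 : ∀ x, |φ x| ≤ 1) (hg1 : ∀ x, |g x| ≤ 1) :
    LipschitzWith (K + L) (φ * g) := by
  refine LipschitzWith.of_dist_le_mul fun x y => ?_
  have h1 := hφ.dist_le_mul x y
  have h2 := hg.dist_le_mul x y
  rw [Real.dist_eq] at h1 h2 ⊢
  simp only [Pi.mul_apply]
  rw [show φ x * g x - φ y * g y = (φ x - φ y) * g x + φ y * (g x - g y) by ring]
  refine (abs_add_le _ _).trans ?_
  rw [abs_mul, abs_mul, NNReal.coe_add, add_mul]
  refine add_le_add ?_ ?_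
  · exact (mul_le_of_le_one_right (abs_nonneg _) (hg1 x)).trans h1
  · exact (mul_le_of_le_one_left (abs_nonneg _) (hφ1 y)).trans h2

/-- Truncation at heights `±1`. -/
def truncOne (t : ℝ) : ℝ := max (-1) (min 1 t)

theorem lipschitzWith_truncOne : LipschitzWith 1 truncOne :=
  (LipschitzWith.id.const_min 1).const_max (-1)

theorem abs_truncOne_le (t : ℝ) : |truncOne t| ≤ 1 :=
  abs_le.2 ⟨le_max_left _ _, max_le (by norm_num) (min_le_left _ _)⟩

theorem truncOne_of_abs_le {t : ℝ} (h : |t| ≤ 1) : truncOne t = t := by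
  rw [abs_le] at h
  rw [truncOne, min_eq_right h.2, max_eq_right h.1]

theorem abs_truncOne_le_abs (t : ℝ) : |truncOne t| ≤ |t| := by
  have h := lipschitzWith_truncOne.dist_le_mul t 0
  have h0 : truncOne 0 = 0 := truncOne_of_abs_le (by simp)
  simpa [h0, Real.dist_eq] using h

/-- The part cut off by truncation is `1`-Lipschitz, so the differential of `u.trunc - u` is bounded
by that of `u` without a factor `2`. The proof checks the cases of the piecewise linear formula. -/
theorem edist_truncOne_sub_le (s t : ℝ) :
    edist (truncOne s - s) (truncOne t - t) ≤ edist s t := by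
  rw [edist_dist, edist_dist]
  refine ENNReal.ofReal_le_ofReal ?_
  rw [Real.dist_eq, Real.dist_eq, truncOne, truncOne]
  rcases le_total s t with h | h <;> rcases max_cases (-1) (min 1 s) with h1 | h1 <;>
    rcases max_cases (-1) (min 1 t) with h2 | h2 <;> rcases min_cases 1 s with h3 | h3 <;>
    rcases min_cases 1 t with h4 | h4 <;> rw [abs_le] <;>
    rcases abs_cases (s - t) with h5 | h5 <;> constructor <;> linarith

variable [MeasurableSpace X] [BorelSpace X] {m : Measure X} {p : ℝ≥0}

/-- Functions whose oscillation is dominated by that of a function in the domain. -/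
def LipDomain.ofEdistLe (u : LipDomain m p) (g : X → ℝ)
    (h : ∀ x y, edist (g x) (g y) ≤ edist (u.val x) (u.val y)) : LipDomain m p :=
  ⟨g, ⟨u.lip.choose, fun x y => (h x y).trans (u.lip.choose_spec x y)⟩,
    u.memLp.mono' (locLip_measurable (LipschitzWith.continuous fun x y =>
      (h x y).trans (u.lip.choose_spec x y))).aestronglyMeasurable (ae_of_all _ fun x => by
        rw [Real.norm_of_nonneg (locLip_nonneg _ _)]
        exact locLip_mono u.lip.choose_spec (Eventually.of_forall fun y => h y x))⟩

/-- The truncation of a function in the domain. -/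
def LipDomain.trunc (u : LipDomain m p) : LipDomain m p :=
  u.ofEdistLe (fun x => truncOne (u.val x)) fun x y => by
    simpa using lipschitzWith_truncOne (u.val x) (u.val y)

theorem LipDomain.memLp_mul (u : LipDomain m p) {φ : X → ℝ} {K : ℝ≥0} (hφ : LipschitzWith K φ)
    (hφ1 : ∀ x, |φ x| ≤ 1) (hφK : MemLp (locLip φ) p m) (hu1 : ∀ x, |u.val x| ≤ 1) :
    MemLp (locLip (φ * u.val)) p m := by
  have hc := (lipschitzWith_mul_of_bounded hφ u.lip.choose_spec hφ1 hu1).continuous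
  refine (u.memLp.add hφK).mono' (locLip_measurable hc).aestronglyMeasurable
    (ae_of_all _ fun x => ?_)
  rw [Real.norm_of_nonneg (locLip_nonneg _ _)]
  have h := locLip_mul_sub_le hφ u.lip.choose_spec x 0
  rw [zero_smul, sub_zero, sub_zero] at h
  refine h.trans (add_le_add ?_ ?_)
  · exact mul_le_of_le_one_left (locLip_nonneg _ _) (hφ1 x)
  · exact mul_le_of_le_one_left (locLip_nonneg _ _) (hu1 x)

/-- The product of a function in the domain with a Lipschitz function, both bounded by `1`. -/
def LipDomain.mul (u : LipDomain m p) {φ : X → ℝ} {K : ℝ≥0} (hφ : LipschitzWith K φ)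
    (hφ1 : ∀ x, |φ x| ≤ 1) (hφK : MemLp (locLip φ) p m) (hu1 : ∀ x, |u.val x| ≤ 1) :
    LipDomain m p :=
  ⟨φ * u.val, ⟨_, lipschitzWith_mul_of_bounded hφ u.lip.choose_spec hφ1 hu1⟩,
    u.memLp_mul hφ hφ1 hφK hu1⟩

variable [Fact (1 ≤ (p : ℝ≥0∞))]

theorem lipFunctional_toFun_ae (u : LipDomain m p) :
    ∀ᵐ x ∂m, (lipFunctional m p).toFun u x = locLip u.val x := u.memLp.coeFn_toLp

theorem norm_dLip (u : LipDomain m p) : ‖dLip m p u‖ = ‖(lipFunctional m p).toFun u‖ :=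
  (lipFunctional m p).norm_d u

/-- The Leibniz rule `d (φ g) ≈ φ d g`, with an error bounded by `|g| lip φ`. -/
theorem norm_dLip_mul_sub_le {g h : LipDomain m p} {φ : X → ℝ} {K : ℝ≥0}
    (hφ : LipschitzWith K φ) (hh : h.val = φ * g.val) {a : LInfty m} (ha : ∀ᵐ x ∂m, a x = φ x)
    {G : Lp ℝ p m} (hG : ∀ᵐ x ∂m, |g.val x| * locLip φ x ≤ G x) :
    ‖dLip m p h - a • dLip m p g‖ ≤ ‖G‖ := by
  set F := lipFunctional m p with hF
  -- Only simple multipliers act on pre-forms. On the fibre `{b n = c}` the difference is the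
  -- differential of `h - c g`, to which the pointwise Leibniz estimate with this `c` applies;
  -- replacing `a` by `b n` costs `ε` twice.
  obtain ⟨b, hb, hab⟩ := a.exists_simple
  have key : ∀ n : ℕ, ‖dLip m p h - a • dLip m p g‖
      ≤ ‖G‖ + 2 * (1 / ((n : ℝ) + 1)) * ‖dLip m p g‖ := by
    intro n
    set ε : ℝ := 1 / ((n : ℝ) + 1) with hε
    have hε0 : 0 ≤ ε := by positivity
    have h1 : ‖a • dLip m p g - F.simpleMul (b n) (hb n) (dLip m p g)‖ ≤ ε * ‖dLip m p g‖ :=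
      F.smul_sub_le a _ (b n) (hb n) ε hε0 (hab n)
    have h2 : dLip m p h - F.simpleMul (b n) (hb n) (dLip m p g)
        = ((F.single h - F.preSMul (b n) (hb n) (F.single g) : F.PreModule) : F.FModule) := by
      rw [Completion.coe_sub, ← F.simpleMul_coe]
      rfl
    have h3 : ‖dLip m p h - F.simpleMul (b n) (hb n) (dLip m p g)‖
        ≤ ‖ε • F.toFun g + G‖ := by
      rw [h2, Completion.norm_coe, ← F.norm_prePnorm]
      refine Lp.norm_le_norm_of_ae_le ?_
      have h4 : ∀ᵐ x ∂m, F.toFun (h - b n x • g) x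
          ≤ |φ x - b n x| * locLip g.val x + |g.val x| * locLip φ x := by
        refine (hb n).1.ae₂ (hb n).1 (P := fun c _ x => F.toFun (h - c • g) x
          ≤ |φ x - c| * locLip g.val x + |g.val x| * locLip φ x) fun c _ => ?_
        filter_upwards [lipFunctional_toFun_ae (h - c • g)] with x hx
        rw [hx]
        have h5 : (h - c • g).val = φ * g.val - c • g.val := by
          rw [← hh]
          rfl
        rw [h5]
        exact locLip_mul_sub_le hφ g.lip.choose_spec x c
      filter_upwards [h4, F.prePnorm_ae (F.single h - F.preSMul (b n) (hb n) (F.single g)),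
        (Lp.coeFn_nonneg _).2
          (F.prePnorm_nonneg (F.single h - F.preSMul (b n) (hb n) (F.single g))),
        Lp.coeFn_add (ε • F.toFun g) G, Lp.coeFn_smul ε (F.toFun g), lipFunctional_toFun_ae g,
        hG, ha, hab n] with x k1 k2 k3 k4 k5 k6 k7 k8 k9
      rw [Real.norm_of_nonneg k3, k2, k4, Pi.add_apply, k5, Pi.smul_apply, k6]
      refine le_trans (le_trans k1 (add_le_add ?_ k7)) (Real.le_norm_self _)
      rw [smul_eq_mul]
      refine mul_le_mul_of_nonneg_right ?_ (locLip_nonneg _ _)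
      rwa [← k8]
    have h6 : ‖ε • F.toFun g + G‖ ≤ ε * ‖dLip m p g‖ + ‖G‖ := by
      refine (norm_add_le _ _).trans (add_le_add (le_of_eq ?_) le_rfl)
      rw [norm_smul, Real.norm_of_nonneg hε0, norm_dLip]
    calc _ ≤ ‖dLip m p h - F.simpleMul (b n) (hb n) (dLip m p g)‖
          + ‖F.simpleMul (b n) (hb n) (dLip m p g) - a • dLip m p g‖ := norm_sub_le_norm_sub_add_norm_sub _ _ _
      _ ≤ _ := by
          rw [norm_sub_rev (F.simpleMul _ _ _)]
          linarith
  have hlim : Tendsto (fun n : ℕ => ‖G‖ + 2 * (1 / ((n : ℝ) + 1)) * ‖dLip m p g‖) atTop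
      (𝓝 ‖G‖) := by
    simpa using ((tendsto_one_div_add_atTop_nhds_zero_nat (𝕜 := ℝ)).const_mul 2).mul_const
      ‖dLip m p g‖ |>.const_add ‖G‖
  exact ge_of_tendsto' hlim key

/-- Truncation changes the differential only where the function exceeds `1`. -/
theorem norm_dLip_trunc_sub_le (u : LipDomain m p) :
    ‖dLip m p u.trunc - dLip m p u‖ ≤ ‖LInfty.chi m (A := {x | 1 ≤ |u.val x|})
      (measurableSet_le measurable_const u.continuous.measurable.abs) • dLip m p u‖ := by
  set F := lipFunctional m p with hF
  rw [← map_sub, norm_dLip, ← F.norm_pnorm]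
  refine Lp.norm_le_norm_of_ae_le ?_
  filter_upwards [lipFunctional_toFun_ae (u.trunc - u),
    F.pnorm_chi_smul_ae (A := {x | 1 ≤ |u.val x|})
      (measurableSet_le measurable_const u.continuous.measurable.abs) (dLip m p u),
    lipFunctional_toFun_ae u] with x h1 h2 h3
  rw [h1, h2]
  have h4 : F.pnorm (dLip m p u) = F.toFun u := F.pnorm_d u
  rw [h4]
  -- Where `|u| < 1`, truncation is the identity near the point by continuity, so the slope of the
  -- difference vanishes.
  by_cases hx : 1 ≤ |u.val x|
  · rw [indicator_of_mem (show x ∈ {x | 1 ≤ |u.val x|} from hx), h3,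
      Real.norm_of_nonneg (locLip_nonneg _ _), Real.norm_of_nonneg (locLip_nonneg _ _)]
    exact locLip_mono u.lip.choose_spec
      (Eventually.of_forall fun y => edist_truncOne_sub_le (u.val y) (u.val x))
  · rw [locLip_eq_zero_of_eventuallyEq, norm_zero]
    · exact norm_nonneg _
    · have h5 : ∀ᶠ y in 𝓝 x, |u.val y| < 1 :=
        u.continuous.abs.continuousAt.eventually_lt_const (not_le.1 hx)
      filter_upwards [h5] with y hy
      change truncOne (u.val y) - u.val y = 0
      rw [truncOne_of_abs_le hy.le, sub_self]

end LipCalculus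

/-! ## Limits of differentials, the `Lipschitz_0` module -/

theorem LpAux.tendsto_norm_of_dominated {X : Type*} [MeasurableSpace X] {m : Measure X}
    {p : ℝ≥0} [Fact (1 ≤ (p : ℝ≥0∞))] {G : ℕ → Lp ℝ p m} {H : Lp ℝ p m} {b : ℕ → X → ℝ}
    (hb : ∀ n x, |b n x| ≤ 1) (hb0 : ∀ᵐ x ∂m, Tendsto (fun n => b n x) atTop (𝓝 0))
    (hG : ∀ n, ∀ᵐ x ∂m, G n x = b n x * H x) : Tendsto (fun n => ‖G n‖) atTop (𝓝 0) := by
  have hp0 := NNReal.coe_pos_of_fact_one_le (p := p)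
  have h1 : Tendsto (fun n => ∫⁻ x, ‖G n x‖ₑ ^ (p : ℝ) ∂m) atTop (𝓝 (∫⁻ _, 0 ∂m)) := by
    refine tendsto_lintegral_of_dominated_convergence' (fun x => ‖H x‖ₑ ^ (p : ℝ))
      (fun n => by fun_prop) (fun n => ?_) ?_ ?_
    · filter_upwards [hG n] with x hx
      rw [hx, enorm_mul]
      gcongr
      refine mul_le_of_le_one_left zero_le ?_
      have h1 : ‖(1 : ℝ)‖ₑ = 1 := by simp
      rw [← h1, enorm_le_iff_norm_le, norm_one]
      exact hb n x
    · rw [← LpFunctional.ofReal_norm_rpow]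
      exact ENNReal.ofReal_ne_top
    · filter_upwards [hb0, ae_all_iff.2 hG] with x h2 h3
      have h4 : Tendsto (fun n => G n x) atTop (𝓝 0) := by
        simpa [h3] using h2.mul_const (H x)
      have h5 := (h4.enorm).ennrpow_const (p : ℝ)
      simpa [hp0] using h5
  rw [lintegral_zero] at h1
  simp only [← LpFunctional.ofReal_norm_rpow] at h1
  have h2 := (ENNReal.tendsto_toReal ENNReal.zero_ne_top).comp h1
  have h3 : Tendsto (fun n => ‖G n‖ ^ (p : ℝ)) atTop (𝓝 0) := by
    refine h2.congr fun n => ?_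
    exact ENNReal.toReal_ofReal (by positivity)
  have h4 := h3.rpow_const (p := (p : ℝ)⁻¹) (Or.inr (by positivity))
  rw [Real.zero_rpow (by positivity)] at h4
  refine h4.congr fun n => ?_
  rw [← Real.rpow_mul (norm_nonneg _), mul_inv_cancel₀ hp0.ne', Real.rpow_one]

theorem IsLpModule.tendsto_chi_smul_iUnion {X : Type*} [MeasurableSpace X] {m : Measure X}
    {p : ℝ≥0} {E : Type*} [NormedAddCommGroup E] [Module (LInfty m) E]
    (hE : IsLpModule m p E) {A : ℕ → Set X} (hA : ∀ n, MeasurableSet (A n)) (hmono : Monotone A)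
    (v : E) : Tendsto (fun n => LInfty.chi m (hA n) • v) atTop
      (𝓝 (LInfty.chi m (MeasurableSet.iUnion hA) • v)) := by
  refine hE.tendsto_smul (C := 1) (fun n => LInfty.abs_chi_le (hA n)) ?_ v
  filter_upwards [ae_all_iff.2 fun n => LInfty.chi_ae (m := m) (hA n),
    LInfty.chi_ae (m := m) (MeasurableSet.iUnion hA)] with x h1 h2
  simp only [h1, h2]
  exact (hmono.tendsto_indicator A (fun _ => (1 : ℝ)) x).mono_right (pure_le_nhds _)

section LimitSet

variable {X : Type*} [MetricSpace X] [MeasurableSpace X] [BorelSpace X] (m : Measure X) (p : ℝ≥0)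
  [Fact (1 ≤ (p : ℝ≥0∞))]

/-- The limits of `d_lip u_n` along sequences `u_n → f` in `L^0(m)`. -/
def lipLimitSet (f : X → ℝ) : Set (LipModule m p) :=
  {ω | ∃ u : ℕ → LipDomain m p, TendstoL0 m (fun n => (u n).val) f ∧
    Tendsto (fun n => dLip m p (u n)) atTop (𝓝 ω)}

variable {m p}

theorem dLip_mem_lipLimitSet (f : LipDomain m p) : dLip m p f ∈ lipLimitSet m p f.val :=
  ⟨fun _ => f, TendstoL0.const _, tendsto_const_nhds⟩

theorem lipLimitSet_congr {f g : X → ℝ} (h : f =ᵐ[m] g) : lipLimitSet m p f = lipLimitSet m p g :=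
  Set.ext fun _ => ⟨fun ⟨u, h1, h2⟩ => ⟨u, h1.congr_right h, h2⟩,
    fun ⟨u, h1, h2⟩ => ⟨u, h1.congr_right h.symm, h2⟩⟩

theorem add_mem_lipLimitSet {f g : X → ℝ} {ω η : LipModule m p} (hω : ω ∈ lipLimitSet m p f)
    (hη : η ∈ lipLimitSet m p g) : ω + η ∈ lipLimitSet m p (f + g) := by
  obtain ⟨u, hu, hu'⟩ := hω
  obtain ⟨v, hv, hv'⟩ := hη
  refine ⟨fun n => u n + v n, hu.add hv, ?_⟩
  simpa only [map_add] using hu'.add hv'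

theorem smul_mem_lipLimitSet {f : X → ℝ} {ω : LipModule m p} (c : ℝ)
    (hω : ω ∈ lipLimitSet m p f) : c • ω ∈ lipLimitSet m p (c • f) := by
  obtain ⟨u, hu, hu'⟩ := hω
  refine ⟨fun n => c • u n, hu.const_smul c, ?_⟩
  simpa only [map_smul] using hu'.const_smul c

/-- Together with `add_mem_lipLimitSet_of_zero`, this makes a nonempty `lipLimitSet f` a translate
of `lipZeroSet`. -/
theorem sub_mem_lipZeroSet {f : X → ℝ} {ω η : LipModule m p} (hω : ω ∈ lipLimitSet m p f)
    (hη : η ∈ lipLimitSet m p f) : ω - η ∈ lipZeroSet m p := by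
  have h := add_mem_lipLimitSet hω (smul_mem_lipLimitSet (-1) hη)
  rw [neg_one_smul, neg_one_smul, ← sub_eq_add_neg, ← sub_eq_add_neg, sub_self] at h
  exact h

theorem add_mem_lipLimitSet_of_zero {f : X → ℝ} {ω ζ : LipModule m p}
    (hω : ω ∈ lipLimitSet m p f) (hζ : ζ ∈ lipZeroSet m p) : ω + ζ ∈ lipLimitSet m p f := by
  have h := add_mem_lipLimitSet hω (g := 0) hζ
  rwa [add_zero f] at h

theorem zero_mem_lipZeroSet : (0 : LipModule m p) ∈ lipZeroSet m p := by
  rw [← map_zero (dLip m p)]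
  exact dLip_mem_lipLimitSet 0

/-- The graph of the limit relation is closed. -/
theorem mem_lipLimitSet_of_tendsto [SigmaFinite m] {fk : ℕ → X → ℝ} {f : X → ℝ}
    (hf : TendstoL0 m fk f) {ωk : ℕ → LipModule m p} {ω : LipModule m p}
    (hω : Tendsto ωk atTop (𝓝 ω)) (h : ∀ k, ωk k ∈ lipLimitSet m p (fk k)) :
    ω ∈ lipLimitSet m p f := by
  choose u hu hu' using h
  obtain ⟨n, hn, hn'⟩ := TendstoL0.diagonal hf hu
    (P := fun k n => dist (dLip m p (u k n)) (ωk k) < 1 / ((k : ℝ) + 1))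
    fun k => (tendsto_iff_dist_tendsto_zero.1 (hu' k)).eventually_lt_const (by positivity)
  refine ⟨fun k => u k (n k), hn', ?_⟩
  refine (tendsto_iff_of_dist ?_).1 hω
  refine squeeze_zero (fun _ => dist_nonneg) (fun k => ?_)
    (tendsto_one_div_add_atTop_nhds_zero_nat (𝕜 := ℝ))
  rw [dist_comm]
  exact (hn k).le

theorem isClosed_lipLimitSet [SigmaFinite m] (f : X → ℝ) : IsClosed (lipLimitSet m p f) := by
  refine IsSeqClosed.isClosed fun ωk ω hk hω => ?_
  exact mem_lipLimitSet_of_tendsto (TendstoL0.const f) hω hk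

/-- Elements of the zero set are limits along sequences bounded by `1` converging a.e. -/
theorem exists_bounded_of_mem_lipZeroSet [SigmaFinite m] {ω : LipModule m p}
    (hω : ω ∈ lipZeroSet m p) : ∃ u : ℕ → LipDomain m p, (∀ n x, |(u n).val x| ≤ 1) ∧
      (∀ᵐ x ∂m, Tendsto (fun n => (u n).val x) atTop (𝓝 0)) ∧
      Tendsto (fun n => dLip m p (u n)) atTop (𝓝 ω) := by
  obtain ⟨v, hv, hv'⟩ := hω
  obtain ⟨φ, hφ, hae⟩ := hv.exists_subseq_ae
  have hE := (lipFunctional m p).isLpModule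
  set u : ℕ → LipDomain m p := fun n => v (φ n) with hu
  have hu' : Tendsto (fun n => dLip m p (u n)) atTop (𝓝 ω) := hv'.comp hφ.tendsto_atTop
  refine ⟨fun n => (u n).trunc, fun n x => abs_truncOne_le _, ?_, ?_⟩
  · filter_upwards [hae] with x hx
    refine squeeze_zero_norm (fun n => ?_) (by simpa using hx.abs)
    exact abs_truncOne_le_abs _
  · have hA : ∀ n, MeasurableSet {x | 1 ≤ |(u n).val x|} := fun n =>
      measurableSet_le measurable_const (u n).continuous.measurable.abs
    -- Truncation changes `d u_n` only on `{|u_n| ≥ 1}`, and a.e. point lies in finitely many of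
    -- these sets. Dominated convergence is applied to the fixed element `ω`, and `d u_n - ω` is
    -- small anyway.
    have h1 : Tendsto (fun n => LInfty.chi m (hA n) • ω) atTop (𝓝 ((0 : LInfty m) • ω)) := by
      refine hE.tendsto_smul (C := 1) (fun n => LInfty.abs_chi_le (hA n)) ?_ ω
      filter_upwards [hae, LInfty.coe_zero_ae (m := m),
        ae_all_iff.2 fun n => LInfty.chi_mem_ae (m := m) (hA n)] with x h2 h3 h4
      rw [h3]
      refine tendsto_const_nhds.congr' ?_
      have h5 : ∀ᶠ n in atTop, |(u n).val x| < 1 := by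
        have := h2.abs
        rw [Pi.zero_apply, abs_zero] at this
        exact this.eventually_lt_const zero_lt_one
      filter_upwards [h5] with n hn
      exact ((h4 n).2 (not_le.2 hn)).symm
    rw [zero_smul] at h1
    have h2 : Tendsto (fun n => LInfty.chi m (hA n) • dLip m p (u n)) atTop (𝓝 0) := by
      have h3 : Tendsto (fun n => LInfty.chi m (hA n) • (dLip m p (u n) - ω)) atTop (𝓝 0) := by
        refine squeeze_zero_norm (fun n => hE.norm_chi_smul_le (hA n) _) ?_
        exact tendsto_iff_norm_sub_tendsto_zero.1 hu'
      simpa [smul_sub] using h3.add h1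
    have h3 : Tendsto (fun n => dLip m p (u n).trunc - dLip m p (u n)) atTop (𝓝 0) :=
      squeeze_zero_norm (fun n => norm_dLip_trunc_sub_le (u n)) (by simpa using h2.norm)
    simpa using h3.add hu'

/-- The zero set is stable under multiplication by Lipschitz functions `0 ≤ φ ≤ 1` whose slope
lives on a set of finite measure. -/
theorem smul_mem_lipZeroSet_of_lipschitz [SigmaFinite m] {ω : LipModule m p}
    (hω : ω ∈ lipZeroSet m p) {φ : X → ℝ} {K : ℝ≥0} (hφ : LipschitzWith K φ)
    (hφ1 : ∀ x, |φ x| ≤ 1) (hφK : MemLp (locLip φ) p m) {a : LInfty m}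
    (ha : ∀ᵐ x ∂m, a x = φ x) : a • ω ∈ lipZeroSet m p := by
  obtain ⟨u, hu1, hu0, hu⟩ := exists_bounded_of_mem_lipZeroSet hω
  have hE := (lipFunctional m p).isLpModule
  refine ⟨fun n => (u n).mul hφ hφ1 hφK (hu1 n), ?_, ?_⟩
  · refine TendstoL0.of_tendsto_ae (fun n => LipDomain.continuous _ |>.aestronglyMeasurable) ?_
    filter_upwards [hu0] with x hx
    have h1 := hx.const_mul (φ x)
    rw [mul_zero] at h1
    exact h1
  · have hmem : ∀ n, MemLp (fun x => |(u n).val x| * locLip φ x) p m := fun n => by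
      refine hφK.mono' (((u n).continuous.measurable.abs).mul
        (locLip_measurable hφ.continuous)).aestronglyMeasurable (ae_of_all _ fun x => ?_)
      rw [norm_mul, Real.norm_of_nonneg (locLip_nonneg _ _), Real.norm_eq_abs, abs_abs]
      exact mul_le_of_le_one_left (locLip_nonneg _ _) (hu1 n x)
    -- By the Leibniz rule, `d(φ u_n) - φ d u_n` is bounded by `|u_n| lip φ`. This tends to zero in
    -- `L^p` with majorant `lip φ`, which is why `u_n` was made bounded and a.e. convergent.
    have h1 : Tendsto (fun n => ‖(hmem n).toLp‖) atTop (𝓝 0) := by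
      refine LpAux.tendsto_norm_of_dominated (H := hφK.toLp) (b := fun n x => |(u n).val x|)
        (fun n x => by rw [abs_abs]; exact hu1 n x) ?_ fun n => ?_
      · filter_upwards [hu0] with x hx
        simpa using hx.abs
      · filter_upwards [(hmem n).coeFn_toLp, hφK.coeFn_toLp] with x h2 h3
        rw [h2, h3]
    have h2 : Tendsto (fun n => dLip m p ((u n).mul hφ hφ1 hφK (hu1 n)) - a • dLip m p (u n))
        atTop (𝓝 0) := by
      refine squeeze_zero_norm (fun n => ?_) h1
      refine norm_dLip_mul_sub_le hφ rfl ha ?_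
      filter_upwards [(hmem n).coeFn_toLp] with x hx
      exact hx.ge
    have h3 := ((hE.continuous_smul a).tendsto ω).comp hu
    simpa using h2.add h3

/-- The indicator of `K` is the limit of Lipschitz cutoffs supported in shrinking neighbourhoods.
Local finiteness gives `K` a neighbourhood of finite measure, so the slopes of the cutoffs, bounded
and zero far from `K`, are in `L^p`. -/
theorem chi_smul_mem_lipZeroSet_of_isCompact [SigmaFinite m] [IsLocallyFiniteMeasure m]
    {ω : LipModule m p} (hω : ω ∈ lipZeroSet m p) {K : Set X} (hK : IsCompact K) :
    LInfty.chi m hK.measurableSet • ω ∈ lipZeroSet m p := by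
  have hE := (lipFunctional m p).isLpModule
  obtain ⟨U, hKU, hU, hmU⟩ := hK.exists_open_superset_measure_lt_top m
  obtain ⟨δ, hδ, hδU⟩ := hK.exists_cthickening_subset_open hU hKU
  -- Widths at most `δ` keep every cutoff inside the closed `δ`-thickening of `K`, which is
  -- contained in `U`.
  set ε : ℕ → ℝ := fun n => δ * (1 / ((n : ℝ) + 1)) with hε
  have hε0 : ∀ n, 0 < ε n := fun n => by positivity
  have hεδ : ∀ n, ε n ≤ δ := fun n => mul_le_of_le_one_right hδ.le (by
    rw [div_le_one (by positivity)]
    linarith [Nat.cast_nonneg (α := ℝ) n])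
  have hεlim : Tendsto ε atTop (𝓝 0) := by
    have h1 := (tendsto_one_div_add_atTop_nhds_zero_nat (𝕜 := ℝ)).const_mul δ
    rwa [mul_zero] at h1
  let φ : ℕ → X → ℝ := fun n x => (thickenedIndicator (hε0 n) K x : ℝ)
  have hφL : ∀ n, LipschitzWith (ε n).toNNReal⁻¹ (φ n) := fun n =>
    fun x y => lipschitzWith_thickenedIndicator (hε0 n) K x y
  have hφ1 : ∀ n x, |φ n x| ≤ 1 := fun n x => by
    rw [abs_of_nonneg (NNReal.coe_nonneg _)]
    exact_mod_cast thickenedIndicator_le_one (hε0 n) K x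
  have hφK : ∀ n, MemLp (locLip (φ n)) p m := fun n => by
    have hC : MeasurableSet (Metric.cthickening δ K) := Metric.isClosed_cthickening.measurableSet
    refine (memLp_indicator_const (p : ℝ≥0∞) hC (((ε n).toNNReal⁻¹ : ℝ≥0) : ℝ)
      (Or.inr ((measure_mono hδU).trans_lt hmU).ne)).mono'
      (locLip_measurable (hφL n).continuous).aestronglyMeasurable (ae_of_all _ fun x => ?_)
    rw [Real.norm_of_nonneg (locLip_nonneg _ _)]
    by_cases hx : x ∈ Metric.cthickening δ K
    · rw [indicator_of_mem hx]
      exact (hφL n).locLip_le x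
    · rw [indicator_of_notMem hx, locLip_eq_zero_of_eventuallyEq]
      filter_upwards [Metric.isClosed_cthickening.isOpen_compl.mem_nhds hx] with y hy
      have h1 : y ∉ Metric.thickening (ε n) K := fun h =>
        hy (Metric.thickening_subset_cthickening _ _ (Metric.thickening_mono (hεδ n) K h))
      change ((thickenedIndicator (hε0 n) K y : ℝ≥0) : ℝ) = 0
      rw [thickenedIndicator_zero (hε0 n) K h1, NNReal.coe_zero]
  let a : ℕ → LInfty m := fun n =>
    LInfty.ofBounded (φ n) (hφL n).continuous.measurable ⟨1, hφ1 n⟩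
  have ha : ∀ n, ∀ᵐ x ∂m, a n x = φ n x := fun n => LInfty.ofBounded_ae _ _
  have h1 : ∀ n, a n • ω ∈ lipZeroSet m p := fun n =>
    smul_mem_lipZeroSet_of_lipschitz hω (hφL n) (hφ1 n) (hφK n) (ha n)
  refine (isClosed_lipLimitSet (m := m) (p := p) 0).mem_of_tendsto
    (hE.tendsto_smul (a := a) (C := 1) (fun n => ?_) ?_ ω) (Eventually.of_forall h1)
  · filter_upwards [ha n] with x hx
    rw [hx]
    exact hφ1 n x
  · filter_upwards [ae_all_iff.2 ha, LInfty.chi_ae (m := m) hK.measurableSet] with x h2 h3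
    simp only [h2, h3]
    have h4 := (tendsto_pi_nhds.1 (thickenedIndicator_tendsto_indicator_closure hε0 hεlim K)) x
    rw [hK.isClosed.closure_eq] at h4
    have h5 := (NNReal.continuous_coe.tendsto _).comp h4
    refine h5.congr' (Eventually.of_forall fun n => rfl) |>.trans (le_of_eq ?_)
    by_cases hx : x ∈ K <;> simp [hx]

/-- By inner regularity a set of finite measure is, up to a null set, an increasing union of compact
sets, and a general set is an increasing union of sets of finite measure. Both limits stay in the
closed set `lipZeroSet`. -/
theorem chi_smul_mem_lipZeroSet [SigmaFinite m] [IsLocallyFiniteMeasure m] [m.InnerRegular]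
    {ω : LipModule m p} (hω : ω ∈ lipZeroSet m p) {A : Set X} (hA : MeasurableSet A) :
    LInfty.chi m hA • ω ∈ lipZeroSet m p := by
  have hE := (lipFunctional m p).isLpModule
  have hfin : ∀ {A : Set X} (hA : MeasurableSet A), m A ≠ ∞ →
      LInfty.chi m hA • ω ∈ lipZeroSet m p := by
    intro A hA hmA
    have hex : ∀ n : ℕ, ∃ K ⊆ A, IsCompact K ∧ m (A \ K) < ((n : ℝ≥0∞) + 1)⁻¹ := fun n =>
      hA.exists_isCompact_sdiff_lt hmA (ENNReal.inv_ne_zero.2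
        (ENNReal.add_ne_top.2 ⟨ENNReal.natCast_ne_top n, ENNReal.one_ne_top⟩))
    choose K hKA hK hmK using hex
    have hC : ∀ n, IsCompact (accumulate K n) := fun n => isCompact_accumulate hK n
    have h1 := hE.tendsto_chi_smul_iUnion (fun n => (hC n).measurableSet) monotone_accumulate ω
    have h2 := (isClosed_lipLimitSet (m := m) (p := p) 0).mem_of_tendsto h1
      (Eventually.of_forall fun n => chi_smul_mem_lipZeroSet_of_isCompact hω (hC n))
    have h3 : (⋃ n, accumulate K n) ⊆ A := by
      rw [iUnion_accumulate]
      exact iUnion_subset hKA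
    have h4 : m (A \ ⋃ n, accumulate K n) = 0 := by
      rw [iUnion_accumulate]
      refine le_antisymm (ge_of_tendsto' (x := atTop) (f := fun n : ℕ => ((n : ℝ≥0∞) + 1)⁻¹) ?_
        fun n => (measure_mono (sdiff_subset_sdiff_right (subset_iUnion K n))).trans
          (hmK n).le) zero_le
      simpa using (tendsto_add_atTop_iff_nat 1).2 ENNReal.tendsto_inv_nat_nhds_zero
    rwa [LInfty.chi_congr (hB := hA)
      (h3.eventuallyLE.antisymm (ae_le_set.2 h4))] at h2
  have hS : ∀ n, MeasurableSet (A ∩ spanningSets m n) := fun n =>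
    hA.inter (measurableSet_spanningSets m n)
  have h1 := hE.tendsto_chi_smul_iUnion hS
    (fun i j hij => inter_subset_inter_right A (monotone_spanningSets m hij)) ω
  have h2 := (isClosed_lipLimitSet (m := m) (p := p) 0).mem_of_tendsto h1
    (Eventually.of_forall fun n => hfin (hS n)
      ((measure_mono inter_subset_right).trans_lt (measure_spanningSets_lt_top m n)).ne)
  have h3 : (⋃ n, A ∩ spanningSets m n) = A := by
    rw [← inter_iUnion, iUnion_spanningSets, inter_univ]
  have h4 : LInfty.chi m (MeasurableSet.iUnion hS) = LInfty.chi m hA :=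
    LInfty.chi_congr (.of_eq h3)
  rwa [h4] at h2

theorem ofSimpleFunc_smul_mem_lipZeroSet [SigmaFinite m] [IsLocallyFiniteMeasure m]
    [m.InnerRegular] {ω : LipModule m p} (hω : ω ∈ lipZeroSet m p) (φ : SimpleFunc X ℝ) :
    LInfty.ofSimpleFunc m φ • ω ∈ lipZeroSet m p := by
  induction φ using SimpleFunc.induction with
  | const c hs =>
    rename_i s
    have h1 : LInfty.ofSimpleFunc m ((SimpleFunc.const X c).piecewise s hs (SimpleFunc.const X 0))
        = c • LInfty.chi m hs := by
      refine LInfty.ext_ae ?_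
      filter_upwards [LInfty.ofSimpleFunc_ae (m := m)
        ((SimpleFunc.const X c).piecewise s hs (SimpleFunc.const X 0)),
        LInfty.coe_real_smul_ae c (LInfty.chi m hs), LInfty.chi_ae (m := m) hs] with x h1 h2 h3
      rw [h1, h2, h3]
      by_cases hx : x ∈ s <;> simp [hx]
    rw [h1, smul_assoc]
    have h2 := smul_mem_lipLimitSet c (chi_smul_mem_lipZeroSet hω hs)
    rwa [smul_zero] at h2
  | add _ h1 h2 =>
    rw [map_add, add_smul]
    exact add_mem_lipLimitSet_of_zero h1 h2

/-- The `Lipschitz_0` module consists of the limits of `d_lip f_n` along `f_n → 0`. -/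
theorem mem_lipZeroModule_iff [SigmaFinite m] [IsLocallyFiniteMeasure m] [m.InnerRegular]
    {ω : LipModule m p} : ω ∈ lipZeroModule m p ↔ ω ∈ lipZeroSet m p := by
  have hE := (lipFunctional m p).isLpModule
  have hcl : IsClosed (lipZeroSet m p) := isClosed_lipLimitSet 0
  -- The set is already a closed `LInfty m`-submodule, so the span and its closure add nothing.
  let Z : Submodule (LInfty m) (LipModule m p) :=
    { carrier := lipZeroSet m p
      add_mem' := fun h1 h2 => add_mem_lipLimitSet_of_zero h1 h2
      zero_mem' := zero_mem_lipZeroSet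
      smul_mem' := fun a ω hω => by
        obtain ⟨φ, C, hC, hlim⟩ := a.exists_simpleFunc_tendsto
        exact hcl.mem_of_tendsto (hE.tendsto_smul hC hlim ω)
          (Eventually.of_forall fun n => ofSimpleFunc_smul_mem_lipZeroSet hω (φ n)) }
  have hle : lipZeroModule m p ≤ Z :=
    Submodule.topologicalClosure_minimal _ (Submodule.span_le.2 fun _ h => h) hcl
  exact ⟨fun h => hle h,
    fun h => Submodule.le_topologicalClosure _ (Submodule.subset_span h)⟩

end LimitSet

/-! ## Functoriality of the generated module -/

namespace LpFunctional

variable {X : Type*} [MeasurableSpace X] {m : Measure X} {p : ℝ≥0} [Fact (1 ≤ (p : ℝ≥0∞))]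
  {D D' : Type*} [AddCommGroup D] [Module ℝ D] [AddCommGroup D'] [Module ℝ D']
  {F : LpFunctional m p D} {G : LpFunctional m p D'} {T : D →ₗ[ℝ] D'}

theorem ptNorm_map_le (hT : ∀ f, G.toFun (T f) ≤ F.toFun f) {s : X → D}
    (hs : CountablyValued s) : ∀ᵐ x ∂m, G.ptNorm (fun y => T (s y)) x ≤ F.ptNorm s x :=
  hs.ae₂ hs (P := fun d _ x => G.toFun (T d) x ≤ F.toFun d x)
    fun d _ => (Lp.coeFn_le _ _).2 (hT d)

/-- The map of pre-forms induced by a map that does not increase the functional. -/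
def preMap (hT : ∀ f, G.toFun (T f) ≤ F.toFun f) : F.PreModule →ₗ[ℝ] G.PreModule where
  toFun s := (⟨fun x => T (s.val x), s.cv.map T, s.memLp.mono'
    (G.ptNorm_measurable (s.cv.map T)).aestronglyMeasurable (by
      filter_upwards [ptNorm_map_le hT s.cv, G.ptNorm_nonneg (s.cv.map T)] with x h1 h2
      rwa [Real.norm_of_nonneg h2])⟩ : G.pfm)
  map_add' s t := Subtype.ext (funext fun x => map_add T (s.val x) (t.val x))
  map_smul' c s := Subtype.ext (funext fun x => map_smul T c (s.val x))

theorem norm_preMap_le (hT : ∀ f, G.toFun (T f) ≤ F.toFun f) (s : F.PreModule) :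
    ‖preMap hT s‖ ≤ 1 * ‖s‖ := by
  rw [one_mul, ← norm_prePnorm, ← norm_prePnorm]
  refine Lp.norm_le_norm_of_ae_le ?_
  filter_upwards [F.prePnorm_ae s, G.prePnorm_ae (preMap hT s), ptNorm_map_le hT s.cv,
    G.ptNorm_nonneg (preMap hT s).cv] with x h1 h2 h3 h4
  rw [h1, h2, Real.norm_of_nonneg h4]
  exact h3.trans (Real.le_norm_self _)

/-- The continuous linear map of modules induced by a map that does not increase the
functional. -/
def mapCLM (hT : ∀ f, G.toFun (T f) ≤ F.toFun f) : F.FModule →L[ℝ] G.FModule :=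
  ((preMap hT).mkContinuous 1 (norm_preMap_le hT)).completion

theorem mapCLM_coe (hT : ∀ f, G.toFun (T f) ≤ F.toFun f) (s : F.PreModule) :
    mapCLM hT (s : F.FModule) = (preMap hT s : G.PreModule) :=
  ContinuousLinearMap.completion_apply_coe _ s

theorem mapCLM_d (hT : ∀ f, G.toFun (T f) ≤ F.toFun f) (f : D) : mapCLM hT (F.d f) = G.d (T f) :=
  mapCLM_coe hT (F.single f)

theorem norm_mapCLM_le (hT : ∀ f, G.toFun (T f) ≤ F.toFun f) (v : F.FModule) :
    ‖mapCLM hT v‖ ≤ ‖v‖ := by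
  induction v using Completion.induction_on with
  | hp => exact isClosed_le (mapCLM hT).continuous.norm continuous_norm
  | ih s =>
    rw [mapCLM_coe, Completion.norm_coe, Completion.norm_coe]
    simpa using norm_preMap_le hT s

theorem mapCLM_simpleMul (hT : ∀ f, G.toFun (T f) ≤ F.toFun f) (b : X → ℝ) (hb : IsSimple b)
    (v : F.FModule) : mapCLM hT (F.simpleMul b hb v) = G.simpleMul b hb (mapCLM hT v) := by
  induction v using Completion.induction_on with
  | hp =>
    exact isClosed_eq ((mapCLM hT).continuous.comp (F.simpleMul b hb).continuous)
      ((G.simpleMul b hb).continuous.comp (mapCLM hT).continuous)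
  | ih s =>
    rw [simpleMul_coe, mapCLM_coe, mapCLM_coe, simpleMul_coe]
    congr 1
    exact Subtype.ext (funext fun x => map_smul T (b x) (s.val x))

/-- The `L^∞`-linear map of modules induced by a map that does not increase the functional. -/
def map (hT : ∀ f, G.toFun (T f) ≤ F.toFun f) : F.FModule →ₗ[LInfty m] G.FModule where
  toFun := mapCLM hT
  map_add' := map_add _
  map_smul' a v := by
    obtain ⟨b, hb, hab⟩ := a.exists_simple
    have h1 := F.tendsto_smul a v hb (fun n => by positivity) tendsto_one_div hab
    have h2 := G.tendsto_smul a (mapCLM hT v) hb (fun n => by positivity) tendsto_one_div hab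
    refine tendsto_nhds_unique (((mapCLM hT).continuous.tendsto _).comp h1) (h2.congr fun n => ?_)
    exact (mapCLM_simpleMul hT _ _ _).symm

theorem continuous_map (hT : ∀ f, G.toFun (T f) ≤ F.toFun f) : Continuous (map hT) :=
  (mapCLM hT).continuous

theorem norm_map_le (hT : ∀ f, G.toFun (T f) ≤ F.toFun f) (v : F.FModule) :
    ‖map hT v‖ ≤ ‖v‖ := norm_mapCLM_le hT v

theorem map_d (hT : ∀ f, G.toFun (T f) ≤ F.toFun f) (f : D) : map hT (F.d f) = G.d (T f) :=
  mapCLM_d hT f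

end LpFunctional

/-! ## Relaxation through limits of differentials -/

section Relaxation

/-- Uniform boundedness principle for the evaluations in the bidual, into which `E` embeds
isometrically. -/
theorem exists_norm_le_of_weak_tendsto {E : Type*} [NormedAddCommGroup E] [NormedSpace ℝ E]
    {x : ℕ → E} {y : E} (h : ∀ L : StrongDual ℝ E, Tendsto (fun n => L (x n)) atTop (𝓝 (L y))) :
    ∃ C, ∀ n, ‖x n‖ ≤ C := by
  obtain ⟨C, hC⟩ := banach_steinhaus (g := fun n => NormedSpace.inclusionInDoubleDual ℝ E (x n))
    fun L => by
      obtain ⟨C, hC⟩ := (h L).norm.bddAbove_range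
      exact ⟨C, fun n => hC ⟨n, rfl⟩⟩
  refine ⟨C, fun n => ?_⟩
  rw [← (NormedSpace.inclusionInDoubleDualLi ℝ (E := E)).norm_map (x n)]
  exact hC n

variable {X : Type*} [MetricSpace X] [MeasurableSpace X] [BorelSpace X] {m : Measure X} {p : ℝ≥0}
  [Fact (1 ≤ (p : ℝ≥0∞))]

/-- Mazur's lemma for sequences with bounded differentials which converge in `L^0(m)`. -/
theorem exists_convex_tendsto [SigmaFinite m] (hrefl : IsReflexive (LipModule m p))
    {E : Type*} [NormedAddCommGroup E] [NormedSpace ℝ E] {u : ℕ → LipDomain m p} {f : X → ℝ}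
    (hu : TendstoL0 m (fun n => (u n).val) f) {C : ℝ} (hC : ∀ n, ‖dLip m p (u n)‖ ≤ C)
    {H : ℕ → E} {G : E}
    (hH : ∀ L : StrongDual ℝ E, Tendsto (fun n => L (H n)) atTop (𝓝 (L G)))
    {𝒦 : Set (LipDomain m p × E)} (h𝒦 : Convex ℝ 𝒦) (hmem : ∀ n, (u n, H n) ∈ 𝒦) :
    ∃ ω ∈ lipLimitSet m p f, ∃ g : ℕ → LipDomain m p × E, (∀ k, g k ∈ 𝒦) ∧
      Tendsto (fun k => dLip m p (g k).1) atTop (𝓝 ω) ∧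
      Tendsto (fun k => (g k).2) atTop (𝓝 G) := by
  -- Convergence in measure need not survive convex combinations, but pointwise convergence does, so
  -- a subsequence converging a.e. is taken beforehand.
  obtain ⟨φ, hφ, hae⟩ := hu.exists_subseq_ae
  let U : Ultrafilter ℕ := Ultrafilter.of atTop
  have hU : (U : Filter ℕ) ≤ atTop := Ultrafilter.of_le _
  obtain ⟨ω, hω⟩ := hrefl.exists_weak_limit (x := fun n => dLip m p (u (φ n)))
    (fun n => hC (φ n)) U
  -- Mazur's lemma is applied in the product, so that the same convex combinations serve the
  -- differentials and the second component. The convex set `𝒦` carries any constraint linking the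
  -- two.
  obtain ⟨g, hg, hlim⟩ := exists_convexHull_tendsto
    ((dLip m p).prodMap (LinearMap.id : E →ₗ[ℝ] E)) (fun n => (u (φ n), H (φ n))) hU
    (y := (ω, G)) fun L => by
      have h1 := hω (L.comp (ContinuousLinearMap.inl ℝ _ E))
      have h2 := ((hH (L.comp (ContinuousLinearMap.inr ℝ (LipModule m p) E))).comp
        hφ.tendsto_atTop).mono_left hU
      have h3 := h1.add h2
      simp only [Function.comp_apply, ContinuousLinearMap.comp_apply, ← map_add,
        ContinuousLinearMap.inl_apply, ContinuousLinearMap.inr_apply, Prod.mk_add_mk, add_zero,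
        zero_add] at h3
      exact h3
  have h1 : Tendsto (fun k => dLip m p (g k).1) atTop (𝓝 ω) :=
    (continuous_fst.tendsto (ω, G)).comp hlim
  have h2 : Tendsto (fun k => (g k).2) atTop (𝓝 G) := (continuous_snd.tendsto (ω, G)).comp hlim
  refine ⟨ω, ⟨fun k => (g k).1, ?_, h1⟩, g, fun k => ?_, h1, h2⟩
  · refine TendstoL0.of_tendsto_ae (fun n => (LipDomain.continuous _).aestronglyMeasurable) ?_
    filter_upwards [hae] with x hx
    rw [Metric.tendsto_atTop] at hx ⊢
    intro ε hε
    obtain ⟨N, hN⟩ := hx ε hε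
    refine ⟨N, fun k hk => ?_⟩
    have hconv : Convex ℝ {v : LipDomain m p × E | v.1.val x ∈ Metric.ball (f x) ε} := by
      let ev : LipDomain m p × E →ₗ[ℝ] ℝ :=
        { toFun := fun v => v.1.val x
          map_add' := fun _ _ => rfl
          map_smul' := fun _ _ => rfl }
      exact (convex_ball (f x) ε).linear_preimage ev
    refine convexHull_min ?_ hconv (hg k)
    rintro _ ⟨n, hn, rfl⟩
    exact hN n (hk.trans hn)
  · refine convexHull_min ?_ h𝒦 (hg k)
    rintro _ ⟨n, -, rfl⟩
    exact hmem (φ n)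

/-- Upper relaxations are the functions above the pointwise norm of a limit of differentials. -/
theorem isUpperRelaxation_iff [SigmaFinite m] (hrefl : IsReflexive (LipModule m p))
    {f : X →ₘ[m] ℝ} {G : Lp ℝ p m} : IsUpperRelaxation m p f G ↔
      ∃ ω ∈ lipLimitSet m p f, (lipFunctional m p).pnorm ω ≤ G := by
  set F := lipFunctional m p with hF
  constructor
  · rintro ⟨u, H, hu, hle, hH⟩
    obtain ⟨C, hC⟩ := exists_norm_le_of_weak_tendsto hH
    -- By subadditivity of the slope, the inequality `lip u ≤ H` survives convex combinations, and
    -- then the strong limits.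
    have hconv : Convex ℝ {v : LipDomain m p × Lp ℝ p m | F.toFun v.1 ≤ v.2} := by
      intro v hv w hw a b ha hb _
      refine (F.add_le _ _).trans (add_le_add ?_ ?_)
      · have h := LpAux.abs_smul_mono a hv
        rwa [← F.smul_eq, abs_of_nonneg ha] at h
      · have h := LpAux.abs_smul_mono b hw
        rwa [← F.smul_eq, abs_of_nonneg hb] at h
    have hC' : ∀ n, ‖dLip m p (u n)‖ ≤ C := fun n => by
      rw [norm_dLip]
      refine (norm_le_norm_of_abs_le_abs ?_).trans (hC n)
      rw [abs_of_nonneg (F.nonneg _), abs_of_nonneg ((F.nonneg _).trans (hle n))]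
      exact hle n
    obtain ⟨ω, hω, g, hg, h1, h2⟩ := exists_convex_tendsto hrefl hu hC' hH hconv hle
    refine ⟨ω, hω, le_of_tendsto_of_tendsto' ((F.continuous_pnorm.tendsto _).comp h1) h2
      fun k => ?_⟩
    exact (F.pnorm_d (g k).1).le.trans (hg k)
  · rintro ⟨ω, ⟨u, hu, hu'⟩, hωG⟩
    -- The slopes converge strongly to `|ω|`; adding the fixed nonnegative gap gives functions above
    -- them with limit `G`.
    refine ⟨u, fun n => F.toFun (u n) + (G - F.pnorm ω), hu,
      fun n => le_add_of_nonneg_right (sub_nonneg.2 hωG), fun L => ?_⟩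
    have h1 : Tendsto (fun n => F.toFun (u n)) atTop (𝓝 (F.pnorm ω)) :=
      ((F.continuous_pnorm.tendsto _).comp hu').congr fun n => F.pnorm_d (u n)
    have h2 := h1.add_const (G - F.pnorm ω)
    rw [add_sub_cancel] at h2
    exact (L.continuous.tendsto _).comp h2

theorem convex_lipLimitSet (f : X → ℝ) : Convex ℝ (lipLimitSet m p f) := by
  intro ω hω η hη a b _ _ hab
  have h := add_mem_lipLimitSet (smul_mem_lipLimitSet a hω) (smul_mem_lipLimitSet b hη)
  rwa [← add_smul, hab, one_smul] at h

variable [IsLocallyFiniteMeasure m] [m.InnerRegular] [SigmaFinite m]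

/-- The set of limits of differentials contains an element realising the relaxed slope. -/
theorem exists_mem_lipLimitSet_pnorm_eq (hrefl : IsReflexive (LipModule m p))
    (f : RelaxedDomain m p) :
    ∃ ω ∈ lipLimitSet m p (f : X →ₘ[m] ℝ), (lipFunctional m p).pnorm ω = relaxedSlope f := by
  set F := lipFunctional m p with hF
  have hp0 := NNReal.coe_pos_of_fact_one_le (p := p)
  have hne : (lipLimitSet m p (f : X →ₘ[m] ℝ)).Nonempty := by
    obtain ⟨G, hG⟩ := f.2
    obtain ⟨ω, hω, -⟩ := (isUpperRelaxation_iff hrefl).1 hG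
    exact ⟨ω, hω⟩
  obtain ⟨ω, hω, hmin⟩ := hrefl.exists_norm_min (convex_lipLimitSet _) (isClosed_lipLimitSet _) hne
  have hle : ∀ η ∈ lipLimitSet m p (f : X →ₘ[m] ℝ), F.pnorm ω ≤ F.pnorm η := by
    intro η hη
    have hA : MeasurableSet {x | F.pnorm η x < F.pnorm ω x} :=
      measurableSet_lt (Lp.stronglyMeasurable _).measurable (Lp.stronglyMeasurable _).measurable
    -- Where `η` is pointwise smaller it replaces `ω`. The result differs from `ω` by `χ_A (η - ω)`,
    -- an element of `lipZeroSet`, so it is still a limit for `f`. Minimality of `‖ω‖` shows that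
    -- nothing was gained, so `|ω| ≤ |η|` a.e.
    set ζ := LInfty.chi m hA • η + LInfty.chi m hA.compl • ω with hζ
    have hζΛ : ζ ∈ lipLimitSet m p (f : X →ₘ[m] ℝ) := by
      have h1 : ζ = ω + LInfty.chi m hA • (η - ω) := by
        have h2 : LInfty.chi m hA.compl • ω = ω - LInfty.chi m hA • ω := by
          rw [eq_sub_iff_add_eq', ← add_smul, LInfty.chi_add_compl, one_smul]
        rw [hζ, h2, smul_sub]
        abel
      rw [h1]
      exact add_mem_lipLimitSet_of_zero hω (chi_smul_mem_lipZeroSet (sub_mem_lipZeroSet hη hω) hA)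
    have h1 := F.pnorm_glue_ae hA η ω
    have h2 : F.pnorm ζ ≤ F.pnorm ω := by
      rw [← Lp.coeFn_le]
      filter_upwards [h1] with x hx
      by_cases h : x ∈ {x | F.pnorm η x < F.pnorm ω x}
      · rw [hx.1 h]
        exact le_of_lt h
      · rw [hx.2 h]
    have h3 := LpAux.norm_sub_rpow_le (F.pnorm_nonneg ζ) h2
    have h4 : ‖F.pnorm ω‖ ^ (p : ℝ) ≤ ‖F.pnorm ζ‖ ^ (p : ℝ) := by
      rw [F.norm_pnorm, F.norm_pnorm]
      exact Real.rpow_le_rpow (norm_nonneg _) (hmin ζ hζΛ) hp0.le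
    have h5 : F.pnorm ω - F.pnorm ζ = 0 := by
      by_contra hcon
      have := Real.rpow_pos_of_pos (norm_pos_iff.2 hcon) (p : ℝ)
      linarith
    have h6 : F.pnorm ω = F.pnorm ζ := sub_eq_zero.1 h5
    rw [← Lp.coeFn_le]
    filter_upwards [h1] with x hx
    by_contra hcon
    have h7 := hx.1 (not_le.1 hcon)
    rw [← hζ, ← h6] at h7
    exact hcon h7.le
  refine ⟨ω, hω, IsGLB.unique ⟨fun G hG => ?_, fun K hK => ?_⟩ (isGLB_relaxedSlope f)⟩
  · obtain ⟨η, hη, hηG⟩ := (isUpperRelaxation_iff hrefl).1 hG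
    exact (hle η hη).trans hηG
  · exact hK ((isUpperRelaxation_iff hrefl).2 ⟨ω, hω, le_rfl⟩)

end Relaxation

/-! ## The cotangent module as a quotient of the Lipschitz module -/

section Cotangent

variable {X : Type*} [MetricSpace X] [MeasurableSpace X] [BorelSpace X] {m : Measure X} {p : ℝ≥0}
  [Fact (1 ≤ (p : ℝ≥0∞))]

variable (m p) in
/-- The inclusion of the Lipschitz domain into the relaxed domain. -/
def toRelaxedLinear : LipDomain m p →ₗ[ℝ] RelaxedDomain m p where
  toFun := LipDomain.toRelaxed
  map_add' _ _ := rfl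
  map_smul' _ _ := rfl

theorem LipDomain.coe_toRelaxed_ae (f : LipDomain m p) :
    (f.toRelaxed : X →ₘ[m] ℝ) =ᵐ[m] f.val := AEEqFun.coeFn_mk _ _

theorem relaxedFunctional_toRelaxed_le (f : LipDomain m p) :
    (relaxedFunctional m p).toFun (toRelaxedLinear m p f) ≤ (lipFunctional m p).toFun f :=
  (isGLB_relaxedSlope f.toRelaxed).1 (isUpperRelaxation_lip f)

variable (m p) in
/-- The projection of the Lipschitz module onto the cotangent module, `d_lip f ↦ d_p f`. -/
def toCotangent : LipModule m p →ₗ[LInfty m] CotangentModule m p :=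
  LpFunctional.map (T := toRelaxedLinear m p) relaxedFunctional_toRelaxed_le

theorem continuous_toCotangent : Continuous (toCotangent m p) := LpFunctional.continuous_map _

theorem norm_toCotangent_le (v : LipModule m p) : ‖toCotangent m p v‖ ≤ ‖v‖ :=
  LpFunctional.norm_map_le _ v

theorem toCotangent_dLip (f : LipDomain m p) :
    toCotangent m p (dLip m p f) = dSob m p f.toRelaxed := LpFunctional.map_d _ f

theorem dLip_mem_lipLimitSet_toRelaxed (f : LipDomain m p) :
    dLip m p f ∈ lipLimitSet m p (f.toRelaxed : X →ₘ[m] ℝ) := by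
  rw [lipLimitSet_congr f.coe_toRelaxed_ae]
  exact dLip_mem_lipLimitSet f

theorem norm_dSob (f : RelaxedDomain m p) : ‖dSob m p f‖ = ‖relaxedSlope f‖ :=
  (relaxedFunctional m p).norm_d f

theorem isClosed_lipZeroModule : IsClosed (lipZeroModule m p : Set (LipModule m p)) :=
  Submodule.isClosed_topologicalClosure _

theorem relaxedSlope_le_pnorm [SigmaFinite m] (hrefl : IsReflexive (LipModule m p)) {f : RelaxedDomain m p}
    {ω : LipModule m p} (hω : ω ∈ lipLimitSet m p (f : X →ₘ[m] ℝ)) :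
    relaxedSlope f ≤ (lipFunctional m p).pnorm ω :=
  (isGLB_relaxedSlope f).1 ((isUpperRelaxation_iff hrefl).2 ⟨ω, hω, le_rfl⟩)

theorem norm_dSob_le [SigmaFinite m] (hrefl : IsReflexive (LipModule m p)) {f : RelaxedDomain m p}
    {ω : LipModule m p} (hω : ω ∈ lipLimitSet m p (f : X →ₘ[m] ℝ)) : ‖dSob m p f‖ ≤ ‖ω‖ := by
  rw [norm_dSob, ← (lipFunctional m p).norm_pnorm]
  refine norm_le_norm_of_abs_le_abs ?_
  rw [abs_of_nonneg (relaxedSlope_nonneg f), abs_of_nonneg ((lipFunctional m p).pnorm_nonneg ω)]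
  exact relaxedSlope_le_pnorm hrefl hω

/-- Let `d_lip u_n → ω` with `u_n → f`. Then `d_lip u_n - ω` is a limit for `u_n - f`, so `‖d_p (u_n
- f)‖ ≤ ‖d_lip u_n - ω‖ → 0`, and the claim follows by continuity of the projection. -/
theorem toCotangent_eq_dSob [SigmaFinite m] (hrefl : IsReflexive (LipModule m p)) {f : RelaxedDomain m p}
    {ω : LipModule m p} (hω : ω ∈ lipLimitSet m p (f : X →ₘ[m] ℝ)) :
    toCotangent m p ω = dSob m p f := by
  obtain ⟨u, hu, hu'⟩ := id hω
  have h1 := (continuous_toCotangent.tendsto ω).comp hu'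
  refine tendsto_nhds_unique h1 (tendsto_iff_norm_sub_tendsto_zero.2 ?_)
  refine squeeze_zero (fun _ => norm_nonneg _) (fun n => ?_)
    (tendsto_iff_norm_sub_tendsto_zero.1 hu')
  rw [Function.comp_apply, toCotangent_dLip, ← map_sub]
  refine norm_dSob_le hrefl ?_
  have h2 := add_mem_lipLimitSet (dLip_mem_lipLimitSet_toRelaxed (u n))
    (smul_mem_lipLimitSet (-1) hω)
  rw [neg_one_smul, neg_one_smul, ← sub_eq_add_neg, ← sub_eq_add_neg] at h2
  rwa [lipLimitSet_congr (AEEqFun.coeFn_sub (u n).toRelaxed.1 f.1).symm] at h2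

variable [IsLocallyFiniteMeasure m] [m.InnerRegular] [SigmaFinite m]

theorem toCotangent_eq_zero (hrefl : IsReflexive (LipModule m p)) {ω : LipModule m p}
    (hω : ω ∈ lipZeroModule m p) : toCotangent m p ω = 0 := by
  rw [mem_lipZeroModule_iff] at hω
  rw [← map_zero (dSob m p)]
  refine toCotangent_eq_dSob hrefl ?_
  have h : ((0 : RelaxedDomain m p) : X →ₘ[m] ℝ) =ᵐ[m] (0 : X → ℝ) := AEEqFun.coeFn_zero
  rwa [lipLimitSet_congr h]

variable (m p) in
/-- The map of the quotient by the `Lipschitz_0` module to the cotangent module. -/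
def quotientToCotangent (hrefl : IsReflexive (LipModule m p)) :
    (LipModule m p ⧸ lipZeroModule m p) →ₗ[LInfty m] CotangentModule m p :=
  (lipZeroModule m p).liftQ (toCotangent m p) fun _ h => toCotangent_eq_zero hrefl h

/-- For a differential, `d_lip f` is congruent modulo `Lipschitz_0` to an `ω` with `|ω| = |Df|`.
Elements satisfying the estimate on every measurable set form a closed set stable under gluing, as
the `p`-th powers of both norms add over `A` and its complement, and such a set is the whole module.
-/
theorem norm_mk_le_norm_toCotangent (hrefl : IsReflexive (LipModule m p)) (v : LipModule m p) :
    ‖(Submodule.Quotient.mk v : LipModule m p ⧸ lipZeroModule m p)‖ ≤ ‖toCotangent m p v‖ := by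
  have hcl : IsClosed (lipZeroModule m p : Set (LipModule m p)) := isClosed_lipZeroModule
  have hp0 := NNReal.coe_pos_of_fact_one_le (p := p)
  set F := lipFunctional m p with hF
  have hE := F.isLpModule
  have hQ := hE.quotient (lipZeroModule m p)
  have hC := (relaxedFunctional m p).isLpModule
  have hcont : Continuous fun v : LipModule m p => (lipZeroModule m p).mkQ v :=
    continuous_quot_mk
  have key : ∀ (A : Set X) (hA : MeasurableSet A),
      ‖(lipZeroModule m p).mkQ (LInfty.chi m hA • v)‖
        ≤ ‖toCotangent m p (LInfty.chi m hA • v)‖ := by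
    refine F.mem_of_isClosed (S := {v | ∀ (A : Set X) (hA : MeasurableSet A),
      ‖(lipZeroModule m p).mkQ (LInfty.chi m hA • v)‖
        ≤ ‖toCotangent m p (LInfty.chi m hA • v)‖}) ?_ (fun f A hA => ?_)
      (fun {B} hB v hv w hw A hA => ?_) v
    · simp only [ofPred_forall]
      refine isClosed_iInter fun A => isClosed_iInter fun hA => ?_
      exact isClosed_le (hcont.comp (hE.continuous_smul _)).norm
        (continuous_toCotangent.comp (hE.continuous_smul _)).norm
    · obtain ⟨ω, hω, hω'⟩ := exists_mem_lipLimitSet_pnorm_eq hrefl f.toRelaxed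
      have h1 : (lipZeroModule m p).mkQ (LInfty.chi m hA • F.d f)
          = (lipZeroModule m p).mkQ (LInfty.chi m hA • ω) := by
        rw [map_smul, map_smul]
        congr 1
        exact (Submodule.Quotient.eq _).2 (mem_lipZeroModule_iff.2
          (sub_mem_lipZeroSet (dLip_mem_lipLimitSet_toRelaxed f) hω))
      have h2 : toCotangent m p (F.d f) = dSob m p f.toRelaxed := toCotangent_dLip f
      have h3 : ‖LInfty.chi m hA • ω‖ = ‖LInfty.chi m hA • dSob m p f.toRelaxed‖ := by
        rw [← F.norm_pnorm, ← (relaxedFunctional m p).norm_pnorm, F.pnorm_chi_smul,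
          (relaxedFunctional m p).pnorm_chi_smul, hω']
        congr 2
        exact ((relaxedFunctional m p).pnorm_d f.toRelaxed).symm
      rw [h1, map_smul (toCotangent m p), h2, ← h3]
      exact Submodule.Quotient.norm_mk_le _ _
    · have hsplit : LInfty.chi m hA • (LInfty.chi m hB • v + LInfty.chi m hB.compl • w)
          = LInfty.chi m hB • LInfty.chi m hA • v
            + LInfty.chi m hB.compl • LInfty.chi m hA • w := by
        rw [smul_add, smul_comm, smul_comm (LInfty.chi m hA) (LInfty.chi m hB.compl)]
      rw [hsplit, map_add, map_add, ← Real.rpow_le_rpow_iff (norm_nonneg _) (norm_nonneg _) hp0]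
      simp only [map_smul]
      rw [hQ.norm_add_rpow hB, hC.norm_add_rpow hB]
      simp only [← map_smul]
      gcongr
      · rw [smul_smul, LInfty.chi_mul]
        exact hv _ _
      · rw [smul_smul, LInfty.chi_mul]
        exact hw _ _
  have h1 := key univ MeasurableSet.univ
  rwa [LInfty.chi_univ, one_smul] at h1

theorem norm_quotientToCotangent (hrefl : IsReflexive (LipModule m p))
    (q : LipModule m p ⧸ lipZeroModule m p) : ‖quotientToCotangent m p hrefl q‖ = ‖q‖ := by
  refine le_antisymm (le_of_forall_pos_le_add fun ε hε => ?_) ?_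
  · obtain ⟨v, rfl, hv⟩ := Submodule.Quotient.norm_mk_lt q hε
    exact (norm_toCotangent_le v).trans hv.le
  · induction q using Submodule.Quotient.induction_on with
    | H v => exact norm_mk_le_norm_toCotangent hrefl v

/-- The range is closed, being isometric to a complete space, it is stable under gluing, and it
contains every `d_p f` because `lipLimitSet f` is nonempty. -/
theorem quotientToCotangent_surjective (hrefl : IsReflexive (LipModule m p)) :
    Function.Surjective (quotientToCotangent m p hrefl) := by
  have hcl : IsClosed (lipZeroModule m p : Set (LipModule m p)) := isClosed_lipZeroModule
  have hiso : Isometry (quotientToCotangent m p hrefl) :=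
    AddMonoidHomClass.isometry_of_norm _ (norm_quotientToCotangent hrefl)
  intro η
  refine (relaxedFunctional m p).mem_of_isClosed
    (S := range (quotientToCotangent m p hrefl)) hiso.isClosedEmbedding.isClosed_range
    (fun f => ?_) (fun {A} hA v hv w hw => ?_) η
  · obtain ⟨ω, hω, -⟩ := exists_mem_lipLimitSet_pnorm_eq hrefl f
    exact ⟨Submodule.Quotient.mk ω, toCotangent_eq_dSob hrefl hω⟩
  · obtain ⟨v, rfl⟩ := hv
    obtain ⟨w, rfl⟩ := hw
    exact ⟨LInfty.chi m hA • v + LInfty.chi m hA.compl • w, by rw [map_add, map_smul, map_smul]⟩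

variable (m p) in
/-- The cotangent module is the quotient of the Lipschitz module by the `Lipschitz_0` module. -/
def quotientEquivCotangent (hrefl : IsReflexive (LipModule m p)) :
    (LipModule m p ⧸ lipZeroModule m p) ≃ₗᵢ[LInfty m] CotangentModule m p where
  __ := LinearEquiv.ofBijective (quotientToCotangent m p hrefl)
    ⟨by
      have hcl : IsClosed (lipZeroModule m p : Set (LipModule m p)) := isClosed_lipZeroModule
      exact (AddMonoidHomClass.isometry_of_norm _ (norm_quotientToCotangent hrefl)).injective,
    quotientToCotangent_surjective hrefl⟩
  norm_map' := norm_quotientToCotangent hrefl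

theorem quotientEquivCotangent_mk (hrefl : IsReflexive (LipModule m p)) (v : LipModule m p) :
    quotientEquivCotangent m p hrefl (Submodule.Quotient.mk v) = toCotangent m p v := rfl

theorem toCotangent_surjective (hrefl : IsReflexive (LipModule m p)) :
    Function.Surjective (toCotangent m p) := fun η => by
  obtain ⟨q, rfl⟩ := quotientToCotangent_surjective hrefl η
  obtain ⟨v, rfl⟩ := Submodule.Quotient.mk_surjective _ q
  exact ⟨v, rfl⟩

theorem toCotangent_eq_zero_iff (hrefl : IsReflexive (LipModule m p)) {v : LipModule m p} :
    toCotangent m p v = 0 ↔ v ∈ lipZeroModule m p := by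
  refine ⟨fun h => ?_, toCotangent_eq_zero hrefl⟩
  rw [← quotientEquivCotangent_mk hrefl, EmbeddingLike.map_eq_zero_iff,
    Submodule.Quotient.mk_eq_zero] at h
  exact h

end Cotangent

/-! ## Reflexivity of the Sobolev space, closability and lower semicontinuity -/

section Closability

variable {X : Type*} [MetricSpace X] [MeasurableSpace X] [BorelSpace X] {m : Measure X} {p : ℝ≥0}
  [Fact (1 ≤ (p : ℝ≥0∞))]

theorem lipEnergy_eq (u : LipDomain m p) :
    lipEnergy m p u = ENNReal.ofReal (‖dLip m p u‖ ^ (p : ℝ)) := by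
  rw [norm_dLip, LpFunctional.ofReal_norm_rpow, lipEnergy]
  refine lintegral_congr_ae ?_
  filter_upwards [lipFunctional_toFun_ae u] with x hx
  rw [hx, Real.enorm_of_nonneg (locLip_nonneg _ _), locLip,
    ENNReal.ofReal_toReal (u.lip.choose_spec.lipConst_ne_top x)]

/-- For fixed `k` the sequence `u_n - u_k` tends to `-u_k`, so lower semicontinuity gives `‖d_lip
u_k‖ ≤ ‖ω - d_lip u_k‖`. Letting `k → ∞` yields `‖ω‖ ≤ 0`. -/
theorem DLipClosable.of_lipEnergyLSC (h : LipEnergyLSC m p) : DLipClosable m p := by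
  have hp0 := NNReal.coe_pos_of_fact_one_le (p := p)
  intro u ω hu hω
  have key : ∀ k, ‖dLip m p (u k)‖ ≤ ‖ω - dLip m p (u k)‖ := by
    intro k
    have h1 : TendstoL0 m (fun n => (u n - u k).val) (-u k).val := by
      have h2 := hu.sub (TendstoL0.const (u k).val)
      rw [zero_sub] at h2
      exact h2
    have h2 := h _ _ h1
    have h3 : Tendsto (fun n => lipEnergy m p (u n - u k)) atTop
        (𝓝 (ENNReal.ofReal (‖ω - dLip m p (u k)‖ ^ (p : ℝ)))) := by
      simp only [lipEnergy_eq, map_sub]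
      exact ENNReal.tendsto_ofReal
        ((hω.sub_const _).norm.rpow_const (Or.inr hp0.le))
    rw [h3.liminf_eq, lipEnergy_eq, map_neg, norm_neg,
      ENNReal.ofReal_le_ofReal_iff (by positivity)] at h2
    exact (Real.rpow_le_rpow_iff (norm_nonneg _) (norm_nonneg _) hp0).1 h2
  have h1 : Tendsto (fun k => ‖ω - dLip m p (u k)‖) atTop (𝓝 0) := by
    simpa using (hω.const_sub ω).norm
  exact norm_le_zero_iff.1 (le_of_tendsto_of_tendsto' hω.norm h1 key)

theorem DLipClosable.eq_of_mem (h : DLipClosable m p) {f : X → ℝ} {ω η : LipModule m p}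
    (hω : ω ∈ lipLimitSet m p f) (hη : η ∈ lipLimitSet m p f) : ω = η := by
  obtain ⟨u, hu, hu'⟩ := sub_mem_lipZeroSet hω hη
  exact sub_eq_zero.1 (h u _ hu hu')

/-- If the energies fell below `c < lipEnergy f` infinitely often, Mazur's lemma would produce a
limit `ω` for `f` with `‖ω‖^p ≤ c`. Closability leaves `d_lip f` as the only such limit. -/
theorem DLipClosable.lipEnergyLSC [SigmaFinite m] (hrefl : IsReflexive (LipModule m p))
    (h : DLipClosable m p) : LipEnergyLSC m p := by
  have hp0 := NNReal.coe_pos_of_fact_one_le (p := p)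
  intro u f hu
  by_contra hcon
  obtain ⟨c, hc1, hc2⟩ := exists_between (not_le.1 hcon)
  obtain ⟨φ, hφ, hφc⟩ := extraction_of_frequently_atTop (frequently_lt_of_liminf_lt (by isBoundedDefault) hc1)
  have hctop : c ≠ ∞ := (hc2.trans_le le_top).ne
  set C : ℝ := c.toReal ^ (p : ℝ)⁻¹ with hC
  have hC' : ∀ n, ‖dLip m p (u (φ n))‖ ≤ C := by
    intro n
    have h1 := (hφc n).le
    rw [lipEnergy_eq, ENNReal.ofReal_le_iff_le_toReal hctop] at h1
    exact (Real.le_rpow_inv_iff_of_pos (norm_nonneg _) ENNReal.toReal_nonneg hp0).2 h1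
  have hconv : Convex ℝ {v : LipDomain m p × ℝ | ‖dLip m p v.1‖ ≤ C} := by
    have h1 := (convex_closedBall (0 : LipModule m p) C).linear_preimage
      ((dLip m p).comp (LinearMap.fst ℝ (LipDomain m p) ℝ))
    intro v hv w hw a b ha hb hab
    have h2 := h1 (mem_closedBall_zero_iff.2 hv) (mem_closedBall_zero_iff.2 hw) ha hb hab
    exact mem_closedBall_zero_iff.1 h2
  -- The second component plays no role here and is constantly zero; the convex constraint is the
  -- norm bound on the differential.
  obtain ⟨ω, hω, g, hg, h1, -⟩ := exists_convex_tendsto hrefl (hu.comp hφ.tendsto_atTop) hC'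
    (H := fun _ => (0 : ℝ)) (G := 0) (fun L => tendsto_const_nhds) hconv hC'
  have h2 : ‖ω‖ ≤ C := le_of_tendsto' h1.norm hg
  rw [h.eq_of_mem hω (dLip_mem_lipLimitSet f)] at h2
  rw [Real.le_rpow_inv_iff_of_pos (norm_nonneg _) ENNReal.toReal_nonneg hp0,
    ← ENNReal.ofReal_le_iff_le_toReal hctop, ← lipEnergy_eq] at h2
  exact absurd hc2 (not_lt.2 h2)

variable [IsLocallyFiniteMeasure m] [m.InnerRegular] [SigmaFinite m]

theorem dLipClosable_iff_eq_bot : DLipClosable m p ↔ lipZeroModule m p = ⊥ := by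
  rw [Submodule.eq_bot_iff]
  refine ⟨fun h ω hω => ?_, fun h u ω hu hω => h ω (mem_lipZeroModule_iff.2 ⟨u, hu, hω⟩)⟩
  obtain ⟨u, hu, hu'⟩ := mem_lipZeroModule_iff.1 hω
  exact h u ω hu hu'

/-- Lifts of elements near `toCotangent v` can be chosen near `v`. -/
theorem exists_norm_sub_lt (hrefl : IsReflexive (LipModule m p)) (v w : LipModule m p) {ε : ℝ}
    (hε : 0 < ε) : ∃ ω, ω - w ∈ lipZeroModule m p ∧
      ‖ω - v‖ < ‖toCotangent m p w - toCotangent m p v‖ + ε := by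
  obtain ⟨z, hz, hz'⟩ := Submodule.Quotient.norm_mk_lt
    (Submodule.Quotient.mk (w - v) : LipModule m p ⧸ lipZeroModule m p) hε
  refine ⟨v + z, ?_, ?_⟩
  · have h1 := (Submodule.Quotient.eq _).1 hz
    rwa [show v + z - w = z - (w - v) by abel]
  · rw [add_sub_cancel_left, ← map_sub]
    exact hz'.trans_le (add_le_add (norm_mk_le_norm_toCotangent hrefl _) le_rfl)

/-- A limit of pairs `(f_n, d_p f_n)` is lifted to the Lipschitz module: a lift `v` of the limit is
approached by representatives `ω n` in the limit sets of `f_n`, and the limit relation has a closed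
graph. -/
theorem isClosed_sobolevSpace (hrefl : IsReflexive (LipModule m p)) :
    IsClosed (SobolevSpace m p : Set (WithLp (p : ℝ≥0∞) (Lp ℝ p m × CotangentModule m p))) := by
  refine IsSeqClosed.isClosed fun z z' hz hlim => ?_
  have h0 : Tendsto (fun n => ((z n).fst, (z n).snd)) atTop (𝓝 (z'.fst, z'.snd)) :=
    ((WithLp.prodContinuousLinearEquiv (p : ℝ≥0∞) ℝ (Lp ℝ p m)
      (CotangentModule m p)).continuous.tendsto z').comp hlim
  have h1 : Tendsto (fun n => (z n).fst) atTop (𝓝 z'.fst) := (continuous_fst.tendsto _).comp h0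
  have h2 : Tendsto (fun n => (z n).snd) atTop (𝓝 z'.snd) := (continuous_snd.tendsto _).comp h0
  obtain ⟨v, hv⟩ := toCotangent_surjective hrefl z'.snd
  choose f hf hf' using hz
  choose w hw hw' using fun n => exists_mem_lipLimitSet_pnorm_eq hrefl (f n)
  -- The lifts `w n` need not converge. Changing them by elements of `Lipschitz_0` brings them
  -- within the quotient distance plus `1/(n+1)` of `v`.
  choose ω hω hω' using fun n : ℕ =>
    exists_norm_sub_lt hrefl v (w n) (ε := 1 / ((n : ℝ) + 1)) (by positivity)
  have h3 : ∀ n, ω n ∈ lipLimitSet m p ((z n).fst : X → ℝ) := fun n => by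
    have h4 := add_mem_lipLimitSet_of_zero (hw n) (mem_lipZeroModule_iff.1 (hω n))
    rw [add_sub_cancel, hf n] at h4
    exact h4
  have h4 : Tendsto ω atTop (𝓝 v) := by
    rw [tendsto_iff_norm_sub_tendsto_zero]
    refine squeeze_zero (fun _ => norm_nonneg _) (fun n => (hω' n).le) ?_
    have h5 : ∀ n, toCotangent m p (w n) = (z n).snd := fun n =>
      (toCotangent_eq_dSob hrefl (hw n)).trans (hf' n)
    simp only [h5, hv]
    simpa using (tendsto_iff_norm_sub_tendsto_zero.1 h2).add
      (tendsto_one_div_add_atTop_nhds_zero_nat (𝕜 := ℝ))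
  have h5 : v ∈ lipLimitSet m p (z'.fst : X → ℝ) :=
    mem_lipLimitSet_of_tendsto (TendstoL0.of_tendsto_Lp h1) h4 h3
  let g : RelaxedDomain m p :=
    ⟨(z'.fst : X →ₘ[m] ℝ), _, (isUpperRelaxation_iff hrefl).2 ⟨v, h5, le_rfl⟩⟩
  exact ⟨g, rfl, (toCotangent_eq_dSob (f := g) hrefl h5).symm.trans hv⟩

theorem isReflexive_sobolevSpace (hp : 1 < p) (hrefl : IsReflexive (LipModule m p))
    (hrefl' : IsReflexive (CotangentModule m p)) : IsReflexive (SobolevSpace m p) := by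
  have h1 : IsReflexive (WithLp (p : ℝ≥0∞) (Lp ℝ p m × CotangentModule m p)) :=
    ((isReflexive_Lp_nnreal hp).prod hrefl').equiv
      (WithLp.prodContinuousLinearEquiv (p : ℝ≥0∞) ℝ (Lp ℝ p m) (CotangentModule m p)).symm
  refine h1.of_isometry (SobolevSpace m p).subtypeₗᵢ ?_
  have h2 : range (SobolevSpace m p).subtypeₗᵢ
      = (SobolevSpace m p : Set (WithLp (p : ℝ≥0∞) (Lp ℝ p m × CotangentModule m p))) :=
    Subtype.range_coe
  rw [h2]
  exact isClosed_sobolevSpace hrefl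

theorem DLipClosable.norm_toCotangent (hrefl : IsReflexive (LipModule m p))
    (h : DLipClosable m p) (v : LipModule m p) : ‖toCotangent m p v‖ = ‖v‖ := by
  refine le_antisymm (norm_toCotangent_le v) (le_of_forall_pos_le_add fun ε hε => ?_)
  obtain ⟨ω, hω, hω'⟩ := exists_norm_sub_lt hrefl 0 v hε
  rw [dLipClosable_iff_eq_bot.1 h, Submodule.mem_bot, sub_eq_zero] at hω
  rw [hω, sub_zero, map_zero, sub_zero] at hω'
  exact hω'.le

/-- If `d_lip` is closable, then the Lipschitz module is the cotangent module. -/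
def DLipClosable.equivCotangent (hrefl : IsReflexive (LipModule m p)) (h : DLipClosable m p) :
    LipModule m p ≃ₗᵢ[LInfty m] CotangentModule m p where
  __ := LinearEquiv.ofBijective (toCotangent m p)
    ⟨(AddMonoidHomClass.isometry_of_norm _ (h.norm_toCotangent hrefl)).injective,
      toCotangent_surjective hrefl⟩
  norm_map' := h.norm_toCotangent hrefl

theorem DLipClosable.relaxedSlope_ae_eq (hrefl : IsReflexive (LipModule m p))
    (h : DLipClosable m p) (f : LipDomain m p) :
    (relaxedSlope f.toRelaxed : X → ℝ) =ᵐ[m] locLip f.val := by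
  obtain ⟨ω, hω, hω'⟩ := exists_mem_lipLimitSet_pnorm_eq hrefl f.toRelaxed
  rw [h.eq_of_mem hω (dLip_mem_lipLimitSet_toRelaxed f)] at hω'
  rw [← hω']
  have h1 : (lipFunctional m p).pnorm (dLip m p f) = (lipFunctional m p).toFun f :=
    (lipFunctional m p).pnorm_d f
  rw [h1]
  exact lipFunctional_toFun_ae f

end Closability

/-! ## Local dimensions -/

section LocalDimension

variable {X : Type*} [MetricSpace X] [MeasurableSpace X] [BorelSpace X] {m : Measure X} {p : ℝ≥0}
  [Fact (1 ≤ (p : ℝ≥0∞))]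

theorem completeSpace_lipZeroModule : CompleteSpace (lipZeroModule m p) :=
  isClosed_lipZeroModule.completeSpace_coe

theorem isLpModule_lipZeroModule : IsLpModule m p (lipZeroModule m p) :=
  (lipFunctional m p).isLpModule.submodule _

variable [IsLocallyFiniteMeasure m] [m.InnerRegular] [SigmaFinite m]

theorem exact_lipZeroModule (hrefl : IsReflexive (LipModule m p)) :
    Function.Exact (lipZeroModule m p).subtype (toCotangent m p) := fun v => by
  rw [toCotangent_eq_zero_iff hrefl]
  exact ⟨fun h => ⟨⟨v, h⟩, rfl⟩, by rintro ⟨z, rfl⟩; exact z.2⟩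

theorem locallyFiniteDim_lipZeroModule_cotangent (hrefl : IsReflexive (LipModule m p))
    (h : LocallyFiniteDim m (LipModule m p)) :
    LocallyFiniteDim m (lipZeroModule m p) ∧ LocallyFiniteDim m (CotangentModule m p) := by
  have := completeSpace_lipZeroModule (m := m) (p := p)
  exact LocallyFiniteDim.of_exact isLpModule_lipZeroModule (lipFunctional m p).isLpModule
    (relaxedFunctional m p).isLpModule (lipZeroModule m p).subtype (toCotangent m p)
    (Submodule.injective_subtype _) (toCotangent_surjective hrefl) (exact_lipZeroModule hrefl) h

theorem localDim_lip_eq_add (hrefl : IsReflexive (LipModule m p)) {δlip δp δ₀ : X → ℕ∞}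
    (h : IsLocalDim m (LipModule m p) δlip) (h' : IsLocalDim m (CotangentModule m p) δp)
    (h'' : IsLocalDim m (lipZeroModule m p) δ₀) : ∀ᵐ x ∂m, δlip x = δp x + δ₀ x :=
  IsLocalDim.ae_eq_add isLpModule_lipZeroModule (lipFunctional m p).isLpModule
    (relaxedFunctional m p).isLpModule (lipZeroModule m p).subtype (toCotangent m p)
    (Submodule.injective_subtype _) (toCotangent_surjective hrefl) (exact_lipZeroModule hrefl)
    h h' h''

theorem localDimBoundedBy_cotangent (hrefl : IsReflexive (LipModule m p)) {N : ℕ}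
    (h : LocalDimBoundedBy m (LipModule m p) N) :
    LocalDimBoundedBy m (CotangentModule m p) N := by
  obtain ⟨δ, hδ, hN⟩ := h
  obtain ⟨⟨δ₀, hδ₀⟩, δp, hδp⟩ := locallyFiniteDim_lipZeroModule_cotangent hrefl ⟨δ, hδ⟩
  refine ⟨δp, hδp, ?_⟩
  filter_upwards [hN, localDim_lip_eq_add hrefl hδ hδp hδ₀] with x h1 h2
  exact le_self_add.trans (h2.symm.le.trans h1)

/-- Closability means that `Lipschitz_0` is zero, equivalently that its dimension vanishes a.e. In
the sum formula the dimension of the cotangent module is finite a.e. and can be cancelled. -/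
theorem dLipClosable_iff_localDim_eq (hrefl : IsReflexive (LipModule m p)) {δlip δp : X → ℕ∞}
    (h : IsLocalDim m (LipModule m p) δlip) (h' : IsLocalDim m (CotangentModule m p) δp) :
    DLipClosable m p ↔ ∀ᵐ x ∂m, δlip x = δp x := by
  obtain ⟨⟨δ₀, hδ₀⟩, -⟩ := locallyFiniteDim_lipZeroModule_cotangent hrefl ⟨δlip, h⟩
  have hadd := localDim_lip_eq_add hrefl h h' hδ₀
  rw [dLipClosable_iff_eq_bot, ← Submodule.subsingleton_iff_eq_bot]
  constructor
  · intro hsub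
    have h1 := hδ₀.ae_eq_of_stalkRank isLpModule_lipZeroModule 0
      fun P _ hP => stalkRank_of_subsingleton hP
    filter_upwards [hadd, h1] with x h2 h3
    rw [h2, h3, Nat.cast_zero, add_zero]
  · intro heq
    refine hδ₀.subsingleton isLpModule_lipZeroModule ?_
    filter_upwards [hadd, heq, measure_eq_zero_iff_ae_notMem.1 h'.2.1] with x h1 h2 h3
    rw [h2] at h1
    have h4 : δp x + 0 = δp x + δ₀ x := (add_zero _).trans h1
    exact ((ENat.add_right_injective_of_ne_top h3) h4).symm

end LocalDimension

theorem mainTheorem4 {X : Type*} [MetricSpace X] [CompleteSpace X] [MeasurableSpace X]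
    [BorelSpace X] (m : Measure X) [IsLocallyFiniteMeasure m] [m.InnerRegular] [SigmaFinite m]
    (p : ℝ≥0) [Fact (1 ≤ (p : ℝ≥0∞))] (hp : 1 < p)
    (hfin : LocallyFiniteDim m (LipModule m p)) :
    -- the Lipschitz module is reflexive
    IsReflexive (LipModule m p) ∧
    -- the cotangent module is the quotient of the Lipschitz module by the `Lipschitz_0` module
    (∃ Φ : (LipModule m p ⧸ lipZeroModule m p) ≃ₗᵢ[LInfty m] CotangentModule m p,
      ∀ f : LipDomain m p,
        Φ (Submodule.Quotient.mk (dLip m p f)) = dSob m p f.toRelaxed) ∧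
    (DLipClosable m p ↔ lipZeroModule m p = ⊥) ∧
    (DLipClosable m p →
      (∃ Φ : LipModule m p ≃ₗᵢ[LInfty m] CotangentModule m p,
        ∀ f : LipDomain m p, Φ (dLip m p f) = dSob m p f.toRelaxed) ∧
      ∀ f : LipDomain m p, (relaxedSlope f.toRelaxed : X → ℝ) =ᵐ[m] locLip f.val) ∧
    -- the dimension formula
    LocallyFiniteDim m (lipZeroModule m p) ∧
    LocallyFiniteDim m (CotangentModule m p) ∧
    (∀ δlip δp δ₀ : X → ℕ∞, IsLocalDim m (LipModule m p) δlip →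
      IsLocalDim m (CotangentModule m p) δp → IsLocalDim m (lipZeroModule m p) δ₀ →
      ∀ᵐ x ∂m, δlip x = δp x + δ₀ x) ∧
    (∀ N : ℕ, LocalDimBoundedBy m (LipModule m p) N →
      LocalDimBoundedBy m (CotangentModule m p) N) ∧
    -- reflexivity of the cotangent module and of the Sobolev space
    IsReflexive (CotangentModule m p) ∧
    IsReflexive (SobolevSpace m p) ∧
    -- closability, equality of dimensions and lower semicontinuity are equivalent
    (∀ δlip δp : X → ℕ∞, IsLocalDim m (LipModule m p) δlip →
      IsLocalDim m (CotangentModule m p) δp →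
      (DLipClosable m p ↔ ∀ᵐ x ∂m, δlip x = δp x)) ∧
    (DLipClosable m p ↔ LipEnergyLSC m p) := by
  -- Reflexivity of the Lipschitz module comes first: Mazur's lemma, and through it the
  -- identification of the cotangent module, depends on it.
  have hrefl : IsReflexive (LipModule m p) :=
    (lipFunctional m p).isLpModule.isReflexive_of_locallyFiniteDim hp hfin
  obtain ⟨hfin₀, hfinp⟩ := locallyFiniteDim_lipZeroModule_cotangent hrefl hfin
  have hrefl' : IsReflexive (CotangentModule m p) :=
    (relaxedFunctional m p).isLpModule.isReflexive_of_locallyFiniteDim hp hfinp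
  exact ⟨hrefl, ⟨quotientEquivCotangent m p hrefl, toCotangent_dLip⟩, dLipClosable_iff_eq_bot,
    fun h => ⟨⟨h.equivCotangent hrefl, toCotangent_dLip⟩, h.relaxedSlope_ae_eq hrefl⟩,
    hfin₀, hfinp, fun _ _ _ h h' h'' => localDim_lip_eq_add hrefl h h' h'',
    fun _ h => localDimBoundedBy_cotangent hrefl h, hrefl',
    isReflexive_sobolevSpace hp hrefl hrefl',
    fun _ _ h h' => dLipClosable_iff_localDim_eq hrefl h h',
    fun h => h.lipEnergyLSC hrefl, fun h => DLipClosable.of_lipEnergyLSC h⟩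

end
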